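/- **Notation.** Work on $\mathbb R^2$, and let $B_r$ be the ball of radius $r$ centred at the origin. For $0\le\alpha<\frac12$ and $R\ge 1$ put $$\|f\|_{L^2_\alpha(R)}=\sup_{r\ge R}\Big(\frac1{r^{2+2\alpha}}\int_{B_r}|f|^2\,dx\Big)^{1/2},\qquad \|f\|_{L^2_\alpha}=\|f\|_{L^2_\alpha(1)} .$$ Let $Y_\alpha$ be the space of divergence-free vector fields $u\in L^2_\alpha(\mathbb R^2;\mathbb R^2)$ whose distributional vorticity $\omega=\partial_1u_2-\partial_2u_1$ is bounded, with norm $\|u\|_{Y_\alpha}=\|\omega\|_{L^\infty}+\|u\|_{L^2_\alpha}$. Let $E(x)=-\frac1{2\pi}\log|x|$, let $\theta$ be a smooth radial function with $0\le\theta\le1$, $\theta=1$ on $\{|x|\le 1\}$ and $\operatorname{supp}\theta\subset\{|x|\le2\}$, and define the pressure force (sum over $j,k\in\{1,2\}$) $$\nabla\Pi(u\otimes v)=\nabla(\theta E)*(\partial_ju_k\,\partial_kv_j)+\nabla\partial_j\partial_k\big((1-\theta)E\big)*(u_jv_k).$$ Given $u_0\in Y_\alpha$, a *Yudovich solution* with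 initial datum $u_0$ is a function $u\in L^\infty_{\rm loc}(\mathbb R_+;Y_\alpha)$ such that, for every $\phi\in C^\infty_c([0,\infty)\times\mathbb R^2;\mathbb R^2)$, $$\int\phi(0,x)\cdot u_0(x)\,dx+\int_0^\infty\!\!\int\big\{u\cdot\partial_t\phi+\nabla\phi:u\otimes u\big\}\,dx\,dt=\int_0^\infty\big\langle\nabla\Pi(u\otimes u),\phi\big\rangle\,dt .$$ **Theorem.** Let $0\le\alpha<\frac12$, let $u_0\in Y_\alpha$ have vorticity $\omega_0$, and let $u$ be a Yudovich solution with initial datum $u_0$. There is a constant $K>0$, depending only on $\frac1{1-2\alpha}$, such that for almost every $t\ge0$ and every radius $R\ge1$ with $$R\ \ge\ \big(Kt+(Kt)^2\|\omega_0\|_{L^\infty}\big)^{\frac1{1-\alpha}}\,\|u_0\|_{L^2_\alpha}^{\frac1{1-\alpha}}$$ one has $$\|u(t)\|_{L^2_\alpha(R)}\le 2\,\|u_0\|_{L^2_\alpha}.$$ If moreover $u$ is given by a weakly continuous representative, that is, $u(t)\in L^1_{\rm loc}$ for every $t\ge 0$ and $t\mapsto\int u(t)\cdot\varphi\,dx$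 is continuous on $[0,\infty)$ for every $\varphi\in C_c^\infty(\mathbb R^2;\mathbb R^2)$, then this holds for every $t\ge0$. -/

import Mathlib

open MeasureTheory Set
open scoped ENNReal NNReal

noncomputable section

namespace Yudovich

/-- The Euclidean plane. -/
abbrev Plane : Type := EuclideanSpace ℝ (Fin 2)

/-- The (classical) partial derivative `∂ⱼ f`. -/
def pd (j : Fin 2) (f : Plane → ℝ) (x : Plane) : ℝ :=
  fderiv ℝ f x (EuclideanSpace.single j 1)

/-- The large-scale Morrey norm
`‖f‖_{L²_α(R)} = sup_{r ≥ R} (r^{-(2+2α)} ∫_{B_r} |f|²)^{1/2}`, with values in `[0, ∞]`. -/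
def morreyNormFrom (α R : ℝ) (f : Plane → Plane) : ℝ≥0∞ :=
  ⨆ (r : ℝ) (_ : R ≤ r),
    ((ENNReal.ofReal (r ^ (2 + 2 * α)))⁻¹ * ∫⁻ x in Metric.ball (0 : Plane) r, ‖f x‖ₑ ^ 2)
      ^ (1 / 2 : ℝ)

/-- The Morrey norm `‖f‖_{L²_α}`, where the supremum is over all radii `r ≥ 1`. -/
def morreyNorm (α : ℝ) (f : Plane → Plane) : ℝ≥0∞ := morreyNormFrom α 1 f

/-- `div u = 0` in the sense of distributions. -/
def IsDivFree (u : Plane → Plane) : Prop :=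
  ∀ φ : Plane → ℝ, ContDiff ℝ (⊤ : ℕ∞) φ → HasCompactSupport φ → ∫ x, fderiv ℝ φ x (u x) = 0

/-- `ω = ∂₁u₂ - ∂₂u₁` in the sense of distributions (the coordinates are `u x 0` and `u x 1`). -/
def IsVorticity (u : Plane → Plane) (ω : Plane → ℝ) : Prop :=
  LocallyIntegrable ω volume ∧
    ∀ φ : Plane → ℝ, ContDiff ℝ (⊤ : ℕ∞) φ → HasCompactSupport φ →
      ∫ x, ω x * φ x = ∫ x, (u x 0 * pd 1 φ x - u x 1 * pd 0 φ x)

/-- The space `Y_α`: divergence-free fields in `L²_α` whose vorticity is bounded. -/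
structure MemY (α : ℝ) (u : Plane → Plane) : Prop where
  aestronglyMeasurable : AEStronglyMeasurable u volume
  morreyNorm_lt_top : morreyNorm α u < ∞
  isDivFree : IsDivFree u
  exists_vorticity : ∃ ω, IsVorticity u ω ∧ MemLp ω ∞ volume

/-- The norm `‖u‖_{Y_α} = ‖ω‖_{L^∞} + ‖u‖_{L²_α}`. The vorticity `ω` of `u` is unique up to null
sets, so that the infimum is over a single value (it is `∞` if `u` has no vorticity). -/
def yudovichNorm (α : ℝ) (u : Plane → Plane) : ℝ≥0∞ :=
  (⨅ (ω : Plane → ℝ) (_ : IsVorticity u ω), eLpNorm ω ∞ volume) + morreyNorm α u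

/-- `u ∈ L^∞_loc(ℝ₊ ; Y_α)`. -/
structure MemLinftyLocY (α : ℝ) (u : ℝ → Plane → Plane) : Prop where
  aestronglyMeasurable :
    AEStronglyMeasurable (Function.uncurry u) ((volume.restrict (Ici (0 : ℝ))).prod volume)
  locally_bounded : ∀ T : ℝ, ∃ M : ℝ≥0, ∀ᵐ t ∂(volume.restrict (Icc 0 T)),
    MemY α (u t) ∧ yudovichNorm α (u t) ≤ M

/-- The radial smooth cut-off functions, with values in `[0, 1]`, equal to one on the unit ball and
supported in the ball of radius two. -/
structure IsCutoff (θ : Plane → ℝ) : Prop where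
  contDiff : ContDiff ℝ (⊤ : ℕ∞) θ
  radial : ∀ x y, ‖x‖ = ‖y‖ → θ x = θ y
  nonneg : ∀ x, 0 ≤ θ x
  le_one : ∀ x, θ x ≤ 1
  eq_one : ∀ x, ‖x‖ ≤ 1 → θ x = 1
  support_subset : tsupport θ ⊆ Metric.closedBall 0 2

/-- The fundamental solution `E(x) = -(2π)⁻¹ log |x|` of `-Δ`. -/
def fundSol (x : Plane) : ℝ := -(1 / (2 * Real.pi)) * Real.log ‖x‖

/-- `g = ∂ⱼ f` in the weak sense. -/
def IsWeakPartial (j : Fin 2) (f g : Plane → ℝ) : Prop :=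
  LocallyIntegrable g volume ∧
    ∀ φ : Plane → ℝ, ContDiff ℝ (⊤ : ℕ∞) φ → HasCompactSupport φ →
      ∫ x, g x * φ x = - ∫ x, f x * pd j φ x

open Classical in
/-- The weak partial derivative `∂ⱼ f` as a function (unique up to null sets where it exists,
as it does for the components of every field in `Y_α`; zero otherwise). -/
def weakPartial (j : Fin 2) (f : Plane → ℝ) : Plane → ℝ :=
  if h : ∃ g, IsWeakPartial j f g then h.choose else 0

/-- The pressure force
`∇Π(u ⊗ v) = ∇(θE) * (∂ⱼuₖ ∂ₖvⱼ) + ∇∂ⱼ∂ₖ((1 - θ)E) * (uⱼ vₖ)`, summed over `j, k`. -/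
def pressureForce (θ : Plane → ℝ) (u v : Plane → Plane) (x : Plane) : Plane :=
  WithLp.toLp 2 fun i : Fin 2 =>
    (∑ j : Fin 2, ∑ k : Fin 2,
      ∫ y, pd i (fun z => θ z * fundSol z) (x - y) *
        (weakPartial j (fun z => u z k) y * weakPartial k (fun z => v z j) y)) +
    ∑ j : Fin 2, ∑ k : Fin 2,
      ∫ y, pd i (pd j (pd k (fun z => (1 - θ z) * fundSol z))) (x - y) * (u y j * v y k)

/-- `u ∈ L^∞_loc(ℝ₊ ; Y_α)` is a Yudovich solution of the Euler equations with initial datum `u₀`: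
for all `φ ∈ 𝒟(ℝ₊ × ℝ² ; ℝ²)`,
`∫ φ(0)·u₀ + ∫₀^∞ ∫ (u·∂ₜφ + ∇φ : u ⊗ u) = ∫₀^∞ ⟨∇Π(u ⊗ u), φ⟩`.
Test functions on `ℝ₊ × ℝ²` are restrictions of test functions on `ℝ × ℝ²`. -/
structure IsYudovichSolution (θ : Plane → ℝ) (α : ℝ) (u₀ : Plane → Plane)
    (u : ℝ → Plane → Plane) : Prop where
  memLinftyLocY : MemLinftyLocY α u
  weak_form : ∀ φ : ℝ × Plane → Plane, ContDiff ℝ (⊤ : ℕ∞) φ → HasCompactSupport φ →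
    (∫ x, inner ℝ (φ (0, x)) (u₀ x)) +
      (∫ t in Ioi (0 : ℝ), ∫ x,
        (inner ℝ (u t x) (deriv (fun s => φ (s, x)) t) +
          inner ℝ (fderiv ℝ (fun y => φ (t, y)) x (u t x)) (u t x))) =
      ∫ t in Ioi (0 : ℝ), ∫ x, inner ℝ (pressureForce θ (u t) (u t) x) (φ (t, x))

/-- `u` is given at every time `t ≥ 0`, by its representative that is continuous in time with values
in the distributions. -/
structure IsWeaklyContinuous (u : ℝ → Plane → Plane) : Prop where
  locallyIntegrable : ∀ t, 0 ≤ t → LocallyIntegrable (u t) volume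
  continuousOn : ∀ φ : Plane → Plane, ContDiff ℝ (⊤ : ℕ∞) φ → HasCompactSupport φ →
    ContinuousOn (fun t => ∫ x, inner ℝ (u t x) (φ x)) (Ici 0)

end Yudovich

end

open MeasureTheory Set
open scoped ENNReal NNReal

noncomputable section

namespace Yudovich

open Filter Topology Metric

/-! The theorem is a bootstrap for local energies. Let `W₀` be the sup norm of the initial vorticity
and `N` a bound for the initial Morrey norm, and suppose that up to some time the solution obeys a
Morrey bound `m` on all balls of radius at least `R`. The energy in a ball of radius `r ≥ R` changes
only through the energy transported across the annulus where a cut-off varies and through the work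
of the pressure. Both fluxes are at most a constant times `U r⁻¹ m² r^(2+2α)`, where `U` bounds the
velocity on the ball of radius `4r` (`exists_energy_flux_le`). Interpolation between the vorticity
bound and the local energy gives `U ≤ C r (√(W₀ X) + X)` with `X = m r^(α-1)`
(`MorreyBd.ae_abs_le_supBd`). As `X` decreases in `r`, the energy at time `t`, divided by
`r^(2+2α)`, is at most `2N² + C t m² (√(W₀ X) + X)` with `X` taken at `r = R`. The condition on `R`
makes `t (√(W₀ X) + X)` small for `m = N` (`rate_le_of_radius_le`), and then the bound `m = 2N`
reproduces itself (`exists_morrey_propagation`). Nothing is known about continuity of the Morrey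
norm in time, so the bootstrap advances by short steps: on the newest step only the crude bound
coming from `L^∞_loc(Y_α)` is used, and the step is short enough to make its contribution harmless.

The pressure. Once mollified, the pressure force is the convolution of `u ⊗ u` with a kernel
`presKer` that depends neither on the cut-off nor on the scale separating near from far
(`IsCutoff.presKer_eq`). On a ball of radius `r` the splitting is therefore made at scale `r`, with
a fixed cut-off. The near part is bounded in `L²`, where `‖D²f‖₂ ≤ ‖Δf‖₂` and Young's inequality
take the place of Calderón–Zygmund theory (`IsCutoff.exists_lintegral_cv_nearKer_le`). The far
kernel decays cubically, and its integrability against `|u|²` is where `α < 1/2` enters and where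
the constant degenerates as `α → 1/2` (`MorreyBd.lintegral_weight_le`).

The vorticity. The velocity bound needs `|ω(t)| ≤ W₀` at later times. The velocity has a locally
square integrable gradient, so the commutator of transport with mollification tends to zero in
`L¹_loc` (`Flow.tendsto_lintegral_comm`), in the manner of DiPerna and Lions. The vorticity is thus
a renormalized solution of its transport equation, and a Gronwall argument with the weight `(1 +
|x|²)⁻²` bounds it (`Evolves.abs_vort_le`). The same commutator estimate justifies the local energy
balance.

A recurring tool is a mollifier whose derivative in the scale is a Laplacian. As `Δu` is a rotated
gradient of `ω`, it gives `|u - u * mols s| ≤ W s` without logarithmic loss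
(`ae_abs_sub_cv_mols_le`). -/

/-! ### Calculus of test functions and partial derivatives. -/

/-- Smooth functions with compact support. -/
structure IsTest (φ : Plane → ℝ) : Prop where
  smooth : ContDiff ℝ (⊤ : ℕ∞) φ
  compact : HasCompactSupport φ

theorem fderiv_eq_sum_pd (f : Plane → ℝ) (x v : Plane) :
    fderiv ℝ f x v = v 0 * pd 0 f x + v 1 * pd 1 f x := by
  have h : v = v 0 • EuclideanSpace.single 0 (1 : ℝ) + v 1 • EuclideanSpace.single 1 (1 : ℝ) := by
    ext i; fin_cases i <;> simp
  conv_lhs => rw [h]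
  simp [pd, map_add, map_smul]

theorem contDiff_pd {f : Plane → ℝ} (hf : ContDiff ℝ (⊤ : ℕ∞) f) (j : Fin 2) :
    ContDiff ℝ (⊤ : ℕ∞) (pd j f) := by
  unfold pd
  exact (hf.fderiv_right (m := (⊤ : ℕ∞)) (by simp)).clm_apply contDiff_const

theorem hasCompactSupport_pd {f : Plane → ℝ} (hf : HasCompactSupport f) (j : Fin 2) :
    HasCompactSupport (pd j f) := by
  unfold pd
  exact hf.fderiv_apply ℝ _

namespace IsTest

variable {f g : Plane → ℝ}

theorem pd (hf : IsTest f) (j : Fin 2) : IsTest (pd j f) :=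
  ⟨contDiff_pd hf.1 j, hasCompactSupport_pd hf.2 j⟩

theorem continuous (hf : IsTest f) : Continuous f := hf.1.continuous

theorem differentiable (hf : IsTest f) : Differentiable ℝ f := hf.1.differentiable (by simp)

theorem integrable (hf : IsTest f) : Integrable f volume :=
  hf.continuous.integrable_of_hasCompactSupport hf.2

theorem add (hf : IsTest f) (hg : IsTest g) : IsTest (fun x => f x + g x) :=
  ⟨hf.1.add hg.1, hf.2.add hg.2⟩

theorem neg (hf : IsTest f) : IsTest (fun x => - f x) :=
  ⟨hf.1.neg, hf.2.neg⟩

theorem sub (hf : IsTest f) (hg : IsTest g) : IsTest (fun x => f x - g x) := by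
  simpa [sub_eq_add_neg] using hf.add hg.neg

theorem mul_left (hf : IsTest f) (hg : ContDiff ℝ (⊤ : ℕ∞) g) : IsTest (fun x => g x * f x) :=
  ⟨hg.mul hf.1, hf.2.mul_left⟩

theorem mul_right (hf : IsTest f) (hg : ContDiff ℝ (⊤ : ℕ∞) g) : IsTest (fun x => f x * g x) :=
  ⟨hf.1.mul hg, hf.2.mul_right⟩

theorem const_mul (hf : IsTest f) (c : ℝ) : IsTest (fun x => c * f x) :=
  hf.mul_left contDiff_const

theorem comp_sub_left (hf : IsTest f) (x : Plane) : IsTest (fun y => f (x - y)) :=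
  ⟨hf.1.comp (contDiff_const.sub contDiff_id),
    hf.2.comp_homeomorph (Homeomorph.subLeft x)⟩

theorem comp_smul (hf : IsTest f) {c : ℝ} (hc : c ≠ 0) : IsTest (fun y => f (c • y)) :=
  ⟨hf.1.comp (contDiff_id.const_smul c),
    hf.2.comp_homeomorph (Homeomorph.smulOfNeZero c hc)⟩

theorem exists_bound (hf : IsTest f) : ∃ C, 0 ≤ C ∧ ∀ x, |f x| ≤ C := by
  obtain ⟨C, hC⟩ := hf.2.exists_bound_of_continuous hf.continuous
  exact ⟨C, (norm_nonneg _).trans (hC 0), hC⟩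

theorem exists_radius (hf : IsTest f) : ∃ r, 1 ≤ r ∧ ∀ x, r ≤ ‖x‖ → f x = 0 := by
  obtain ⟨r, hr⟩ := hf.2.isCompact.isBounded.subset_ball 0
  refine ⟨max r 1, le_max_right _ _, fun x hx => ?_⟩
  by_contra h
  have := hr (subset_tsupport f h)
  rw [mem_ball_zero_iff] at this
  exact absurd ((le_max_left r 1).trans hx) (not_le.2 this)

end IsTest

theorem isTest_of_norm {f : Plane → ℝ} (hf : ContDiff ℝ (⊤ : ℕ∞) f) {r : ℝ}
    (h : ∀ x, r < ‖x‖ → f x = 0) : IsTest f :=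
  ⟨hf, HasCompactSupport.intro (isCompact_closedBall (0 : Plane) r) fun x hx => h x (by
    simpa using hx)⟩

section Rules

variable {f g : Plane → ℝ} {x : Plane} (j : Fin 2)

theorem pd_add (hf : DifferentiableAt ℝ f x) (hg : DifferentiableAt ℝ g x) :
    pd j (fun y => f y + g y) x = pd j f x + pd j g x := by
  unfold pd; rw [fderiv_fun_add hf hg]; rfl

theorem pd_sub (hf : DifferentiableAt ℝ f x) (hg : DifferentiableAt ℝ g x) :
    pd j (fun y => f y - g y) x = pd j f x - pd j g x := by
  unfold pd; rw [fderiv_fun_sub hf hg]; rfl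

theorem pd_neg : pd j (fun y => - f y) x = - pd j f x := by
  unfold pd; rw [fderiv_fun_neg]; rfl

theorem pd_mul (hf : DifferentiableAt ℝ f x) (hg : DifferentiableAt ℝ g x) :
    pd j (fun y => f y * g y) x = f x * pd j g x + g x * pd j f x := by
  unfold pd; rw [fderiv_fun_mul hf hg]; simp

theorem pd_const_mul (hf : DifferentiableAt ℝ f x) (c : ℝ) :
    pd j (fun y => c * f y) x = c * pd j f x := by
  unfold pd; rw [fderiv_const_mul hf]; simp

theorem pd_const (c : ℝ) : pd j (fun _ => c) x = 0 := by
  unfold pd; simp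

theorem pd_comp_sub_right (a : Plane) : pd j (fun y => f (y - a)) x = pd j f (x - a) := by
  unfold pd; rw [fderiv_comp_sub]

theorem pd_comp_smul (c : ℝ) : pd j (fun y => f (c • y)) x = c * pd j f (c • x) := by
  unfold pd; rw [fderiv_comp_smul]; simp

theorem pd_comp_sub_left (a : Plane) : pd j (fun y => f (a - y)) x = - pd j f (a - x) := by
  have h := pd_comp_sub_right (f := fun y => f ((-1 : ℝ) • y)) (x := x) j a
  rw [pd_comp_smul] at h
  simpa using h

theorem pd_congr_of_eventuallyEq (h : f =ᶠ[𝓝 x] g) : pd j f x = pd j g x := by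
  unfold pd; rw [h.fderiv_eq]

theorem pd_scomp {β : ℝ → ℝ} (hβ : DifferentiableAt ℝ β (f x)) (hf : DifferentiableAt ℝ f x) :
    pd j (fun y => β (f y)) x = deriv β (f x) * pd j f x := by
  unfold pd
  have := (hβ.hasDerivAt.comp_hasFDerivAt x hf.hasFDerivAt).fderiv
  rw [show (fun y => β (f y)) = β ∘ f from rfl, this]; simp

end Rules

theorem pd_comm {f : Plane → ℝ} (hf : ContDiff ℝ (⊤ : ℕ∞) f) (i j : Fin 2) :
    pd i (pd j f) = pd j (pd i f) := by
  ext x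
  have hd : DifferentiableAt ℝ (fderiv ℝ f) x :=
    (hf.fderiv_right (m := (⊤ : ℕ∞)) (by simp)).differentiable (by simp) x
  have h (a b : Fin 2) : pd a (pd b f) x =
      fderiv ℝ (fderiv ℝ f) x (EuclideanSpace.single a 1) (EuclideanSpace.single b 1) := by
    unfold pd
    rw [fderiv_clm_apply hd (differentiableAt_const _)]
    simp
  rw [h, h]
  have hs : IsSymmSndFDerivAt ℝ f x :=
    (hf.contDiffAt).isSymmSndFDerivAt (by simp [minSmoothness_of_isRCLikeNormedField]; exact WithTop.coe_le_coe.2 le_top)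
  exact hs _ _

theorem integral_mul_pd {f g : Plane → ℝ} (hf : ContDiff ℝ (⊤ : ℕ∞) f)
    (hg : ContDiff ℝ (⊤ : ℕ∞) g) (hc : HasCompactSupport f ∨ HasCompactSupport g) (j : Fin 2) :
    ∫ x, f x * pd j g x = - ∫ x, pd j f x * g x := by
  have key : HasCompactSupport (fun x => f x * g x) := by
    rcases hc with h | h
    · exact h.mul_right
    · exact h.mul_left
  refine integral_mul_fderiv_eq_neg_fderiv_mul_of_integrable (μ := volume) ?_ ?_ ?_
    (fun x _ => hf.differentiable (by simp) x) (fun x _ => hg.differentiable (by simp) x)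
  · apply Continuous.integrable_of_hasCompactSupport
    · exact (contDiff_pd hf j).continuous.mul hg.continuous
    · rcases hc with h | h
      · exact (hasCompactSupport_pd h j).mul_right
      · exact h.mul_left
  · apply Continuous.integrable_of_hasCompactSupport
    · exact hf.continuous.mul (contDiff_pd hg j).continuous
    · rcases hc with h | h
      · exact h.mul_right
      · exact (hasCompactSupport_pd h j).mul_left
  · exact (hf.continuous.mul hg.continuous).integrable_of_hasCompactSupport key

theorem integral_pd_eq_zero {f : Plane → ℝ} (hf : IsTest f) (j : Fin 2) : ∫ x, pd j f x = 0 := by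
  have := integral_mul_pd (f := fun _ => (1 : ℝ)) contDiff_const hf.1 (Or.inr hf.2) j
  simpa [pd_const] using this

/-! ### Convolution -/

/-- The convolution of two scalar functions on the plane. -/
def cv (f k : Plane → ℝ) : Plane → ℝ := convolution f k (ContinuousLinearMap.mul ℝ ℝ) volume

theorem cv_apply (f k : Plane → ℝ) (x : Plane) : cv f k x = ∫ t, f t * k (x - t) := rfl

theorem cv_apply' (f k : Plane → ℝ) (x : Plane) : cv f k x = ∫ t, f (x - t) * k t :=
  convolution_mul_swap

theorem cv_comm (f k : Plane → ℝ) : cv f k = cv k f := by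
  ext x; rw [cv_apply, cv_apply']; simp only [mul_comm]

theorem contDiff_cv {f k : Plane → ℝ} (hf : LocallyIntegrable f volume) (hk : IsTest k) :
    ContDiff ℝ (⊤ : ℕ∞) (cv f k) :=
  hk.2.contDiff_convolution_right _ hf hk.1

theorem isTest_cv {f k : Plane → ℝ} (hf : LocallyIntegrable f volume) (hfc : HasCompactSupport f)
    (hk : IsTest k) : IsTest (cv f k) :=
  ⟨contDiff_cv hf hk, hfc.convolution _ hk.2⟩

theorem pd_cv {f k : Plane → ℝ} (hf : LocallyIntegrable f volume) (hk : IsTest k) (j : Fin 2) :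
    pd j (cv f k) = cv f (pd j k) := by
  ext x
  have h := (hk.2.hasFDerivAt_convolution_right (ContinuousLinearMap.mul ℝ ℝ) hf
    (hk.1.of_le (by exact_mod_cast le_top)) x).fderiv
  have e : cv f k = convolution f k (ContinuousLinearMap.mul ℝ ℝ) volume := rfl
  unfold pd
  rw [e, h]
  have hc : HasCompactSupport (fderiv ℝ k) := hk.2.fderiv ℝ
  have hcont : Continuous (fderiv ℝ k) := hk.1.continuous_fderiv (by simp)
  rw [convolution_precompR_apply _ hf hc hcont]
  rfl

theorem integrable_cv_integrand {f k : Plane → ℝ} (hf : LocallyIntegrable f volume)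
    (hk : Continuous k) (hkc : HasCompactSupport k) (x : Plane) :
    Integrable (fun t => f t * k (x - t)) volume :=
  (hkc.convolutionExists_right (ContinuousLinearMap.mul ℝ ℝ) hf hk x)

/-! ### Quadratic bounds for convolutions -/

/-- Cauchy–Schwarz after splitting `|k|` into two square roots. One copy of `|k|` stays inside the
integral, so that local information on `f` can be used as well as global. -/
theorem enorm_cv_sq_le {f k : Plane → ℝ} (hf : AEMeasurable f volume) (hk : Continuous k)
    (x : Plane) :
    ‖cv f k x‖ₑ ^ 2 ≤ (∫⁻ t, ‖k t‖ₑ) * ∫⁻ t, ‖f t‖ₑ ^ 2 * ‖k (x - t)‖ₑ := by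
  have hk' : ∫⁻ t, ‖k (x - t)‖ₑ = ∫⁻ t, ‖k t‖ₑ :=
    lintegral_sub_left_eq_self (fun t => ‖k t‖ₑ) x
  have h1 : ‖cv f k x‖ₑ ≤ ∫⁻ t, ‖k (x - t)‖ₑ ^ (1 / 2 : ℝ) *
      (‖f t‖ₑ * ‖k (x - t)‖ₑ ^ (1 / 2 : ℝ)) := by
    rw [cv_apply]
    refine (enorm_integral_le_lintegral_enorm _).trans (le_of_eq ?_)
    congr 1; ext t
    rw [enorm_mul, mul_left_comm, ← ENNReal.rpow_add_of_nonneg _ _ (by norm_num) (by norm_num)]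
    norm_num
  have hkm : AEMeasurable (fun t => ‖k (x - t)‖ₑ ^ (1 / 2 : ℝ)) volume := by
    have : Continuous fun t => k (x - t) := by fun_prop
    exact (this.measurable.enorm.pow_const _).aemeasurable
  have h2 := ENNReal.lintegral_mul_le_Lp_mul_Lq volume (Real.HolderConjugate.two_two) hkm
    (hf.enorm.mul hkm)
  have e1 : ∀ a : ℝ≥0∞, (a ^ (1 / 2 : ℝ)) ^ (2 : ℝ) = a := fun a => by
    rw [← ENNReal.rpow_mul]; norm_num
  have e2 : ∀ a : ℝ≥0∞, (a ^ (1 / 2 : ℝ)) ^ 2 = a := fun a => by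
    rw [← ENNReal.rpow_two, e1]
  have h3 := h1.trans h2
  have h4 : ‖cv f k x‖ₑ ^ 2 ≤ _ := pow_le_pow_left' h3 2
  refine h4.trans (le_of_eq ?_)
  simp only [Pi.mul_apply]
  rw [mul_pow, e2, e2]
  simp only [e1, hk', ENNReal.mul_rpow_of_nonneg _ _ (zero_le_two (α := ℝ)), ENNReal.rpow_two]

/-- Young's inequality, by integrating the pointwise bound `enorm_cv_sq_le` and exchanging the
integrals. -/
theorem lintegral_cv_sq_le {f k : Plane → ℝ} (hf : AEMeasurable f volume) (hk : Continuous k) :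
    ∫⁻ x, ‖cv f k x‖ₑ ^ 2 ≤ (∫⁻ t, ‖k t‖ₑ) ^ 2 * ∫⁻ t, ‖f t‖ₑ ^ 2 := by
  calc ∫⁻ x, ‖cv f k x‖ₑ ^ 2
      ≤ ∫⁻ x, (∫⁻ t, ‖k t‖ₑ) * ∫⁻ t, ‖f t‖ₑ ^ 2 * ‖k (x - t)‖ₑ :=
        lintegral_mono fun x => enorm_cv_sq_le hf hk x
    _ ≤ (∫⁻ t, ‖k t‖ₑ) * ∫⁻ x, ∫⁻ t, ‖f t‖ₑ ^ 2 * ‖k (x - t)‖ₑ := by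
        rw [lintegral_const_mul'']
        have : AEMeasurable (fun p : Plane × Plane => ‖f p.2‖ₑ ^ 2 * ‖k (p.1 - p.2)‖ₑ)
            (volume.prod volume) := by
          have h1 : AEMeasurable (fun p : Plane × Plane => f p.2) (volume.prod volume) :=
            hf.comp_snd
          have h2 : Continuous fun p : Plane × Plane => k (p.1 - p.2) := by fun_prop
          exact (h1.enorm.pow_const 2).mul h2.measurable.enorm.aemeasurable
        exact this.lintegral_prod_right'
    _ = (∫⁻ t, ‖k t‖ₑ) * ∫⁻ t, ∫⁻ x, ‖f t‖ₑ ^ 2 * ‖k (x - t)‖ₑ := by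
        rw [lintegral_lintegral_swap]
        have h1 : AEMeasurable (fun p : Plane × Plane => f p.2) (volume.prod volume) :=
          hf.comp_snd
        have h2 : Continuous fun p : Plane × Plane => k (p.1 - p.2) := by fun_prop
        exact (h1.enorm.pow_const 2).mul h2.measurable.enorm.aemeasurable
    _ = (∫⁻ t, ‖k t‖ₑ) * ∫⁻ t, ‖f t‖ₑ ^ 2 * ∫⁻ x, ‖k x‖ₑ := by
        congr 1
        refine lintegral_congr fun t => ?_
        rw [lintegral_const_mul]
        · congr 1
          exact lintegral_sub_right_eq_self (fun t => ‖k t‖ₑ) t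
        · have : Continuous fun x => k (x - t) := by fun_prop
          exact this.measurable.enorm
    _ = _ := by
        rw [lintegral_mul_const'' _ (hf.enorm.pow_const 2)]; ring

/-! ### The mollifier -/

/-- The profile `2 σ'(1 - |x|²)` where `σ` is the smooth transition function. -/
def molProfile (x : Plane) : ℝ := 2 * deriv Real.smoothTransition (1 - ‖x‖ ^ 2)

theorem contDiff_one_sub_normSq : ContDiff ℝ (⊤ : ℕ∞) fun x : Plane => 1 - ‖x‖ ^ 2 :=
  contDiff_const.sub (contDiff_norm_sq ℝ)

theorem contDiff_deriv_smoothTransition :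
    ContDiff ℝ (⊤ : ℕ∞) (deriv Real.smoothTransition) := by
  have h : ContDiff ℝ (⊤ : ℕ∞) Real.smoothTransition := Real.smoothTransition.contDiff
  exact (contDiff_infty_iff_deriv.1 h).2

theorem contDiff_molProfile : ContDiff ℝ (⊤ : ℕ∞) molProfile :=
  contDiff_const.mul (contDiff_deriv_smoothTransition.comp contDiff_one_sub_normSq)

theorem monotone_smoothTransition : Monotone Real.smoothTransition := by
  exact Real.smoothTransition.monotone

theorem molProfile_nonneg (x : Plane) : 0 ≤ molProfile x :=
  mul_nonneg zero_le_two (Monotone.deriv_nonneg monotone_smoothTransition)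

theorem molProfile_eq_zero {x : Plane} (hx : 1 ≤ ‖x‖) : molProfile x = 0 := by
  rcases hx.eq_or_lt with h | h
  -- On the unit sphere the argument is exactly `0`; the derivative vanishes there as a limit from
  -- the negative axis.
  · have hc : IsClosed {y : ℝ | deriv Real.smoothTransition y = 0} :=
      isClosed_eq contDiff_deriv_smoothTransition.continuous continuous_const
    have hs : Iio (0 : ℝ) ⊆ {y : ℝ | deriv Real.smoothTransition y = 0} := fun y hy => by
      have : Real.smoothTransition =ᶠ[𝓝 y] fun _ => 0 := by
        filter_upwards [Iio_mem_nhds hy] with z hz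
        exact Real.smoothTransition.zero_of_nonpos (le_of_lt hz)
      simp [this.deriv_eq]
    have h0 : (0 : ℝ) ∈ closure (Iio (0 : ℝ)) := by simp
    have := (hc.closure_subset_iff.2 hs) h0
    rw [mem_ofPred_eq] at this
    simp [molProfile, ← h, this]
  · have hy : 1 - ‖x‖ ^ 2 < 0 := by nlinarith
    have : Real.smoothTransition =ᶠ[𝓝 (1 - ‖x‖ ^ 2)] fun _ => 0 := by
      filter_upwards [Iio_mem_nhds hy] with z hz
      exact Real.smoothTransition.zero_of_nonpos (le_of_lt hz)
    simp [molProfile, this.deriv_eq]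

theorem isTest_molProfile : IsTest molProfile :=
  isTest_of_norm contDiff_molProfile fun _ hx => molProfile_eq_zero hx.le

/-- The potential whose gradient is `x ↦ x * molProfile x`. -/
def potProfile (x : Plane) : ℝ := - Real.smoothTransition (1 - ‖x‖ ^ 2)

theorem isTest_potProfile : IsTest potProfile :=
  isTest_of_norm ((Real.smoothTransition.contDiff.comp contDiff_one_sub_normSq).neg)
    (r := 1) fun x hx => by
      simp only [potProfile, neg_eq_zero]
      exact Real.smoothTransition.zero_of_nonpos (by nlinarith)

theorem pd_normSq (j : Fin 2) (x : Plane) : pd j (fun y => ‖y‖ ^ 2) x = 2 * x j := by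
  have h := (hasStrictFDerivAt_norm_sq x).hasFDerivAt.fderiv
  unfold pd
  rw [h]
  simp [EuclideanSpace.inner_single_right]

/-- This is the reason for the shape of `molProfile`: the field `x ↦ molProfile x • x` is the
gradient of a compactly supported potential, so that differentiating the mollifier in its scale
produces a Laplacian. -/
theorem pd_potProfile (j : Fin 2) (x : Plane) : pd j potProfile x = x j * molProfile x := by
  have h1 : DifferentiableAt ℝ (fun y : Plane => 1 - ‖y‖ ^ 2) x :=
    contDiff_one_sub_normSq.differentiable (by simp) x
  have h2 : DifferentiableAt ℝ Real.smoothTransition (1 - ‖x‖ ^ 2) :=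
    (Real.smoothTransition.contDiff (n := 1)).differentiable (by simp) _
  have h3 := pd_scomp (f := fun y : Plane => 1 - ‖y‖ ^ 2) j h2 h1
  have h4 : pd j (fun y : Plane => 1 - ‖y‖ ^ 2) x = - (2 * x j) := by
    rw [pd_sub j (differentiableAt_const _) ((contDiff_norm_sq ℝ).differentiable
      (n := (⊤ : ℕ∞)) (by simp) x), pd_const, pd_normSq]; ring
  unfold potProfile
  rw [pd_neg, h3, h4, molProfile]; ring

/-- If the profile vanished identically, its potential would be constant, but that potential is `-1`
at the origin and `0` on the unit sphere. -/
theorem integral_molProfile_pos : 0 < ∫ x, molProfile x := by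
  rw [integral_pos_iff_support_of_nonneg molProfile_nonneg isTest_molProfile.integrable]
  have ho : IsOpen (Function.support molProfile) :=
    contDiff_molProfile.continuous.isOpen_support
  refine ho.measure_pos volume ?_
  by_contra hne
  rw [not_nonempty_iff_eq_empty, Function.support_eq_empty_iff] at hne
  have hz : ∀ x, fderiv ℝ potProfile x = 0 := fun x => by
    ext v
    rw [fderiv_eq_sum_pd, pd_potProfile, pd_potProfile, hne]; simp
  have := is_const_of_fderiv_eq_zero isTest_potProfile.differentiable hz 0
    (EuclideanSpace.single 0 1)
  simp [potProfile] at this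

/-- The normalised radial mollifier, supported in the unit ball. -/
def mol (x : Plane) : ℝ := (∫ y, molProfile y)⁻¹ * molProfile x

/-- The potential of `x ↦ x * mol x`. -/
def molPot (x : Plane) : ℝ := (∫ y, molProfile y)⁻¹ * potProfile x

theorem isTest_mol : IsTest mol := isTest_molProfile.const_mul _

theorem isTest_molPot : IsTest molPot := isTest_potProfile.const_mul _

theorem mol_nonneg (x : Plane) : 0 ≤ mol x :=
  mul_nonneg (inv_nonneg.2 integral_molProfile_pos.le) (molProfile_nonneg x)

theorem mol_eq_zero {x : Plane} (hx : 1 ≤ ‖x‖) : mol x = 0 := by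
  simp [mol, molProfile_eq_zero hx]

theorem integral_mol : ∫ x, mol x = 1 := by
  unfold mol
  rw [integral_const_mul, inv_mul_cancel₀ integral_molProfile_pos.ne']

theorem pd_molPot (j : Fin 2) (x : Plane) : pd j molPot x = x j * mol x := by
  unfold molPot mol
  rw [pd_const_mul j (isTest_potProfile.differentiable x), pd_potProfile]; ring

/-- The rescaled mollifier `s⁻² mol (x / s)`. -/
def mols (s : ℝ) (x : Plane) : ℝ := (s ^ 2)⁻¹ * mol (s⁻¹ • x)

theorem integral_comp_inv_smul_plane (f : Plane → ℝ) {s : ℝ} (hs : 0 < s) :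
    ∫ x, f (s⁻¹ • x) = s ^ 2 * ∫ x, f x := by
  rw [Measure.integral_comp_inv_smul]
  simp [abs_of_pos hs]

section Mols

variable {s : ℝ}

theorem isTest_mols (hs : 0 < s) : IsTest (mols s) :=
  (isTest_mol.comp_smul (inv_ne_zero hs.ne')).const_mul _

theorem mols_nonneg (x : Plane) : 0 ≤ mols s x :=
  mul_nonneg (inv_nonneg.2 (sq_nonneg s)) (mol_nonneg _)

theorem mols_eq_zero (hs : 0 < s) {x : Plane} (hx : s ≤ ‖x‖) : mols s x = 0 := by
  have : 1 ≤ ‖s⁻¹ • x‖ := by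
    rw [norm_smul, norm_inv, Real.norm_of_nonneg hs.le, inv_mul_eq_div, le_div_iff₀ hs]; linarith
  simp [mols, mol_eq_zero this]

theorem integral_mols (hs : 0 < s) : ∫ x, mols s x = 1 := by
  unfold mols
  rw [integral_const_mul, integral_comp_inv_smul_plane mol hs, integral_mol]
  field_simp

theorem lintegral_mols (hs : 0 < s) : ∫⁻ x, ‖mols s x‖ₑ = 1 := by
  have := ofReal_integral_eq_lintegral_ofReal (isTest_mols hs).integrable
    (Eventually.of_forall fun x => mols_nonneg (s := s) x)
  rw [integral_mols hs, ENNReal.ofReal_one] at this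
  rw [this]
  refine lintegral_congr fun x => ?_
  rw [Real.enorm_of_nonneg (mols_nonneg x)]

theorem exists_mol_bound : ∃ C, 1 ≤ C ∧ (∀ x, |mol x| ≤ C) ∧ ∀ j x, |pd j mol x| ≤ C := by
  obtain ⟨C, h0, hC⟩ := isTest_mol.exists_bound
  obtain ⟨C0, _, hC0⟩ := (isTest_mol.pd 0).exists_bound
  obtain ⟨C1, _, hC1⟩ := (isTest_mol.pd 1).exists_bound
  refine ⟨1 + C + |C0| + |C1|, by linarith [abs_nonneg C0, abs_nonneg C1],
    fun x => ?_, fun j x => ?_⟩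
  · linarith [hC x, abs_nonneg C0, abs_nonneg C1]
  · fin_cases j
    · exact (hC0 x).trans (by linarith [abs_nonneg C1, le_abs_self C0])
    · exact (hC1 x).trans (by linarith [abs_nonneg C0, le_abs_self C1])

/-- A common bound for the mollifier and its first derivatives. -/
def molBd : ℝ := exists_mol_bound.choose

theorem one_le_molBd : 1 ≤ molBd := exists_mol_bound.choose_spec.1

theorem molBd_pos : 0 < molBd := zero_lt_one.trans_le one_le_molBd

theorem abs_mols_le (hs : 0 < s) (x : Plane) : |mols s x| ≤ molBd * (s ^ 2)⁻¹ := by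
  rw [mols, abs_mul, abs_of_nonneg (inv_nonneg.2 (sq_nonneg s)), mul_comm]
  gcongr
  exact exists_mol_bound.choose_spec.2.1 _

theorem pd_mols (hs : 0 < s) (j : Fin 2) (x : Plane) :
    pd j (mols s) x = (s ^ 3)⁻¹ * pd j mol (s⁻¹ • x) := by
  unfold mols
  rw [pd_const_mul j ((isTest_mol.comp_smul (inv_ne_zero hs.ne')).differentiable x), pd_comp_smul]
  field_simp

theorem abs_pd_mols_le (hs : 0 < s) (j : Fin 2) (x : Plane) :
    |pd j (mols s) x| ≤ molBd * (s ^ 3)⁻¹ := by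
  rw [pd_mols hs, abs_mul, abs_of_nonneg (inv_nonneg.2 (by positivity)), mul_comm]
  gcongr
  exact exists_mol_bound.choose_spec.2.2 _ _

/-- Off the closed ball the function vanishes locally. Points of the sphere are reached from outside
along their ray, by continuity of the derivative. -/
theorem pd_eq_zero_of_forall {f : Plane → ℝ} {r : ℝ} (h : ∀ x, r ≤ ‖x‖ → f x = 0)
    (hf : ContDiff ℝ (⊤ : ℕ∞) f) (j : Fin 2) {x : Plane} (hr : 0 < r) (hx : r ≤ ‖x‖) :
    pd j f x = 0 := by
  have key : ∀ y : Plane, r < ‖y‖ → pd j f y = 0 := fun y hy => by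
    have : f =ᶠ[𝓝 y] fun _ => 0 := by
      filter_upwards [(isOpen_lt continuous_const continuous_norm).mem_nhds hy] with z hz
      exact h z (le_of_lt hz)
    rw [pd_congr_of_eventuallyEq j this, pd_const]
  have hx0 : 0 < ‖x‖ := hr.trans_le hx
  have ht : Tendsto (fun n : ℕ => (1 + 1 / ((n : ℝ) + 1)) • x) atTop (𝓝 x) := by
    have h1 : Tendsto (fun n : ℕ => (1 + 1 / ((n : ℝ) + 1))) atTop (𝓝 (1 + 0)) :=
      tendsto_const_nhds.add tendsto_one_div_add_atTop_nhds_zero_nat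
    simpa using h1.smul_const x
  have h2 := ((contDiff_pd hf j).continuous.tendsto x).comp ht
  refine tendsto_nhds_unique h2 (tendsto_const_nhds.congr fun n => ?_)
  simp only [Function.comp_apply]
  rw [key]
  rw [norm_smul, Real.norm_of_nonneg (by positivity)]
  have : 0 < 1 / ((n : ℝ) + 1) := by positivity
  nlinarith

theorem pd_mols_eq_zero (hs : 0 < s) (j : Fin 2) {x : Plane} (hx : s ≤ ‖x‖) :
    pd j (mols s) x = 0 :=
  pd_eq_zero_of_forall (fun _ => mols_eq_zero hs) (isTest_mols hs).1 j hs hx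

theorem pd_molPot_smul (hs : 0 < s) (j : Fin 2) (x : Plane) :
    pd j (fun y => molPot (s⁻¹ • y)) x = x j * mols s x := by
  rw [pd_comp_smul, pd_molPot, mols]
  simp; field_simp

end Mols

/-! ### Lebesgue points -/

theorem volume_closedBall_plane (x : Plane) {s : ℝ} (hs : 0 ≤ s) :
    volume.real (closedBall x s) = s ^ 2 * Real.pi := by
  simp [Measure.real, EuclideanSpace.volume_closedBall_fin_two, ENNReal.toReal_mul, hs, Real.pi_nonneg]

theorem ae_tendsto_lebesgue {f : Plane → ℝ} (hf : LocallyIntegrable f volume) :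
    ∀ᵐ x, Tendsto (fun s : ℝ => (s ^ 2)⁻¹ * ∫ y in closedBall x s, |f y - f x|)
      (𝓝[>] 0) (𝓝 0) := by
  filter_upwards [(Besicovitch.vitaliFamily (volume : Measure Plane)).ae_tendsto_average_norm_sub
    hf] with x hx
  have h := (hx.comp (Besicovitch.tendsto_filterAt volume x)).const_mul Real.pi
  rw [mul_zero] at h
  refine h.congr' ?_
  filter_upwards [self_mem_nhdsWithin] with s hs
  have hs' : (0 : ℝ) < s := hs
  simp only [Function.comp_apply]
  rw [setAverage_eq, volume_closedBall_plane x hs'.le, smul_eq_mul]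
  simp only [Real.norm_eq_abs]
  field_simp

/-- The mollifier has mass one and is at most `molBd * (s ^ 2)⁻¹` on a ball of radius `s`, so the
error is controlled by a mean oscillation, which vanishes at Lebesgue points. -/
theorem abs_cv_mols_sub_le {f : Plane → ℝ} (hf : LocallyIntegrable f volume) {s : ℝ} (hs : 0 < s)
    (x : Plane) (c : ℝ) :
    |cv f (mols s) x - c| ≤ molBd * ((s ^ 2)⁻¹ * ∫ y in closedBall x s, |f y - c|) := by
  have hm := isTest_mols hs
  have hint : Integrable (fun t => mols s (x - t)) volume := (hm.comp_sub_left x).integrable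
  have h1 : ∫ t, mols s (x - t) = 1 := by
    rw [integral_sub_left_eq_self (mols s) volume x, integral_mols hs]
  have h2 : cv f (mols s) x - c = ∫ t, (f t - c) * mols s (x - t) := by
    simp only [sub_mul]
    rw [integral_sub (integrable_cv_integrand hf hm.continuous hm.2 x) (hint.const_mul c),
      integral_const_mul, h1, cv_apply, mul_one]
  have h3 : ∫ t, (f t - c) * mols s (x - t) =
      ∫ t in closedBall x s, (f t - c) * mols s (x - t) := by
    rw [setIntegral_eq_integral_of_forall_compl_eq_zero]
    intro t ht
    rw [mols_eq_zero hs, mul_zero]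
    rw [mem_closedBall, not_le, dist_eq_norm, norm_sub_rev] at ht
    exact ht.le
  rw [h2, h3, ← mul_assoc, ← integral_const_mul]
  refine norm_integral_le_of_norm_le (μ := volume.restrict (closedBall x s))
    (f := fun t => (f t - c) * mols s (x - t)) ?_ (Eventually.of_forall fun t => ?_)
  · refine Integrable.const_mul ?_ _
    have : IntegrableOn (fun y => f y - c) (closedBall x s) volume :=
      (hf.integrableOn_isCompact (isCompact_closedBall x s)).sub
        (integrableOn_const measure_closedBall_lt_top.ne)
    exact this.abs
  · rw [Real.norm_eq_abs, abs_mul, mul_comm]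
    gcongr
    exact abs_mols_le hs _

theorem ae_tendsto_cv_mols {f : Plane → ℝ} (hf : LocallyIntegrable f volume) :
    ∀ᵐ x, Tendsto (fun s : ℝ => cv f (mols s) x) (𝓝[>] 0) (𝓝 (f x)) := by
  filter_upwards [ae_tendsto_lebesgue hf] with x hx
  rw [tendsto_iff_norm_sub_tendsto_zero]
  refine tendsto_of_tendsto_of_tendsto_of_le_of_le' tendsto_const_nhds
    (by simpa using hx.const_mul molBd) (Eventually.of_forall fun _ => norm_nonneg _) ?_
  filter_upwards [self_mem_nhdsWithin] with s hs
  exact abs_cv_mols_sub_le hf hs x (f x)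

/-! ### Cut-off functions -/

/-- A fixed smooth cut-off, equal to one on the unit ball and zero off the ball of radius `9/8`. -/
def cutBump : ContDiffBump (0 : Plane) := ⟨1, 9 / 8, by norm_num, by norm_num⟩

/-- The cut-off function at scale `r`. -/
def cutoff (r : ℝ) (x : Plane) : ℝ := cutBump (r⁻¹ • x)

section Cutoff

variable {r : ℝ}

theorem isTest_cutBump : IsTest (fun x => cutBump x) := ⟨cutBump.contDiff, cutBump.hasCompactSupport⟩

theorem isTest_cutoff (hr : 0 < r) : IsTest (cutoff r) :=
  isTest_cutBump.comp_smul (inv_ne_zero hr.ne')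

theorem cutoff_nonneg (x : Plane) : 0 ≤ cutoff r x := cutBump.nonneg

theorem cutoff_le_one (x : Plane) : cutoff r x ≤ 1 := cutBump.le_one

theorem cutoff_eq_one (hr : 0 < r) {x : Plane} (hx : ‖x‖ ≤ r) : cutoff r x = 1 := by
  refine cutBump.one_of_mem_closedBall ?_
  rw [mem_closedBall_zero_iff, norm_smul, norm_inv, Real.norm_of_nonneg hr.le, inv_mul_eq_div,
    div_le_iff₀ hr]
  simpa [cutBump] using hx

theorem cutoff_eq_zero (hr : 0 < r) {x : Plane} (hx : 9 / 8 * r ≤ ‖x‖) : cutoff r x = 0 := by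
  refine cutBump.zero_of_le_dist ?_
  rw [dist_zero_right, norm_smul, norm_inv, Real.norm_of_nonneg hr.le, inv_mul_eq_div,
    le_div_iff₀ hr]
  simpa [cutBump] using hx

theorem exists_cutoff_bound : ∃ C, 1 ≤ C ∧ ∀ r, 0 < r → ∀ j x, |pd j (cutoff r) x| ≤ C / r := by
  obtain ⟨C0, _, hC0⟩ := (isTest_cutBump.pd 0).exists_bound
  obtain ⟨C1, _, hC1⟩ := (isTest_cutBump.pd 1).exists_bound
  refine ⟨1 + |C0| + |C1|, by linarith [abs_nonneg C0, abs_nonneg C1], fun r hr j x => ?_⟩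
  have : pd j (cutoff r) x = r⁻¹ * pd j (fun x => cutBump x) (r⁻¹ • x) := pd_comp_smul j r⁻¹
  rw [this, abs_mul, abs_of_pos (inv_pos.2 hr), inv_mul_eq_div]
  gcongr
  fin_cases j
  · exact (hC0 _).trans (by linarith [abs_nonneg C1, le_abs_self C0])
  · exact (hC1 _).trans (by linarith [abs_nonneg C0, le_abs_self C1])

/-- A bound for the gradient of the cut-off functions. -/
def cutBd : ℝ := exists_cutoff_bound.choose

theorem one_le_cutBd : 1 ≤ cutBd := exists_cutoff_bound.choose_spec.1

theorem abs_pd_cutoff_le (hr : 0 < r) (j : Fin 2) (x : Plane) : |pd j (cutoff r) x| ≤ cutBd / r :=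
  exists_cutoff_bound.choose_spec.2 r hr j x

theorem pd_cutoff_eq_zero (hr : 0 < r) (j : Fin 2) {x : Plane} (hx : 9 / 8 * r ≤ ‖x‖) :
    pd j (cutoff r) x = 0 :=
  pd_eq_zero_of_forall (fun _ => cutoff_eq_zero hr) (isTest_cutoff hr).1 j (by positivity) hx

theorem pd_cutoff_eq_zero_of_lt (hr : 0 < r) (j : Fin 2) {x : Plane} (hx : ‖x‖ < r) :
    pd j (cutoff r) x = 0 := by
  have : cutoff r =ᶠ[𝓝 x] fun _ => 1 := by
    filter_upwards [(isOpen_lt continuous_norm continuous_const).mem_nhds hx] with z hz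
    exact cutoff_eq_one hr (le_of_lt hz)
  rw [pd_congr_of_eventuallyEq j this, pd_const]

end Cutoff

/-- A radial cut-off function. -/
def radialCut (x : Plane) : ℝ := Real.smoothTransition (2 - ‖x‖ ^ 2)

/-- The energy estimates are run with this cut-off instead of the given `θ`, which keeps the final
constant independent of `θ`. -/
theorem isCutoff_radialCut : IsCutoff radialCut where
  contDiff := Real.smoothTransition.contDiff.comp (contDiff_const.sub (contDiff_norm_sq ℝ))
  radial x y h := by simp [radialCut, h]
  nonneg x := Real.smoothTransition.nonneg _
  le_one x := Real.smoothTransition.le_one _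
  eq_one x hx := Real.smoothTransition.one_of_one_le (by nlinarith [norm_nonneg x])
  support_subset := by
    refine closure_minimal (fun x hx => ?_) isClosed_closedBall
    rw [mem_closedBall_zero_iff]
    by_contra h
    exact hx (Real.smoothTransition.zero_of_nonpos (by nlinarith))

/-! ### Fields with bounded vorticity -/

section Weak

variable {u : Plane → Plane} {ω : Plane → ℝ} {W : ℝ}

theorem integrable_mul_test {f φ : Plane → ℝ} (hf : LocallyIntegrable f volume) (hφ : IsTest φ) :
    Integrable (fun x => f x * φ x) volume := by
  simpa using integrable_cv_integrand (k := fun y => φ (-y)) hf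
    (by have := hφ.continuous; fun_prop) (hφ.2.comp_homeomorph (Homeomorph.neg Plane)) 0

theorem IsDivFree.integral_eq (hu : ∀ j, LocallyIntegrable (fun x => u x j) volume)
    (hd : IsDivFree u) {φ : Plane → ℝ} (hφ : IsTest φ) :
    (∫ x, u x 0 * pd 0 φ x) + ∫ x, u x 1 * pd 1 φ x = 0 := by
  rw [← integral_add (integrable_mul_test (hu 0) (hφ.pd 0)) (integrable_mul_test (hu 1) (hφ.pd 1))]
  rw [← hd φ hφ.1 hφ.2]
  exact integral_congr_ae (Eventually.of_forall fun x => (fderiv_eq_sum_pd _ _ _).symm)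

theorem IsVorticity.integral_eq (hu : ∀ j, LocallyIntegrable (fun x => u x j) volume)
    (hω : IsVorticity u ω) {φ : Plane → ℝ} (hφ : IsTest φ) :
    ∫ x, ω x * φ x = (∫ x, u x 0 * pd 1 φ x) - ∫ x, u x 1 * pd 0 φ x := by
  rw [← integral_sub (integrable_mul_test (hu 0) (hφ.pd 1)) (integrable_mul_test (hu 1) (hφ.pd 0))]
  exact hω.2 φ hφ.1 hφ.2

/-- First component of the weak identity between `Δu` and the rotated gradient of `ω`: the
divergence condition is tested with `∂₀φ`, the vorticity with `∂₁φ`. -/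
theorem integral_laplacian_zero (hu : ∀ j, LocallyIntegrable (fun x => u x j) volume)
    (hd : IsDivFree u) (hω : IsVorticity u ω) {φ : Plane → ℝ} (hφ : IsTest φ) :
    ∫ x, u x 0 * (pd 0 (pd 0 φ) x + pd 1 (pd 1 φ) x) = ∫ x, ω x * pd 1 φ x := by
  have h1 := hd.integral_eq hu (hφ.pd 0)
  have h2 := hω.integral_eq hu (hφ.pd 1)
  rw [pd_comm hφ.1 1 0] at h1
  simp only [mul_add]
  rw [integral_add (integrable_mul_test (hu 0) ((hφ.pd 0).pd 0))
    (integrable_mul_test (hu 0) ((hφ.pd 1).pd 1))]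
  linarith

theorem integral_laplacian_one (hu : ∀ j, LocallyIntegrable (fun x => u x j) volume)
    (hd : IsDivFree u) (hω : IsVorticity u ω) {φ : Plane → ℝ} (hφ : IsTest φ) :
    ∫ x, u x 1 * (pd 0 (pd 0 φ) x + pd 1 (pd 1 φ) x) = - ∫ x, ω x * pd 0 φ x := by
  have h1 := hd.integral_eq hu (hφ.pd 1)
  have h2 := hω.integral_eq hu (hφ.pd 0)
  rw [← pd_comm hφ.1 1 0] at h1
  simp only [mul_add]
  rw [integral_add (integrable_mul_test (hu 1) ((hφ.pd 0).pd 0))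
    (integrable_mul_test (hu 1) ((hφ.pd 1).pd 1))]
  linarith

theorem isTest_molPot_smul {s : ℝ} (hs : 0 < s) : IsTest (fun y => molPot (s⁻¹ • y)) :=
  isTest_molPot.comp_smul (inv_ne_zero hs.ne')

theorem abs_coord_le (x : Plane) (j : Fin 2) : |x j| ≤ ‖x‖ := EuclideanSpace.norm_eq x ▸ by
  refine Real.le_sqrt_of_sq_le ?_
  simp only [Fin.sum_univ_two, Real.norm_eq_abs, sq_abs]
  fin_cases j <;> simp <;> positivity

theorem abs_pd_molPot_le {s : ℝ} (hs : 0 < s) (j : Fin 2) (x : Plane) :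
    |pd j (fun y => molPot (s⁻¹ • y)) x| ≤ s * mols s x := by
  rw [pd_molPot_smul hs, abs_mul, abs_of_nonneg (mols_nonneg x)]
  rcases le_or_gt s ‖x‖ with h | h
  · simp [mols_eq_zero hs h]
  · exact mul_le_mul_of_nonneg_right ((abs_coord_le x j).trans h.le) (mols_nonneg x)

/-- The derivative of `s ↦ mols s x`. -/
def molsDeriv (s : ℝ) (x : Plane) : ℝ :=
  -s⁻¹ * (pd 0 (pd 0 fun y => molPot (s⁻¹ • y)) x + pd 1 (pd 1 fun y => molPot (s⁻¹ • y)) x)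

theorem continuous_coord (j : Fin 2) : ContDiff ℝ (⊤ : ℕ∞) fun x : Plane => x j := by
  fun_prop

theorem pd_coord (j : Fin 2) (x : Plane) : pd j (fun y => y j) x = 1 := by
  unfold pd
  have : (fun y : Plane => y j) = EuclideanSpace.proj (𝕜 := ℝ) j := rfl
  rw [this, ContinuousLinearMap.fderiv]
  simp

/-- Dilations preserve the mass, so the derivative in the scale is `-s⁻¹ div (x mols)`, and `x mols`
is the gradient of the rescaled potential. Here the divergence is expanded. -/
theorem molsDeriv_eq {s : ℝ} (hs : 0 < s) (x : Plane) :
    molsDeriv s x = -s⁻¹ * (2 * mols s x + x 0 * pd 0 (mols s) x + x 1 * pd 1 (mols s) x) := by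
  have h (j : Fin 2) : pd j (pd j fun y => molPot (s⁻¹ • y)) x =
      x j * pd j (mols s) x + mols s x := by
    rw [show (pd j fun y => molPot (s⁻¹ • y)) = fun y => y j * mols s y from
      funext fun y => pd_molPot_smul hs j y, pd_mul j
      ((continuous_coord j).differentiable (by simp) x) ((isTest_mols hs).differentiable x),
      pd_coord, mul_one]
  rw [molsDeriv, h, h]; ring

theorem hasDerivAt_mols {s : ℝ} (hs : 0 < s) (x : Plane) :
    HasDerivAt (fun s => mols s x) (molsDeriv s x) s := by
  have h1 : HasDerivAt (fun s : ℝ => s⁻¹ • x) ((-(s ^ 2)⁻¹) • x) s :=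
    (hasDerivAt_inv hs.ne').smul_const x
  have h2 := (isTest_mol.differentiable (s⁻¹ • x)).hasFDerivAt.comp_hasDerivAt s h1
  have h3 : HasDerivAt (fun s : ℝ => (s ^ 2)⁻¹) (-(2 * s) / (s ^ 2) ^ 2) s := by
    have := (hasDerivAt_pow 2 s).inv (by positivity)
    exact (this : HasDerivAt (fun s : ℝ => (s ^ 2)⁻¹) _ s).congr_deriv (by simp)
  have h4 := h3.mul h2
  refine h4.congr_deriv ?_
  rw [molsDeriv_eq hs, pd_mols hs, pd_mols hs, fderiv_eq_sum_pd]
  simp only [Function.comp_apply, mols, PiLp.smul_apply, smul_eq_mul]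
  field_simp
  ring

theorem abs_molsDeriv_le {s : ℝ} (hs : 0 < s) (x : Plane) :
    |molsDeriv s x| ≤ 4 * molBd * (s ^ 3)⁻¹ := by
  rw [molsDeriv_eq hs]
  rcases le_or_gt s ‖x‖ with h | h
  · rw [mols_eq_zero hs h, pd_mols_eq_zero hs _ h, pd_mols_eq_zero hs _ h]
    have := molBd_pos
    simp; positivity
  · have e0 : |x 0 * pd 0 (mols s) x| ≤ s * (molBd * (s ^ 3)⁻¹) := by
      rw [abs_mul]
      exact mul_le_mul ((abs_coord_le x 0).trans h.le) (abs_pd_mols_le hs 0 x) (abs_nonneg _) hs.le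
    have e1 : |x 1 * pd 1 (mols s) x| ≤ s * (molBd * (s ^ 3)⁻¹) := by
      rw [abs_mul]
      exact mul_le_mul ((abs_coord_le x 1).trans h.le) (abs_pd_mols_le hs 1 x) (abs_nonneg _) hs.le
    have e2 := abs_mols_le hs x
    rw [abs_mul, abs_neg, abs_of_pos (inv_pos.2 hs)]
    have e3 : |2 * mols s x + x 0 * pd 0 (mols s) x + x 1 * pd 1 (mols s) x| ≤
        2 * (molBd * (s ^ 2)⁻¹) + s * (molBd * (s ^ 3)⁻¹) + s * (molBd * (s ^ 3)⁻¹) := by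
      refine (abs_add_three _ _ _).trans ?_
      rw [abs_mul, abs_of_pos (zero_lt_two' ℝ)]
      linarith
    calc s⁻¹ * _ ≤ s⁻¹ * _ := mul_le_mul_of_nonneg_left e3 (inv_pos.2 hs).le
      _ = _ := by field_simp; ring

theorem molsDeriv_eq_zero {s : ℝ} (hs : 0 < s) {x : Plane} (h : s ≤ ‖x‖) : molsDeriv s x = 0 := by
  rw [molsDeriv_eq hs, mols_eq_zero hs h, pd_mols_eq_zero hs _ h, pd_mols_eq_zero hs _ h]; simp

theorem isTest_molsDeriv {s : ℝ} (hs : 0 < s) : IsTest (molsDeriv s) :=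
  ((((isTest_molPot_smul hs).pd 0).pd 0).add (((isTest_molPot_smul hs).pd 1).pd 1)).const_mul _

theorem hasDerivAt_cv_mols {f : Plane → ℝ} (hf : LocallyIntegrable f volume) {s : ℝ} (hs : 0 < s)
    (x : Plane) : HasDerivAt (fun s => cv f (mols s) x) (cv f (molsDeriv s) x) s := by
  have hmem : ball s (s / 2) ∈ 𝓝 s := ball_mem_nhds s (by positivity)
  have hpos : ∀ r ∈ ball s (s / 2), s / 2 < r ∧ r < 2 * s := fun r hr => by
    rw [mem_ball, Real.dist_eq, abs_lt] at hr
    constructor <;> linarith [hr.1, hr.2]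
  refine (hasDerivAt_integral_of_dominated_loc_of_deriv_le (μ := volume)
    (F := fun r t => f t * mols r (x - t)) (F' := fun r t => f t * molsDeriv r (x - t))
    (bound := fun t => |(closedBall x (2 * s)).indicator f t| * (4 * molBd * ((s / 2) ^ 3)⁻¹))
    hmem ?_ ?_ ?_ ?_ ?_ ?_).2
  · filter_upwards [hmem] with r hr
    have := isTest_mols (lt_trans (by positivity) (hpos r hr).1)
    exact (integrable_cv_integrand hf this.continuous this.2 x).aestronglyMeasurable
  · exact integrable_cv_integrand hf (isTest_mols hs).continuous (isTest_mols hs).2 x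
  · exact (integrable_cv_integrand hf (isTest_molsDeriv hs).continuous
      (isTest_molsDeriv hs).2 x).aestronglyMeasurable
  · refine Eventually.of_forall fun t r hr => ?_
    have hr0 : 0 < r := lt_trans (by positivity) (hpos r hr).1
    rw [norm_mul, Real.norm_eq_abs, Real.norm_eq_abs]
    by_cases ht : t ∈ closedBall x (2 * s)
    · rw [indicator_of_mem ht]
      gcongr
      refine (abs_molsDeriv_le hr0 _).trans ?_
      have := molBd_pos
      gcongr
      exact (hpos r hr).1.le
    · rw [molsDeriv_eq_zero hr0]
      · simp; have := molBd_pos; positivity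
      · rw [mem_closedBall, not_le, dist_eq_norm, norm_sub_rev] at ht
        linarith [(hpos r hr).2]
  · refine Integrable.mul_const ?_ _
    exact ((integrable_indicator_iff measurableSet_closedBall).2
      (hf.integrableOn_isCompact (isCompact_closedBall x _))).abs
  · refine Eventually.of_forall fun t r hr => ?_
    exact (hasDerivAt_mols (lt_trans (by positivity) (hpos r hr).1) (x - t)).const_mul (f t)

theorem abs_integral_mul_pd_molPot_le (hW : ∀ᵐ x, |ω x| ≤ W) {s : ℝ} (hs : 0 < s) (j : Fin 2)
    (x : Plane) : |∫ t, ω t * pd j (fun y => molPot (s⁻¹ • (x - y))) t| ≤ s * W := by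
  have e (t : Plane) : |pd j (fun y => molPot (s⁻¹ • (x - y))) t| ≤ s * mols s (x - t) := by
    have := pd_comp_sub_left (f := fun y => molPot (s⁻¹ • y)) (x := t) j x
    rw [this, abs_neg]
    exact abs_pd_molPot_le hs j _
  have hi : Integrable (fun t => W * (s * mols s (x - t))) volume :=
    ((((isTest_mols hs).comp_sub_left x).integrable).const_mul s).const_mul W
  calc |∫ t, ω t * pd j (fun y => molPot (s⁻¹ • (x - y))) t|
      ≤ ∫ t, W * (s * mols s (x - t)) := by
        refine norm_integral_le_of_norm_le (μ := volume)
          (f := fun t => ω t * pd j (fun y => molPot (s⁻¹ • (x - y))) t) hi ?_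
        filter_upwards [hW] with t ht
        rw [norm_mul]
        exact mul_le_mul ht (e t) (abs_nonneg _) ((abs_nonneg _).trans ht)
    _ = s * W := by
        rw [integral_const_mul, integral_const_mul, integral_sub_left_eq_self (mols s) volume x,
          integral_mols hs]; ring

/-- `molsDeriv s` is `-s⁻¹` times a Laplacian. Passing it to `u` leaves one derivative of the
potential against `ω`, and this derivative is at most `s * mols s`, of integral `s`. The powers of
`s` cancel, so no logarithm appears, in contrast with the modulus of continuity of `u`. -/
theorem abs_cv_molsDeriv_le (hu : ∀ j, LocallyIntegrable (fun x => u x j) volume)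
    (hd : IsDivFree u) (hω : IsVorticity u ω) (hW : ∀ᵐ x, |ω x| ≤ W) {s : ℝ} (hs : 0 < s)
    (j : Fin 2) (x : Plane) : |cv (fun y => u y j) (molsDeriv s) x| ≤ W := by
  have hφ : IsTest (fun y => molPot (s⁻¹ • (x - y))) := (isTest_molPot_smul hs).comp_sub_left x
  have e2 (i : Fin 2) (t : Plane) : pd i (pd i fun y => molPot (s⁻¹ • (x - y))) t =
      pd i (pd i fun y => molPot (s⁻¹ • y)) (x - t) := by
    have h1 : (pd i fun y => molPot (s⁻¹ • (x - y))) =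
        fun t => - pd i (fun y => molPot (s⁻¹ • y)) (x - t) :=
      funext fun t => pd_comp_sub_left (f := fun y => molPot (s⁻¹ • y)) (x := t) i x
    rw [h1, pd_neg, pd_comp_sub_left, neg_neg]
  have e3 : cv (fun y => u y j) (molsDeriv s) x = -s⁻¹ * ∫ t, u t j *
      (pd 0 (pd 0 fun y => molPot (s⁻¹ • (x - y))) t +
        pd 1 (pd 1 fun y => molPot (s⁻¹ • (x - y))) t) := by
    rw [cv_apply, ← integral_const_mul]
    refine integral_congr_ae (Eventually.of_forall fun t => ?_)
    simp only [molsDeriv, e2]; ring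
  have e4 : |∫ t, u t j * (pd 0 (pd 0 fun y => molPot (s⁻¹ • (x - y))) t +
        pd 1 (pd 1 fun y => molPot (s⁻¹ • (x - y))) t)| ≤ s * W := by
    fin_cases j
    · exact (integral_laplacian_zero hu hd hω hφ).symm ▸
        abs_integral_mul_pd_molPot_le hW hs 1 x
    · refine (congrArg abs (integral_laplacian_one hu hd hω hφ)).trans_le ?_
      rw [abs_neg]
      exact abs_integral_mul_pd_molPot_le hW hs 0 x
  rw [e3, abs_mul, abs_neg, abs_of_pos (inv_pos.2 hs)]
  calc s⁻¹ * _ ≤ s⁻¹ * (s * W) := mul_le_mul_of_nonneg_left e4 (inv_pos.2 hs).le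
    _ = W := by field_simp

theorem abs_cv_mols_sub_cv_mols_le (hu : ∀ j, LocallyIntegrable (fun x => u x j) volume)
    (hd : IsDivFree u) (hω : IsVorticity u ω) (hW : ∀ᵐ x, |ω x| ≤ W) {s r : ℝ} (hs : 0 < s)
    (hr : 0 < r) (j : Fin 2) (x : Plane) :
    |cv (fun y => u y j) (mols r) x - cv (fun y => u y j) (mols s) x| ≤ W * |r - s| :=
  (convex_Ioi (0 : ℝ)).norm_image_sub_le_of_norm_hasDerivWithin_le
    (f := fun s => cv (fun y => u y j) (mols s) x)
    (fun _ ht => (hasDerivAt_cv_mols (hu j) ht x).hasDerivWithinAt)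
    (fun _ ht => abs_cv_molsDeriv_le hu hd hω hW ht j x) hs hr

/-- Compare scale `s` with a scale tending to `0`. The null set comes only from the convergence of
the mollifications, hence does not depend on `s`. -/
theorem ae_abs_sub_cv_mols_le (hu : ∀ j, LocallyIntegrable (fun x => u x j) volume)
    (hd : IsDivFree u) (hω : IsVorticity u ω) (hW : ∀ᵐ x, |ω x| ≤ W) (j : Fin 2) :
    ∀ᵐ x, ∀ s : ℝ, 0 < s → |u x j - cv (fun y => u y j) (mols s) x| ≤ W * s := by
  filter_upwards [ae_tendsto_cv_mols (hu j)] with x hx s hs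
  have h1 : Tendsto (fun r : ℝ => |cv (fun y => u y j) (mols r) x -
      cv (fun y => u y j) (mols s) x|) (𝓝[>] 0) (𝓝 |u x j - cv (fun y => u y j) (mols s) x|) :=
    (hx.sub_const _).abs
  have h2 : Tendsto (fun r : ℝ => W * |r - s|) (𝓝[>] 0) (𝓝 (W * |0 - s|)) :=
    (Continuous.tendsto (by fun_prop) 0).mono_left nhdsWithin_le_nhds
  rw [zero_sub, abs_neg, abs_of_pos hs] at h2
  refine le_of_tendsto_of_tendsto h1 h2 ?_
  filter_upwards [self_mem_nhdsWithin] with r hr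
  exact abs_cv_mols_sub_cv_mols_le hu hd hω hW hs hr j x

end Weak

/-- A divergence-free field of at most linear growth with bounded vorticity. -/
structure Flow (u : Plane → Plane) (ω : Plane → ℝ) (W A : ℝ) : Prop where
  meas : AEStronglyMeasurable u volume
  growth : ∀ᵐ x, ‖u x‖ ≤ A * (1 + ‖x‖)
  divFree : IsDivFree u
  vort : IsVorticity u ω
  bound : ∀ᵐ x, |ω x| ≤ W

theorem aestronglyMeasurable_coord {X : Type*} [MeasurableSpace X] {μ : Measure X}
    {u : X → Plane} (hu : AEStronglyMeasurable u μ) (j : Fin 2) :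
    AEStronglyMeasurable (fun x => u x j) μ :=
  (continuous_coord j).continuous.comp_aestronglyMeasurable hu

theorem locallyIntegrable_of_growth {f : Plane → ℝ} (hm : AEStronglyMeasurable f volume)
    {b : Plane → ℝ} (hb : Continuous b) (h : ∀ᵐ x, |f x| ≤ b x) : LocallyIntegrable f volume :=
  hb.locallyIntegrable.mono hm (by
    filter_upwards [h] with x hx
    exact hx.trans (le_abs_self _))

namespace Flow

variable {u : Plane → Plane} {ω : Plane → ℝ} {W A : ℝ}

theorem coord_growth (hu : Flow u ω W A) (j : Fin 2) : ∀ᵐ x, |u x j| ≤ A * (1 + ‖x‖) := by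
  filter_upwards [hu.growth] with x hx
  exact (abs_coord_le _ j).trans hx

theorem coord_meas (hu : Flow u ω W A) (j : Fin 2) :
    AEStronglyMeasurable (fun x => u x j) volume := aestronglyMeasurable_coord hu.meas j

theorem loc (hu : Flow u ω W A) (j : Fin 2) : LocallyIntegrable (fun x => u x j) volume :=
  locallyIntegrable_of_growth (hu.coord_meas j) (b := fun x => A * (1 + ‖x‖)) (by fun_prop)
    (hu.coord_growth j)

theorem W_nonneg (hu : Flow u ω W A) : 0 ≤ W := by
  obtain ⟨x, hx⟩ := hu.bound.exists
  exact (abs_nonneg _).trans hx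

theorem A_nonneg (hu : Flow u ω W A) : 0 ≤ A := by
  obtain ⟨x, hx⟩ := hu.growth.exists
  by_contra h
  nlinarith [norm_nonneg (u x), norm_nonneg x]

end Flow

/-! ### Gradient bounds -/

/-- The two integrands differ by twice the Jacobian `∂₀V₀ ∂₁V₁ - ∂₁V₀ ∂₀V₁`, whose integral vanishes
by two integrations by parts. -/
theorem integral_grad_sq {V₀ V₁ : Plane → ℝ} (h₀ : IsTest V₀) (h₁ : IsTest V₁) :
    ∫ x, (pd 0 V₀ x ^ 2 + pd 1 V₀ x ^ 2 + pd 0 V₁ x ^ 2 + pd 1 V₁ x ^ 2) =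
      ∫ x, ((pd 0 V₀ x + pd 1 V₁ x) ^ 2 + (pd 0 V₁ x - pd 1 V₀ x) ^ 2) := by
  have e1 := integral_mul_pd h₀.1 (h₁.pd 1).1 (Or.inl h₀.2) 0
  have e2 := integral_mul_pd h₀.1 (h₁.pd 0).1 (Or.inl h₀.2) 1
  rw [pd_comm h₁.1 0 1] at e1
  have e3 : ∫ x, pd 0 V₀ x * pd 1 V₁ x = ∫ x, pd 1 V₀ x * pd 0 V₁ x := by linarith
  have i1 : Integrable (fun x => pd 0 V₀ x * pd 1 V₁ x) volume :=
    ((h₀.pd 0).mul_right (h₁.pd 1).1).integrable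
  have i2 : Integrable (fun x => pd 1 V₀ x * pd 0 V₁ x) volume :=
    ((h₀.pd 1).mul_right (h₁.pd 0).1).integrable
  have i3 : Integrable (fun x => (pd 0 V₀ x + pd 1 V₁ x) ^ 2 + (pd 0 V₁ x - pd 1 V₀ x) ^ 2)
      volume := by
    have t1 := (h₀.pd 0).add (h₁.pd 1)
    have t2 := (h₁.pd 0).sub (h₀.pd 1)
    simpa [sq] using ((t1.mul_right t1.1).add (t2.mul_right t2.1)).integrable
  have e4 : ∀ x, pd 0 V₀ x ^ 2 + pd 1 V₀ x ^ 2 + pd 0 V₁ x ^ 2 + pd 1 V₁ x ^ 2 =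
      ((pd 0 V₀ x + pd 1 V₁ x) ^ 2 + (pd 0 V₁ x - pd 1 V₀ x) ^ 2) -
        2 * (pd 0 V₀ x * pd 1 V₁ x - pd 1 V₀ x * pd 0 V₁ x) := fun x => by ring
  simp only [e4]
  have i4 : Integrable (fun x => 2 * (pd 0 V₀ x * pd 1 V₁ x - pd 1 V₀ x * pd 0 V₁ x)) volume :=
    (i1.sub i2).const_mul 2
  rw [integral_sub i3 i4, integral_const_mul, integral_sub i1 i2, e3]
  simp

theorem integral_pd_sq_le {V : Fin 2 → Plane → ℝ} (h : ∀ k, IsTest (V k)) (j k : Fin 2) :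
    ∫ x, pd j (V k) x ^ 2 ≤
      ∫ x, ((pd 0 (V 0) x + pd 1 (V 1) x) ^ 2 + (pd 0 (V 1) x - pd 1 (V 0) x) ^ 2) := by
  rw [← integral_grad_sq (h 0) (h 1)]
  have t (i l) : IsTest (fun x => pd i (V l) x ^ 2) := by
    simpa [sq] using ((h l).pd i).mul_right ((h l).pd i).1
  refine integral_mono (t j k).integrable
    ((((t 0 0).add (t 1 0)).add (t 0 1)).add (t 1 1)).integrable fun x => ?_
  have p (i l) : 0 ≤ pd i (V l) x ^ 2 := sq_nonneg _
  have := p 0 0; have := p 0 1; have := p 1 0; have := p 1 1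
  fin_cases j <;> fin_cases k <;> simp only [Fin.zero_eta, Fin.mk_one] <;> linarith

/-- The cut-off spoils the divergence condition only by terms of order zero in `v`. Divergence and
curl of the truncated field thus involve `v` and its curl alone, and `integral_grad_sq` returns the
whole gradient. -/
theorem integral_pd_cutoff_mul_sq_le {v : Fin 2 → Plane → ℝ}
    (hv : ∀ k, ContDiff ℝ (⊤ : ℕ∞) (v k)) (hd : ∀ x, pd 0 (v 0) x + pd 1 (v 1) x = 0)
    {r : ℝ} (hr : 1 ≤ r) (j k : Fin 2) :
    ∫ x, pd j (fun y => cutoff r y * v k y) x ^ 2 ≤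
      8 * cutBd ^ 2 * ∫ x in closedBall 0 (9 / 8 * r),
        (v 0 x ^ 2 + v 1 x ^ 2 + (pd 0 (v 1) x - pd 1 (v 0) x) ^ 2) := by
  have hr0 : 0 < r := by linarith
  have hχ := isTest_cutoff hr0
  have hV : ∀ k, IsTest (fun y => cutoff r y * v k y) := fun k => hχ.mul_right (hv k)
  have hp (i l : Fin 2) (x : Plane) : pd i (fun y => cutoff r y * v l y) x =
      cutoff r x * pd i (v l) x + v l x * pd i (cutoff r) x :=
    pd_mul i (hχ.differentiable x) ((hv l).differentiable (by simp) x)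
  have hcont : Continuous fun x => v 0 x ^ 2 + v 1 x ^ 2 + (pd 0 (v 1) x - pd 1 (v 0) x) ^ 2 := by
    have := fun k => (hv k).continuous
    have := fun i k => (contDiff_pd (hv k) i).continuous
    have h0 := this 0 1; have h1 := this 1 0
    fun_prop
  refine (integral_pd_sq_le hV j k).trans ?_
  rw [← integral_const_mul, ← integral_indicator measurableSet_closedBall]
  refine integral_mono_of_nonneg (Eventually.of_forall fun x => by positivity) ?_
    (Eventually.of_forall fun x => ?_)
  · rw [integrable_indicator_iff measurableSet_closedBall]
    exact (hcont.const_mul _).locallyIntegrable.integrableOn_isCompact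
      (isCompact_closedBall 0 _) |>.congr_fun (fun _ _ => rfl) measurableSet_closedBall
  · simp only [hp]
    by_cases hx : x ∈ closedBall (0 : Plane) (9 / 8 * r)
    · rw [indicator_of_mem hx]
      have b : ∀ i, |pd i (cutoff r) x| ≤ cutBd := fun i =>
        (abs_pd_cutoff_le hr0 i x).trans (div_le_self (zero_le_one.trans one_le_cutBd) hr)
      have c0 := cutoff_nonneg (r := r) x
      have c1 := cutoff_le_one (r := r) x
      have e1 : cutoff r x * pd 0 (v 0) x + v 0 x * pd 0 (cutoff r) x +
          (cutoff r x * pd 1 (v 1) x + v 1 x * pd 1 (cutoff r) x) =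
          v 0 x * pd 0 (cutoff r) x + v 1 x * pd 1 (cutoff r) x := by
        linear_combination cutoff r x * hd x
      rw [e1]
      have e2 : cutoff r x * pd 0 (v 1) x + v 1 x * pd 0 (cutoff r) x -
          (cutoff r x * pd 1 (v 0) x + v 0 x * pd 1 (cutoff r) x) =
          cutoff r x * (pd 0 (v 1) x - pd 1 (v 0) x) +
            (v 1 x * pd 0 (cutoff r) x - v 0 x * pd 1 (cutoff r) x) := by ring
      rw [e2]
      have s0 : pd 0 (cutoff r) x ^ 2 ≤ cutBd ^ 2 := sq_le_sq' (abs_le.1 (b 0)).1 (abs_le.1 (b 0)).2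
      have s1 : pd 1 (cutoff r) x ^ 2 ≤ cutBd ^ 2 := sq_le_sq' (abs_le.1 (b 1)).1 (abs_le.1 (b 1)).2
      have s2 : cutoff r x ^ 2 ≤ 1 := by nlinarith
      have s3 : (1 : ℝ) ≤ cutBd ^ 2 := one_le_pow₀ one_le_cutBd
      generalize pd 0 (cutoff r) x = a at *
      generalize pd 1 (cutoff r) x = a' at *
      generalize pd 0 (v 1) x - pd 1 (v 0) x = w at *
      generalize cutoff r x = c at *
      generalize v 0 x = p at *
      generalize v 1 x = q at *
      have t1 : (p * a + q * a') ^ 2 ≤ 2 * (p ^ 2 * a ^ 2 + q ^ 2 * a' ^ 2) := by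
        nlinarith [sq_nonneg (p * a - q * a')]
      have t2 : (c * w + (q * a - p * a')) ^ 2 ≤
          2 * (c ^ 2 * w ^ 2) + 4 * (q ^ 2 * a ^ 2 + p ^ 2 * a' ^ 2) := by
        nlinarith [sq_nonneg (c * w - (q * a - p * a')), sq_nonneg (q * a + p * a')]
      have t3 : p ^ 2 * a ^ 2 ≤ p ^ 2 * cutBd ^ 2 := by gcongr
      have t4 : q ^ 2 * a' ^ 2 ≤ q ^ 2 * cutBd ^ 2 := by gcongr
      have t5 : q ^ 2 * a ^ 2 ≤ q ^ 2 * cutBd ^ 2 := by gcongr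
      have t6 : p ^ 2 * a' ^ 2 ≤ p ^ 2 * cutBd ^ 2 := by gcongr
      have t7 : c ^ 2 * w ^ 2 ≤ cutBd ^ 2 * w ^ 2 :=
        mul_le_mul_of_nonneg_right (s2.trans s3) (sq_nonneg w)
      have t8 : 0 ≤ p ^ 2 * cutBd ^ 2 := by positivity
      have t9 : 0 ≤ q ^ 2 * cutBd ^ 2 := by positivity
      have t10 : 0 ≤ cutBd ^ 2 * w ^ 2 := by positivity
      nlinarith
    · rw [indicator_of_notMem hx]
      rw [mem_closedBall_zero_iff, not_le] at hx
      rw [cutoff_eq_zero hr0 hx.le, pd_cutoff_eq_zero hr0 0 hx.le, pd_cutoff_eq_zero hr0 1 hx.le]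
      simp

/-! ### Mollified flows -/

/-- The mollification of the components of a field. -/
def smo (u : Plane → Plane) (s : ℝ) (k : Fin 2) : Plane → ℝ := cv (fun x => u x k) (mols s)

theorem cv_mols_abs_le {f : Plane → ℝ} {s c : ℝ} (hs : 0 < s)
    {x : Plane} (h : ∀ᵐ t, ‖t - x‖ ≤ s → |f t| ≤ c) : |cv f (mols s) x| ≤ c := by
  have hi : Integrable (fun t => c * mols s (x - t)) volume :=
    ((isTest_mols hs).comp_sub_left x).integrable.const_mul c
  calc |cv f (mols s) x| ≤ ∫ t, c * mols s (x - t) := by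
        rw [cv_apply]
        refine norm_integral_le_of_norm_le (μ := volume) (f := fun t => f t * mols s (x - t)) hi ?_
        filter_upwards [h] with t ht
        rw [norm_mul, Real.norm_eq_abs, Real.norm_eq_abs, abs_of_nonneg (mols_nonneg _)]
        rcases le_or_gt ‖t - x‖ s with h1 | h1
        · exact mul_le_mul_of_nonneg_right (ht h1) (mols_nonneg _)
        · rw [norm_sub_rev] at h1
          simp [mols_eq_zero hs h1.le]
    _ = c := by
        rw [integral_const_mul, integral_sub_left_eq_self (mols s) volume x, integral_mols hs,
          mul_one]

namespace Flow

variable {u : Plane → Plane} {ω : Plane → ℝ} {W A : ℝ} {s : ℝ}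

theorem contDiff_smo (hu : Flow u ω W A) (hs : 0 < s) (k : Fin 2) :
    ContDiff ℝ (⊤ : ℕ∞) (smo u s k) := contDiff_cv (hu.loc k) (isTest_mols hs)

theorem pd_cv_apply_eq {f : Plane → ℝ} (hf : LocallyIntegrable f volume) {k : Plane → ℝ}
    (hk : IsTest k) (j : Fin 2) (x : Plane) :
    pd j (cv f k) x = - ∫ t, f t * pd j (fun y => k (x - y)) t := by
  rw [pd_cv hf hk, cv_apply, ← integral_neg]
  refine integral_congr_ae (Eventually.of_forall fun t => ?_)
  simp only [pd_comp_sub_left]; ring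

theorem div_cv (hu : Flow u ω W A) {k : Plane → ℝ} (hk : IsTest k) (x : Plane) :
    pd 0 (cv (fun x => u x 0) k) x + pd 1 (cv (fun x => u x 1) k) x = 0 := by
  rw [pd_cv_apply_eq (hu.loc 0) hk, pd_cv_apply_eq (hu.loc 1) hk]
  have := hu.divFree.integral_eq hu.loc (hk.comp_sub_left x)
  linarith

theorem curl_cv (hu : Flow u ω W A) {k : Plane → ℝ} (hk : IsTest k) (x : Plane) :
    pd 0 (cv (fun x => u x 1) k) x - pd 1 (cv (fun x => u x 0) k) x = cv ω k x := by
  rw [pd_cv_apply_eq (hu.loc 1) hk, pd_cv_apply_eq (hu.loc 0) hk, cv_apply]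
  have := hu.vort.integral_eq hu.loc (hk.comp_sub_left x)
  linarith

theorem div_smo (hu : Flow u ω W A) (hs : 0 < s) (x : Plane) :
    pd 0 (smo u s 0) x + pd 1 (smo u s 1) x = 0 := hu.div_cv (isTest_mols hs) x

theorem curl_smo (hu : Flow u ω W A) (hs : 0 < s) (x : Plane) :
    pd 0 (smo u s 1) x - pd 1 (smo u s 0) x = cv ω (mols s) x := hu.curl_cv (isTest_mols hs) x

theorem abs_smo_le (hu : Flow u ω W A) (hs : 0 < s) (k : Fin 2) (x : Plane) :
    |smo u s k x| ≤ A * (1 + s + ‖x‖) := by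
  refine cv_mols_abs_le hs ?_
  filter_upwards [hu.coord_growth k] with t ht h
  have h0 := hu.A_nonneg
  have : ‖t‖ ≤ s + ‖x‖ := by
    calc ‖t‖ = ‖(t - x) + x‖ := by simp
      _ ≤ ‖t - x‖ + ‖x‖ := norm_add_le _ _
      _ ≤ _ := by linarith
  exact ht.trans (mul_le_mul_of_nonneg_left (by linarith) h0)

theorem abs_cv_vort_le (hu : Flow u ω W A) (hs : 0 < s) (x : Plane) : |cv ω (mols s) x| ≤ W :=
  cv_mols_abs_le hs (by filter_upwards [hu.bound] with t ht _ using ht)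

theorem ae_abs_sub_smo_le (hu : Flow u ω W A) (k : Fin 2) :
    ∀ᵐ x, ∀ s : ℝ, 0 < s → |u x k - smo u s k x| ≤ W * s :=
  ae_abs_sub_cv_mols_le hu.loc hu.divFree hu.vort hu.bound k

theorem abs_smo_sub_smo_le (hu : Flow u ω W A) {r : ℝ} (hs : 0 < s) (hr : 0 < r) (k : Fin 2)
    (x : Plane) : |smo u r k x - smo u s k x| ≤ W * |r - s| :=
  abs_cv_mols_sub_cv_mols_le hu.loc hu.divFree hu.vort hu.bound hs hr k x

/-- The bound for the local energy of the gradient. -/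
def gradBd (W A r : ℝ) : ℝ :=
  8 * cutBd ^ 2 * ((9 / 8 * r) ^ 2 * Real.pi * (2 * (A * (2 + 9 / 8 * r)) ^ 2 + W ^ 2))

theorem gradBd_nonneg {W A r : ℝ} : 0 ≤ gradBd W A r := by
  have := Real.pi_pos
  unfold gradBd; positivity

theorem integral_pd_cutoff_smo_sq_le (hu : Flow u ω W A) (hs : 0 < s) (hs1 : s ≤ 1) {r : ℝ}
    (hr : 1 ≤ r) (j k : Fin 2) :
    ∫ x, pd j (fun y => cutoff r y * smo u s k y) x ^ 2 ≤ gradBd W A r := by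
  refine (integral_pd_cutoff_mul_sq_le (hu.contDiff_smo hs) (hu.div_smo hs) hr j k).trans ?_
  unfold gradBd
  refine mul_le_mul_of_nonneg_left ?_ (by positivity)
  have hA := hu.A_nonneg
  have h1 : ∀ x ∈ closedBall (0 : Plane) (9 / 8 * r), ‖smo u s 0 x ^ 2 + smo u s 1 x ^ 2 +
      (pd 0 (smo u s 1) x - pd 1 (smo u s 0) x) ^ 2‖ ≤
        2 * (A * (2 + 9 / 8 * r)) ^ 2 + W ^ 2 := fun x hx => by
    rw [mem_closedBall_zero_iff] at hx
    rw [Real.norm_of_nonneg (by positivity), hu.curl_smo hs]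
    have e (i) : smo u s i x ^ 2 ≤ (A * (2 + 9 / 8 * r)) ^ 2 := by
      rw [← sq_abs]
      gcongr
      exact (hu.abs_smo_le hs i x).trans (mul_le_mul_of_nonneg_left (by linarith) hA)
    have e' : cv ω (mols s) x ^ 2 ≤ W ^ 2 := by
      rw [← sq_abs]
      gcongr
      exact hu.abs_cv_vort_le hs x
    linarith [e 0, e 1]
  have h2 := norm_setIntegral_le_of_norm_le_const (μ := volume)
    (measure_closedBall_lt_top (x := (0 : Plane)) (r := 9 / 8 * r)) h1
  rw [volume_closedBall_plane _ (by linarith)] at h2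
  linarith [(le_abs_self _).trans h2]

end Flow

/-! ### Square integrable functions -/

section L2

variable {X : Type*} [MeasurableSpace X] {μ : Measure X} {f g : X → ℝ}

theorem eLpNorm_two_toReal_sq (hf : MemLp f 2 μ) : (eLpNorm f 2 μ).toReal ^ 2 = ∫ x, f x ^ 2 ∂μ := by
  have h0 : 0 ≤ ∫ x, f x ^ 2 ∂μ := integral_nonneg fun x => sq_nonneg _
  rw [hf.eLpNorm_eq_integral_rpow_norm (by simp) (by simp)]
  simp only [ENNReal.toReal_ofNat, Real.rpow_two, Real.norm_eq_abs, sq_abs]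
  rw [ENNReal.toReal_ofReal (by positivity), ← Real.rpow_natCast, ← Real.rpow_mul h0]
  norm_num

theorem dist_toLp_sq (hf : MemLp f 2 μ) (hg : MemLp g 2 μ) :
    dist (hf.toLp f) (hg.toLp g) ^ 2 = ∫ x, (f x - g x) ^ 2 ∂μ := by
  rw [dist_eq_norm, ← MemLp.toLp_sub, Lp.norm_toLp, eLpNorm_two_toReal_sq (hf.sub hg)]
  rfl

theorem sq_integral_mul_le (hf : MemLp f 2 μ) (hg : MemLp g 2 μ) :
    (∫ x, f x * g x ∂μ) ^ 2 ≤ (∫ x, f x ^ 2 ∂μ) * ∫ x, g x ^ 2 ∂μ := by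
  have h := integral_mul_norm_le_Lp_mul_Lq (μ := μ) Real.HolderConjugate.two_two
    (f := f) (g := g) (by simpa using hf) (by simpa using hg)
  have h1 : |∫ x, f x * g x ∂μ| ≤ ∫ x, ‖f x‖ * ‖g x‖ ∂μ := by
    refine (norm_integral_le_integral_norm (fun x => f x * g x)).trans_eq ?_
    simp only [norm_mul]
  have h2 := h1.trans h
  simp only [Real.rpow_two, Real.norm_eq_abs, sq_abs] at h2
  rw [← Real.sqrt_eq_rpow, ← Real.sqrt_eq_rpow,
    ← Real.sqrt_mul (integral_nonneg fun x => sq_nonneg _)] at h2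
  rw [← sq_abs]
  exact (Real.le_sqrt (abs_nonneg _) (mul_nonneg (integral_nonneg fun x => sq_nonneg _)
    (integral_nonneg fun x => sq_nonneg _))).1 h2

theorem tendsto_integral_mul_of_L2 {ι : Type*} {l : Filter ι} {F : ι → X → ℝ}
    (hF : ∀ n, MemLp (F n) 2 μ) (hf : MemLp f 2 μ) (hg : MemLp g 2 μ)
    (h : Tendsto (fun n => ∫ x, (F n x - f x) ^ 2 ∂μ) l (𝓝 0)) :
    Tendsto (fun n => ∫ x, F n x * g x ∂μ) l (𝓝 (∫ x, f x * g x ∂μ)) := by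
  rw [tendsto_iff_norm_sub_tendsto_zero]
  have h1 : Tendsto (fun n => √((∫ x, (F n x - f x) ^ 2 ∂μ) * ∫ x, g x ^ 2 ∂μ)) l (𝓝 0) := by
    simpa using (h.mul_const (∫ x, g x ^ 2 ∂μ)).sqrt
  refine squeeze_zero (fun _ => norm_nonneg _) (fun n => ?_) h1
  have i1 : Integrable (fun x => F n x * g x) μ := (hF n).integrable_mul hg
  have i2 : Integrable (fun x => f x * g x) μ := hf.integrable_mul hg
  rw [← integral_sub i1 i2]
  refine Real.le_sqrt_of_sq_le ?_
  rw [Real.norm_eq_abs, sq_abs]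
  simp only [← sub_mul]
  exact sq_integral_mul_le ((hF n).sub hf) hg

theorem exists_L2_limit {F : ℕ → X → ℝ} (hF : ∀ n, MemLp (F n) 2 μ) {a : ℕ → ℝ}
    (ha : Tendsto a atTop (𝓝 0)) (h : ∀ n m, ∫ x, (F n x - F m x) ^ 2 ∂μ ≤ a n + a m) :
    ∃ G, MemLp G 2 μ ∧ Tendsto (fun n => ∫ x, (F n x - G x) ^ 2 ∂μ) atTop (𝓝 0) := by
  have hc : CauchySeq fun n => (hF n).toLp (F n) := by
    rw [cauchySeq_iff_tendsto_dist_atTop_0, ← prod_atTop_atTop_eq]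
    have h1 : Tendsto (fun n : ℕ × ℕ => √(a n.1 + a n.2)) (atTop ×ˢ atTop) (𝓝 0) := by
      simpa using ((ha.comp tendsto_fst).add (ha.comp tendsto_snd)).sqrt
    refine squeeze_zero (fun _ => dist_nonneg) (fun n => ?_) h1
    refine Real.le_sqrt_of_sq_le ?_
    rw [dist_toLp_sq]
    exact h _ _
  obtain ⟨G, hG⟩ := cauchySeq_tendsto_of_complete hc
  refine ⟨G, Lp.memLp G, ?_⟩
  have h2 := (tendsto_iff_dist_tendsto_zero.1 hG).pow 2
  rw [zero_pow two_ne_zero] at h2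
  refine h2.congr fun n => ?_
  have := dist_toLp_sq (hF n) (Lp.memLp G)
  rwa [Lp.toLp_coeFn] at this

end L2

theorem IsTest.memLp {f : Plane → ℝ} (hf : IsTest f) (p : ℝ≥0∞) : MemLp f p volume :=
  hf.continuous.memLp_of_hasCompactSupport hf.2

/-! ### Weak first derivatives as local `L²` limits of mollified derivatives. -/

/-- A sequence of scales decreasing to zero. -/
def eps (n : ℕ) : ℝ := 1 / ((n : ℝ) + 1)

theorem eps_pos (n : ℕ) : 0 < eps n := by unfold eps; positivity

theorem eps_le_one (n : ℕ) : eps n ≤ 1 := by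
  unfold eps
  rw [div_le_one (by positivity)]
  linarith [Nat.cast_nonneg (α := ℝ) n]

theorem tendsto_eps : Tendsto eps atTop (𝓝 0) := tendsto_one_div_add_atTop_nhds_zero_nat

theorem tendsto_eps_within : Tendsto eps atTop (𝓝[>] 0) :=
  tendsto_nhdsWithin_iff.2 ⟨tendsto_eps, Eventually.of_forall eps_pos⟩

theorem tendsto_setIntegral_sq_sub_mols {f : Plane → ℝ} {W : ℝ}
    (hf : LocallyIntegrable f volume) (hW : ∀ᵐ x, |f x| ≤ W) (r : ℝ) :
    Tendsto (fun n => ∫ x in closedBall (0 : Plane) r, (cv f (mols (eps n)) x - f x) ^ 2) atTop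
      (𝓝 0) := by
  have h0 : ∫ x in closedBall (0 : Plane) r, (0 : ℝ) = 0 := by simp
  rw [← h0]
  refine tendsto_integral_of_dominated_convergence (fun _ => (2 * W) ^ 2) (fun n => ?_) ?_
    (fun n => ?_) ?_
  · exact (((contDiff_cv hf (isTest_mols (eps_pos n))).continuous.aestronglyMeasurable.sub
      hf.aestronglyMeasurable).pow 2).restrict
  · exact integrableOn_const measure_closedBall_lt_top.ne
  · filter_upwards [ae_restrict_of_ae hW] with x hx
    have h1 : |cv f (mols (eps n)) x| ≤ W :=
      cv_mols_abs_le (eps_pos n) (by filter_upwards [hW] with t ht _ using ht)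
    rw [norm_pow, Real.norm_eq_abs]
    gcongr
    exact (abs_sub _ _).trans (by linarith)
  · filter_upwards [ae_restrict_of_ae (ae_tendsto_cv_mols hf)] with x hx
    have := ((hx.comp tendsto_eps_within).sub_const (f x)).pow 2
    simpa using this

namespace Flow

variable {u : Plane → Plane} {ω : Plane → ℝ} {W A : ℝ} {s : ℝ}

/-- The difference of two mollifications is again divergence-free; it is of size `W * (eps n + eps
m)`, and its curl tends to zero in `L²` on bounded sets because `ω` is bounded.
`integral_pd_cutoff_mul_sq_le` then makes the truncated gradients a Cauchy sequence. -/
theorem exists_grad_limit (hu : Flow u ω W A) {r : ℝ} (hr : 1 ≤ r) (j k : Fin 2) :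
    ∃ G, MemLp G 2 volume ∧ Tendsto (fun n => ∫ x,
      (pd j (fun y => cutoff r y * smo u (eps n) k y) x - G x) ^ 2) atTop (𝓝 0) := by
  have hr0 : 0 < r := by linarith
  have hχ := isTest_cutoff hr0
  set B := closedBall (0 : Plane) (9 / 8 * r) with hB
  set V := volume.real B with hV
  have hVn : 0 ≤ V := measureReal_nonneg
  have hF (n) : IsTest (fun y => cutoff r y * smo u (eps n) k y) :=
    hχ.mul_right (hu.contDiff_smo (eps_pos n) k)
  set a : ℕ → ℝ := fun n => ∫ x in B, (cv ω (mols (eps n)) x - ω x) ^ 2 with ha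
  have hat : Tendsto a atTop (𝓝 0) := tendsto_setIntegral_sq_sub_mols hu.vort.1 hu.bound _
  refine exists_L2_limit (fun n => ((hF n).pd j).memLp 2)
    (a := fun n => 8 * cutBd ^ 2 * (V * (4 * (W * eps n) ^ 2) + 2 * a n)) ?_ fun n m => ?_
  · have := (((((tendsto_eps.const_mul W).pow 2).const_mul 4).const_mul V).add
      (hat.const_mul 2)).const_mul (8 * cutBd ^ 2)
    simpa using this
  · set v : Fin 2 → Plane → ℝ := fun i y => smo u (eps n) i y - smo u (eps m) i y with hv
    have hvc : ∀ i, ContDiff ℝ (⊤ : ℕ∞) (v i) := fun i =>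
      (hu.contDiff_smo (eps_pos n) i).sub (hu.contDiff_smo (eps_pos m) i)
    have hpd (i l x) : pd i (v l) x = pd i (smo u (eps n) l) x - pd i (smo u (eps m) l) x :=
      pd_sub i ((hu.contDiff_smo (eps_pos n) l).differentiable (by simp) x)
        ((hu.contDiff_smo (eps_pos m) l).differentiable (by simp) x)
    have hd : ∀ x, pd 0 (v 0) x + pd 1 (v 1) x = 0 := fun x => by
      rw [hpd, hpd]; linarith [hu.div_smo (eps_pos n) x, hu.div_smo (eps_pos m) x]
    have hc : ∀ x, pd 0 (v 1) x - pd 1 (v 0) x =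
        cv ω (mols (eps n)) x - cv ω (mols (eps m)) x := fun x => by
      rw [hpd, hpd]; linarith [hu.curl_smo (eps_pos n) x, hu.curl_smo (eps_pos m) x]
    have key := integral_pd_cutoff_mul_sq_le hvc hd hr j k
    have e1 : ∀ x, pd j (fun y => cutoff r y * smo u (eps n) k y) x -
        pd j (fun y => cutoff r y * smo u (eps m) k y) x =
        pd j (fun y => cutoff r y * v k y) x := fun x => by
      rw [← pd_sub j ((hF n).differentiable x) ((hF m).differentiable x)]
      congr 1; ext y; simp only [hv]; ring
    simp only [e1]
    refine key.trans ?_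
    have hi (n) : Integrable (fun x => (cv ω (mols (eps n)) x - ω x) ^ 2) (volume.restrict B) := by
      have hfin : IsFiniteMeasure (volume.restrict B) :=
        ⟨by simpa using measure_closedBall_lt_top⟩
      refine Integrable.of_bound (((contDiff_cv hu.vort.1
        (isTest_mols (eps_pos n))).continuous.aestronglyMeasurable.sub
        hu.vort.1.aestronglyMeasurable).pow 2).restrict ((2 * W) ^ 2) ?_
      filter_upwards [ae_restrict_of_ae hu.bound] with x hx
      rw [norm_pow, Real.norm_eq_abs]
      gcongr
      exact (abs_sub _ _).trans (by linarith [hu.abs_cv_vort_le (eps_pos n) x])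
    have hcst : Integrable (fun _ : Plane => 4 * (W * eps n) ^ 2 + 4 * (W * eps m) ^ 2)
        (volume.restrict B) := integrableOn_const measure_closedBall_lt_top.ne
    have h2 : ∫ x in B, (v 0 x ^ 2 + v 1 x ^ 2 + (pd 0 (v 1) x - pd 1 (v 0) x) ^ 2) ≤
        ∫ x in B, ((4 * (W * eps n) ^ 2 + 4 * (W * eps m) ^ 2) +
          (2 * (cv ω (mols (eps n)) x - ω x) ^ 2 + 2 * (cv ω (mols (eps m)) x - ω x) ^ 2)) := by
      refine integral_mono_of_nonneg (Eventually.of_forall fun x => by positivity)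
        (hcst.add (((hi n).const_mul 2).add ((hi m).const_mul 2)))
        (Eventually.of_forall fun x => ?_)
      simp only [hc]
      have e2 (i) : v i x ^ 2 ≤ 2 * (W * eps n) ^ 2 + 2 * (W * eps m) ^ 2 := by
        have h3 := hu.abs_smo_sub_smo_le (eps_pos m) (eps_pos n) i x
        have h4 : |eps n - eps m| ≤ eps n + eps m := by
          rw [abs_le]; constructor <;> linarith [eps_pos n, eps_pos m]
        have h5 : |v i x| ≤ W * eps n + W * eps m := by
          have := h3.trans (mul_le_mul_of_nonneg_left h4 hu.W_nonneg)
          linarith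
        rw [← sq_abs]
        have h6 := abs_nonneg (v i x)
        nlinarith [sq_nonneg (W * eps n - W * eps m)]
      have e3 := e2 0
      have e4 := e2 1
      nlinarith [sq_nonneg (cv ω (mols (eps n)) x - ω x + (cv ω (mols (eps m)) x - ω x))]
    have h3 : ∫ x in B, ((4 * (W * eps n) ^ 2 + 4 * (W * eps m) ^ 2) +
          (2 * (cv ω (mols (eps n)) x - ω x) ^ 2 + 2 * (cv ω (mols (eps m)) x - ω x) ^ 2)) =
        V * (4 * (W * eps n) ^ 2 + 4 * (W * eps m) ^ 2) + (2 * a n + 2 * a m) := by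
      have hs : Integrable (fun x => 2 * (cv ω (mols (eps n)) x - ω x) ^ 2 +
          2 * (cv ω (mols (eps m)) x - ω x) ^ 2) (volume.restrict B) :=
        ((hi n).const_mul 2).add ((hi m).const_mul 2)
      rw [integral_add hcst hs,
        integral_add ((hi n).const_mul 2) ((hi m).const_mul 2), integral_const_mul,
        integral_const_mul, setIntegral_const, smul_eq_mul]
    calc 8 * cutBd ^ 2 * _ ≤ 8 * cutBd ^ 2 *
          (V * (4 * (W * eps n) ^ 2 + 4 * (W * eps m) ^ 2) + (2 * a n + 2 * a m)) := by
          refine mul_le_mul_of_nonneg_left (h2.trans_eq h3) (by positivity)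
      _ = _ := by ring

theorem tendsto_integral_smo_mul (hu : Flow u ω W A) (k : Fin 2) {φ : Plane → ℝ} (hφ : IsTest φ) :
    Tendsto (fun n => ∫ x, smo u (eps n) k x * φ x) atTop (𝓝 (∫ x, u x k * φ x)) := by
  rw [tendsto_iff_norm_sub_tendsto_zero]
  have h1 : Tendsto (fun n => W * eps n * ∫ x, |φ x|) atTop (𝓝 0) := by
    simpa using (tendsto_eps.const_mul W).mul_const (∫ x, |φ x|)
  refine squeeze_zero (fun _ => norm_nonneg _) (fun n => ?_) h1
  have hs := (hu.contDiff_smo (eps_pos n) k).continuous.locallyIntegrable (μ := volume)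
  rw [← integral_sub (integrable_mul_test hs hφ) (integrable_mul_test (hu.loc k) hφ),
    ← integral_const_mul]
  refine norm_integral_le_of_norm_le (hφ.integrable.abs.const_mul _) ?_
  filter_upwards [hu.ae_abs_sub_smo_le k] with x hx
  rw [← sub_mul, norm_mul, norm_sub_rev]
  exact mul_le_mul_of_nonneg_right (hx _ (eps_pos n)) (abs_nonneg _)

theorem exists_local_weakPartial (hu : Flow u ω W A) {r : ℝ} (hr : 1 ≤ r) (j k : Fin 2) :
    ∃ G, MemLp G 2 volume ∧ Tendsto (fun n => ∫ x,
      (pd j (fun y => cutoff r y * smo u (eps n) k y) x - G x) ^ 2) atTop (𝓝 0) ∧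
      ∀ φ, IsTest φ → tsupport φ ⊆ ball 0 r → ∫ x, G x * φ x = - ∫ x, u x k * pd j φ x := by
  obtain ⟨G, hG, hlim⟩ := hu.exists_grad_limit hr j k
  refine ⟨G, hG, hlim, fun φ hφ hsupp => ?_⟩
  have hr0 : 0 < r := by linarith
  have hχ := isTest_cutoff hr0
  have h1 := tendsto_integral_mul_of_L2 (fun n => ((hχ.mul_right
    (hu.contDiff_smo (eps_pos n) k)).pd j).memLp 2) hG (hφ.memLp 2) hlim
  refine tendsto_nhds_unique h1 ?_
  refine ((hu.tendsto_integral_smo_mul k (hφ.pd j)).neg).congr fun n => ?_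
  have h2 := integral_mul_pd (hχ.mul_right (hu.contDiff_smo (eps_pos n) k)).1 hφ.1
    (Or.inr hφ.2) j
  have h3 : ∫ x, smo u (eps n) k x * pd j φ x =
      ∫ x, cutoff r x * smo u (eps n) k x * pd j φ x := by
    refine integral_congr_ae (Eventually.of_forall fun x => ?_)
    by_cases hx : x ∈ tsupport φ
    · have := hsupp hx
      rw [mem_ball_zero_iff] at this
      simp [cutoff_eq_one hr0 this.le]
    · have : pd j φ x = 0 := by
        have h5 : x ∉ tsupport (pd j φ) := fun h => hx (by
          have := tsupport_fderiv_apply_subset ℝ (f := φ) (EuclideanSpace.single j (1 : ℝ))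
          exact this h)
        exact image_eq_zero_of_notMem_tsupport h5
      simp [this]
  rw [h3, h2, neg_neg]

end Flow

theorem IsTest.exists_tsupport_subset {φ : Plane → ℝ} (hφ : IsTest φ) :
    ∃ N : ℕ, tsupport φ ⊆ ball 0 ((N : ℝ) + 1) := by
  obtain ⟨r, hr⟩ := hφ.2.isCompact.isBounded.subset_ball 0
  obtain ⟨N, hN⟩ := exists_nat_ge r
  exact ⟨N, hr.trans (ball_subset_ball (by linarith))⟩

theorem isWeakPartial_unique {f g g' : Plane → ℝ} {j : Fin 2} (h : IsWeakPartial j f g)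
    (h' : IsWeakPartial j f g') : g =ᵐ[volume] g' := by
  refine ae_eq_of_integral_contDiff_smul_eq h.1 h'.1 fun φ h1 h2 => ?_
  have e := (h.2 φ h1 h2).trans (h'.2 φ h1 h2).symm
  simpa only [smul_eq_mul, mul_comm] using e

namespace Flow

variable {u : Plane → Plane} {ω : Plane → ℝ} {W A : ℝ} {s : ℝ}

theorem exists_isWeakPartial (hu : Flow u ω W A) (j k : Fin 2) :
    ∃ g, IsWeakPartial j (fun x => u x k) g ∧ ∀ N : ℕ, ∃ G, MemLp G 2 volume ∧
      (∀ᵐ x, x ∈ ball (0 : Plane) ((N : ℝ) + 1) → g x = G x) ∧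
      Tendsto (fun n => ∫ x,
        (pd j (fun y => cutoff ((N : ℝ) + 1) y * smo u (eps n) k y) x - G x) ^ 2) atTop (𝓝 0) := by
  have hex := fun N : ℕ => hu.exists_local_weakPartial (r := (N : ℝ) + 1)
    (by linarith [Nat.cast_nonneg (α := ℝ) N]) j k
  choose G hG hlim hw using hex
  have hagree : ∀ n N : ℕ, n ≤ N → ∀ᵐ x, x ∈ ball (0 : Plane) ((n : ℝ) + 1) →
      G n x - G N x = 0 := fun n N hnN => by
    refine isOpen_ball.ae_eq_zero_of_integral_contDiff_smul_eq_zero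
      ((((hG n).sub (hG N)).locallyIntegrable one_le_two).locallyIntegrableOn _)
      fun φ h1 h2 h3 => ?_
    have hφ : IsTest φ := ⟨h1, h2⟩
    have h4 : tsupport φ ⊆ ball 0 ((N : ℝ) + 1) :=
      h3.trans (ball_subset_ball (by have : (n : ℝ) ≤ N := by exact_mod_cast hnN
                                     linarith))
    have i (m) : Integrable (fun x => G m x * φ x) volume :=
      (hG m).integrable_mul (hφ.memLp 2)
    have e : ∀ x, φ x • (G n x - G N x) = G n x * φ x - G N x * φ x := fun x => by
      rw [smul_eq_mul]; ring
    simp only [e]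
    rw [integral_sub (i n) (i N), hw n φ hφ h3, hw N φ hφ h4, sub_self]
  -- Every point lies in the ball attached to its own index, since `‖x‖ < ⌈‖x‖⌉₊ + 1`; this glues
  -- the local limits into one function.
  set g : Plane → ℝ := fun x => G ⌈‖x‖⌉₊ x with hg
  have hgN : ∀ N : ℕ, ∀ᵐ x, x ∈ ball (0 : Plane) ((N : ℝ) + 1) → g x = G N x := fun N => by
    have h1 := ae_all_iff.2 fun n => ae_all_iff.2 fun (h : n ≤ N) => hagree n N h
    have h2 := ae_all_iff.2 fun n => ae_all_iff.2 fun (h : N ≤ n) => hagree N n h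
    filter_upwards [h1, h2] with x a b hx
    rcases le_total ⌈‖x‖⌉₊ N with h | h
    · have : x ∈ ball (0 : Plane) ((⌈‖x‖⌉₊ : ℝ) + 1) := by
        rw [mem_ball_zero_iff]; linarith [Nat.le_ceil ‖x‖]
      linarith [a _ h this]
    · linarith [b _ h hx]
  have hloc : LocallyIntegrable g volume := by
    rw [locallyIntegrable_iff]
    intro K hK
    obtain ⟨r, hr⟩ := hK.isBounded.subset_ball 0
    obtain ⟨N, hN⟩ := exists_nat_ge r
    have h1 : IntegrableOn (G N) K volume :=
      ((hG N).locallyIntegrable one_le_two).integrableOn_isCompact hK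
    refine h1.congr ?_
    refine (ae_restrict_iff' hK.measurableSet).2 ?_
    filter_upwards [hgN N] with x hx hxK
    exact (hx (ball_subset_ball (by linarith) (hr hxK))).symm
  refine ⟨g, ⟨hloc, fun φ h1 h2 => ?_⟩, fun N => ⟨G N, hG N, hgN N, hlim N⟩⟩
  have hφ : IsTest φ := ⟨h1, h2⟩
  obtain ⟨N, hN⟩ := hφ.exists_tsupport_subset
  rw [← hw N φ hφ hN]
  refine integral_congr_ae ?_
  filter_upwards [hgN N] with x hx
  by_cases h : x ∈ tsupport φ
  · simp only [hx (hN h)]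
  · simp [image_eq_zero_of_notMem_tsupport h]

theorem isWeakPartial_weakPartial (hu : Flow u ω W A) (j k : Fin 2) :
    IsWeakPartial j (fun x => u x k) (weakPartial j fun x => u x k) := by
  obtain ⟨g, hg, _⟩ := hu.exists_isWeakPartial j k
  have h : ∃ g, IsWeakPartial j (fun x => u x k) g := ⟨g, hg⟩
  rw [weakPartial, dif_pos h]
  exact h.choose_spec

/-- `weakPartial` is picked by choice. Uniqueness of weak derivatives identifies it with the glued
limit, which has the integrability and the approximation property. -/
theorem weakPartial_local (hu : Flow u ω W A) (j k : Fin 2) (r : ℝ) :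
    MemLp (weakPartial j fun x => u x k) 2 (volume.restrict (closedBall 0 r)) ∧
      Tendsto (fun n => ∫ x in closedBall (0 : Plane) r, (pd j (smo u (eps n) k) x -
        weakPartial j (fun x => u x k) x) ^ 2) atTop (𝓝 0) := by
  obtain ⟨g, hg, hN⟩ := hu.exists_isWeakPartial j k
  obtain ⟨N, hrN⟩ := exists_nat_ge r
  obtain ⟨G, hG, hgG, hlim⟩ := hN N
  have hsub : closedBall (0 : Plane) r ⊆ ball 0 ((N : ℝ) + 1) :=
    closedBall_subset_ball (by linarith)
  have hN0 : (0 : ℝ) < (N : ℝ) + 1 := by positivity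
  have hae : ∀ᵐ x ∂(volume.restrict (closedBall (0 : Plane) r)),
      weakPartial j (fun x => u x k) x = G x := by
    refine (ae_restrict_iff' measurableSet_closedBall).2 ?_
    filter_upwards [isWeakPartial_unique (hu.isWeakPartial_weakPartial j k) hg, hgG] with x h1 h2 hx
    rw [h1, h2 (hsub hx)]
  refine ⟨(memLp_congr_ae hae).2 (hG.restrict _), ?_⟩
  refine squeeze_zero (fun _ => integral_nonneg fun x => sq_nonneg _) (fun n => ?_) hlim
  have hF : IsTest (pd j fun y => cutoff ((N : ℝ) + 1) y * smo u (eps n) k y) :=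
    ((isTest_cutoff hN0).mul_right (hu.contDiff_smo (eps_pos n) k)).pd j
  have hi : Integrable (fun x => (pd j (fun y => cutoff ((N : ℝ) + 1) y *
      smo u (eps n) k y) x - G x) ^ 2) volume := ((hF.memLp 2).sub hG).integrable_sq
  refine le_trans (le_of_eq ?_) (setIntegral_le_integral (s := closedBall 0 r) hi
    (Eventually.of_forall fun x => sq_nonneg _))
  refine integral_congr_ae ?_
  filter_upwards [hae, ae_restrict_mem measurableSet_closedBall] with x h1 h2
  rw [h1]
  congr 2
  refine pd_congr_of_eventuallyEq j ?_
  filter_upwards [isOpen_ball.mem_nhds (hsub h2)] with y hy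
  rw [mem_ball_zero_iff] at hy
  rw [cutoff_eq_one hN0 hy.le, one_mul]

end Flow

/-! ### Difference quotients -/

theorem norm_sq_plane (h : Plane) : ‖h‖ ^ 2 = h 0 ^ 2 + h 1 ^ 2 := by
  rw [EuclideanSpace.norm_sq_eq]; simp [Fin.sum_univ_two]

/-- The increment is the integral of a derivative along the segment; Cauchy–Schwarz on `[0, 1]` and
translation invariance conclude. -/
theorem lintegral_diff_sq_le {V : Plane → ℝ} (hV : IsTest V) (h : Plane) :
    ∫⁻ x, ENNReal.ofReal ((V (x - h) - V x) ^ 2) ≤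
      ENNReal.ofReal (‖h‖ ^ 2 * ((∫ x, pd 0 V x ^ 2) + ∫ x, pd 1 V x ^ 2)) := by
  set D : Plane → ℝ := fun y => - fderiv ℝ V y h with hD
  have hDc : Continuous D :=
    ((hV.1.continuous_fderiv (by simp)).clm_apply continuous_const).neg
  have t (i) : IsTest (fun x => pd i V x ^ 2) := by
    simpa [sq] using (hV.pd i).mul_right (hV.pd i).1
  have key : ∀ x, ENNReal.ofReal ((V (x - h) - V x) ^ 2) ≤
      ∫⁻ s in Ioc (0 : ℝ) 1, ENNReal.ofReal (D (x - s • h) ^ 2) := fun x => by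
    have hcont : Continuous fun s : ℝ => D (x - s • h) := by fun_prop
    have hd : ∀ s : ℝ, HasDerivAt (fun s : ℝ => V (x - s • h)) (D (x - s • h)) s := fun s => by
      have h1 : HasDerivAt (fun s : ℝ => x - s • h) (-((1 : ℝ) • h)) s :=
        ((hasDerivAt_id s).smul_const h).const_sub x
      have h2 := (hV.differentiable (x - s • h)).hasFDerivAt.comp_hasDerivAt s h1
      refine h2.congr_deriv ?_
      simp [hD]
    have h3 := intervalIntegral.integral_eq_sub_of_hasDerivAt (a := 0) (b := 1)
      (fun s _ => hd s) (hcont.intervalIntegrable 0 1)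
    simp only [one_smul, zero_smul, sub_zero] at h3
    rw [intervalIntegral.integral_of_le zero_le_one] at h3
    have hm : MemLp (fun s : ℝ => D (x - s • h)) 2 (volume.restrict (Ioc (0 : ℝ) 1)) := by
      obtain ⟨C, hC⟩ := isCompact_Icc.exists_bound_of_continuousOn (s := Icc (0 : ℝ) 1)
        hcont.continuousOn
      refine MemLp.of_bound hcont.aestronglyMeasurable C ?_
      filter_upwards [ae_restrict_mem measurableSet_Ioc] with s hs
      exact hC s (Ioc_subset_Icc_self hs)
    have h4 := sq_integral_mul_le hm (memLp_const (1 : ℝ))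
    simp only [mul_one, one_pow] at h4
    rw [h3] at h4
    rw [← ofReal_integral_eq_lintegral_ofReal hm.integrable_sq
      (Eventually.of_forall fun s => sq_nonneg _)]
    refine ENNReal.ofReal_le_ofReal ?_
    simpa using h4
  have hDsq : Integrable (fun x => D x ^ 2) volume := by
    have hD0 : HasCompactSupport D := (hV.2.fderiv_apply ℝ h).neg
    have : HasCompactSupport fun x => D x ^ 2 := by
      simp only [sq]
      exact hD0.mul_right (f' := D)
    exact (hDc.pow 2).integrable_of_hasCompactSupport this
  have hjoint : Measurable fun p : Plane × ℝ => ENNReal.ofReal (D (p.1 - p.2 • h) ^ 2) := by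
    have : Continuous fun p : Plane × ℝ => D (p.1 - p.2 • h) ^ 2 := by fun_prop
    exact this.measurable.ennreal_ofReal
  calc ∫⁻ x, ENNReal.ofReal ((V (x - h) - V x) ^ 2)
      ≤ ∫⁻ x, ∫⁻ s in Ioc (0 : ℝ) 1, ENNReal.ofReal (D (x - s • h) ^ 2) := lintegral_mono key
    _ = ∫⁻ s in Ioc (0 : ℝ) 1, ∫⁻ x, ENNReal.ofReal (D (x - s • h) ^ 2) :=
        lintegral_lintegral_swap hjoint.aemeasurable
    _ = ∫⁻ s in Ioc (0 : ℝ) 1, ∫⁻ x, ENNReal.ofReal (D x ^ 2) := by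
        refine lintegral_congr fun s => ?_
        exact lintegral_sub_right_eq_self (fun x => ENNReal.ofReal (D x ^ 2)) (s • h)
    _ = ENNReal.ofReal (∫ x, D x ^ 2) := by
        rw [← ofReal_integral_eq_lintegral_ofReal hDsq (Eventually.of_forall fun s => sq_nonneg _)]
        simp
    _ ≤ _ := by
        refine ENNReal.ofReal_le_ofReal ?_
        rw [← integral_add (t 0).integrable (t 1).integrable, ← integral_const_mul]
        refine integral_mono hDsq (((t 0).add (t 1)).integrable.const_mul _) fun x => ?_
        simp only [hD, fderiv_eq_sum_pd, norm_sq_plane]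
        nlinarith [sq_nonneg (h 0 * pd 1 V x - h 1 * pd 0 V x)]

namespace Flow

variable {u : Plane → Plane} {ω : Plane → ℝ} {W A : ℝ} {s : ℝ}

theorem ae_tendsto_smo (hu : Flow u ω W A) (k : Fin 2) :
    ∀ᵐ x, Tendsto (fun n => smo u (eps n) k x) atTop (𝓝 (u x k)) := by
  filter_upwards [hu.ae_abs_sub_smo_le k] with x hx
  rw [tendsto_iff_norm_sub_tendsto_zero]
  refine squeeze_zero (fun _ => norm_nonneg _) (fun n => ?_)
    (by simpa using tendsto_eps.const_mul W)
  rw [norm_sub_rev]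
  exact hx _ (eps_pos n)

/-- The gradients of the mollifications are bounded in `L²` uniformly in the scale, and Fatou's
lemma passes to the limit. At radius `r + 1` the cut-off equals one at both `x` and `x - h`. -/
theorem lintegral_diff_sq_le (hu : Flow u ω W A) {r : ℝ} (hr : 1 ≤ r) {h : Plane} (hh : ‖h‖ ≤ 1)
    (k : Fin 2) : ∫⁻ x in ball (0 : Plane) r, ENNReal.ofReal ((u (x - h) k - u x k) ^ 2) ≤
      ENNReal.ofReal (‖h‖ ^ 2 * (2 * gradBd W A (r + 1))) := by
  have hr1 : 0 < r + 1 := by linarith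
  have hV (n) : IsTest fun y => cutoff (r + 1) y * smo u (eps n) k y :=
    (isTest_cutoff hr1).mul_right (hu.contDiff_smo (eps_pos n) k)
  have h1 : ∀ n, ∫⁻ x in ball (0 : Plane) r, ENNReal.ofReal
      ((smo u (eps n) k (x - h) - smo u (eps n) k x) ^ 2) ≤
      ENNReal.ofReal (‖h‖ ^ 2 * (2 * gradBd W A (r + 1))) := fun n => by
    calc _ = ∫⁻ x in ball (0 : Plane) r, ENNReal.ofReal
          ((cutoff (r + 1) (x - h) * smo u (eps n) k (x - h) -
            cutoff (r + 1) x * smo u (eps n) k x) ^ 2) := by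
          refine setLIntegral_congr_fun measurableSet_ball fun x hx => ?_
          rw [mem_ball_zero_iff] at hx
          have h2 : ‖x - h‖ ≤ r + 1 := (norm_sub_le _ _).trans (by linarith)
          simp only [cutoff_eq_one hr1 h2, cutoff_eq_one hr1 (show ‖x‖ ≤ r + 1 by linarith), one_mul]
      _ ≤ _ := setLIntegral_le_lintegral _ _
      _ ≤ _ := Yudovich.lintegral_diff_sq_le (hV n) h
      _ ≤ _ := by
          refine ENNReal.ofReal_le_ofReal (mul_le_mul_of_nonneg_left ?_ (sq_nonneg _))
          have := hu.integral_pd_cutoff_smo_sq_le (eps_pos n) (eps_le_one n)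
            (r := r + 1) (by linarith)
          linarith [this 0 k, this 1 k]
  have hlim : ∀ᵐ x, Tendsto (fun n => ENNReal.ofReal
      ((smo u (eps n) k (x - h) - smo u (eps n) k x) ^ 2)) atTop
      (𝓝 (ENNReal.ofReal ((u (x - h) k - u x k) ^ 2))) := by
    have h2 := (measurePreserving_sub_right (volume : Measure Plane) h).quasiMeasurePreserving.ae
      (hu.ae_tendsto_smo k)
    filter_upwards [hu.ae_tendsto_smo k, h2] with x hx hx'
    exact (ENNReal.continuous_ofReal.tendsto _).comp ((hx'.sub hx).pow 2)
  calc _ = ∫⁻ x in ball (0 : Plane) r, liminf (fun n => ENNReal.ofReal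
      ((smo u (eps n) k (x - h) - smo u (eps n) k x) ^ 2)) atTop := by
        refine lintegral_congr_ae (ae_restrict_of_ae ?_)
        filter_upwards [hlim] with x hx
        exact hx.liminf_eq.symm
    _ ≤ liminf (fun n => ∫⁻ x in ball (0 : Plane) r, ENNReal.ofReal
      ((smo u (eps n) k (x - h) - smo u (eps n) k x) ^ 2)) atTop := by
        refine lintegral_liminf_le fun n => ?_
        have := (hu.contDiff_smo (eps_pos n) k).continuous
        have : Continuous fun x => (smo u (eps n) k (x - h) - smo u (eps n) k x) ^ 2 := by fun_prop
        exact this.measurable.ennreal_ofReal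
    _ ≤ _ := (liminf_le_liminf (Eventually.of_forall h1)).trans (by simp)

end Flow

/-! ### The kernels of the pressure -/

theorem pd_eqOn_of_isOpen {f g : Plane → ℝ} {U : Set Plane} (hU : IsOpen U) (h : EqOn f g U)
    (j : Fin 2) : EqOn (pd j f) (pd j g) U := fun _ hx =>
  pd_congr_of_eventuallyEq j (h.eventuallyEq_of_mem (hU.mem_nhds hx))

theorem contDiffAt_fundSol {x : Plane} (hx : x ≠ 0) : ContDiffAt ℝ (⊤ : ℕ∞) fundSol x := by
  unfold fundSol
  exact contDiffAt_const.mul ((contDiffAt_norm ℝ hx).log (norm_ne_zero_iff.2 hx))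

/-- The additive constant `-(2π)⁻¹ log c` is recorded as the value at a vector of length `c`. Being
constant, it disappears under differentiation, so that derivatives are homogeneous. -/
theorem fundSol_smul {c : ℝ} (hc : 0 < c) {x : Plane} (hx : x ≠ 0) :
    fundSol (c • x) = fundSol x + fundSol (EuclideanSpace.single 0 c) := by
  have h1 : ‖x‖ ≠ 0 := norm_ne_zero_iff.2 hx
  have h2 : ‖EuclideanSpace.single (0 : Fin 2) c‖ = c := by
    rw [PiLp.norm_single, Real.norm_of_nonneg hc.le]
  unfold fundSol
  rw [norm_smul, h2, Real.norm_of_nonneg hc.le, Real.log_mul hc.ne' h1]; ring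

/-- The singular part of the fundamental solution at scale `r`. -/
def nearKer (θ : Plane → ℝ) (r : ℝ) (z : Plane) : ℝ := θ (r⁻¹ • z) * fundSol (r⁻¹ • z)

/-- The smooth part of the fundamental solution at scale `r`. -/
def farKer (θ : Plane → ℝ) (r : ℝ) (z : Plane) : ℝ := (1 - θ (r⁻¹ • z)) * fundSol (r⁻¹ • z)

namespace IsCutoff

variable {θ : Plane → ℝ} {r : ℝ}

theorem eq_zero (hθ : IsCutoff θ) {x : Plane} (hx : 2 < ‖x‖) : θ x = 0 := by
  by_contra h
  have := hθ.support_subset (subset_tsupport θ h)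
  rw [mem_closedBall_zero_iff] at this
  linarith

theorem isTest (hθ : IsCutoff θ) : IsTest θ := isTest_of_norm hθ.contDiff fun _ => hθ.eq_zero

theorem contDiff_far (hθ : IsCutoff θ) :
    ContDiff ℝ (⊤ : ℕ∞) fun z => (1 - θ z) * fundSol z := by
  rw [contDiff_iff_contDiffAt]
  intro x
  by_cases hx : x = 0
  · subst hx
    have : (fun z => (1 - θ z) * fundSol z) =ᶠ[𝓝 0] fun _ => (0 : ℝ) := by
      filter_upwards [ball_mem_nhds (0 : Plane) zero_lt_one] with z hz
      rw [mem_ball_zero_iff] at hz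
      simp [hθ.eq_one z hz.le]
    exact contDiffAt_const.congr_of_eventuallyEq this
  · exact (contDiffAt_const.sub hθ.contDiff.contDiffAt).mul (contDiffAt_fundSol hx)

theorem contDiff_farKer (hθ : IsCutoff θ) : ContDiff ℝ (⊤ : ℕ∞) (farKer θ r) :=
  hθ.contDiff_far.comp (contDiff_id.const_smul r⁻¹)

theorem nearKer_add_farKer (hr : 0 < r) {z : Plane} (hz : z ≠ 0) :
    nearKer θ r z + farKer θ r z = fundSol z + fundSol (EuclideanSpace.single 0 r⁻¹) := by
  rw [nearKer, farKer, ← fundSol_smul (inv_pos.2 hr) hz]; ring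

theorem nearKer_eq_zero (hθ : IsCutoff θ) (hr : 0 < r) {z : Plane} (hz : 2 * r < ‖z‖) :
    nearKer θ r z = 0 := by
  rw [nearKer, hθ.eq_zero, zero_mul]
  rw [norm_smul, norm_inv, Real.norm_of_nonneg hr.le, inv_mul_eq_div, lt_div_iff₀ hr]
  exact hz

end IsCutoff

/-- The third derivatives of the smooth part of the fundamental solution. -/
def farD (θ : Plane → ℝ) (r : ℝ) (i j k : Fin 2) : Plane → ℝ := pd i (pd j (pd k (farKer θ r)))

section FarBounds

variable {θ : Plane → ℝ} {r : ℝ}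

theorem contDiff_farD (hθ : IsCutoff θ) (i j k : Fin 2) :
    ContDiff ℝ (⊤ : ℕ∞) (farD θ r i j k) :=
  contDiff_pd (contDiff_pd (contDiff_pd hθ.contDiff_farKer k) j) i

theorem pd3_comp_smul (f : Plane → ℝ) (c : ℝ) (i j k : Fin 2) (x : Plane) :
    pd i (pd j (pd k fun y => f (c • y))) x = c ^ 3 * pd i (pd j (pd k f)) (c • x) := by
  have hsm (a : ℝ) (l : Fin 2) (g : Plane → ℝ) (x : Plane) :
      pd l (fun y => a * g y) x = a * pd l g x := by
    have : (fun y => a * g y) = a • g := rfl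
    unfold pd
    rw [this, fderiv_const_smul_field]; simp
  rw [show (pd k fun y => f (c • y)) = fun y => c * pd k f (c • y) from
    funext fun y => pd_comp_smul k c]
  rw [show (pd j fun y => c * pd k f (c • y)) = fun y => c * (c * pd j (pd k f) (c • y)) from
    funext fun y => by rw [hsm, pd_comp_smul]]
  rw [hsm, hsm, pd_comp_smul]
  ring

theorem farD_scale (θ : Plane → ℝ) (r : ℝ) (i j k : Fin 2) (x : Plane) :
    farD θ r i j k x = (r⁻¹) ^ 3 * farD θ 1 i j k (r⁻¹ • x) := by
  have h1 : farKer θ 1 = fun z => (1 - θ z) * fundSol z := by ext z; simp [farKer]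
  have h2 : farKer θ r = fun y => farKer θ 1 (r⁻¹ • y) := by ext z; simp [farKer]
  unfold farD
  rw [h2, pd3_comp_smul]

/-- Compactness settles `‖x‖ ≤ 3`. Beyond radius `2` the kernel is the fundamental solution itself,
whose third derivatives are homogeneous of degree `-3`, and larger `x` are brought back to the
sphere of radius `3`. -/
theorem exists_farD_bound_aux (hθ : IsCutoff θ) (i j k : Fin 2) :
    ∃ C, 0 ≤ C ∧ ∀ x, |farD θ 1 i j k x| ≤ C / (1 + ‖x‖) ^ 3 := by
  obtain ⟨C, hC⟩ := (isCompact_closedBall (0 : Plane) 3).exists_bound_of_continuousOn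
    (contDiff_farD (r := 1) hθ i j k).continuous.continuousOn
  have hC0 : 0 ≤ C := (norm_nonneg _).trans (hC 0 (by simp))
  refine ⟨64 * C, by positivity, fun x => ?_⟩
  rw [le_div_iff₀ (by positivity)]
  rcases le_or_gt ‖x‖ 3 with h | h
  · have h1 := hC x (by simpa using h)
    rw [Real.norm_eq_abs] at h1
    have h2 : (1 + ‖x‖) ^ 3 ≤ 4 ^ 3 := by gcongr; linarith
    calc |farD θ 1 i j k x| * (1 + ‖x‖) ^ 3 ≤ C * 4 ^ 3 := by gcongr
      _ = _ := by ring
  · set l := ‖x‖ / 3 with hl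
    have hl1 : 1 < l := by rw [hl]; linarith
    have hl0 : 0 < l := by linarith
    set y := l⁻¹ • x with hy
    have hxy : x = l • y := by rw [hy, smul_smul, mul_inv_cancel₀ hl0.ne', one_smul]
    have hyn : ‖y‖ = 3 := by
      rw [hy, norm_smul, norm_inv, Real.norm_of_nonneg hl0.le, hl]
      field_simp
    have hU : IsOpen {w : Plane | 2 < ‖w‖} := isOpen_lt continuous_const continuous_norm
    have heq : EqOn (fun w => farKer θ 1 (l • w))
        (fun w => farKer θ 1 w + fundSol (EuclideanSpace.single 0 l)) {w : Plane | 2 < ‖w‖} := by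
      intro w hw
      have hw' : 2 < ‖w‖ := hw
      have hw0 : w ≠ 0 := by rintro rfl; simp at hw'; linarith
      have h2 : 2 < ‖l • w‖ := by
        rw [norm_smul, Real.norm_of_nonneg hl0.le]; nlinarith
      simp only [farKer, inv_one, one_smul, hθ.eq_zero hw', hθ.eq_zero h2]
      rw [fundSol_smul hl0 hw0]; ring
    have e1 : EqOn (pd k fun w => farKer θ 1 (l • w)) (pd k (farKer θ 1)) {w : Plane | 2 < ‖w‖} := by
      intro w hw
      rw [pd_eqOn_of_isOpen hU heq k hw, pd_add k
        ((hθ.contDiff_farKer (r := 1)).differentiable (by simp) w) (differentiableAt_const _),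
        pd_const, add_zero]
    have e3 := pd_eqOn_of_isOpen hU (pd_eqOn_of_isOpen hU e1 j) i (show y ∈ _ from by
      change 2 < ‖y‖; rw [hyn]; norm_num)
    rw [pd3_comp_smul, ← hxy] at e3
    have h1 := hC y (by simp [hyn])
    rw [Real.norm_eq_abs] at h1
    have e4 : |farD θ 1 i j k x| * l ^ 3 ≤ C := by
      rw [← abs_of_pos (pow_pos hl0 3), ← abs_mul, mul_comm]
      exact (congrArg abs e3).trans_le h1
    -- Here `1 + ‖x‖ = 1 + 3 * l ≤ 4 * l`, whence the factor `64 = 4 ^ 3`.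
    have h3 : (1 + ‖x‖) ^ 3 ≤ (4 * l) ^ 3 := by
      gcongr; rw [hl]; linarith
    calc |farD θ 1 i j k x| * (1 + ‖x‖) ^ 3 ≤ |farD θ 1 i j k x| * (4 * l) ^ 3 := by gcongr
      _ = 64 * (|farD θ 1 i j k x| * l ^ 3) := by ring
      _ ≤ 64 * C := by gcongr

theorem exists_farD_bound (hθ : IsCutoff θ) :
    ∃ C, 0 < C ∧ ∀ r, 0 < r → ∀ i j k x, |farD θ r i j k x| ≤ C / (r + ‖x‖) ^ 3 := by
  choose C hC0 hC using exists_farD_bound_aux hθ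
  refine ⟨1 + ∑ i, ∑ j, ∑ k, C i j k, by
    have : 0 ≤ ∑ i, ∑ j, ∑ k, C i j k := Finset.sum_nonneg fun i _ => Finset.sum_nonneg fun j _ =>
      Finset.sum_nonneg fun k _ => hC0 i j k
    linarith, fun r hr i j k x => ?_⟩
  have hle : C i j k ≤ 1 + ∑ i, ∑ j, ∑ k, C i j k := by
    have h1 : C i j k ≤ ∑ k, C i j k :=
      Finset.single_le_sum (fun k _ => hC0 i j k) (Finset.mem_univ k)
    have h2 : ∑ k, C i j k ≤ ∑ j, ∑ k, C i j k :=
      Finset.single_le_sum (f := fun j => ∑ k, C i j k)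
        (fun j _ => Finset.sum_nonneg fun k _ => hC0 i j k) (Finset.mem_univ j)
    have h3 : ∑ j, ∑ k, C i j k ≤ ∑ i, ∑ j, ∑ k, C i j k :=
      Finset.single_le_sum (f := fun i => ∑ j, ∑ k, C i j k)
        (fun i _ => Finset.sum_nonneg fun j _ => Finset.sum_nonneg fun k _ => hC0 i j k)
        (Finset.mem_univ i)
    linarith
  rw [farD_scale, abs_mul, abs_of_pos (by positivity)]
  have h1 := hC i j k (r⁻¹ • x)
  rw [norm_smul, norm_inv, Real.norm_of_nonneg hr.le] at h1
  calc (r⁻¹) ^ 3 * |farD θ 1 i j k (r⁻¹ • x)| ≤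
        (r⁻¹) ^ 3 * ((1 + ∑ i, ∑ j, ∑ k, C i j k) / (1 + r⁻¹ * ‖x‖) ^ 3) := by
        gcongr; exact h1.trans (by gcongr)
    _ = _ := by
      have : 1 + r⁻¹ * ‖x‖ = (r + ‖x‖) / r := by field_simp
      rw [this]
      have : r + ‖x‖ ≠ 0 := by positivity
      field_simp

end FarBounds

/-! ### Integrability of the singular kernel -/

/-- The integrable majorant of the singular kernels. -/
def singBd (x : Plane) : ℝ := (closedBall (0 : Plane) 2).indicator (fun x => ‖x‖⁻¹) x

/-- In polar coordinates the Jacobian cancels the singularity. -/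
theorem integrable_singBd : Integrable singBd volume := by
  have h : singBd = fun x => (fun y : ℝ => (Iic (2 : ℝ)).indicator (fun y => y⁻¹) y) ‖x‖ := by
    ext x
    simp [singBd, indicator]
  rw [h]
  refine (integrable_fun_norm_addHaar (volume : Measure Plane)
    (f := fun y : ℝ => (Iic (2 : ℝ)).indicator (fun y => y⁻¹) y)).2 ?_
  have hdim : Module.finrank ℝ Plane = 2 := by simp
  rw [hdim]
  have h2 : IntegrableOn (fun _ : ℝ => (1 : ℝ)) (Ioc 0 2) volume := integrableOn_const (by simp)
  have h3 : IntegrableOn ((Iic (2 : ℝ)).indicator fun _ : ℝ => (1 : ℝ)) (Ioi 0) volume := by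
    rw [IntegrableOn, integrable_indicator_iff measurableSet_Iic, IntegrableOn,
      Measure.restrict_restrict measurableSet_Iic, inter_comm, Ioi_inter_Iic]
    exact h2
  refine h3.congr_fun (fun y hy => ?_) measurableSet_Ioi
  have hy' : (0 : ℝ) < y := hy
  by_cases h4 : y ≤ 2
  · simp [indicator, h4, hy'.ne']
  · simp [indicator, h4]

/-- A smooth approximation of the fundamental solution. -/
def regSol (d : ℝ) (x : Plane) : ℝ := -(1 / (4 * Real.pi)) * Real.log (‖x‖ ^ 2 + d ^ 2)

section Reg

variable {d : ℝ}

theorem contDiff_regSol (hd : 0 < d) : ContDiff ℝ (⊤ : ℕ∞) (regSol d) := by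
  unfold regSol
  refine contDiff_const.mul (ContDiff.log ((contDiff_norm_sq ℝ).add contDiff_const) fun x => ?_)
  positivity

theorem pd_regSol (hd : 0 < d) (j : Fin 2) (x : Plane) :
    pd j (regSol d) x = -(1 / (2 * Real.pi)) * (x j / (‖x‖ ^ 2 + d ^ 2)) := by
  have hne : ‖x‖ ^ 2 + d ^ 2 ≠ 0 := by positivity
  have h1 : DifferentiableAt ℝ (fun y : Plane => ‖y‖ ^ 2 + d ^ 2) x :=
    ((contDiff_norm_sq ℝ).add contDiff_const).differentiable (n := (⊤ : ℕ∞)) (by simp) x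
  have h2 := pd_scomp (β := Real.log) j (Real.differentiableAt_log hne) h1
  have h0 : DifferentiableAt ℝ (fun y : Plane => ‖y‖ ^ 2) x :=
    (contDiff_norm_sq ℝ).differentiable (n := (⊤ : ℕ∞)) (by simp) x
  rw [pd_add j h0 (differentiableAt_const _), pd_normSq, pd_const, Real.deriv_log] at h2
  unfold regSol
  rw [pd_const_mul j (h1.log hne), h2]
  have := Real.pi_pos.ne'
  field_simp
  ring

/-- The right-hand side is an approximate Dirac mass: its `L¹` norm does not depend on `d`. This is
the source of the uniform constants below. -/
theorem laplacian_regSol (hd : 0 < d) (x : Plane) :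
    pd 0 (pd 0 (regSol d)) x + pd 1 (pd 1 (regSol d)) x =
      -(1 / Real.pi) * (d ^ 2 / (‖x‖ ^ 2 + d ^ 2) ^ 2) := by
  have hne : ‖x‖ ^ 2 + d ^ 2 ≠ 0 := by positivity
  have h0 : DifferentiableAt ℝ (fun y : Plane => ‖y‖ ^ 2) x :=
    (contDiff_norm_sq ℝ).differentiable (n := (⊤ : ℕ∞)) (by simp) x
  have h1 : DifferentiableAt ℝ (fun y : Plane => ‖y‖ ^ 2 + d ^ 2) x := h0.add_const _
  have h2 (j : Fin 2) : pd j (pd j (regSol d)) x = -(1 / (2 * Real.pi)) *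
      ((‖x‖ ^ 2 + d ^ 2)⁻¹ - x j * (2 * x j) / (‖x‖ ^ 2 + d ^ 2) ^ 2) := by
    have e : pd j (regSol d) =
        fun y => -(1 / (2 * Real.pi)) * (y j * (fun z : Plane => (‖z‖ ^ 2 + d ^ 2)⁻¹) y) :=
      funext fun y => by rw [pd_regSol hd, div_eq_mul_inv (y j)]
    have hx : DifferentiableAt ℝ (fun y : Plane => y j) x :=
      (continuous_coord j).differentiable (by simp) x
    have hinv := pd_scomp (β := fun t : ℝ => t⁻¹) j (differentiableAt_inv hne) h1
    rw [pd_add j h0 (differentiableAt_const _), pd_normSq, pd_const, deriv_inv] at hinv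
    have h3 : DifferentiableAt ℝ (fun z : Plane => (‖z‖ ^ 2 + d ^ 2)⁻¹) x := h1.inv hne
    have hx3 : DifferentiableAt ℝ (fun y : Plane => y j * (fun z : Plane => (‖z‖ ^ 2 + d ^ 2)⁻¹) y) x :=
      hx.mul h3
    rw [e, pd_const_mul j hx3, pd_mul j hx h3, hinv, pd_coord]
    ring
  rw [h2, h2]
  have hn := norm_sq_plane x
  have := Real.pi_pos.ne'
  rw [hn] at hne ⊢
  field_simp
  ring

theorem abs_log_le_inv {t : ℝ} (h0 : 0 < t) (h2 : t ≤ 2) : |Real.log t| ≤ 4 * t⁻¹ := by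
  have h1 : Real.log t ≤ t - 1 := Real.log_le_sub_one_of_pos h0
  have h3 : Real.log t⁻¹ ≤ t⁻¹ - 1 := Real.log_le_sub_one_of_pos (inv_pos.2 h0)
  rw [Real.log_inv] at h3
  have h4 : 0 < t⁻¹ := inv_pos.2 h0
  have h5 : t ≤ 4 * t⁻¹ := by
    rw [← div_eq_mul_inv, le_div_iff₀ h0]; nlinarith
  rw [abs_le]; constructor <;> linarith

theorem abs_regSol_le (hd : 0 ≤ d) (hd1 : d ≤ 1) {x : Plane} (hx0 : x ≠ 0) (hx : ‖x‖ ≤ 2) :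
    |regSol d x| ≤ 8 * ‖x‖⁻¹ := by
  have hn : 0 < ‖x‖ := norm_pos_iff.2 hx0
  have h1 : Real.log (‖x‖ ^ 2) ≤ Real.log (‖x‖ ^ 2 + d ^ 2) :=
    Real.log_le_log (by positivity) (by nlinarith [sq_nonneg d])
  have h2 : Real.log (‖x‖ ^ 2 + d ^ 2) ≤ ‖x‖ ^ 2 + d ^ 2 - 1 :=
    Real.log_le_sub_one_of_pos (by positivity)
  have h3 : ‖x‖ ^ 2 + d ^ 2 - 1 ≤ 8 * ‖x‖⁻¹ := by
    rw [← div_eq_mul_inv, le_div_iff₀ hn]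
    have hd2 : d ^ 2 ≤ 1 := by nlinarith
    have : ‖x‖ ^ 2 * ‖x‖ ≤ 2 ^ 2 * 2 := by gcongr
    nlinarith
  have h4 := abs_log_le_inv hn hx
  rw [Real.log_pow] at h1
  push_cast at h1
  have h5 : |Real.log (‖x‖ ^ 2 + d ^ 2)| ≤ 8 * ‖x‖⁻¹ := by
    rw [abs_le] at h4 ⊢
    constructor <;> linarith
  have hpi : 1 / (4 * Real.pi) ≤ 1 := by
    rw [div_le_one (by positivity)]; nlinarith [Real.pi_gt_three]
  have hpi0 : 0 ≤ 1 / (4 * Real.pi) := by positivity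
  unfold regSol
  rw [abs_mul, abs_neg, abs_of_nonneg hpi0]
  nlinarith [abs_nonneg (Real.log (‖x‖ ^ 2 + d ^ 2))]

theorem abs_pd_regSol_le (hd : 0 < d) (j : Fin 2) {x : Plane} (hx0 : x ≠ 0) :
    |pd j (regSol d) x| ≤ ‖x‖⁻¹ := by
  have hn : 0 < ‖x‖ := norm_pos_iff.2 hx0
  rw [pd_regSol hd, abs_mul, abs_neg, abs_of_nonneg (by positivity), abs_div,
    abs_of_pos (show 0 < ‖x‖ ^ 2 + d ^ 2 by positivity)]
  have h1 : |x j| / (‖x‖ ^ 2 + d ^ 2) ≤ ‖x‖⁻¹ := by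
    rw [div_le_iff₀ (by positivity)]
    have := abs_coord_le x j
    have h2 : ‖x‖⁻¹ * ‖x‖ ^ 2 = ‖x‖ := by field_simp
    have h3 : 0 ≤ ‖x‖⁻¹ * d ^ 2 := by positivity
    nlinarith
  have hpi : 1 / (2 * Real.pi) ≤ 1 := by
    rw [div_le_one (by positivity)]; nlinarith [Real.pi_gt_three]
  have hpi0 : 0 ≤ 1 / (2 * Real.pi) := by positivity
  have h0 : 0 ≤ |x j| / (‖x‖ ^ 2 + d ^ 2) := by positivity
  nlinarith

theorem pd_fundSol (j : Fin 2) {x : Plane} (hx : x ≠ 0) :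
    pd j fundSol x = -(1 / (2 * Real.pi)) * (x j / ‖x‖ ^ 2) := by
  have e : fundSol = fun y => -(1 / (4 * Real.pi)) * Real.log (‖y‖ ^ 2) := by
    ext y; rw [fundSol, Real.log_pow]; push_cast
    have := Real.pi_pos.ne'
    field_simp; ring
  have hne : ‖x‖ ^ 2 ≠ 0 := by have := norm_pos_iff.2 hx; positivity
  have h0 : DifferentiableAt ℝ (fun y : Plane => ‖y‖ ^ 2) x :=
    (contDiff_norm_sq ℝ).differentiable (n := (⊤ : ℕ∞)) (by simp) x
  have h2 := pd_scomp (β := Real.log) j (Real.differentiableAt_log hne) h0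
  rw [pd_normSq, Real.deriv_log] at h2
  rw [e, pd_const_mul j (h0.log hne), h2]
  have := Real.pi_pos.ne'
  field_simp
  ring

theorem tendsto_regSol {x : Plane} (hx : x ≠ 0) :
    Tendsto (fun n => regSol (eps n) x) atTop (𝓝 (fundSol x)) := by
  have hne : ‖x‖ ^ 2 + 0 ^ 2 ≠ 0 := by have := norm_pos_iff.2 hx; positivity
  have h : ContinuousAt (fun d : ℝ => regSol d x) 0 := by
    unfold regSol
    exact continuousAt_const.mul (ContinuousAt.log (by fun_prop) hne)
  have h2 : regSol 0 x = fundSol x := by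
    rw [regSol, fundSol, zero_pow two_ne_zero, add_zero, Real.log_pow]; push_cast
    have := Real.pi_pos.ne'
    field_simp; ring
  rw [← h2]
  exact h.tendsto.comp tendsto_eps

theorem tendsto_pd_regSol (j : Fin 2) {x : Plane} (hx : x ≠ 0) :
    Tendsto (fun n => pd j (regSol (eps n)) x) atTop (𝓝 (pd j fundSol x)) := by
  have hne : ‖x‖ ^ 2 + 0 ^ 2 ≠ 0 := by have := norm_pos_iff.2 hx; positivity
  have h : ContinuousAt (fun d : ℝ => -(1 / (2 * Real.pi)) * (x j / (‖x‖ ^ 2 + d ^ 2))) 0 :=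
    continuousAt_const.mul (ContinuousAt.div continuousAt_const (by fun_prop) hne)
  have h2 := h.tendsto.comp tendsto_eps
  rw [zero_pow two_ne_zero, add_zero, ← pd_fundSol j hx] at h2
  exact h2.congr fun n => (pd_regSol (eps_pos n) j x).symm

end Reg

theorem pd_eq_zero_of_gt {f : Plane → ℝ} {r : ℝ} (h : ∀ x, r < ‖x‖ → f x = 0) (j : Fin 2)
    {x : Plane} (hx : r < ‖x‖) : pd j f x = 0 := by
  have hU : IsOpen {w : Plane | r < ‖w‖} := isOpen_lt continuous_const continuous_norm
  rw [pd_eqOn_of_isOpen hU (g := fun _ => (0 : ℝ)) (fun w hw => h w hw) j hx, pd_const]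

theorem tendsto_cv_of_dominated {K : ℕ → Plane → ℝ} {k b : Plane → ℝ} {ρ : Plane → ℝ}
    (hK : ∀ n, AEStronglyMeasurable (K n) volume) (hb : Integrable b volume)
    (hKb : ∀ n, ∀ᵐ x, |K n x| ≤ b x) (hlim : ∀ᵐ x, Tendsto (fun n => K n x) atTop (𝓝 (k x)))
    (hρ : IsTest ρ) (x : Plane) : Tendsto (fun n => cv (K n) ρ x) atTop (𝓝 (cv k ρ x)) := by
  obtain ⟨C, hC0, hC⟩ := hρ.exists_bound
  simp only [cv_apply]
  refine tendsto_integral_of_dominated_convergence (fun t => b t * C) (fun n => ?_)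
    (hb.mul_const C) (fun n => ?_) ?_
  · exact (hK n).mul (hρ.comp_sub_left x).continuous.aestronglyMeasurable
  · filter_upwards [hKb n] with t ht
    rw [norm_mul]
    exact mul_le_mul ht (hC _) (abs_nonneg _) ((abs_nonneg _).trans ht)
  · filter_upwards [hlim] with t ht
    exact ht.mul_const _

/-- The smooth approximation of the singular part of the fundamental solution. -/
def nearReg (θ : Plane → ℝ) (d : ℝ) (z : Plane) : ℝ := θ z * regSol d z

theorem singBd_nonneg (x : Plane) : 0 ≤ singBd x :=
  indicator_nonneg (fun x _ => inv_nonneg.2 (norm_nonneg x)) x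

theorem singBd_of_le {x : Plane} (hx : ‖x‖ ≤ 2) : singBd x = ‖x‖⁻¹ := by
  simp [singBd, hx]

theorem ae_ne_zero : ∀ᵐ x : Plane, x ≠ 0 := by
  simp [ae_iff, measure_singleton]

namespace IsCutoff

variable {θ : Plane → ℝ} {d : ℝ}

theorem abs_le_one (hθ : IsCutoff θ) (x : Plane) : |θ x| ≤ 1 := by
  rw [abs_of_nonneg (hθ.nonneg x)]; exact hθ.le_one x

theorem isTest_nearReg (hθ : IsCutoff θ) (hd : 0 < d) : IsTest (nearReg θ d) :=
  hθ.isTest.mul_right (contDiff_regSol hd)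

theorem abs_nearReg_le (hθ : IsCutoff θ) (hd : 0 ≤ d) (hd1 : d ≤ 1) {x : Plane} (hx0 : x ≠ 0) :
    |nearReg θ d x| ≤ 8 * singBd x := by
  rcases le_or_gt ‖x‖ 2 with h | h
  · rw [nearReg, abs_mul, singBd_of_le h]
    calc |θ x| * |regSol d x| ≤ 1 * (8 * ‖x‖⁻¹) :=
          mul_le_mul (hθ.abs_le_one x) (abs_regSol_le hd hd1 hx0 h) (abs_nonneg _) zero_le_one
      _ = _ := one_mul _
  · simp only [nearReg, hθ.eq_zero h, zero_mul, abs_zero]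
    exact mul_nonneg (by norm_num) (singBd_nonneg x)

theorem pd_nearReg (hθ : IsCutoff θ) (hd : 0 < d) (j : Fin 2) (x : Plane) :
    pd j (nearReg θ d) x = θ x * pd j (regSol d) x + regSol d x * pd j θ x :=
  pd_mul j (hθ.isTest.differentiable x) ((contDiff_regSol hd).differentiable (by simp) x)

theorem exists_pd_bound (hθ : IsCutoff θ) : ∃ C, 0 ≤ C ∧ (∀ j x, |pd j θ x| ≤ C) ∧
    ∀ i j x, |pd i (pd j θ) x| ≤ C := by
  choose C hC0 hC using fun j => (hθ.isTest.pd j).exists_bound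
  choose D hD0 hD using fun i j => ((hθ.isTest.pd j).pd i).exists_bound
  refine ⟨(∑ j, C j) + ∑ i, ∑ j, D i j, add_nonneg (Finset.sum_nonneg fun j _ => hC0 j)
    (Finset.sum_nonneg fun i _ => Finset.sum_nonneg fun j _ => hD0 i j), fun j x => ?_,
    fun i j x => ?_⟩
  · have h1 : C j ≤ ∑ j, C j := Finset.single_le_sum (fun j _ => hC0 j) (Finset.mem_univ j)
    have h2 : 0 ≤ ∑ i, ∑ j, D i j :=
      Finset.sum_nonneg fun i _ => Finset.sum_nonneg fun j _ => hD0 i j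
    linarith [hC j x]
  · have h1 : D i j ≤ ∑ j, D i j := Finset.single_le_sum (fun j _ => hD0 i j) (Finset.mem_univ j)
    have h2 : ∑ j, D i j ≤ ∑ i, ∑ j, D i j := Finset.single_le_sum (f := fun i => ∑ j, D i j)
      (fun i _ => Finset.sum_nonneg fun j _ => hD0 i j) (Finset.mem_univ i)
    have h3 : 0 ≤ ∑ j, C j := Finset.sum_nonneg fun j _ => hC0 j
    linarith [hD i j x]

theorem exists_pd_nearReg_bound (hθ : IsCutoff θ) : ∃ C, ∀ d, 0 < d → d ≤ 1 → ∀ j x, x ≠ 0 →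
    |pd j (nearReg θ d) x| ≤ C * singBd x := by
  obtain ⟨C, hC0, hC, -⟩ := hθ.exists_pd_bound
  refine ⟨1 + 8 * C, fun d hd hd1 j x hx0 => ?_⟩
  rcases le_or_gt ‖x‖ 2 with h | h
  · rw [hθ.pd_nearReg hd, singBd_of_le h]
    have h1 : |θ x * pd j (regSol d) x| ≤ 1 * ‖x‖⁻¹ := by
      rw [abs_mul]
      exact mul_le_mul (hθ.abs_le_one x) (abs_pd_regSol_le hd j hx0) (abs_nonneg _) zero_le_one
    have h2 : |regSol d x * pd j θ x| ≤ (8 * ‖x‖⁻¹) * C := by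
      rw [abs_mul]
      exact mul_le_mul (abs_regSol_le hd.le hd1 hx0 h) (hC j x) (abs_nonneg _) (by positivity)
    refine (abs_add_le _ _).trans ?_
    linarith
  · rw [pd_eq_zero_of_gt (f := nearReg θ d)
      (fun y hy => by rw [nearReg, hθ.eq_zero hy, zero_mul]) j h, abs_zero]
    exact mul_nonneg (by positivity) (singBd_nonneg x)

theorem pd_nearKer (hθ : IsCutoff θ) (j : Fin 2) {x : Plane} (hx : x ≠ 0) :
    pd j (fun z => θ z * fundSol z) x = θ x * pd j fundSol x + fundSol x * pd j θ x :=
  pd_mul j (hθ.isTest.differentiable x) ((contDiffAt_fundSol hx).differentiableAt (by simp))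

theorem tendsto_nearReg (θ : Plane → ℝ) {x : Plane} (hx : x ≠ 0) :
    Tendsto (fun n => nearReg θ (eps n) x) atTop (𝓝 (θ x * fundSol x)) :=
  (tendsto_regSol hx).const_mul _

theorem tendsto_pd_nearReg (hθ : IsCutoff θ) (j : Fin 2) {x : Plane} (hx : x ≠ 0) :
    Tendsto (fun n => pd j (nearReg θ (eps n)) x) atTop
      (𝓝 (pd j (fun z => θ z * fundSol z) x)) := by
  rw [hθ.pd_nearKer j hx]
  refine (((tendsto_pd_regSol j hx).const_mul (θ x)).add
    ((tendsto_regSol hx).mul_const (pd j θ x))).congr fun n => ?_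
  rw [hθ.pd_nearReg (eps_pos n)]

theorem integrable_near (hθ : IsCutoff θ) : Integrable (fun z => θ z * fundSol z) volume := by
  refine Integrable.mono' (integrable_singBd.const_mul 8) ?_ ?_
  · refine aestronglyMeasurable_of_tendsto_ae atTop
      (fun n => (hθ.isTest_nearReg (eps_pos n)).continuous.aestronglyMeasurable) ?_
    filter_upwards [ae_ne_zero] with x hx using tendsto_nearReg θ hx
  · filter_upwards [ae_ne_zero] with x hx
    exact le_of_tendsto (tendsto_nearReg θ hx).norm
      (Eventually.of_forall fun n => hθ.abs_nearReg_le (eps_pos n).le (eps_le_one n) hx)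

theorem integrable_pd_near (hθ : IsCutoff θ) (j : Fin 2) :
    Integrable (pd j fun z => θ z * fundSol z) volume := by
  obtain ⟨C, hC⟩ := hθ.exists_pd_nearReg_bound
  refine Integrable.mono' (integrable_singBd.const_mul C) ?_ ?_
  · refine aestronglyMeasurable_of_tendsto_ae atTop
      (fun n => ((hθ.isTest_nearReg (eps_pos n)).pd j).continuous.aestronglyMeasurable) ?_
    filter_upwards [ae_ne_zero] with x hx using hθ.tendsto_pd_nearReg j hx
  · filter_upwards [ae_ne_zero] with x hx
    exact le_of_tendsto (hθ.tendsto_pd_nearReg j hx).norm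
      (Eventually.of_forall fun n => hC _ (eps_pos n) (eps_le_one n) j x hx)

/-- The pointwise derivative of the singular kernel, meaningful off the origin, is its
distributional derivative: no mass sits at the origin. The identity holds for the smooth kernels
`nearReg` and passes to the limit by domination. -/
theorem cv_pd_near (hθ : IsCutoff θ) (j : Fin 2) {ρ : Plane → ℝ} (hρ : IsTest ρ) (x : Plane) :
    cv (pd j fun z => θ z * fundSol z) ρ x = cv (fun z => θ z * fundSol z) (pd j ρ) x := by
  obtain ⟨C, hC⟩ := hθ.exists_pd_nearReg_bound
  have h1 := tendsto_cv_of_dominated (K := fun n => pd j (nearReg θ (eps n)))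
    (fun n => ((hθ.isTest_nearReg (eps_pos n)).pd j).continuous.aestronglyMeasurable)
    (integrable_singBd.const_mul C)
    (fun n => by
      filter_upwards [ae_ne_zero] with x hx
      exact hC (eps n) (eps_pos n) (eps_le_one n) j x hx)
    (by filter_upwards [ae_ne_zero] with x hx using hθ.tendsto_pd_nearReg j hx) hρ x
  have h2 := tendsto_cv_of_dominated (K := fun n => nearReg θ (eps n))
    (fun n => (hθ.isTest_nearReg (eps_pos n)).continuous.aestronglyMeasurable)
    (integrable_singBd.const_mul 8)
    (fun n => by filter_upwards [ae_ne_zero] with x hx using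
      hθ.abs_nearReg_le (eps_pos n).le (eps_le_one n) hx)
    (by filter_upwards [ae_ne_zero] with x hx using tendsto_nearReg θ hx) (hρ.pd j) x
  refine tendsto_nhds_unique h1 (h2.congr fun n => ?_)
  have hR := hθ.isTest_nearReg (eps_pos n)
  rw [← pd_cv hR.continuous.locallyIntegrable hρ, cv_comm,
    pd_cv hρ.continuous.locallyIntegrable hR, cv_comm]

theorem nearKer_one (θ : Plane → ℝ) : nearKer θ 1 = fun z => θ z * fundSol z := by
  ext z; simp [nearKer]

theorem integrable_nearKer (hθ : IsCutoff θ) {r : ℝ} (hr : 0 < r) :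
    Integrable (nearKer θ r) volume :=
  hθ.integrable_near.comp_smul (inv_ne_zero hr.ne')

theorem hasCompactSupport_nearKer (hθ : IsCutoff θ) {r : ℝ} (hr : 0 < r) :
    HasCompactSupport (nearKer θ r) :=
  HasCompactSupport.intro (isCompact_closedBall (0 : Plane) (2 * r)) fun x hx =>
    hθ.nearKer_eq_zero hr (by simpa using hx)

theorem isTest_cv_nearKer (hθ : IsCutoff θ) {r : ℝ} (hr : 0 < r) {ρ : Plane → ℝ}
    (hρ : IsTest ρ) : IsTest (cv (nearKer θ r) ρ) :=
  isTest_cv (hθ.integrable_nearKer hr).locallyIntegrable (hθ.hasCompactSupport_nearKer hr) hρ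

end IsCutoff

/-! ### The quadratic estimate for the second derivatives of the potential -/

/-- The Laplacian. -/
def lap (f : Plane → ℝ) (x : Plane) : ℝ := pd 0 (pd 0 f) x + pd 1 (pd 1 f) x

theorem IsTest.lap {f : Plane → ℝ} (hf : IsTest f) : IsTest (lap f) :=
  ((hf.pd 0).pd 0).add ((hf.pd 1).pd 1)

/-- The field `∇f` has zero curl and divergence `Δf`, so this is a case of `integral_pd_sq_le`. -/
theorem integral_pd_pd_sq_le {f : Plane → ℝ} (hf : IsTest f) (j k : Fin 2) :
    ∫ x, pd j (pd k f) x ^ 2 ≤ ∫ x, lap f x ^ 2 := by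
  refine (integral_pd_sq_le (V := fun k => pd k f) (fun k => hf.pd k) j k).trans_eq ?_
  rw [pd_comm hf.1 0 1]
  simp [lap]

theorem integrable_bracket : Integrable (fun x : Plane => ((1 + ‖x‖ ^ 2) ^ 2)⁻¹) volume := by
  have h := integrable_rpow_neg_one_add_norm_sq (E := Plane) (μ := volume) (r := 4) (by
    simp; norm_num)
  refine h.congr (Eventually.of_forall fun x => ?_)
  simp only
  rw [show (-(4 : ℝ) / 2) = -(2 : ℕ) by norm_num, Real.rpow_neg (by positivity), Real.rpow_natCast]

theorem integral_abs_lap_regSol_aux {d : ℝ} (hd : 0 < d) :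
    Integrable (fun x : Plane => d ^ 2 / (‖x‖ ^ 2 + d ^ 2) ^ 2) volume ∧
    ∫ x : Plane, d ^ 2 / (‖x‖ ^ 2 + d ^ 2) ^ 2 = ∫ x : Plane, ((1 + ‖x‖ ^ 2) ^ 2)⁻¹ := by
  have e : (fun x : Plane => d ^ 2 / (‖x‖ ^ 2 + d ^ 2) ^ 2) =
      fun x => (d ^ 2)⁻¹ * (fun y : Plane => ((1 + ‖y‖ ^ 2) ^ 2)⁻¹) (d⁻¹ • x) := by
    ext x
    simp only [norm_smul, norm_inv, Real.norm_of_nonneg hd.le]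
    have : ‖x‖ ^ 2 + d ^ 2 ≠ 0 := by positivity
    field_simp
    ring
  rw [e]
  refine ⟨(integrable_bracket.comp_smul (inv_ne_zero hd.ne')).const_mul _, ?_⟩
  rw [integral_const_mul, integral_comp_inv_smul_plane (fun y : Plane => ((1 + ‖y‖ ^ 2) ^ 2)⁻¹) hd]
  field_simp

namespace IsCutoff

variable {θ : Plane → ℝ} {d : ℝ}

theorem lap_nearReg (hθ : IsCutoff θ) (hd : 0 < d) (x : Plane) :
    lap (nearReg θ d) x = θ x * lap (regSol d) x + 2 * (pd 0 θ x * pd 0 (regSol d) x +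
      pd 1 θ x * pd 1 (regSol d) x) + regSol d x * lap θ x := by
  have hR := contDiff_regSol hd
  have h (j : Fin 2) : pd j (pd j (nearReg θ d)) x = θ x * pd j (pd j (regSol d)) x +
      2 * (pd j θ x * pd j (regSol d) x) + regSol d x * pd j (pd j θ) x := by
    have e : pd j (nearReg θ d) = fun x => θ x * pd j (regSol d) x + regSol d x * pd j θ x :=
      funext fun x => hθ.pd_nearReg hd j x
    have d1 := hθ.isTest.differentiable x
    have d2 := (contDiff_pd hR j).differentiable (by simp) x
    have d3 := hR.differentiable (by simp) x
    have d4 := (hθ.isTest.pd j).differentiable x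
    have d12 : DifferentiableAt ℝ (fun y => θ y * pd j (regSol d) y) x := d1.mul d2
    have d34 : DifferentiableAt ℝ (fun y => regSol d y * pd j θ y) x := d3.mul d4
    rw [e, pd_add j d12 d34, pd_mul j d1 d2, pd_mul j d3 d4]
    ring
  rw [lap, h, h, lap, lap]; ring

/-- Of the terms of `Δ(θ E_d)`, the one containing `ΔE_d` is an approximate Dirac mass of fixed `L¹`
norm; those with derivatives of `θ` are dominated by `singBd`. -/
theorem exists_integral_lap_bound (hθ : IsCutoff θ) : ∃ C, 0 < C ∧ ∀ d, 0 < d → d ≤ 1 →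
    ∫ x, |lap (nearReg θ d) x| ≤ C := by
  obtain ⟨C, hC0, hC, hC2⟩ := hθ.exists_pd_bound
  have hI0 : 0 ≤ ∫ x : Plane, ((1 + ‖x‖ ^ 2) ^ 2)⁻¹ := integral_nonneg fun x => by positivity
  have hS0 : 0 ≤ ∫ x, singBd x := integral_nonneg singBd_nonneg
  refine ⟨1 + ((∫ x : Plane, ((1 + ‖x‖ ^ 2) ^ 2)⁻¹) + 20 * C * ∫ x, singBd x), by positivity,
    fun d hd hd1 => ?_⟩
  obtain ⟨hi, he⟩ := integral_abs_lap_regSol_aux hd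
  rw [← he, ← integral_const_mul, ← integral_add hi (integrable_singBd.const_mul _)]
  refine le_trans (integral_mono_ae (hθ.isTest_nearReg hd).lap.integrable.abs
    (hi.add (integrable_singBd.const_mul (20 * C))) ?_) (by simp)
  filter_upwards [ae_ne_zero] with x hx0
  simp only [Pi.add_apply]
  have hp : 0 ≤ d ^ 2 / (‖x‖ ^ 2 + d ^ 2) ^ 2 := by positivity
  rcases le_or_gt ‖x‖ 2 with h | h
  · rw [hθ.lap_nearReg hd, singBd_of_le h]
    have h1 : |θ x * lap (regSol d) x| ≤ 1 * (d ^ 2 / (‖x‖ ^ 2 + d ^ 2) ^ 2) := by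
      rw [abs_mul]
      refine mul_le_mul (hθ.abs_le_one x) ?_ (abs_nonneg _) zero_le_one
      rw [lap, laplacian_regSol hd, abs_mul, abs_neg, abs_of_nonneg hp,
        abs_of_nonneg (by positivity)]
      have : 1 / Real.pi ≤ 1 := by
        rw [div_le_one Real.pi_pos]; linarith [Real.pi_gt_three]
      nlinarith
    have h2 (j : Fin 2) : |pd j θ x * pd j (regSol d) x| ≤ C * ‖x‖⁻¹ := by
      rw [abs_mul]
      exact mul_le_mul (hC j x) (abs_pd_regSol_le hd j hx0) (abs_nonneg _) hC0
    have h3 : |regSol d x * lap θ x| ≤ (8 * ‖x‖⁻¹) * (C + C) := by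
      rw [abs_mul]
      exact mul_le_mul (abs_regSol_le hd.le hd1 hx0 h)
        ((abs_add_le _ _).trans (add_le_add (hC2 0 0 x) (hC2 1 1 x))) (abs_nonneg _)
        (by positivity)
    refine (abs_add_three _ _ _).trans ?_
    rw [abs_mul 2, abs_of_pos (zero_lt_two' ℝ)]
    have h4 := abs_add_le (pd 0 θ x * pd 0 (regSol d) x) (pd 1 θ x * pd 1 (regSol d) x)
    have h5 := h2 0
    have h6 := h2 1
    nlinarith
  · have h0 : ∀ y : Plane, 2 < ‖y‖ → nearReg θ d y = 0 := fun y hy => by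
      rw [nearReg, hθ.eq_zero hy, zero_mul]
    have hz (j : Fin 2) : pd j (pd j (nearReg θ d)) x = 0 :=
      pd_eq_zero_of_gt (fun y hy => pd_eq_zero_of_gt h0 j hy) j h
    rw [lap, hz, hz, add_zero, abs_zero]
    have := singBd_nonneg x
    positivity

/-- For a smooth kernel `K`, `‖∂ⱼ∂ₖ(K * g)‖₂ ≤ ‖Δ(K * g)‖₂ = ‖g * ΔK‖₂ ≤ ‖ΔK‖₁ ‖g‖₂`, and `‖ΔK‖₁` is
bounded uniformly in the regularization and in `r`. Fatou's lemma removes the regularization. -/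
theorem exists_lintegral_cv_nearKer_le (hθ : IsCutoff θ) : ∃ C : ℝ, 0 < C ∧ ∀ r, 0 < r →
    ∀ g, IsTest g → ∀ j k, ∫⁻ x, ‖cv (nearKer θ r) (pd j (pd k g)) x‖ₑ ^ 2 ≤
      ENNReal.ofReal (C ^ 2) * ∫⁻ x, ‖g x‖ₑ ^ 2 := by
  obtain ⟨C, hC0, hC⟩ := hθ.exists_integral_lap_bound
  refine ⟨C, hC0, fun r hr g hg j k => ?_⟩
  have hr' := inv_ne_zero hr.ne'
  set K : ℕ → Plane → ℝ := fun n z => nearReg θ (eps n) (r⁻¹ • z) with hK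
  have hKt (n) : IsTest (K n) := (hθ.isTest_nearReg (eps_pos n)).comp_smul hr'
  have hne : ∀ᵐ x : Plane, r⁻¹ • x ≠ 0 := by
    filter_upwards [ae_ne_zero] with x hx using smul_ne_zero hr' hx
  have hlim : ∀ x, Tendsto (fun n => cv (K n) (pd j (pd k g)) x) atTop
      (𝓝 (cv (nearKer θ r) (pd j (pd k g)) x)) := fun x =>
    tendsto_cv_of_dominated (fun n => (hKt n).continuous.aestronglyMeasurable)
      ((integrable_singBd.comp_smul hr').const_mul 8)
      (fun n => by filter_upwards [hne] with x hx using
        hθ.abs_nearReg_le (eps_pos n).le (eps_le_one n) hx)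
      (by filter_upwards [hne] with x hx using tendsto_nearReg θ hx) ((hg.pd k).pd j) x
  have hlapK (n) (x) : lap (K n) x = (r⁻¹) ^ 2 * lap (nearReg θ (eps n)) (r⁻¹ • x) := by
    have hR := hθ.isTest_nearReg (eps_pos n)
    have h2 (i : Fin 2) : pd i (pd i (K n)) x =
        (r⁻¹) ^ 2 * pd i (pd i (nearReg θ (eps n))) (r⁻¹ • x) := by
      rw [show pd i (K n) = fun y => r⁻¹ * pd i (nearReg θ (eps n)) (r⁻¹ • y) from
        funext fun y => pd_comp_smul i r⁻¹, pd_const_mul i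
        (((hR.pd i).comp_smul hr').differentiable x), pd_comp_smul]
      ring
    rw [lap, h2, h2, lap]; ring
  have hL1 (n) : ∫⁻ x, ‖lap (K n) x‖ₑ ≤ ENNReal.ofReal C := by
    rw [← ofReal_integral_norm_eq_lintegral_enorm (hKt n).lap.integrable]
    refine ENNReal.ofReal_le_ofReal ?_
    -- The factor `r⁻²` of the Laplacian cancels the Jacobian `r²`: in the plane this norm is
    -- invariant under dilation.
    have : ∫ x, ‖lap (K n) x‖ = ∫ x, |lap (nearReg θ (eps n)) x| := by
      simp only [hlapK, norm_mul, Real.norm_eq_abs]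
      rw [integral_const_mul,
        integral_comp_inv_smul_plane (fun x => |lap (nearReg θ (eps n)) x|) hr,
        abs_of_pos (by positivity)]
      field_simp
    rw [this]
    exact hC _ (eps_pos n) (eps_le_one n)
  have hbd (n) : ∫⁻ x, ‖cv (K n) (pd j (pd k g)) x‖ₑ ^ 2 ≤
      ENNReal.ofReal (C ^ 2) * ∫⁻ x, ‖g x‖ₑ ^ 2 := by
    have hloc := (hKt n).continuous.locallyIntegrable (μ := volume)
    have hf : IsTest (cv (K n) g) := isTest_cv hloc (hKt n).2 hg
    have e1 : cv (K n) (pd j (pd k g)) = pd j (pd k (cv (K n) g)) := by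
      rw [pd_cv hloc hg, pd_cv hloc (hg.pd k)]
    have e2 : lap (cv (K n) g) = cv g (lap (K n)) := by
      ext x
      have hgl := hg.continuous.locallyIntegrable (μ := volume)
      have h3 (i : Fin 2) : pd i (pd i (cv (K n) g)) = cv g (pd i (pd i (K n))) := by
        rw [cv_comm, pd_cv hgl (hKt n), pd_cv hgl ((hKt n).pd i)]
      rw [lap, h3, h3, cv_apply, cv_apply, cv_apply]
      rw [← integral_add
        (integrable_cv_integrand hgl ((hKt n).pd 0 |>.pd 0).continuous ((hKt n).pd 0 |>.pd 0).2 x)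
        (integrable_cv_integrand hgl ((hKt n).pd 1 |>.pd 1).continuous ((hKt n).pd 1 |>.pd 1).2 x)]
      simp only [lap, mul_add]
    have conv (F : Plane → ℝ) (hF : IsTest F) :
        ∫⁻ x, ‖F x‖ₑ ^ 2 = ENNReal.ofReal (∫ x, F x ^ 2) := by
      rw [ofReal_integral_eq_lintegral_ofReal (hF.memLp 2).integrable_sq
        (Eventually.of_forall fun x => sq_nonneg _)]
      refine lintegral_congr fun x => ?_
      rw [← sq_abs, ENNReal.ofReal_pow (abs_nonneg _), Real.enorm_eq_ofReal_abs]
    rw [e1, conv _ ((hf.pd k).pd j)]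
    calc _ ≤ ENNReal.ofReal (∫ x, lap (cv (K n) g) x ^ 2) :=
          ENNReal.ofReal_le_ofReal (integral_pd_pd_sq_le hf j k)
      _ = ∫⁻ x, ‖cv g (lap (K n)) x‖ₑ ^ 2 := by rw [← conv _ hf.lap, e2]
      _ ≤ (∫⁻ t, ‖lap (K n) t‖ₑ) ^ 2 * ∫⁻ t, ‖g t‖ₑ ^ 2 :=
          lintegral_cv_sq_le hg.continuous.aemeasurable (hKt n).lap.continuous
      _ ≤ _ := by
          rw [ENNReal.ofReal_pow hC0.le]
          gcongr
          exact hL1 n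
  calc _ = ∫⁻ x, liminf (fun n => ‖cv (K n) (pd j (pd k g)) x‖ₑ ^ 2) atTop := by
        refine lintegral_congr fun x => ?_
        exact (((ENNReal.continuous_pow 2).tendsto _).comp
          ((continuous_enorm.tendsto _).comp (hlim x))).liminf_eq.symm
    _ ≤ liminf (fun n => ∫⁻ x, ‖cv (K n) (pd j (pd k g)) x‖ₑ ^ 2) atTop := by
        refine lintegral_liminf_le fun n => ?_
        exact ((contDiff_cv (hKt n).continuous.locallyIntegrable
          ((hg.pd k).pd j)).continuous.measurable.enorm.pow_const 2)
    _ ≤ _ := (liminf_le_liminf (Eventually.of_forall hbd)).trans (by simp)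

end IsCutoff

/-! ### Kernels with cubic decay -/

/-- Continuous kernels with cubic decay at infinity. -/
structure IsDecaying (K : Plane → ℝ) : Prop where
  continuous : Continuous K
  bound : ∃ C, 0 ≤ C ∧ ∀ z, |K z| ≤ C / (1 + ‖z‖) ^ 3

/-- Functions which are integrable for the weight `(1 + |y|)⁻³`. -/
def CubicIntegrable (f : Plane → ℝ) : Prop :=
  Integrable (fun y => f y / (1 + ‖y‖) ^ 3) volume

/-- Peetre's inequality: decay in `x - y` is exchanged for decay in `y`, at the price of a
polynomial factor in `x`. -/
theorem one_add_norm_le (x y : Plane) : 1 + ‖y‖ ≤ (1 + ‖x‖) * (1 + ‖x - y‖) := by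
  have h : ‖y‖ ≤ ‖x‖ + ‖x - y‖ := by
    calc ‖y‖ = ‖x - (x - y)‖ := by simp
      _ ≤ _ := norm_sub_le _ _
  nlinarith [norm_nonneg x, norm_nonneg (x - y)]

theorem inv_cube_le (x y : Plane) {C : ℝ} (hC : 0 ≤ C) :
    C / (1 + ‖x - y‖) ^ 3 ≤ C * (1 + ‖x‖) ^ 3 / (1 + ‖y‖) ^ 3 := by
  rw [div_le_div_iff₀ (by positivity) (by positivity), mul_assoc, ← mul_pow]
  have := one_add_norm_le x y
  gcongr

theorem CubicIntegrable.aestronglyMeasurable {f : Plane → ℝ} (hf : CubicIntegrable f) :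
    AEStronglyMeasurable f volume := by
  have hc : Continuous fun y : Plane => (1 + ‖y‖) ^ 3 := by fun_prop
  refine ((Integrable.aestronglyMeasurable (f := fun y => f y / (1 + ‖y‖) ^ 3) hf).mul
    hc.aestronglyMeasurable).congr (Eventually.of_forall fun y => ?_)
  have : (1 + ‖y‖) ^ 3 ≠ 0 := by positivity
  simp only [Pi.mul_apply]
  field_simp

theorem CubicIntegrable.locallyIntegrable {f : Plane → ℝ} (hf : CubicIntegrable f) :
    LocallyIntegrable f volume := by
  have hc : Continuous fun y : Plane => (1 + ‖y‖) ^ 3 := by fun_prop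
  have h : LocallyIntegrable (fun y => f y / (1 + ‖y‖) ^ 3) volume := Integrable.locallyIntegrable hf
  have h2 := (h.locallyIntegrableOn univ).continuousOn_mul hc.continuousOn
    isOpen_univ.isLocallyClosed
  have e : (fun y : Plane => (1 + ‖y‖) ^ 3 * (f y / (1 + ‖y‖) ^ 3)) = f := by
    ext y
    have : (1 + ‖y‖) ^ 3 ≠ 0 := by positivity
    field_simp
  rwa [e, locallyIntegrableOn_univ] at h2

namespace IsDecaying

variable {K f : Plane → ℝ}

theorem integrable_mul (hK : IsDecaying K) (hf : CubicIntegrable f) (x : Plane) :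
    Integrable (fun y => f y * K (x - y)) volume := by
  obtain ⟨C, hC0, hC⟩ := hK.bound
  have hc := hK.continuous
  refine Integrable.mono' (hf.abs.const_mul (C * (1 + ‖x‖) ^ 3))
    (hf.aestronglyMeasurable.mul (by fun_prop : Continuous fun y => K (x - y)).aestronglyMeasurable)
    (Eventually.of_forall fun y => ?_)
  have h := (hC (x - y)).trans (inv_cube_le x y hC0)
  rw [norm_mul, abs_div, abs_of_pos (show 0 < (1 + ‖y‖) ^ 3 by positivity)]
  calc |f y| * |K (x - y)| ≤ |f y| * (C * (1 + ‖x‖) ^ 3 / (1 + ‖y‖) ^ 3) :=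
        mul_le_mul_of_nonneg_left h (abs_nonneg _)
    _ = _ := by ring

theorem abs_cv_le {C : ℝ} (hC0 : 0 ≤ C) (hC : ∀ z, |K z| ≤ C / (1 + ‖z‖) ^ 3)
    (hf : CubicIntegrable f) (x : Plane) :
    |cv f K x| ≤ C * (1 + ‖x‖) ^ 3 * ∫ y, |f y / (1 + ‖y‖) ^ 3| := by
  rw [cv_apply, ← integral_const_mul]
  refine norm_integral_le_of_norm_le (μ := volume) (f := fun y => f y * K (x - y))
    (hf.abs.const_mul _) (Eventually.of_forall fun y => ?_)
  have h := (hC (x - y)).trans (inv_cube_le x y hC0)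
  rw [norm_mul, abs_div, abs_of_pos (show 0 < (1 + ‖y‖) ^ 3 by positivity)]
  calc |f y| * |K (x - y)| ≤ |f y| * (C * (1 + ‖x‖) ^ 3 / (1 + ‖y‖) ^ 3) :=
        mul_le_mul_of_nonneg_left h (abs_nonneg _)
    _ = _ := by ring

theorem continuous_cv (hK : IsDecaying K) (hf : CubicIntegrable f) : Continuous (cv f K) := by
  obtain ⟨C, hC0, hC⟩ := hK.bound
  have hc := hK.continuous
  rw [continuous_iff_continuousAt]
  intro x₀
  simp only [funext (cv_apply f K)]
  refine continuousAt_of_dominated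
    (bound := fun y => (C * (2 + ‖x₀‖) ^ 3) * |f y / (1 + ‖y‖) ^ 3|) ?_ ?_ (hf.abs.const_mul _) ?_
  · exact Eventually.of_forall fun x => (hK.integrable_mul hf x).aestronglyMeasurable
  · filter_upwards [ball_mem_nhds x₀ one_pos] with x hx
    refine Eventually.of_forall fun y => ?_
    have hx' : ‖x‖ ≤ 1 + ‖x₀‖ := by
      rw [mem_ball, dist_eq_norm] at hx
      calc ‖x‖ = ‖(x - x₀) + x₀‖ := by simp
        _ ≤ ‖x - x₀‖ + ‖x₀‖ := norm_add_le _ _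
        _ ≤ _ := by linarith
    have h := (hC (x - y)).trans (inv_cube_le x y hC0)
    rw [norm_mul, abs_div, abs_of_pos (show 0 < (1 + ‖y‖) ^ 3 by positivity)]
    calc |f y| * |K (x - y)| ≤ |f y| * (C * (1 + ‖x‖) ^ 3 / (1 + ‖y‖) ^ 3) :=
          mul_le_mul_of_nonneg_left h (abs_nonneg _)
      _ ≤ |f y| * (C * (2 + ‖x₀‖) ^ 3 / (1 + ‖y‖) ^ 3) := by
          have : 1 + ‖x‖ ≤ 2 + ‖x₀‖ := by linarith
          gcongr
      _ = _ := by ring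
  · exact Eventually.of_forall fun y => by fun_prop

theorem add {K' : Plane → ℝ} (hK : IsDecaying K) (hK' : IsDecaying K') :
    IsDecaying (fun z => K z + K' z) := by
  obtain ⟨C, hC0, hC⟩ := hK.bound
  obtain ⟨C', hC0', hC'⟩ := hK'.bound
  refine ⟨hK.continuous.add hK'.continuous, C + C', by positivity, fun z => ?_⟩
  rw [add_div]
  exact (abs_add_le _ _).trans (add_le_add (hC z) (hC' z))

end IsDecaying

theorem IsTest.isDecaying {f : Plane → ℝ} (hf : IsTest f) : IsDecaying f := by
  obtain ⟨C, hC0, hC⟩ := hf.exists_bound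
  obtain ⟨r, hr1, hr⟩ := hf.exists_radius
  refine ⟨hf.continuous, C * (1 + r) ^ 3, by positivity, fun z => ?_⟩
  rcases le_or_gt r ‖z‖ with h | h
  · rw [hr z h, abs_zero]; positivity
  · rw [le_div_iff₀ (by positivity)]
    gcongr
    exact hC z

/-- Translates of a kernel with decay, averaged by a test function. -/
theorem abs_cv_le_of_decay {G ρ : Plane → ℝ} {C r a : ℝ} (hr : 0 < r) (hC0 : 0 ≤ C)
    (har : a ≤ r) (hG : ∀ z, |G z| ≤ C / (r + ‖z‖) ^ 3)
    (hρ : Integrable ρ volume) (hsupp : ∀ x, a ≤ ‖x‖ → ρ x = 0) (x : Plane) :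
    |cv G ρ x| ≤ (8 * C * ∫ t, |ρ t|) / (r + ‖x‖) ^ 3 := by
  have hb : ∀ t, |G (x - t) * ρ t| ≤ 8 * C / (r + ‖x‖) ^ 3 * |ρ t| := fun t => by
    rcases le_or_gt a ‖t‖ with h | h
    · simp [hsupp t h]
    · rw [abs_mul]
      refine mul_le_mul_of_nonneg_right ((hG _).trans ?_) (abs_nonneg _)
      rw [div_le_div_iff₀ (by positivity) (by positivity)]
      have h1 : ‖x‖ ≤ ‖x - t‖ + ‖t‖ := by
        calc ‖x‖ = ‖(x - t) + t‖ := by simp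
          _ ≤ _ := norm_add_le _ _
      have h2 : r + ‖x‖ ≤ 2 * (r + ‖x - t‖) := by linarith [norm_nonneg (x - t)]
      calc C * (r + ‖x‖) ^ 3 ≤ C * (2 * (r + ‖x - t‖)) ^ 3 := by gcongr
        _ = _ := by ring
  rw [cv_apply']
  refine (norm_integral_le_of_norm_le (μ := volume) (f := fun t => G (x - t) * ρ t)
    (hρ.abs.const_mul _) (Eventually.of_forall hb)).trans_eq ?_
  rw [integral_const_mul]; ring

theorem IsDecaying.cv {K ρ : Plane → ℝ} (hK : IsDecaying K) (hρ : Continuous ρ)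
    (hρc : HasCompactSupport ρ) : IsDecaying (cv K ρ) := by
  obtain ⟨C, hC0, hC⟩ := hK.bound
  obtain ⟨a, ha1, ha⟩ : ∃ r, 1 ≤ r ∧ ∀ x, r ≤ ‖x‖ → ρ x = 0 := by
    obtain ⟨r, hr⟩ := hρc.isCompact.isBounded.subset_ball 0
    refine ⟨max r 1, le_max_right _ _, fun x hx => ?_⟩
    by_contra h
    have := hr (subset_tsupport ρ h)
    rw [mem_ball_zero_iff] at this
    exact absurd ((le_max_left r 1).trans hx) (not_le.2 this)
  have hcont : Continuous (Yudovich.cv K ρ) :=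
    hρc.continuous_convolution_right _ hK.continuous.locallyIntegrable hρ
  refine ⟨hcont, 8 * (C * a ^ 3) * ∫ t, |ρ t|, by
    have : 0 ≤ ∫ t, |ρ t| := integral_nonneg fun t => abs_nonneg _
    positivity, fun z => ?_⟩
  have h := abs_cv_le_of_decay (G := K) (C := C * a ^ 3) (r := a) (by linarith)
    (by positivity) le_rfl (fun z => (hC z).trans ?_)
    (hρ.integrable_of_hasCompactSupport hρc) ha z
  · refine h.trans ?_
    have : 0 ≤ ∫ t, |ρ t| := integral_nonneg fun t => abs_nonneg _
    gcongr
  · rw [div_le_div_iff₀ (by positivity) (by positivity), mul_assoc, ← mul_pow]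
    have : a + ‖z‖ ≤ a * (1 + ‖z‖) := by nlinarith [norm_nonneg z]
    gcongr

theorem cv_assoc_of_decaying {f K ρ : Plane → ℝ} (hf : CubicIntegrable f) (hK : IsDecaying K)
    (hρ : IsTest ρ) (x : Plane) : cv (cv f K) ρ x = cv f (cv K ρ) x := by
  refine convolution_assoc (ContinuousLinearMap.mul ℝ ℝ) (ContinuousLinearMap.mul ℝ ℝ)
    (ContinuousLinearMap.mul ℝ ℝ) (ContinuousLinearMap.mul ℝ ℝ) (fun a b c => by simp [mul_assoc])
    hf.aestronglyMeasurable hK.continuous.aestronglyMeasurable hρ.continuous.aestronglyMeasurable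
    (Eventually.of_forall fun y => hK.integrable_mul hf y)
    (Eventually.of_forall fun y => hρ.2.norm.convolutionExists_right _
      hK.continuous.norm.locallyIntegrable hρ.continuous.norm y) ?_
  have hK' : IsDecaying fun z => ‖K z‖ := ⟨hK.continuous.norm, by
    obtain ⟨C, hC0, hC⟩ := hK.bound
    exact ⟨C, hC0, fun z => by simpa using hC z⟩⟩
  have hf' : CubicIntegrable fun y => ‖f y‖ := by
    refine (Integrable.norm hf).congr (Eventually.of_forall fun y => ?_)
    simp only [norm_div, norm_pow]
    rw [Real.norm_of_nonneg (show 0 ≤ 1 + ‖y‖ by positivity)]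
  exact (hK'.cv hρ.continuous.norm hρ.2.norm).integrable_mul hf' x

theorem cv_assoc_of_compact {f N ρ : Plane → ℝ} (hf : Integrable f volume)
    (hN : Integrable N volume) (hNc : HasCompactSupport N) (hρ : IsTest ρ) (x : Plane) :
    cv (cv f N) ρ x = cv f (cv N ρ) x := by
  refine convolution_assoc (ContinuousLinearMap.mul ℝ ℝ) (ContinuousLinearMap.mul ℝ ℝ)
    (ContinuousLinearMap.mul ℝ ℝ) (ContinuousLinearMap.mul ℝ ℝ) (fun a b c => by simp [mul_assoc])
    hf.aestronglyMeasurable hN.aestronglyMeasurable hρ.continuous.aestronglyMeasurable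
    (hf.ae_convolution_exists _ hN)
    (Eventually.of_forall fun y => hρ.2.norm.convolutionExists_right _
      hN.norm.locallyIntegrable hρ.continuous.norm y) ?_
  exact (HasCompactSupport.convolution (ContinuousLinearMap.mul ℝ ℝ) hNc.norm
    hρ.2.norm).convolutionExists_right _ hf.norm.locallyIntegrable
    (hρ.2.norm.continuous_convolution_right _ hN.norm.locallyIntegrable hρ.continuous.norm) x

/-! ### The kernel of the mollified pressure force -/

/-- The kernel obtained by mollifying the pressure force. -/
def presKer (θ : Plane → ℝ) (r : ℝ) (ρ : Plane → ℝ) (i j k : Fin 2) (x : Plane) : ℝ :=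
  cv (nearKer θ r) (pd i (pd j (pd k ρ))) x + cv (farD θ r i j k) ρ x

namespace IsCutoff

variable {θ θ' : Plane → ℝ} {r r' : ℝ} {ρ : Plane → ℝ}

theorem isDecaying_farD (hθ : IsCutoff θ) (i j k : Fin 2) : IsDecaying (farD θ 1 i j k) := by
  obtain ⟨C, hC0, hC⟩ := exists_farD_bound hθ
  exact ⟨(contDiff_farD hθ i j k).continuous, C, hC0.le, fun z => hC 1 one_pos i j k z⟩

theorem isDecaying_cv_farD (hθ : IsCutoff θ) (hρ : IsTest ρ) (i j k : Fin 2) :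
    IsDecaying (cv (farD θ 1 i j k) ρ) :=
  (hθ.isDecaying_farD i j k).cv hρ.continuous hρ.2

theorem isDecaying_presKer (hθ : IsCutoff θ) (hρ : IsTest ρ) (i j k : Fin 2) :
    IsDecaying (presKer θ 1 ρ i j k) :=
  (hθ.isTest_cv_nearKer one_pos (((hρ.pd k).pd j).pd i)).isDecaying.add
    (hθ.isDecaying_cv_farD hρ i j k)

/-- Near and far kernels always sum to the fundamental solution up to a constant. Two near kernels
thus differ by a smooth compactly supported `κ`, on which the three derivatives may be placed; there
they produce exactly the difference of the far kernels. -/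
theorem presKer_eq (hθ : IsCutoff θ) (hθ' : IsCutoff θ') (hr : 0 < r) (hr' : 0 < r')
    (hρ : IsTest ρ) (i j k : Fin 2) : presKer θ r ρ i j k = presKer θ' r' ρ i j k := by
  set c : ℝ := fundSol (EuclideanSpace.single 0 r⁻¹) - fundSol (EuclideanSpace.single 0 r'⁻¹) with hc
  set κ : Plane → ℝ := fun z => (farKer θ' r' z - farKer θ r z) + c with hκ
  have hne : ∀ z : Plane, z ≠ 0 → nearKer θ r z = nearKer θ' r' z + κ z := fun z hz => by
    have h1 := nearKer_add_farKer (θ := θ) hr hz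
    have h2 := nearKer_add_farKer (θ := θ') hr' hz
    simp only [hκ, hc]
    linarith
  have hκs : ContDiff ℝ (⊤ : ℕ∞) κ := (hθ'.contDiff_farKer.sub hθ.contDiff_farKer).add contDiff_const
  -- Far out both near kernels vanish, hence so does `κ`: the constant `c` makes up for the two
  -- different scales.
  have hκt : IsTest κ := isTest_of_norm hκs (r := max (2 * r) (2 * r')) fun z hz => by
    have hz0 : z ≠ 0 := by
      rintro rfl
      rw [norm_zero] at hz
      have := (le_max_left (2 * r) (2 * r')).trans_lt hz
      linarith
    have h := hne z hz0
    rw [hθ.nearKer_eq_zero hr ((le_max_left _ _).trans_lt hz),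
      hθ'.nearKer_eq_zero hr' ((le_max_right _ _).trans_lt hz)] at h
    linarith
  ext x
  set D := pd i (pd j (pd k ρ)) with hD
  have hDt : IsTest D := ((hρ.pd k).pd j).pd i
  have e1 : cv (nearKer θ r) D x = cv (nearKer θ' r') D x + cv κ D x := by
    rw [cv_apply, cv_apply, cv_apply, ← integral_add
      (integrable_cv_integrand (hθ'.integrable_nearKer hr').locallyIntegrable hDt.continuous hDt.2 x)
      (integrable_cv_integrand hκt.continuous.locallyIntegrable hDt.continuous hDt.2 x)]
    refine integral_congr_ae ?_
    filter_upwards [ae_ne_zero] with z hz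
    rw [hne z hz]; ring
  have hf := contDiff_farD (r := r) hθ i j k
  have hf' := contDiff_farD (r := r') hθ' i j k
  have e2 : pd i (pd j (pd k κ)) = fun z => farD θ' r' i j k z - farD θ r i j k z := by
    have dd {a b : Plane → ℝ} (ha : ContDiff ℝ (⊤ : ℕ∞) a) (hb : ContDiff ℝ (⊤ : ℕ∞) b) (l : Fin 2) :
        pd l (fun z => a z - b z) = fun z => pd l a z - pd l b z :=
      funext fun z => pd_sub l (ha.differentiable (by simp) z) (hb.differentiable (by simp) z)
    have d0 : pd k κ = fun z => pd k (farKer θ' r') z - pd k (farKer θ r) z := by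
      ext z
      have hs : DifferentiableAt ℝ (fun z => farKer θ' r' z - farKer θ r z) z :=
        (hθ'.contDiff_farKer.sub hθ.contDiff_farKer).differentiable (by simp) z
      rw [hκ, pd_add k hs (differentiableAt_const c), pd_const, add_zero,
        dd hθ'.contDiff_farKer hθ.contDiff_farKer]
    rw [d0, dd (contDiff_pd hθ'.contDiff_farKer k) (contDiff_pd hθ.contDiff_farKer k),
      dd (contDiff_pd (contDiff_pd hθ'.contDiff_farKer k) j)
        (contDiff_pd (contDiff_pd hθ.contDiff_farKer k) j)]
    rfl
  have e3 : cv κ D x = cv (farD θ' r' i j k) ρ x - cv (farD θ r i j k) ρ x := by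
    have hκl := hκt.continuous.locallyIntegrable (μ := volume)
    have hρl := hρ.continuous.locallyIntegrable (μ := volume)
    rw [hD, ← pd_cv hκl ((hρ.pd k).pd j), ← pd_cv hκl (hρ.pd k), ← pd_cv hκl hρ, cv_comm κ ρ,
      pd_cv hρl hκt, pd_cv hρl (hκt.pd k), pd_cv hρl ((hκt.pd k).pd j), e2, cv_comm ρ,
      cv_apply, cv_apply, cv_apply, ← integral_sub
      (integrable_cv_integrand hf'.continuous.locallyIntegrable hρ.continuous hρ.2 x)
      (integrable_cv_integrand hf.continuous.locallyIntegrable hρ.continuous hρ.2 x)]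
    exact integral_congr_ae (Eventually.of_forall fun z => by ring)
  rw [presKer, presKer, ← hD, e1, e3]; ring

/-- As a function of the index `i` the kernel is a gradient. This removes the pressure from the
vorticity equation. -/
theorem presKer_curl (hθ : IsCutoff θ) (hρ : IsTest ρ) (j k : Fin 2) :
    presKer θ r (pd 0 ρ) 1 j k = presKer θ r (pd 1 ρ) 0 j k := by
  ext x
  have h3 : pd 1 (pd j (pd k (pd 0 ρ))) = pd 0 (pd j (pd k (pd 1 ρ))) := by
    rw [pd_comm hρ.1 k 0, pd_comm (hρ.pd k).1 j 0, pd_comm hρ.1 k 1, pd_comm (hρ.pd k).1 j 1,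
      pd_comm ((hρ.pd k).pd j).1 1 0]
  have hF : ContDiff ℝ (⊤ : ℕ∞) (pd j (pd k (farKer θ r))) :=
    contDiff_pd (contDiff_pd hθ.contDiff_farKer k) j
  have hρl := hρ.continuous.locallyIntegrable (μ := volume)
  have h (a b : Fin 2) : cv (farD θ r a j k) (pd b ρ) x =
      pd b (pd a (cv (pd j (pd k (farKer θ r))) ρ)) x := by
    rw [← pd_cv (contDiff_farD hθ a j k).continuous.locallyIntegrable hρ, farD]
    congr 1
    rw [pd_cv hF.continuous.locallyIntegrable hρ]
    ext y
    have e := integral_mul_pd hF ((hρ.comp_sub_left y).1) (Or.inr (hρ.comp_sub_left y).2) a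
    rw [cv_apply, cv_apply]
    simp only [pd_comp_sub_left, mul_neg, integral_neg] at e
    linarith
  rw [presKer, presKer, h3, h, h,
    pd_comm (contDiff_cv hF.continuous.locallyIntegrable hρ) 0 1]

end IsCutoff

/-! ### The pressure source as a double divergence, and the mollified pressure force. -/

section Quadratic

/-- For divergence-free fields `∑ ∂ⱼ∂ₖ(vⱼ vₖ) = ∑ ∂ⱼvₖ ∂ₖvⱼ`. The intermediate `D k` is the
convective derivative `v · ∇vₖ`, and the second derivatives left over combine into `v · ∇ div v =
0`. -/
theorem integral_grad_mul_smooth {v : Fin 2 → Plane → ℝ} (hv : ∀ k, ContDiff ℝ (⊤ : ℕ∞) (v k))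
    (hd : ∀ x, pd 0 (v 0) x + pd 1 (v 1) x = 0) {Φ : Plane → ℝ} (hΦ : IsTest Φ) :
    ∑ j, ∑ k, ∫ x, v j x * v k x * pd j (pd k Φ) x =
      ∑ j, ∑ k, ∫ x, pd j (v k) x * pd k (v j) x * Φ x := by
  have hdv (j k : Fin 2) (x : Plane) : DifferentiableAt ℝ (v k) x := (hv k).differentiable (by simp) x
  have hdp (j k : Fin 2) (x : Plane) : DifferentiableAt ℝ (pd j (v k)) x :=
    (contDiff_pd (hv k) j).differentiable (by simp) x
  set D : Fin 2 → Plane → ℝ := fun k x => v 0 x * pd 0 (v k) x + v 1 x * pd 1 (v k) x with hD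
  have hDs (k) : ContDiff ℝ (⊤ : ℕ∞) (D k) :=
    ((hv 0).mul (contDiff_pd (hv k) 0)).add ((hv 1).mul (contDiff_pd (hv k) 1))
  have key (k : Fin 2) : (∫ x, v 0 x * v k x * pd 0 (pd k Φ) x) +
      ∫ x, v 1 x * v k x * pd 1 (pd k Φ) x = ∫ x, pd k (D k) x * Φ x := by
    have e (j : Fin 2) := integral_mul_pd (f := fun x => v j x * v k x) ((hv j).mul (hv k))
      (hΦ.pd k).1 (Or.inr (hΦ.pd k).2) j
    have i (j : Fin 2) : Integrable (fun x => pd j (fun x => v j x * v k x) x * pd k Φ x) volume :=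
      ((hΦ.pd k).mul_left (contDiff_pd ((hv j).mul (hv k)) j)).integrable
    rw [e 0, e 1, ← neg_add, ← integral_add (i 0) (i 1)]
    have e2 := integral_mul_pd (hDs k) hΦ.1 (Or.inr hΦ.2) k
    rw [← neg_eq_iff_eq_neg.2 e2, neg_inj]
    refine integral_congr_ae (Eventually.of_forall fun x => ?_)
    simp only [hD]
    rw [pd_mul 0 (hdv 0 0 x) (hdv 0 k x), pd_mul 1 (hdv 0 1 x) (hdv 0 k x)]
    linear_combination (v k x * pd k Φ x) * hd x
  have hdiv (j : Fin 2) (x : Plane) : pd j (pd 0 (v 0)) x + pd j (pd 1 (v 1)) x = 0 := by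
    rw [← pd_add j (hdp 0 0 x) (hdp 1 1 x), funext hd, pd_const]
  simp only [Fin.sum_univ_two]
  have i (j k : Fin 2) : Integrable (fun x => pd j (v k) x * pd k (v j) x * Φ x) volume :=
    (hΦ.mul_left ((contDiff_pd (hv k) j).mul (contDiff_pd (hv j) k))).integrable
  have iD (k : Fin 2) : Integrable (fun x => pd k (D k) x * Φ x) volume :=
    (hΦ.mul_left (contDiff_pd (hDs k) k)).integrable
  have h0 := key 0
  have h1 := key 1
  have i2 (j : Fin 2) : Integrable (fun x => pd j (v 0) x * pd 0 (v j) x * Φ x +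
    pd j (v 1) x * pd 1 (v j) x * Φ x) volume := (i j 0).add (i j 1)
  rw [← integral_add (i 0 0) (i 0 1), ← integral_add (i 1 0) (i 1 1), ← integral_add (i2 0) (i2 1)]
  have h : (∫ x, pd 0 (D 0) x * Φ x) + ∫ x, pd 1 (D 1) x * Φ x =
      ∫ x, (pd 0 (v 0) x * pd 0 (v 0) x * Φ x + pd 0 (v 1) x * pd 1 (v 0) x * Φ x) +
        (pd 1 (v 0) x * pd 0 (v 1) x * Φ x + pd 1 (v 1) x * pd 1 (v 1) x * Φ x) := by
    rw [← integral_add (iD 0) (iD 1)]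
    refine integral_congr_ae (Eventually.of_forall fun x => ?_)
    simp only [hD]
    have t (j k : Fin 2) : DifferentiableAt ℝ (fun x => v j x * pd j (v k) x) x :=
      (hdv 0 j x).mul (hdp j k x)
    rw [pd_add 0 (t 0 0) (t 1 0), pd_add 1 (t 0 1) (t 1 1), pd_mul 0 (hdv 0 0 x) (hdp 0 0 x),
      pd_mul 0 (hdv 0 1 x) (hdp 1 0 x), pd_mul 1 (hdv 0 0 x) (hdp 0 1 x),
      pd_mul 1 (hdv 0 1 x) (hdp 1 1 x)]
    have c0 := hdiv 0 x
    have c1 := hdiv 1 x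
    rw [pd_comm (hv 1) 0 1] at c0
    rw [pd_comm (hv 0) 1 0] at c1
    linear_combination (Φ x * v 0 x) * c0 + (Φ x * v 1 x) * c1
  linarith

variable {X : Type*} [MeasurableSpace X] {μ : Measure X}

theorem tendsto_integral_mul_mul_of_L2 {F G : ℕ → X → ℝ} {f g φ : X → ℝ} {C : ℝ}
    (hF : ∀ n, MemLp (F n) 2 μ) (hG : ∀ n, MemLp (G n) 2 μ) (hf : MemLp f 2 μ) (hg : MemLp g 2 μ)
    (hFf : Tendsto (fun n => ∫ x, (F n x - f x) ^ 2 ∂μ) atTop (𝓝 0))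
    (hGg : Tendsto (fun n => ∫ x, (G n x - g x) ^ 2 ∂μ) atTop (𝓝 0))
    (hφm : AEStronglyMeasurable φ μ) (hφ : ∀ x, |φ x| ≤ C) :
    Tendsto (fun n => ∫ x, F n x * G n x * φ x ∂μ) atTop (𝓝 (∫ x, f x * g x * φ x ∂μ)) := by
  have hC : 0 ≤ C ∨ IsEmpty X := by
    rcases isEmpty_or_nonempty X with h | ⟨⟨x⟩⟩
    · exact Or.inr h
    · exact Or.inl ((abs_nonneg _).trans (hφ x))
  rcases hC with hC | hE
  swap
  · simp [Measure.eq_zero_of_isEmpty μ]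
  have mulφ {a : X → ℝ} (ha : MemLp a 2 μ) : MemLp (fun x => a x * φ x) 2 μ := by
    refine (ha.const_mul C).mono (ha.1.mul hφm) (Eventually.of_forall fun x => ?_)
    rw [norm_mul, norm_mul, mul_comm, Real.norm_of_nonneg hC]
    exact mul_le_mul_of_nonneg_right (hφ x) (norm_nonneg _)
  have t1 := tendsto_integral_mul_of_L2 hF hf (mulφ hg) hFf
  have t2 := tendsto_integral_mul_of_L2 hG hg (mulφ hf) hGg
  have t3 : Tendsto (fun n => ∫ x, (F n x - f x) * ((G n x - g x) * φ x) ∂μ) atTop (𝓝 0) := by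
    refine squeeze_zero_norm (a := fun n => C * ((∫ x, (F n x - f x) ^ 2 ∂μ) +
      ∫ x, (G n x - g x) ^ 2 ∂μ)) (fun n => ?_) (by simpa using (hFf.add hGg).const_mul C)
    have i1 : Integrable (fun x => (F n x - f x) ^ 2) μ := ((hF n).sub hf).integrable_sq
    have i2 : Integrable (fun x => (G n x - g x) ^ 2) μ := ((hG n).sub hg).integrable_sq
    rw [← integral_add i1 i2, ← integral_const_mul]
    refine norm_integral_le_of_norm_le ((i1.add i2).const_mul C) (Eventually.of_forall fun x => ?_)
    rw [norm_mul, norm_mul]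
    simp only [Real.norm_eq_abs]
    have h2 : |F n x - f x| * |G n x - g x| ≤ (F n x - f x) ^ 2 + (G n x - g x) ^ 2 := by
      rw [← sq_abs (F n x - f x), ← sq_abs (G n x - g x)]
      nlinarith [sq_nonneg (|F n x - f x| - |G n x - g x|), sq_nonneg (|F n x - f x|),
        sq_nonneg (|G n x - g x|)]
    calc |F n x - f x| * (|G n x - g x| * |φ x|) = (|F n x - f x| * |G n x - g x|) * |φ x| := by ring
      _ ≤ ((F n x - f x) ^ 2 + (G n x - g x) ^ 2) * C :=
        mul_le_mul h2 (hφ x) (abs_nonneg _) (by positivity)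
      _ = _ := by ring
  have := (t3.add (t1.add t2)).sub_const (∫ x, f x * (g x * φ x) ∂μ)
  have hlim : 0 + ((∫ x, f x * (g x * φ x) ∂μ) + ∫ x, g x * (f x * φ x) ∂μ) -
      (∫ x, f x * (g x * φ x) ∂μ) = ∫ x, f x * g x * φ x ∂μ := by
    rw [zero_add, add_sub_cancel_left]
    exact integral_congr_ae (Eventually.of_forall fun x => by ring)
  rw [hlim] at this
  refine this.congr fun n => ?_
  have a1 : Integrable (fun x => (F n x - f x) * ((G n x - g x) * φ x)) μ :=
    ((hF n).sub hf).integrable_mul (mulφ ((hG n).sub hg))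
  have a2 : Integrable (fun x => F n x * (g x * φ x)) μ := (hF n).integrable_mul (mulφ hg)
  have a3 : Integrable (fun x => G n x * (f x * φ x)) μ := (hG n).integrable_mul (mulφ hf)
  have a4 : Integrable (fun x => f x * (g x * φ x)) μ := hf.integrable_mul (mulφ hg)
  have a5 : Integrable (fun x => F n x * (g x * φ x) + G n x * (f x * φ x)) μ := a2.add a3
  have a6 : Integrable (fun x => (F n x - f x) * ((G n x - g x) * φ x) +
    (F n x * (g x * φ x) + G n x * (f x * φ x))) μ := a1.add a5
  rw [← integral_add a2 a3, ← integral_add a1 a5, ← integral_sub a6 a4]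
  exact integral_congr_ae (Eventually.of_forall fun x => by ring)

end Quadratic

theorem memLp_closedBall {f : Plane → ℝ} (hf : Continuous f) (r : ℝ) :
    MemLp f 2 (volume.restrict (closedBall 0 r)) := by
  obtain ⟨C, hC⟩ := (isCompact_closedBall (0 : Plane) r).exists_bound_of_continuousOn hf.continuousOn
  have : IsFiniteMeasure (volume.restrict (closedBall (0 : Plane) r)) :=
    isFiniteMeasure_restrict.2 measure_closedBall_lt_top.ne
  exact MemLp.of_bound hf.aestronglyMeasurable C
    ((ae_restrict_iff' measurableSet_closedBall).2 (Eventually.of_forall hC))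

theorem setIntegral_closedBall_eq {f : Plane → ℝ} {r : ℝ} (h : ∀ x, r ≤ ‖x‖ → f x = 0) :
    ∫ x in closedBall (0 : Plane) r, f x = ∫ x, f x := by
  refine setIntegral_eq_integral_of_forall_compl_eq_zero fun x hx => h x ?_
  rw [mem_closedBall_zero_iff, not_le] at hx
  exact hx.le

namespace Flow

variable {u : Plane → Plane} {ω : Plane → ℝ} {W A : ℝ}

/-- A mollified flow converges boundedly. -/
theorem tendsto_integral_smo_smo_mul (hu : Flow u ω W A) (j k : Fin 2) {φ : Plane → ℝ}
    (hφ : IsTest φ) : Tendsto (fun n => ∫ x, smo u (eps n) j x * smo u (eps n) k x * φ x) atTop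
      (𝓝 (∫ x, u x j * u x k * φ x)) := by
  refine tendsto_integral_of_dominated_convergence (fun x => (A * (2 + ‖x‖)) ^ 2 * |φ x|)
    (fun n => ?_) ?_ (fun n => Eventually.of_forall fun x => ?_) ?_
  · exact (((hu.contDiff_smo (eps_pos n) j).continuous.mul
      (hu.contDiff_smo (eps_pos n) k).continuous).mul hφ.continuous).aestronglyMeasurable
  · have hc : Continuous fun x => (A * (2 + ‖x‖)) ^ 2 * |φ x| := by
      have := hφ.continuous
      fun_prop
    exact hc.integrable_of_hasCompactSupport (hφ.2.abs.mul_left)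
  · have h (l) : |smo u (eps n) l x| ≤ A * (2 + ‖x‖) :=
      (hu.abs_smo_le (eps_pos n) l x).trans
        (mul_le_mul_of_nonneg_left (by linarith [eps_le_one n]) hu.A_nonneg)
    rw [norm_mul, norm_mul, sq]
    exact mul_le_mul_of_nonneg_right (mul_le_mul (h j) (h k) (abs_nonneg _)
      ((abs_nonneg _).trans (h j))) (abs_nonneg _)
  · filter_upwards [hu.ae_tendsto_smo j, hu.ae_tendsto_smo k] with x h1 h2
    exact (h1.mul h2).mul_const _

theorem integral_grad_mul (hu : Flow u ω W A) {Φ : Plane → ℝ} (hΦ : IsTest Φ) :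
    ∑ j, ∑ k, ∫ x, u x j * u x k * pd j (pd k Φ) x =
      ∑ j, ∑ k, ∫ x, (weakPartial j (fun y => u y k) x * weakPartial k (fun y => u y j) x) * Φ x := by
  obtain ⟨r, hr1, hr⟩ := hΦ.exists_radius
  obtain ⟨C, hC0, hC⟩ := hΦ.exists_bound
  have l1 : Tendsto (fun n => ∑ j, ∑ k, ∫ x, smo u (eps n) j x * smo u (eps n) k x *
      pd j (pd k Φ) x) atTop (𝓝 (∑ j, ∑ k, ∫ x, u x j * u x k * pd j (pd k Φ) x)) :=
    tendsto_finsetSum _ fun j _ => tendsto_finsetSum _ fun k _ =>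
      hu.tendsto_integral_smo_smo_mul j k ((hΦ.pd k).pd j)
  refine tendsto_nhds_unique l1 ?_
  have l2 : Tendsto (fun n => ∑ j, ∑ k, ∫ x, pd j (smo u (eps n) k) x * pd k (smo u (eps n) j) x *
      Φ x) atTop (𝓝 (∑ j, ∑ k, ∫ x, (weakPartial j (fun y => u y k) x *
        weakPartial k (fun y => u y j) x) * Φ x)) := by
    refine tendsto_finsetSum _ fun j _ => tendsto_finsetSum _ fun k _ => ?_
    have e1 := setIntegral_closedBall_eq (f := fun x => (weakPartial j (fun y => u y k) x *
      weakPartial k (fun y => u y j) x) * Φ x) (r := r) fun x hx => by rw [hr x hx, mul_zero]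
    have e2 (n) := setIntegral_closedBall_eq (f := fun x => pd j (smo u (eps n) k) x *
      pd k (smo u (eps n) j) x * Φ x) (r := r) fun x hx => by rw [hr x hx, mul_zero]
    simp only [← e1, ← e2]
    obtain ⟨m1, t1⟩ := hu.weakPartial_local j k r
    obtain ⟨m2, t2⟩ := hu.weakPartial_local k j r
    exact tendsto_integral_mul_mul_of_L2
      (fun n => memLp_closedBall (contDiff_pd (hu.contDiff_smo (eps_pos n) k) j).continuous r)
      (fun n => memLp_closedBall (contDiff_pd (hu.contDiff_smo (eps_pos n) j) k).continuous r)
      m1 m2 t1 t2 hΦ.continuous.aestronglyMeasurable hC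
  refine l2.congr fun n => ?_
  exact (integral_grad_mul_smooth (fun k => hu.contDiff_smo (eps_pos n) k)
    (hu.div_smo (eps_pos n)) hΦ).symm

end Flow

/-- Although `G` is only locally integrable, only its values in the ball of radius `‖x₀‖ + a + 2`
matter, `a` bounding the support of `ρ` and `2` that of `N`. Truncation reduces to associativity for
integrable functions. -/
theorem cv_assoc_near {G N ρ : Plane → ℝ} (hG : ∀ r, IntegrableOn G (closedBall 0 r) volume)
    (hN : Integrable N volume) (hN0 : ∀ z, 2 < ‖z‖ → N z = 0) (hρ : IsTest ρ) (x₀ : Plane) :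
    Integrable (fun x => cv G N x * ρ (x₀ - x)) volume ∧
      ∫ x, cv G N x * ρ (x₀ - x) = cv G (cv N ρ) x₀ := by
  obtain ⟨a, ha1, ha⟩ := hρ.exists_radius
  set R : ℝ := ‖x₀‖ + a + 2 with hR
  set g : Plane → ℝ := (closedBall (0 : Plane) R).indicator G with hg
  have hgi : Integrable g volume := (integrable_indicator_iff measurableSet_closedBall).2 (hG R)
  have hNc : HasCompactSupport N :=
    HasCompactSupport.intro (isCompact_closedBall (0 : Plane) 2) fun x hx => hN0 x (by simpa using hx)
  have hgG {t : Plane} (ht : ‖t‖ ≤ R) : g t = G t := by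
    rw [hg, indicator_of_mem (by simpa using ht)]
  have e1 (x : Plane) : cv G N x * ρ (x₀ - x) = cv g N x * ρ (x₀ - x) := by
    rcases le_or_gt a ‖x₀ - x‖ with h | h
    · rw [ha _ h, mul_zero, mul_zero]
    · congr 1
      rw [cv_apply, cv_apply]
      refine integral_congr_ae (Eventually.of_forall fun t => ?_)
      dsimp only
      rcases le_or_gt ‖x - t‖ 2 with h2 | h2
      · rw [hgG]
        calc ‖t‖ = ‖x₀ - (x₀ - x) - (x - t)‖ := by congr 1; abel
          _ ≤ ‖x₀ - (x₀ - x)‖ + ‖x - t‖ := norm_sub_le _ _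
          _ ≤ ‖x₀‖ + ‖x₀ - x‖ + ‖x - t‖ := by gcongr; exact norm_sub_le _ _
          _ ≤ R := by rw [hR]; linarith
      · rw [hN0 _ h2, mul_zero, mul_zero]
  have e2 : cv G (cv N ρ) x₀ = cv g (cv N ρ) x₀ := by
    rw [cv_apply, cv_apply]
    refine integral_congr_ae (Eventually.of_forall fun t => ?_)
    dsimp only
    rcases le_or_gt ‖t‖ R with h | h
    · rw [hgG h]
    · have : cv N ρ (x₀ - t) = 0 := by
        rw [cv_apply]
        refine integral_eq_zero_of_ae (Eventually.of_forall fun y => ?_)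
        simp only [Pi.zero_apply]
        rcases le_or_gt ‖y‖ 2 with h2 | h2
        · rw [ha, mul_zero]
          have : ‖t‖ ≤ ‖x₀‖ + ‖y‖ + ‖x₀ - t - y‖ := by
            calc ‖t‖ = ‖x₀ - y - (x₀ - t - y)‖ := by congr 1; abel
              _ ≤ ‖x₀ - y‖ + ‖x₀ - t - y‖ := norm_sub_le _ _
              _ ≤ _ := by gcongr; exact norm_sub_le _ _
          rw [hR] at h
          linarith
        · rw [hN0 _ h2, zero_mul]
      rw [this, mul_zero, mul_zero]
  simp only [e1]
  refine ⟨?_, ?_⟩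
  · obtain ⟨C, hC0, hC⟩ := hρ.exists_bound
    have hi : Integrable (cv g N) volume := hgi.integrable_convolution _ hN
    exact hi.mul_bdd (c := C) (hρ.comp_sub_left x₀).continuous.aestronglyMeasurable
      (Eventually.of_forall fun x => hC _)
  · rw [e2, ← cv_assoc_of_compact hgi hN hNc hρ, cv_apply]

namespace Flow

variable {u : Plane → Plane} {ω : Plane → ℝ} {W A : ℝ} {θ ρ : Plane → ℝ}

theorem integrableOn_grad_mul (hu : Flow u ω W A) (j k : Fin 2) (r : ℝ) :
    IntegrableOn (fun x => weakPartial j (fun y => u y k) x * weakPartial k (fun y => u y j) x)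
      (closedBall 0 r) volume :=
  (hu.weakPartial_local j k r).1.integrable_mul (hu.weakPartial_local k j r).1

/-- The mollified pressure force. -/
theorem integral_pressureForce (hu : Flow u ω W A)
    (hc : ∀ j k, CubicIntegrable fun y => u y j * u y k) (hθ : IsCutoff θ) (hρ : IsTest ρ)
    (i : Fin 2) (x₀ : Plane) : ∫ x, pressureForce θ u u x i * ρ (x₀ - x) =
      ∑ j, ∑ k, cv (fun y => u y j * u y k) (presKer θ 1 ρ i j k) x₀ := by
  set G : Fin 2 → Fin 2 → Plane → ℝ := fun j k x =>
    weakPartial j (fun y => u y k) x * weakPartial k (fun y => u y j) x with hG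
  set f : Fin 2 → Fin 2 → Plane → ℝ := fun j k y => u y j * u y k with hf
  set N := pd i (fun z => θ z * fundSol z) with hN
  have hN0 : ∀ z, 2 < ‖z‖ → N z = 0 := fun z hz =>
    pd_eq_zero_of_gt (fun y hy => by rw [hθ.eq_zero hy, zero_mul]) i hz
  have hfar : ∀ j k, farD θ 1 i j k = pd i (pd j (pd k fun z => (1 - θ z) * fundSol z)) := by
    intro j k
    have : farKer θ 1 = fun z => (1 - θ z) * fundSol z := by ext z; simp [farKer]
    rw [farD, this]
  have e0 (x : Plane) : pressureForce θ u u x i * ρ (x₀ - x) =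
      (∑ j, ∑ k, cv (G j k) N x * ρ (x₀ - x)) +
        ∑ j, ∑ k, cv (f j k) (farD θ 1 i j k) x * ρ (x₀ - x) := by
    simp only [← Finset.sum_mul, ← add_mul]
    congr 1
    simp only [pressureForce, cv_apply, hfar, hG, hf, mul_comm]
    rfl
  have near (j k) := cv_assoc_near (G := G j k) (fun r => hu.integrableOn_grad_mul j k r)
    (hθ.integrable_pd_near i) hN0 hρ x₀
  have farv (j k) : ∫ x, cv (f j k) (farD θ 1 i j k) x * ρ (x₀ - x) =
      cv (f j k) (cv (farD θ 1 i j k) ρ) x₀ := by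
    rw [← cv_assoc_of_decaying (hc j k) (hθ.isDecaying_farD i j k) hρ, cv_apply]
  have fari (j k) : Integrable (fun x => cv (f j k) (farD θ 1 i j k) x * ρ (x₀ - x)) volume :=
    integrable_mul_test ((hθ.isDecaying_farD i j k).continuous_cv (hc j k)).locallyIntegrable
      (hρ.comp_sub_left x₀)
  simp only [e0]
  have s1 : Integrable (fun x => ∑ j, ∑ k, cv (G j k) N x * ρ (x₀ - x)) volume :=
    integrable_finsetSum _ fun j _ => integrable_finsetSum _ fun k _ => (near j k).1
  have s2 : Integrable (fun x => ∑ j, ∑ k, cv (f j k) (farD θ 1 i j k) x * ρ (x₀ - x)) volume :=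
    integrable_finsetSum _ fun j _ => integrable_finsetSum _ fun k _ => fari j k
  rw [integral_add s1 s2,
    integral_finsetSum _ fun j _ => integrable_finsetSum _ fun k _ => (near j k).1,
    integral_finsetSum _ fun j _ => integrable_finsetSum _ fun k _ => fari j k]
  simp only [integral_finsetSum _ fun k _ => (near _ k).1,
    integral_finsetSum _ fun k _ => fari _ k, (near _ _).2, farv]
  -- The near part tests the products of weak derivatives against `Ψ(x₀ - ·)`. `integral_grad_mul`
  -- turns it into `u ⊗ u` tested against second derivatives of `Ψ`, which form the near part of
  -- `presKer`.
  set Ψ := cv N ρ with hΨ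
  have hΨe : Ψ = cv (nearKer θ 1) (pd i ρ) := by
    ext x
    rw [hΨ, hN, hθ.cv_pd_near i hρ, IsCutoff.nearKer_one]
  have hΨt : IsTest Ψ := hΨe ▸ hθ.isTest_cv_nearKer one_pos (hρ.pd i)
  have hl := (hθ.integrable_nearKer one_pos).locallyIntegrable
  have hd (j k) : pd j (pd k Ψ) = cv (nearKer θ 1) (pd i (pd j (pd k ρ))) := by
    rw [hΨe, pd_cv hl (hρ.pd i), pd_cv hl ((hρ.pd i).pd k), pd_comm hρ.1 k i,
      pd_comm (hρ.pd k).1 j i]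
  have hq := hu.integral_grad_mul (hΨt.comp_sub_left x₀)
  have hpd (j k) (x : Plane) : pd j (pd k fun y => Ψ (x₀ - y)) x = pd j (pd k Ψ) (x₀ - x) := by
    have h1 : (pd k fun y => Ψ (x₀ - y)) = fun y => - pd k Ψ (x₀ - y) :=
      funext fun y => pd_comp_sub_left k x₀
    rw [h1, pd_neg, pd_comp_sub_left, neg_neg]
  simp only [hpd, hd] at hq
  simp only [cv_apply (G _ _)]
  rw [hG, ← hq]
  simp only [← Finset.sum_add_distrib]
  refine Finset.sum_congr rfl fun j _ => Finset.sum_congr rfl fun k _ => ?_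
  have i1 := (hθ.isTest_cv_nearKer one_pos (((hρ.pd k).pd j).pd i)).isDecaying.integrable_mul (hc j k) x₀
  have i2 := (hθ.isDecaying_cv_farD hρ i j k).integrable_mul (hc j k) x₀
  rw [cv_apply (f j k), cv_apply (f j k), ← integral_add i1 i2]
  refine integral_congr_ae (Eventually.of_forall fun y => ?_)
  simp only [presKer, hf]
  ring

end Flow

/-! ### Morrey bounds and the pointwise bounds on the velocity that they imply. -/

/-- Quadratic Morrey bounds on all balls of radius at least `R`. -/
def MorreyBd (α R m : ℝ) (f : Plane → Plane) : Prop :=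
  ∀ r, R ≤ r → ∫⁻ x in ball (0 : Plane) r, ‖f x‖ₑ ^ 2 ≤ ENNReal.ofReal (m ^ 2 * r ^ (2 + 2 * α))

theorem morreyNormFrom_le_iff {α R m : ℝ} (hR : 0 < R) (hm : 0 ≤ m) {f : Plane → Plane} :
    morreyNormFrom α R f ≤ ENNReal.ofReal m ↔ MorreyBd α R m f := by
  unfold morreyNormFrom MorreyBd
  rw [iSup₂_le_iff]
  refine forall₂_congr fun r hr => ?_
  have hr0 : 0 < r := hR.trans_le hr
  have hp : 0 < r ^ (2 + 2 * α) := Real.rpow_pos_of_pos hr0 _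
  have h1 : ENNReal.ofReal m = (ENNReal.ofReal (m ^ 2)) ^ (1 / 2 : ℝ) := by
    rw [ENNReal.ofReal_rpow_of_nonneg (sq_nonneg _) (by norm_num), ← Real.sqrt_eq_rpow,
      Real.sqrt_sq hm]
  rw [h1, ENNReal.rpow_le_rpow_iff (by norm_num), ENNReal.inv_mul_le_iff
    (by simpa using hp) ENNReal.ofReal_ne_top, mul_comm (m ^ 2), ENNReal.ofReal_mul hp.le]

theorem MorreyBd.mono {α R R' m m' : ℝ} {f : Plane → Plane} (h : MorreyBd α R m f) (hR0 : 0 ≤ R)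
    (hR : R ≤ R') (hm0 : 0 ≤ m) (hm : m ≤ m') : MorreyBd α R' m' f := fun r hr =>
  (h r (hR.trans hr)).trans (ENNReal.ofReal_le_ofReal (by
    have : 0 ≤ r ^ (2 + 2 * α) := Real.rpow_nonneg (hR0.trans (hR.trans hr)) _
    gcongr))

theorem MorreyBd.congr {α R m : ℝ} {f g : Plane → Plane} (h : MorreyBd α R m f)
    (hfg : f =ᵐ[volume] g) : MorreyBd α R m g := fun r hr => by
  refine (le_of_eq ?_).trans (h r hr)
  refine lintegral_congr_ae (ae_restrict_of_ae ?_)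
  filter_upwards [hfg] with x hx
  rw [hx]

theorem IsDivFree.congr {u v : Plane → Plane} (h : IsDivFree u) (huv : u =ᵐ[volume] v) :
    IsDivFree v := fun φ h1 h2 => by
  rw [← h φ h1 h2]
  refine integral_congr_ae ?_
  filter_upwards [huv] with x hx
  rw [hx]

theorem IsVorticity.congr {u v : Plane → Plane} {ω : Plane → ℝ} (h : IsVorticity u ω)
    (huv : u =ᵐ[volume] v) : IsVorticity v ω := ⟨h.1, fun φ h1 h2 => by
  rw [h.2 φ h1 h2]
  refine integral_congr_ae ?_
  filter_upwards [huv] with x hx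
  rw [hx]⟩

theorem isVorticity_unique {u : Plane → Plane} {ω ω' : Plane → ℝ} (h : IsVorticity u ω)
    (h' : IsVorticity u ω') : ω =ᵐ[volume] ω' := by
  refine ae_eq_of_integral_contDiff_smul_eq h.1 h'.1 fun φ h1 h2 => ?_
  have e := (h.2 φ h1 h2).trans (h'.2 φ h1 h2).symm
  simpa only [smul_eq_mul, mul_comm] using e

theorem enorm_coord_le (x : Plane) (j : Fin 2) : ‖x j‖ₑ ≤ ‖x‖ₑ := by
  rw [← ofReal_norm, ← ofReal_norm]
  exact ENNReal.ofReal_le_ofReal (abs_coord_le x j)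

theorem norm_le_of_coord {x : Plane} {a : ℝ} (h : ∀ j, |x j| ≤ a) : ‖x‖ ≤ 2 * a := by
  have h0 := h 0
  have h1 := h 1
  have ha : 0 ≤ a := (abs_nonneg _).trans h0
  refine le_of_sq_le_sq ?_ (by positivity)
  rw [norm_sq_plane, ← sq_abs (x 0), ← sq_abs (x 1)]
  nlinarith [abs_nonneg (x 0), abs_nonneg (x 1)]

section Sup

variable {u : Plane → Plane} {ω : Plane → ℝ} {W α m : ℝ}

theorem MorreyBd.lintegral_ball_lt_top (h : MorreyBd α 1 m u) (r : ℝ) :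
    ∫⁻ x in ball (0 : Plane) r, ‖u x‖ₑ ^ 2 < ∞ :=
  (lintegral_mono_set (ball_subset_ball (le_max_left r 1))).trans_lt
    ((h (max r 1) (le_max_right _ _)).trans_lt ENNReal.ofReal_lt_top)

theorem MorreyBd.memLp_ball (h : MorreyBd α 1 m u) (hu : AEStronglyMeasurable u volume) (r : ℝ) :
    MemLp u 2 (volume.restrict (ball 0 r)) := by
  refine ⟨hu.restrict, ?_⟩
  rw [eLpNorm_lt_top_iff_lintegral_rpow_enorm_lt_top (by simp) (by simp)]
  simpa using h.lintegral_ball_lt_top r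

theorem MorreyBd.locallyIntegrable (h : MorreyBd α 1 m u) (hu : AEStronglyMeasurable u volume)
    (j : Fin 2) : LocallyIntegrable (fun x => u x j) volume := by
  have hl : LocallyIntegrable u volume := fun x => by
    have : IsFiniteMeasure (volume.restrict (ball (0 : Plane) (‖x‖ + 1))) :=
      isFiniteMeasure_restrict.2 measure_ball_lt_top.ne
    exact ⟨ball 0 (‖x‖ + 1), isOpen_ball.mem_nhds (by simp),
      (h.memLp_ball hu (‖x‖ + 1)).integrable (by norm_num)⟩
  refine hl.mono (aestronglyMeasurable_coord hu j) (Eventually.of_forall fun x => abs_coord_le _ j)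

/-- Cauchy–Schwarz with the mollifier as weight gives `√molBd * s⁻¹ * E`; since `1 ≤ molBd` the root
may be dropped. -/
theorem abs_cv_mols_le_of_L2 (hu : AEStronglyMeasurable u volume) {s E : ℝ} (hs : 0 < s)
    (hE : 0 ≤ E) (j : Fin 2) {x : Plane}
    (h : ∫⁻ y in ball (0 : Plane) (‖x‖ + s), ‖u y‖ₑ ^ 2 ≤ ENNReal.ofReal (E ^ 2)) :
    |cv (fun y => u y j) (mols s) x| ≤ molBd * s⁻¹ * E := by
  have hB := one_le_molBd
  have h1 := enorm_cv_sq_le (aestronglyMeasurable_coord hu j).aemeasurable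
    (isTest_mols hs).continuous x
  rw [lintegral_mols hs, one_mul] at h1
  have h2 : ∫⁻ t, ‖u t j‖ₑ ^ 2 * ‖mols s (x - t)‖ₑ ≤
      ENNReal.ofReal (molBd * (s ^ 2)⁻¹) * ENNReal.ofReal (E ^ 2) := by
    refine le_trans ?_ (mul_le_mul_right h _)
    rw [← lintegral_const_mul' _ _ ENNReal.ofReal_ne_top, ← lintegral_indicator measurableSet_ball]
    refine lintegral_mono fun t => ?_
    by_cases ht : t ∈ ball (0 : Plane) (‖x‖ + s)
    · rw [indicator_of_mem ht, mul_comm]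
      gcongr
      · rw [← ofReal_norm]
        exact ENNReal.ofReal_le_ofReal (abs_mols_le hs _)
      · exact enorm_coord_le _ _
    · rw [mols_eq_zero hs]
      · simp
      · rw [mem_ball_zero_iff, not_lt] at ht
        have : ‖t‖ ≤ ‖x‖ + ‖x - t‖ := by
          calc ‖t‖ = ‖x - (x - t)‖ := by simp
            _ ≤ _ := norm_sub_le _ _
        linarith
  have h3 := h1.trans h2
  rw [← ENNReal.ofReal_mul (by positivity), ← ofReal_norm, ← ENNReal.ofReal_pow (norm_nonneg _),
    ENNReal.ofReal_le_ofReal_iff (by positivity), Real.norm_eq_abs] at h3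
  refine le_of_sq_le_sq (h3.trans ?_) (by positivity)
  have : molBd * (s ^ 2)⁻¹ * E ^ 2 = molBd * (s⁻¹ * E) ^ 2 := by rw [← inv_pow]; ring
  rw [this, mul_assoc, mul_pow _ (s⁻¹ * E)]
  exact mul_le_mul_of_nonneg_right (by nlinarith) (sq_nonneg _)

/-- The scale `s` and the energy bound `E` are quantified after the null set, so that they may be
chosen as functions of `x`. -/
theorem ae_abs_coord_le (hm : MorreyBd α 1 m u) (hu : AEStronglyMeasurable u volume)
    (hd : IsDivFree u) (hω : IsVorticity u ω) (hW : ∀ᵐ x, |ω x| ≤ W) (j : Fin 2) :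
    ∀ᵐ x, ∀ s : ℝ, 0 < s → ∀ E : ℝ, 0 ≤ E →
      ∫⁻ y in ball (0 : Plane) (‖x‖ + s), ‖u y‖ₑ ^ 2 ≤ ENNReal.ofReal (E ^ 2) →
        |u x j| ≤ W * s + molBd * s⁻¹ * E := by
  filter_upwards [ae_abs_sub_cv_mols_le (hm.locallyIntegrable hu) hd hω hW j] with x hx s hs E hE h
  have h1 := hx s hs
  have h2 := abs_cv_mols_le_of_L2 hu hs hE j h
  have h3 := abs_sub_abs_le_abs_sub (u x j) (cv (fun y => u y j) (mols s) x)
  linarith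

/-- At the scale `1 + ‖x‖` both contributions of `ae_abs_coord_le` grow at most linearly, because
the Morrey exponent `2 + 2 * α` does not exceed `4`. -/
theorem flow_of_morrey (hm : MorreyBd α 1 m u) (hm0 : 0 ≤ m) (hα : α ≤ 1)
    (hu : AEStronglyMeasurable u volume) (hd : IsDivFree u) (hω : IsVorticity u ω)
    (hW : ∀ᵐ x, |ω x| ≤ W) : Flow u ω W (2 * (W + 4 * molBd * m)) := by
  refine ⟨hu, ?_, hd, hω, hW⟩
  have hB := molBd_pos
  filter_upwards [ae_abs_coord_le hm hu hd hω hW 0, ae_abs_coord_le hm hu hd hω hW 1] with x h0 h1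
  set a := 1 + ‖x‖ with ha
  have ha1 : 1 ≤ a := by linarith [norm_nonneg x]
  have hE : ∫⁻ y in ball (0 : Plane) (‖x‖ + a), ‖u y‖ₑ ^ 2 ≤ ENNReal.ofReal ((4 * m * a ^ 2) ^ 2) := by
    refine (hm _ (by linarith [norm_nonneg x])).trans (ENNReal.ofReal_le_ofReal ?_)
    have hb : 1 ≤ ‖x‖ + a := by linarith [norm_nonneg x]
    have h4 : (‖x‖ + a) ^ (2 + 2 * α) ≤ (‖x‖ + a) ^ (4 : ℝ) :=
      Real.rpow_le_rpow_of_exponent_le hb (by linarith)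
    rw [show (4 : ℝ) = (4 : ℕ) by norm_num, Real.rpow_natCast] at h4
    have h5 : (‖x‖ + a) ^ 4 ≤ (2 * a) ^ 4 := by gcongr; linarith
    calc m ^ 2 * (‖x‖ + a) ^ (2 + 2 * α) ≤ m ^ 2 * (2 * a) ^ 4 := by
          gcongr; exact h4.trans h5
      _ = _ := by ring
  have key (j : Fin 2) (h : ∀ s : ℝ, 0 < s → ∀ E : ℝ, 0 ≤ E →
      ∫⁻ y in ball (0 : Plane) (‖x‖ + s), ‖u y‖ₑ ^ 2 ≤ ENNReal.ofReal (E ^ 2) →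
        |u x j| ≤ W * s + molBd * s⁻¹ * E) : |u x j| ≤ (W + 4 * molBd * m) * a := by
    refine (h a (by linarith) _ (by positivity) hE).trans_eq ?_
    field_simp
  refine (norm_le_of_coord fun j => ?_).trans_eq (by ring : 2 * ((W + 4 * molBd * m) * a) = _)
  fin_cases j
  · exact key 0 h0
  · exact key 1 h1

end Sup

/-! ### Weighted integrals -/

/-- The constant in the summation over dyadic annuli. -/
def dyadBd (α : ℝ) : ℝ := 8 / (1 - (2 : ℝ) ^ (-(1 - 2 * α)))

theorem dyadBd_pos {α : ℝ} (hα : α < 1 / 2) : 0 < dyadBd α := by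
  have : (2 : ℝ) ^ (-(1 - 2 * α)) < 1 := Real.rpow_lt_one_of_one_lt_of_neg (by norm_num) (by linarith)
  exact div_pos (by norm_num) (by linarith)

/-- Dyadic summation: at radius `2 ^ k * r` the energy growth against the cubic weight leaves the
factor `q ^ k` with `q = 2 ^ (2α - 1)`. The series converges exactly because `α < 1/2`, and its sum
blows up at the endpoint. -/
theorem MorreyBd.lintegral_weight_le {α r m : ℝ} {u : Plane → Plane} (h : MorreyBd α r m u)
    (hr : 0 < r) (hα : α < 1 / 2) (hu : AEStronglyMeasurable u volume) :
    ∫⁻ y, ‖u y‖ₑ ^ 2 * ENNReal.ofReal (1 / (r + ‖y‖) ^ 3) ≤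
      ENNReal.ofReal (dyadBd α * (m ^ 2 * r ^ (2 * α - 1))) := by
  set q : ℝ := (2 : ℝ) ^ (-(1 - 2 * α)) with hq
  have hq0 : 0 < q := Real.rpow_pos_of_pos (by norm_num) _
  have hq1 : q < 1 := Real.rpow_lt_one_of_one_lt_of_neg (by norm_num) (by linarith)
  have hpt (y : Plane) : ‖u y‖ₑ ^ 2 * ENNReal.ofReal (1 / (r + ‖y‖) ^ 3) ≤
      ∑' k : ℕ, ENNReal.ofReal (8 / (2 ^ k * r) ^ 3) *
        (ball (0 : Plane) (2 ^ k * r)).indicator (fun y => ‖u y‖ₑ ^ 2) y := by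
    have hex : ∃ k : ℕ, ‖y‖ < 2 ^ k * r := by
      obtain ⟨k, hk⟩ := pow_unbounded_of_one_lt (‖y‖ / r) (one_lt_two (α := ℝ))
      exact ⟨k, (div_lt_iff₀ hr).1 hk⟩
    classical
    -- Minimality of `k` gives `2 ^ k * r ≤ 2 * (r + ‖y‖)`; the cube of `2` is the `8` in `dyadBd`.
    set k := Nat.find hex with hk
    have hk1 : ‖y‖ < 2 ^ k * r := Nat.find_spec hex
    refine le_trans ?_ (ENNReal.le_tsum k)
    rw [indicator_of_mem (by simpa using hk1), mul_comm]
    refine mul_le_mul' (ENNReal.ofReal_le_ofReal ?_) le_rfl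
    have hlow : 2 ^ k * r ≤ 2 * (r + ‖y‖) := by
      rcases Nat.eq_zero_or_pos k with h0 | h0
      · rw [h0]; simp; linarith [norm_nonneg y]
      · have := Nat.find_min hex (m := k - 1) (by omega)
        rw [not_lt] at this
        obtain ⟨l, hl⟩ : ∃ l, k = l + 1 := ⟨k - 1, by omega⟩
        rw [hl] at this ⊢
        simp only [Nat.add_sub_cancel] at this
        rw [pow_succ]; linarith
    rw [div_le_div_iff₀ (by positivity) (by positivity)]
    calc 1 * (2 ^ k * r) ^ 3 ≤ (2 * (r + ‖y‖)) ^ 3 := by rw [one_mul]; gcongr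
      _ = _ := by ring
  refine (lintegral_mono hpt).trans ?_
  rw [lintegral_tsum fun k => ?_]
  swap
  · exact ((hu.enorm.pow_const 2).indicator measurableSet_ball).const_mul _
  have hterm (k : ℕ) : ∫⁻ y, ENNReal.ofReal (8 / (2 ^ k * r) ^ 3) *
        (ball (0 : Plane) (2 ^ k * r)).indicator (fun y => ‖u y‖ₑ ^ 2) y ≤
      ENNReal.ofReal (8 * (m ^ 2 * r ^ (2 * α - 1)) * q ^ k) := by
    rw [lintegral_const_mul' _ _ ENNReal.ofReal_ne_top, lintegral_indicator measurableSet_ball]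
    have h2k : (1 : ℝ) ≤ 2 ^ k := one_le_pow₀ (by norm_num)
    refine (mul_le_mul_right (h (2 ^ k * r) (by nlinarith)) _).trans ?_
    rw [← ENNReal.ofReal_mul (by positivity)]
    refine ENNReal.ofReal_le_ofReal (le_of_eq ?_)
    have e1 : (2 ^ k * r) ^ (2 + 2 * α) = (2 ^ k * r) ^ 3 * (2 ^ k * r) ^ (2 * α - 1) := by
      rw [← Real.rpow_natCast _ 3, ← Real.rpow_add (by positivity)]
      norm_num; ring_nf
    have e2 : (2 ^ k * r) ^ (2 * α - 1) = q ^ k * r ^ (2 * α - 1) := by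
      rw [Real.mul_rpow (by positivity) hr.le, hq, ← Real.rpow_natCast, ← Real.rpow_natCast,
        ← Real.rpow_mul (by norm_num), ← Real.rpow_mul (by norm_num)]
      congr 2; ring
    rw [e1, e2]
    have : (2 ^ k * r) ^ 3 ≠ 0 := by positivity
    field_simp
  refine (ENNReal.tsum_le_tsum hterm).trans ?_
  have hsum : Summable fun k : ℕ => 8 * (m ^ 2 * r ^ (2 * α - 1)) * q ^ k :=
    (summable_geometric_of_lt_one hq0.le hq1).mul_left _
  have hrp : 0 < r ^ (2 * α - 1) := Real.rpow_pos_of_pos hr _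
  rw [← ENNReal.ofReal_tsum_of_nonneg (fun k => by positivity) hsum]
  refine ENNReal.ofReal_le_ofReal (le_of_eq ?_)
  rw [tsum_mul_left, tsum_geometric_of_lt_one hq0.le hq1, dyadBd, ← hq]
  ring

theorem MorreyBd.cubicIntegrable {α m : ℝ} {u : Plane → Plane} (h : MorreyBd α 1 m u)
    (hα : α < 1 / 2) (hu : AEStronglyMeasurable u volume) (j k : Fin 2) :
    CubicIntegrable (fun y => u y j * u y k) ∧
      ∫ y, |u y j * u y k / (1 + ‖y‖) ^ 3| ≤ dyadBd α * m ^ 2 := by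
  have hc : Continuous fun y : Plane => (1 + ‖y‖) ^ 3 := by fun_prop
  have hmeas : AEStronglyMeasurable (fun y => u y j * u y k / (1 + ‖y‖) ^ 3) volume := by
    have hc' : Continuous fun y : Plane => ((1 + ‖y‖) ^ 3)⁻¹ :=
      hc.inv₀ fun y => by positivity
    simp only [div_eq_mul_inv]
    exact ((aestronglyMeasurable_coord hu j).mul (aestronglyMeasurable_coord hu k)).mul
      hc'.aestronglyMeasurable
  have hle : ∫⁻ y, ‖u y j * u y k / (1 + ‖y‖) ^ 3‖ₑ ≤ ENNReal.ofReal (dyadBd α * m ^ 2) := by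
    refine le_trans (lintegral_mono fun y => ?_)
      ((h.lintegral_weight_le one_pos hα hu).trans_eq (by simp))
    rw [div_eq_mul_inv, enorm_mul, enorm_mul, sq, one_div,
      Real.enorm_of_nonneg (show 0 ≤ ((1 + ‖y‖) ^ 3)⁻¹ by positivity)]
    gcongr <;> exact enorm_coord_le _ _
  refine ⟨⟨hmeas, hle.trans_lt ENNReal.ofReal_lt_top⟩, ?_⟩
  have hd := (dyadBd_pos hα).le
  simp only [← Real.norm_eq_abs]
  rw [integral_norm_eq_lintegral_enorm hmeas]
  exact ENNReal.toReal_le_of_le_ofReal (by positivity) hle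

/-! ### Weak differential equations on a time interval. -/

section Line

variable {F b : ℝ → ℝ} {C w₀ T : ℝ}

theorem locallyIntegrable_of_bounded (hF : StronglyMeasurable F) (hC : ∀ t, |F t| ≤ C) :
    LocallyIntegrable F volume :=
  (continuous_const (y := C)).locallyIntegrable.mono hF.aestronglyMeasurable
    (Eventually.of_forall fun t => (hC t).trans (le_abs_self C))

theorem intervalIntegrable_of_bounded (hF : StronglyMeasurable F) (hC : ∀ t, |F t| ≤ C) (a b : ℝ) :
    IntervalIntegrable F volume a b :=
  intervalIntegrable_iff.2 <|
    ((locallyIntegrable_of_bounded hF hC).integrableOn_isCompact isCompact_uIcc).mono_set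
      uIoc_subset_uIcc

theorem lipschitzWith_primitive (hF : StronglyMeasurable F) (hC : ∀ t, |F t| ≤ C) (w₀ : ℝ) :
    LipschitzWith C.toNNReal fun t => w₀ + ∫ s in (0 : ℝ)..t, F s := by
  have hC0 : 0 ≤ C := (abs_nonneg _).trans (hC 0)
  refine LipschitzWith.of_dist_le_mul fun t s => ?_
  have hi := intervalIntegrable_of_bounded hF hC
  rw [Real.dist_eq, Real.dist_eq, Real.coe_toNNReal _ hC0, add_sub_add_left_eq_sub,
    intervalIntegral.integral_interval_sub_left (hi 0 t) (hi 0 s)]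
  exact intervalIntegral.norm_integral_le_of_norm_le_const (f := F) fun x _ => hC x

/-- The primitive of a bounded function is Lipschitz, so its composition with `β` is absolutely
continuous and the chain rule at almost every time can be integrated. -/
theorem comp_primitive_sub (hF : StronglyMeasurable F) (hC : ∀ t, |F t| ≤ C) {β : ℝ → ℝ}
    (hβ : ContDiff ℝ 1 β) (w₀ t : ℝ) :
    β (w₀ + ∫ s in (0 : ℝ)..t, F s) - β w₀ =
      ∫ s in (0 : ℝ)..t, deriv β (w₀ + ∫ r in (0 : ℝ)..s, F r) * F s := by
  set w : ℝ → ℝ := fun t => w₀ + ∫ s in (0 : ℝ)..t, F s with hw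
  have hL := lipschitzWith_primitive hF hC w₀
  obtain ⟨R, hR⟩ := (isCompact_uIcc.image (s := uIcc 0 t) hL.continuous).isBounded.subset_closedBall 0
  obtain ⟨K, hK⟩ : ∃ K, LipschitzOnWith K β (closedBall 0 R) :=
    hβ.contDiffOn.exists_lipschitzOnWith one_ne_zero (convex_closedBall _ _) (isCompact_closedBall _ _)
  have hAC : AbsolutelyContinuousOnInterval (fun t => β (w t)) 0 t :=
    (hK.comp (hL.lipschitzOnWith (s := uIcc 0 t)) fun x hx =>
      hR (mem_image_of_mem w hx)).absolutelyContinuousOnInterval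
  have h := hAC.integral_deriv_eq_sub
  have h0 : w 0 = w₀ := by simp [hw]
  simp only [h0] at h
  rw [← h]
  refine intervalIntegral.integral_congr_ae ?_
  filter_upwards [LocallyIntegrable.ae_hasDerivAt_integral
      (locallyIntegrable_of_bounded hF hC)] with s hs _
  have hd : HasDerivAt w (F s) s := (hs 0).const_add w₀
  exact (((hβ.differentiable one_ne_zero) (w s)).hasDerivAt.comp s hd).deriv

/-- The du Bois-Reymond lemma with an initial value. Test functions vanish beyond `T` but not at
`0`, and the boundary term fixes the constant of integration. -/
theorem ae_eq_primitive_of_weak (hT : 0 < T) (hb : StronglyMeasurable b) (hF : StronglyMeasurable F)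
    {B : ℝ} (hB : ∀ t, |b t| ≤ B) (hC : ∀ t, |F t| ≤ C)
    (h : ∀ a : ℝ → ℝ, ContDiff ℝ (⊤ : ℕ∞) a → HasCompactSupport a → (∀ t, T ≤ t → a t = 0) →
      a 0 * w₀ + ∫ t in (0 : ℝ)..T, (deriv a t * b t + a t * F t) = 0) :
    ∀ᵐ t, t ∈ Ioo 0 T → b t = w₀ + ∫ s in (0 : ℝ)..t, F s := by
  have hL := lipschitzWith_primitive hF hC w₀
  set w : ℝ → ℝ := fun t => w₀ + ∫ s in (0 : ℝ)..t, F s with hw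
  have hbl := locallyIntegrable_of_bounded hb hB
  have hwl : LocallyIntegrable w volume := hL.continuous.locallyIntegrable
  have hkey := isOpen_Ioo.ae_eq_zero_of_integral_contDiff_smul_eq_zero (U := Ioo (0 : ℝ) T)
    (μ := volume) (f := fun t => b t - w t) ((hbl.sub hwl).locallyIntegrableOn _) ?_
  · filter_upwards [hkey] with t ht h1
    linarith [ht h1]
  intro ψ hψ hψc hψs
  have hψ0 : ∀ t, t ∉ Ioo 0 T → ψ t = 0 := fun t ht => by
    by_contra h0
    exact ht (hψs (subset_tsupport _ h0))
  -- The primitive vanishing beyond `T` is constant on the negative axis, so the bump `κ` introduced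
  -- below is needed for compact support.
  set P : ℝ → ℝ := fun t => ∫ s in T..t, ψ s with hP
  have hψcont := hψ.continuous
  have hPd (t : ℝ) : HasDerivAt P (ψ t) t := intervalIntegral.integral_hasDerivAt_right
    (hψcont.intervalIntegrable _ _) (hψcont.stronglyMeasurableAtFilter _ _) hψcont.continuousAt
  have hPsm : ContDiff ℝ (⊤ : ℕ∞) P := by
    rw [contDiff_infty_iff_deriv]
    refine ⟨fun t => (hPd t).differentiableAt, ?_⟩
    rw [show deriv P = ψ from funext fun t => (hPd t).deriv]
    exact hψ
  have hPT : ∀ t, T ≤ t → P t = 0 := fun t ht => by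
    rw [hP]
    dsimp only
    rw [intervalIntegral.integral_congr (g := fun _ => 0) (fun s hs => ?_)]
    · simp
    · rw [uIcc_of_le ht] at hs
      exact hψ0 s fun h => absurd h.2 (not_lt.2 hs.1)
  let κ : ContDiffBump (0 : ℝ) := ⟨T + 1, T + 2, by linarith, by linarith⟩
  have hκ1 : ∀ t ∈ Ioo (-1) (T + 1), κ t = 1 := fun t ht => κ.one_of_mem_closedBall (by
    rw [mem_closedBall_zero_iff, Real.norm_eq_abs, abs_le]
    exact ⟨by linarith [ht.1], ht.2.le⟩)
  have ha := h (fun t => κ t * P t) (κ.contDiff.mul hPsm) (κ.hasCompactSupport.mul_right)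
    (fun t ht => by rw [hPT t ht, mul_zero])
  have hda : ∀ t ∈ uIcc 0 T, deriv (fun t => κ t * P t) t * b t + κ t * P t * F t =
      ψ t * b t + P t * F t := fun t ht => by
    rw [uIcc_of_le hT.le] at ht
    have hmem : Ioo (-1) (T + 1) ∈ 𝓝 t := Ioo_mem_nhds (by linarith [ht.1]) (by linarith [ht.2])
    have e : (fun t => κ t * P t) =ᶠ[𝓝 t] P := by
      filter_upwards [hmem] with s hs
      rw [hκ1 s hs, one_mul]
    rw [e.deriv_eq, (hPd t).deriv, hκ1 t (mem_of_mem_nhds hmem), one_mul]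
  rw [intervalIntegral.integral_congr hda] at ha
  have hibp := AbsolutelyContinuousOnInterval.integral_mul_deriv_eq_deriv_mul (f := P) (g := w)
    (a := 0) (b := T) ((hPsm.of_le (by exact_mod_cast le_top)).contDiffOn.absolutelyContinuousOnInterval)
    (hL.lipschitzOnWith.absolutelyContinuousOnInterval)
  have e1 : ∫ t in (0 : ℝ)..T, P t * deriv w t = ∫ t in (0 : ℝ)..T, P t * F t := by
    refine intervalIntegral.integral_congr_ae ?_
    filter_upwards [LocallyIntegrable.ae_hasDerivAt_integral
      (locallyIntegrable_of_bounded hF hC)] with s hs _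
    have hd : HasDerivAt w (F s) s := (hs 0).const_add w₀
    rw [hd.deriv]
  have e2 : w 0 = w₀ := by simp [hw]
  rw [e1, hPT T le_rfl, e2, show deriv P = ψ from funext fun t => (hPd t).deriv] at hibp
  have i1 : IntervalIntegrable (fun t => ψ t * b t) volume 0 T :=
    (intervalIntegrable_of_bounded hb hB 0 T).continuousOn_mul hψcont.continuousOn
  have i2 : IntervalIntegrable (fun t => P t * F t) volume 0 T :=
    (intervalIntegrable_of_bounded hF hC 0 T).continuousOn_mul hPsm.continuous.continuousOn
  have i3 : IntervalIntegrable (fun t => ψ t * w t) volume 0 T :=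
    (hψcont.mul hL.continuous).intervalIntegrable _ _
  rw [intervalIntegral.integral_add i1 i2, hibp,
    hκ1 0 ⟨by norm_num, by linarith⟩] at ha
  have e3 : ∫ t, ψ t • (b t - w t) = ∫ t in (0 : ℝ)..T, (ψ t * b t - ψ t * w t) := by
    rw [intervalIntegral.integral_of_le hT.le,
      setIntegral_eq_integral_of_forall_compl_eq_zero]
    · exact integral_congr_ae (Eventually.of_forall fun t => by simp [mul_sub])
    · intro t ht
      rw [hψ0 t fun h => ht ⟨h.1, h.2.le⟩]; ring
  rw [e3, intervalIntegral.integral_sub i1 i3]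
  linarith

end Line

/-! ### The evolution equation of the mollified velocity. -/

/-- A jointly measurable family of flows with uniform bounds. -/
structure FlowFamily (α W m : ℝ) (u : ℝ → Plane → Plane) (ω : ℝ → Plane → ℝ) : Prop where
  meas : StronglyMeasurable (Function.uncurry u)
  divFree : ∀ t, IsDivFree (u t)
  vort : ∀ t, IsVorticity (u t) (ω t)
  bound : ∀ t, ∀ᵐ x, |ω t x| ≤ W
  morrey : ∀ t, MorreyBd α 1 m (u t)
  nonneg : 0 ≤ m
  lt_half : α < 1 / 2

/-- The linear growth constant of a family of flows. -/
def growthBd (W m : ℝ) : ℝ := 2 * (W + 4 * molBd * m)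

theorem stronglyMeasurable_cv_family {f : ℝ → Plane → ℝ}
    (hf : StronglyMeasurable (Function.uncurry f)) {K : Plane → ℝ} (hK : Continuous K) :
    StronglyMeasurable fun p : ℝ × Plane => cv (f p.1) K p.2 := by
  simp only [cv_apply]
  refine StronglyMeasurable.integral_prod_right (f := fun (p : ℝ × Plane) t => f p.1 t * K (p.2 - t)) ?_
  have h1 : StronglyMeasurable fun q : (ℝ × Plane) × Plane => f q.1.1 q.2 :=
    hf.comp_measurable ((measurable_fst.comp measurable_fst).prodMk measurable_snd)
  have h2 : Continuous fun q : (ℝ × Plane) × Plane => K (q.1.2 - q.2) := by fun_prop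
  exact h1.mul h2.stronglyMeasurable

theorem stronglyMeasurable_slice {f : ℝ × Plane → ℝ} (hf : StronglyMeasurable f) (x : Plane) :
    StronglyMeasurable fun t => f (t, x) :=
  hf.comp_measurable (measurable_id.prodMk measurable_const)

/-- The right-hand side of the evolution equation for the mollified components. -/
def force (θ ρ : Plane → ℝ) (i : Fin 2) (v : Plane → Plane) (x : Plane) : ℝ :=
  -(∑ j, cv (fun y => v y j * v y i) (pd j ρ) x) -
    ∑ j, ∑ k, cv (fun y => v y j * v y k) (presKer θ 1 ρ i j k) x

namespace FlowFamily

variable {α W m : ℝ} {u : ℝ → Plane → Plane} {ω : ℝ → Plane → ℝ} {θ ρ : Plane → ℝ}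

theorem slice_meas (hu : FlowFamily α W m u ω) (t : ℝ) : AEStronglyMeasurable (u t) volume :=
  (hu.meas.comp_measurable (measurable_const.prodMk measurable_id)).aestronglyMeasurable

theorem flow (hu : FlowFamily α W m u ω) (t : ℝ) : Flow (u t) (ω t) W (growthBd W m) :=
  flow_of_morrey (hu.morrey t) hu.nonneg (by linarith [hu.lt_half]) (hu.slice_meas t) (hu.divFree t)
    (hu.vort t) (hu.bound t)

theorem coord_meas (hu : FlowFamily α W m u ω) (j : Fin 2) :
    StronglyMeasurable (Function.uncurry fun t x => u t x j) :=
  (continuous_coord j).continuous.comp_stronglyMeasurable hu.meas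

theorem mul_meas (hu : FlowFamily α W m u ω) (j k : Fin 2) :
    StronglyMeasurable (Function.uncurry fun t x => u t x j * u t x k) :=
  (hu.coord_meas j).mul (hu.coord_meas k)

theorem cubicIntegrable (hu : FlowFamily α W m u ω) (t : ℝ) (j k : Fin 2) :
    CubicIntegrable (fun y => u t y j * u t y k) :=
  ((hu.morrey t).cubicIntegrable hu.lt_half (hu.slice_meas t) j k).1

theorem exists_abs_cv_le (hu : FlowFamily α W m u ω) {K : Plane → ℝ} (hK : IsDecaying K) :
    ∃ C, 0 ≤ C ∧ ∀ j k t x, |cv (fun y => u t y j * u t y k) K x| ≤ C * (1 + ‖x‖) ^ 3 := by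
  obtain ⟨C, hC0, hC⟩ := hK.bound
  have hd := (dyadBd_pos hu.lt_half).le
  refine ⟨C * (dyadBd α * m ^ 2), by positivity, fun j k t x => ?_⟩
  have h := ((hu.morrey t).cubicIntegrable hu.lt_half (hu.slice_meas t) j k)
  refine (IsDecaying.abs_cv_le hC0 hC h.1 x).trans ?_
  calc C * (1 + ‖x‖) ^ 3 * ∫ y, |u t y j * u t y k / (1 + ‖y‖) ^ 3|
      ≤ C * (1 + ‖x‖) ^ 3 * (dyadBd α * m ^ 2) := by gcongr; exact h.2
    _ = _ := by ring

theorem continuous_force (hu : FlowFamily α W m u ω) (hθ : IsCutoff θ) (hρ : IsTest ρ) (i : Fin 2)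
    (t : ℝ) : Continuous (force θ ρ i (u t)) := by
  unfold force
  refine ((continuous_finsetSum _ fun j _ => ?_).neg).sub
    (continuous_finsetSum _ fun j _ => continuous_finsetSum _ fun k _ => ?_)
  · exact (hρ.pd j).isDecaying.continuous_cv (hu.cubicIntegrable t j i)
  · exact (hθ.isDecaying_presKer hρ i j k).continuous_cv (hu.cubicIntegrable t j k)

theorem meas_force (hu : FlowFamily α W m u ω) (hθ : IsCutoff θ) (hρ : IsTest ρ) (i : Fin 2) :
    StronglyMeasurable fun p : ℝ × Plane => force θ ρ i (u p.1) p.2 := by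
  unfold force
  refine ((Finset.stronglyMeasurable_fun_sum _ fun j _ => ?_).neg).sub
    (Finset.stronglyMeasurable_fun_sum _ fun j _ => Finset.stronglyMeasurable_fun_sum _ fun k _ => ?_)
  · exact stronglyMeasurable_cv_family (hu.mul_meas j i) (hρ.pd j).continuous
  · exact stronglyMeasurable_cv_family (hu.mul_meas j k) (hθ.isDecaying_presKer hρ i j k).continuous

theorem exists_force_bound (hu : FlowFamily α W m u ω) (hθ : IsCutoff θ) (hρ : IsTest ρ)
    (i : Fin 2) : ∃ C, 0 ≤ C ∧ ∀ t x, |force θ ρ i (u t) x| ≤ C * (1 + ‖x‖) ^ 3 := by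
  choose C₁ hC₁0 hC₁ using fun j => hu.exists_abs_cv_le (hρ.pd j).isDecaying
  choose C₂ hC₂0 hC₂ using fun j k => hu.exists_abs_cv_le (hθ.isDecaying_presKer hρ i j k)
  refine ⟨∑ j, C₁ j + ∑ j, ∑ k, C₂ j k, add_nonneg (Finset.sum_nonneg fun j _ => hC₁0 j)
    (Finset.sum_nonneg fun j _ => Finset.sum_nonneg fun k _ => hC₂0 j k), fun t x => ?_⟩
  unfold force
  rw [add_mul, Finset.sum_mul, Finset.sum_mul]
  simp only [Finset.sum_mul]
  refine (abs_sub _ _).trans ?_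
  rw [abs_neg]
  refine add_le_add ((Finset.abs_sum_le_sum_abs _ _).trans (Finset.sum_le_sum fun j _ => hC₁ j j i t x))
    ((Finset.abs_sum_le_sum_abs _ _).trans (Finset.sum_le_sum fun j _ =>
      (Finset.abs_sum_le_sum_abs _ _).trans (Finset.sum_le_sum fun k _ => hC₂ j k j k t x)))

theorem continuous_cv (hu : FlowFamily α W m u ω) (hρ : IsTest ρ) (i : Fin 2) (t : ℝ) :
    Continuous (cv (fun y => u t y i) ρ) := (contDiff_cv ((hu.flow t).loc i) hρ).continuous

theorem exists_cv_bound (hu : FlowFamily α W m u ω) (hρ : IsTest ρ) (i : Fin 2) (x : Plane) :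
    ∃ C, ∀ t, |cv (fun y => u t y i) ρ x| ≤ C := by
  have hc : Continuous fun y : Plane => growthBd W m * (1 + ‖y‖) := by fun_prop
  have hi : Integrable (fun y => growthBd W m * (1 + ‖y‖) * |ρ (x - y)|) volume :=
    (integrable_cv_integrand (k := fun y => |ρ y|) hc.locallyIntegrable
      (continuous_abs.comp hρ.continuous) hρ.2.abs x)
  refine ⟨∫ y, growthBd W m * (1 + ‖y‖) * |ρ (x - y)|, fun t => ?_⟩
  rw [cv_apply]
  refine norm_integral_le_of_norm_le (μ := volume) (f := fun y => u t y i * ρ (x - y)) hi ?_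
  filter_upwards [(hu.flow t).coord_growth i] with y hy
  rw [norm_mul]
  exact mul_le_mul_of_nonneg_right hy (norm_nonneg _)

end FlowFamily

/-- The time-integrated evolution equation of the mollified components, at almost every time. -/
def Evolves (θ : Plane → ℝ) (u₀ : Plane → Plane) (T : ℝ) (u : ℝ → Plane → Plane) : Prop :=
  ∀ ρ, IsTest ρ → ∀ i, ∀ᵐ t, t ∈ Ioo 0 T → ∀ x, cv (fun y => u t y i) ρ x =
    cv (fun y => u₀ y i) ρ x + ∫ s in (0 : ℝ)..t, force θ ρ i (u s) x

section Weak

variable {α W m T : ℝ} {u v : ℝ → Plane → Plane} {ω : ℝ → Plane → ℝ} {θ ρ : Plane → ℝ}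
  {u₀ : Plane → Plane}

theorem cv_congr_ae {f g : Plane → ℝ} (h : f =ᵐ[volume] g) (k : Plane → ℝ) (x : Plane) :
    cv f k x = cv g k x := by
  rw [cv_apply, cv_apply]
  refine integral_congr_ae ?_
  filter_upwards [h] with y hy
  rw [hy]

theorem Flow.congr {u v : Plane → Plane} {ω : Plane → ℝ} {W A : ℝ} (hu : Flow u ω W A)
    (h : u =ᵐ[volume] v) : Flow v ω W A :=
  ⟨hu.meas.congr h, by filter_upwards [hu.growth, h] with x h1 h2; rwa [← h2], hu.divFree.congr h,
    hu.vort.congr h, hu.bound⟩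

theorem FlowFamily.pressure_integral (hu : FlowFamily α W m u ω) (hθ : IsCutoff θ) (hρ : IsTest ρ)
    {t : ℝ} (hv : u t =ᵐ[volume] v t) (i : Fin 2) (x₀ : Plane) :
    ∫ x, pressureForce θ (v t) (v t) x i * ρ (x₀ - x) =
      ∑ j, ∑ k, cv (fun y => u t y j * u t y k) (presKer θ 1 ρ i j k) x₀ := by
  have hjk (j k) : (fun y => u t y j * u t y k) =ᵐ[volume] fun y => v t y j * v t y k := by
    filter_upwards [hv] with y hy
    rw [hy]
  have hc (j k) : CubicIntegrable fun y => v t y j * v t y k := by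
    refine (Integrable.congr (hu.cubicIntegrable t j k) ?_)
    filter_upwards [hjk j k] with y hy
    rw [hy]
  rw [((hu.flow t).congr hv).integral_pressureForce hc hθ hρ i x₀]
  refine Finset.sum_congr rfl fun j _ => Finset.sum_congr rfl fun k _ => ?_
  exact (cv_congr_ae (hjk j k) _ _).symm

/-- The test field `a(t) ρ(x₀ - x) eᵢ` turns every space integral into a convolution at `x₀`. In the
same stroke `v` is replaced by its modification `u`, for which measurability and bounds hold at
every time. -/
theorem IsYudovichSolution.weak_scalar (hv : IsYudovichSolution θ α u₀ v)
    (hu : FlowFamily α W m u ω) (hθ : IsCutoff θ) (hT : 0 < T)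
    (huv : ∀ᵐ t ∂(volume.restrict (Icc 0 T)), u t =ᵐ[volume] v t) (hρ : IsTest ρ) (i : Fin 2)
    (x₀ : Plane) {a : ℝ → ℝ} (ha : ContDiff ℝ (⊤ : ℕ∞) a) (hac : HasCompactSupport a)
    (haT : ∀ t, T ≤ t → a t = 0) :
    a 0 * cv (fun y => u₀ y i) ρ x₀ + ∫ t in (0 : ℝ)..T,
      (deriv a t * cv (fun y => u t y i) ρ x₀ + a t * force θ ρ i (u t) x₀) = 0 := by
  set η : Plane → ℝ := fun x => ρ (x₀ - x) with hη
  have hηt : IsTest η := hρ.comp_sub_left x₀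
  set e : Plane := EuclideanSpace.single i 1 with he
  have hinner (w : Plane) (c : ℝ) : inner ℝ (c • e) w = c * w i := by
    rw [he, real_inner_smul_left, EuclideanSpace.inner_single_left]; simp
  have hinner' (w : Plane) (c : ℝ) : inner ℝ w (c • e) = c * w i := by
    rw [real_inner_comm, hinner]
  have hdT : ∀ t, T < t → deriv a t = 0 := fun t ht => by
    have : a =ᶠ[𝓝 t] fun _ => 0 := by
      filter_upwards [Ioi_mem_nhds ht] with s hs using haT s (le_of_lt hs)
    rw [this.deriv_eq, deriv_const]
  have hφ : ContDiff ℝ (⊤ : ℕ∞) fun p : ℝ × Plane => (a p.1 * η p.2) • e :=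
    ((ha.comp contDiff_fst).mul (hηt.1.comp contDiff_snd)).smul contDiff_const
  have hφc : HasCompactSupport fun p : ℝ × Plane => (a p.1 * η p.2) • e := by
    refine HasCompactSupport.intro (hac.isCompact.prod hηt.2.isCompact) fun p hp => ?_
    rw [mem_prod, not_and_or] at hp
    rcases hp with h | h
    · rw [image_eq_zero_of_notMem_tsupport h]; simp
    · rw [image_eq_zero_of_notMem_tsupport h]; simp
  have h := hv.weak_form _ hφ hφc
  simp only [hinner, hinner'] at h
  have hd1 (t : ℝ) (x : Plane) : deriv (fun s => (a s * η x) • e) t = (deriv a t * η x) • e := by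
    have h1 := ((ha.differentiable (by simp) t).hasDerivAt.mul_const (η x)).smul_const e
    exact h1.deriv
  have hd2 (t : ℝ) (x w : Plane) : fderiv ℝ (fun y => (a t * η y) • e) x w =
      (a t * fderiv ℝ η x w) • e := by
    have h1 := ((hηt.differentiable x).hasFDerivAt.const_mul (a t)).smul_const e
    rw [h1.fderiv]
    simp
  simp only [hd1, hd2, hinner, hinner'] at h
  have e0 : ∫ x, a 0 * η x * u₀ x i = a 0 * cv (fun y => u₀ y i) ρ x₀ := by
    rw [cv_apply, ← integral_const_mul]
    exact integral_congr_ae (Eventually.of_forall fun x => by simp only [hη]; ring)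
  have toT (L : ℝ → ℝ) (hL : ∀ t, T < t → L t = 0) : ∫ t in Ioi (0 : ℝ), L t = ∫ t in (0 : ℝ)..T, L t := by
    rw [intervalIntegral.integral_of_le hT.le]
    refine (setIntegral_eq_of_subset_of_forall_sdiff_eq_zero measurableSet_Ioi Ioc_subset_Ioi_self
      fun t ht => hL t ?_)
    by_contra h
    exact ht.2 ⟨ht.1, not_lt.1 h⟩
  have huv' : ∀ᵐ t, t ∈ uIoc 0 T → u t =ᵐ[volume] v t := by
    rw [ae_restrict_iff' measurableSet_Icc] at huv
    filter_upwards [huv] with t ht h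
    rw [uIoc_of_le hT.le] at h
    exact ht ⟨h.1.le, h.2⟩
  rw [e0, toT _ fun t ht => by simp [haT t ht.le, hdT t ht],
    toT _ fun t ht => by simp [haT t ht.le]] at h
  have e1 : ∫ t in (0 : ℝ)..T, ∫ x, (deriv a t * η x * v t x i + a t * fderiv ℝ η x (v t x) * v t x i) =
      ∫ t in (0 : ℝ)..T, (deriv a t * cv (fun y => u t y i) ρ x₀ -
        a t * ∑ j, cv (fun y => u t y j * u t y i) (pd j ρ) x₀) := by
    refine intervalIntegral.integral_congr_ae ?_
    filter_upwards [huv'] with t ht htT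
    have hi : Integrable (fun x => deriv a t * (u t x i * ρ (x₀ - x))) volume :=
      (integrable_cv_integrand ((hu.flow t).loc i) hρ.continuous hρ.2 x₀).const_mul _
    have hj (j : Fin 2) : Integrable (fun x => (u t x j * u t x i) * pd j ρ (x₀ - x)) volume :=
      (hρ.pd j).isDecaying.integrable_mul (hu.cubicIntegrable t j i) x₀
    have hjs : Integrable (fun x => a t * ∑ j, (u t x j * u t x i) * pd j ρ (x₀ - x)) volume :=
      (integrable_finsetSum _ fun j _ => hj j).const_mul _
    have : (∑ j, cv (fun y => u t y j * u t y i) (pd j ρ) x₀) =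
        ∫ x, ∑ j, (u t x j * u t x i) * pd j ρ (x₀ - x) := by
      rw [integral_finsetSum _ fun j _ => hj j]
      rfl
    rw [this, cv_apply, ← integral_const_mul, ← integral_const_mul, ← integral_sub hi hjs]
    refine integral_congr_ae ?_
    filter_upwards [ht htT] with x hx
    rw [← hx, fderiv_eq_sum_pd, hη, pd_comp_sub_left, pd_comp_sub_left, Fin.sum_univ_two]
    ring
  have e2 : ∫ t in (0 : ℝ)..T, ∫ x, a t * η x * pressureForce θ (v t) (v t) x i =
      ∫ t in (0 : ℝ)..T, a t * ∑ j, ∑ k, cv (fun y => u t y j * u t y k) (presKer θ 1 ρ i j k) x₀ := by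
    refine intervalIntegral.integral_congr_ae ?_
    filter_upwards [huv'] with t ht htT
    rw [← hu.pressure_integral hθ hρ (ht htT) i x₀, ← integral_const_mul]
    exact integral_congr_ae (Eventually.of_forall fun x => by simp only [hη]; ring)
  rw [e1, e2] at h
  obtain ⟨Cb, hCb⟩ := hu.exists_cv_bound hρ i x₀
  have mb : StronglyMeasurable fun t => cv (fun y => u t y i) ρ x₀ :=
    stronglyMeasurable_slice (stronglyMeasurable_cv_family (hu.coord_meas i) hρ.continuous) x₀
  have m2 : StronglyMeasurable fun t => ∑ j, ∑ k,
      cv (fun y => u t y j * u t y k) (presKer θ 1 ρ i j k) x₀ :=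
    Finset.stronglyMeasurable_fun_sum _ fun j _ => Finset.stronglyMeasurable_fun_sum _ fun k _ =>
      stronglyMeasurable_slice (stronglyMeasurable_cv_family (hu.mul_meas j k)
        (hθ.isDecaying_presKer hρ i j k).continuous) x₀
  have m1 : StronglyMeasurable fun t => ∑ j, cv (fun y => u t y j * u t y i) (pd j ρ) x₀ :=
    Finset.stronglyMeasurable_fun_sum _ fun j _ =>
      stronglyMeasurable_slice (stronglyMeasurable_cv_family (hu.mul_meas j i)
        (hρ.pd j).continuous) x₀
  choose C₁ hC₁0 hC₁ using fun j => hu.exists_abs_cv_le (hρ.pd j).isDecaying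
  choose C₂ hC₂0 hC₂ using fun j k => hu.exists_abs_cv_le (hθ.isDecaying_presKer hρ i j k)
  have ib := intervalIntegrable_of_bounded mb hCb 0 T
  have i1 := intervalIntegrable_of_bounded m1 (C := ∑ j, C₁ j * (1 + ‖x₀‖) ^ 3) (fun t =>
    (Finset.abs_sum_le_sum_abs _ _).trans (Finset.sum_le_sum fun j _ => hC₁ j j i t x₀)) 0 T
  have i2 := intervalIntegrable_of_bounded m2 (C := ∑ j, ∑ k, C₂ j k * (1 + ‖x₀‖) ^ 3) (fun t =>
    (Finset.abs_sum_le_sum_abs _ _).trans (Finset.sum_le_sum fun j _ =>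
      (Finset.abs_sum_le_sum_abs _ _).trans (Finset.sum_le_sum fun k _ => hC₂ j k j k t x₀))) 0 T
  have hda : Continuous (deriv a) := ha.continuous_deriv (by simp)
  have j0 : IntervalIntegrable (fun t => deriv a t * cv (fun y => u t y i) ρ x₀) volume 0 T :=
    ib.continuousOn_mul hda.continuousOn
  have j1 : IntervalIntegrable (fun t => a t * ∑ j, cv (fun y => u t y j * u t y i) (pd j ρ) x₀)
      volume 0 T := i1.continuousOn_mul ha.continuous.continuousOn
  have j2 : IntervalIntegrable (fun t => a t * ∑ j, ∑ k,
      cv (fun y => u t y j * u t y k) (presKer θ 1 ρ i j k) x₀)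
      volume 0 T := i2.continuousOn_mul ha.continuous.continuousOn
  have e3 : ∫ t in (0 : ℝ)..T,
      (deriv a t * cv (fun y => u t y i) ρ x₀ + a t * force θ ρ i (u t) x₀) =
      (∫ t in (0 : ℝ)..T, (deriv a t * cv (fun y => u t y i) ρ x₀ -
        a t * ∑ j, cv (fun y => u t y j * u t y i) (pd j ρ) x₀)) -
      ∫ t in (0 : ℝ)..T, a t * ∑ j, ∑ k,
        cv (fun y => u t y j * u t y k) (presKer θ 1 ρ i j k) x₀ := by
    rw [← intervalIntegral.integral_sub (j0.sub j1) j2]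
    refine intervalIntegral.integral_congr fun t _ => ?_
    simp only [force]
    ring
  rw [e3]
  linarith

/-- At each point `x` the weak equation in time is integrated. The exceptional times depend on `x`;
a countable dense set of points and the continuity of both sides in `x` make them common to all
points. -/
theorem IsYudovichSolution.evolves (hv : IsYudovichSolution θ α u₀ v)
    (hu : FlowFamily α W m u ω) (hθ : IsCutoff θ) (hT : 0 < T)
    (huv : ∀ᵐ t ∂(volume.restrict (Icc 0 T)), u t =ᵐ[volume] v t)
    (hu₀ : ∀ i, LocallyIntegrable (fun x => u₀ x i) volume) : Evolves θ u₀ T u := by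
  intro ρ hρ i
  obtain ⟨C, hC0, hC⟩ := hu.exists_force_bound hθ hρ i
  have hm := hu.meas_force hθ hρ i
  have hx (x : Plane) : ∀ᵐ t, t ∈ Ioo 0 T → cv (fun y => u t y i) ρ x =
      cv (fun y => u₀ y i) ρ x + ∫ s in (0 : ℝ)..t, force θ ρ i (u s) x := by
    obtain ⟨B, hB⟩ := hu.exists_cv_bound hρ i x
    exact ae_eq_primitive_of_weak hT
      (stronglyMeasurable_slice (stronglyMeasurable_cv_family (hu.coord_meas i) hρ.continuous) x)
      (stronglyMeasurable_slice hm x) hB (fun t => hC t x)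
      fun a h1 h2 h3 => hv.weak_scalar hu hθ hT huv hρ i x h1 h2 h3
  have hdense := TopologicalSpace.exists_countable_dense Plane
  obtain ⟨D, hDc, hD⟩ := hdense
  have hall : ∀ᵐ t, ∀ x ∈ D, t ∈ Ioo 0 T → cv (fun y => u t y i) ρ x =
      cv (fun y => u₀ y i) ρ x + ∫ s in (0 : ℝ)..t, force θ ρ i (u s) x :=
    (ae_ball_iff hDc).2 fun x _ => hx x
  filter_upwards [hall] with t ht htT
  have hc1 := hu.continuous_cv hρ i t
  have hc2 : Continuous fun x => cv (fun y => u₀ y i) ρ x + ∫ s in (0 : ℝ)..t, force θ ρ i (u s) x := by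
    refine (contDiff_cv (hu₀ i) hρ).continuous.add ?_
    rw [continuous_iff_continuousAt]
    intro x₀
    refine intervalIntegral.continuousAt_of_dominated_interval
      (bound := fun _ => C * (2 + ‖x₀‖) ^ 3) ?_ ?_ (by simp) ?_
    · exact Eventually.of_forall fun x => (stronglyMeasurable_slice hm x).aestronglyMeasurable
    · filter_upwards [ball_mem_nhds x₀ one_pos] with x hx
      refine Eventually.of_forall fun s _ => (hC s x).trans ?_
      have hx' : ‖x‖ ≤ 1 + ‖x₀‖ := by
        rw [mem_ball, dist_eq_norm] at hx
        calc ‖x‖ = ‖(x - x₀) + x₀‖ := by simp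
          _ ≤ ‖x - x₀‖ + ‖x₀‖ := norm_add_le _ _
          _ ≤ _ := by linarith
      have : 1 + ‖x‖ ≤ 2 + ‖x₀‖ := by linarith
      gcongr
    · exact Eventually.of_forall fun s _ => (hu.continuous_force hθ hρ i s).continuousAt
  intro x
  exact congrFun (Continuous.ext_on hD hc1 hc2 fun x hx => ht x hx htT) x

end Weak

theorem isDivFree_zero : IsDivFree fun _ => 0 := fun φ _ _ => by simp

theorem isVorticity_zero : IsVorticity (fun _ => 0) fun _ => 0 :=
  ⟨locallyIntegrable_const 0, fun φ _ _ => by simp⟩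

/-- Extracting a vorticity from the infimum in `yudovichNorm` requires a strict inequality, hence `M
+ 1`. -/
theorem exists_vorticity_of_yudovichNorm_le {α : ℝ} {v : Plane → Plane} {M : ℝ≥0}
    (h : yudovichNorm α v ≤ M) : (∃ ω, IsVorticity v ω ∧ ∀ᵐ x, |ω x| ≤ M + 1) ∧
      MorreyBd α 1 M v := by
  have h1 : (⨅ (ω : Plane → ℝ) (_ : IsVorticity v ω), eLpNorm ω ∞ volume) ≤ M :=
    le_self_add.trans h
  have h2 : morreyNorm α v ≤ M := le_add_self.trans h
  refine ⟨?_, ?_⟩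
  · have h3 : (⨅ (ω : Plane → ℝ) (_ : IsVorticity v ω), eLpNorm ω ∞ volume) < ((M + 1 : ℝ≥0) : ℝ≥0∞) :=
      h1.trans_lt (by exact_mod_cast lt_add_one M)
    simp only [iInf_lt_iff] at h3
    obtain ⟨ω, hω, hlt⟩ := h3
    refine ⟨ω, hω, ?_⟩
    rw [eLpNorm_exponent_top] at hlt
    filter_upwards [ae_le_eLpNormEssSup (f := ω) (μ := volume)] with x hx
    have h4 : ‖ω x‖ₑ ≤ ((M + 1 : ℝ≥0) : ℝ≥0∞) := hx.trans hlt.le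
    rw [enorm_eq_nnnorm] at h4
    have h5 : ‖ω x‖₊ ≤ M + 1 := by exact_mod_cast h4
    exact_mod_cast h5
  · rw [← morreyNormFrom_le_iff one_pos M.coe_nonneg, ENNReal.ofReal_coe_nnreal]
    exact h2

/-- A measurable representative is set to zero on a measurable null set containing the bad times of
`[0, T]`. All bounds then hold at every time, which spares later arguments the exceptional sets. -/
theorem MemLinftyLocY.exists_flowFamily {α : ℝ} {v : ℝ → Plane → Plane} (hv : MemLinftyLocY α v)
    (hα : α < 1 / 2) (T : ℝ) : ∃ W m u ω, FlowFamily α W m u ω ∧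
      ∀ᵐ t ∂(volume.restrict (Icc 0 T)), u t =ᵐ[volume] v t := by
  obtain ⟨M, hM⟩ := hv.locally_bounded T
  set g := hv.aestronglyMeasurable.mk (Function.uncurry v) with hg
  have hgm : StronglyMeasurable g := hv.aestronglyMeasurable.stronglyMeasurable_mk
  have hae : ∀ᵐ t ∂(volume.restrict (Ici (0 : ℝ))), ∀ᵐ x, v t x = g (t, x) :=
    Measure.ae_ae_of_ae_prod hv.aestronglyMeasurable.ae_eq_mk
  have hae' : ∀ᵐ t ∂(volume.restrict (Icc (0 : ℝ) T)), ∀ᵐ x, v t x = g (t, x) :=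
    ae_restrict_of_ae_restrict_of_subset Icc_subset_Ici_self hae
  have hgood := hM.and hae'
  obtain ⟨s, hs, hsm, hs0⟩ := exists_measurable_superset_of_null (ae_iff.1 hgood)
  have hmem : ∀ t, t ∉ s → (MemY α (v t) ∧ yudovichNorm α (v t) ≤ M) ∧ ∀ᵐ x, v t x = g (t, x) :=
    fun t ht => by
      by_contra h
      exact ht (hs h)
  classical
  set u : ℝ → Plane → Plane := fun t x => if t ∈ s then 0 else g (t, x) with hu
  have hu1 (t : ℝ) (ht : t ∉ s) : v t =ᵐ[volume] u t := by
    filter_upwards [(hmem t ht).2] with x hx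
    rw [hx, hu]; simp [ht]
  have hu0 (t : ℝ) (ht : t ∈ s) : u t = fun _ => 0 := by ext x; simp [hu, ht]
  have hω : ∀ t, ∃ ω, IsVorticity (u t) ω ∧ ∀ᵐ x, |ω x| ≤ (M : ℝ) + 1 := fun t => by
    by_cases ht : t ∈ s
    · rw [hu0 t ht]
      exact ⟨_, isVorticity_zero, Eventually.of_forall fun x => by simp; positivity⟩
    · obtain ⟨ω, h1, h2⟩ := (exists_vorticity_of_yudovichNorm_le (hmem t ht).1.2).1
      exact ⟨ω, h1.congr (hu1 t ht), h2⟩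
  choose ω hω1 hω2 using hω
  refine ⟨M + 1, M, u, ω, ⟨?_, fun t => ?_, hω1, hω2, fun t => ?_, M.coe_nonneg, hα⟩, ?_⟩
  · have e : Function.uncurry u = (s ×ˢ (univ : Set Plane)).piecewise (fun _ => 0) g := by
      ext ⟨t, x⟩ : 1
      by_cases ht : t ∈ s <;> simp [hu, ht, Set.piecewise]
    rw [e]
    exact StronglyMeasurable.piecewise (hsm.prod MeasurableSet.univ) stronglyMeasurable_const hgm
  · by_cases ht : t ∈ s
    · rw [hu0 t ht]; exact isDivFree_zero
    · exact (hmem t ht).1.1.isDivFree.congr (hu1 t ht)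
  · by_cases ht : t ∈ s
    · rw [hu0 t ht]; intro r _; simp
    · exact (exists_vorticity_of_yudovichNorm_le (hmem t ht).1.2).2.congr (hu1 t ht)
  · rw [ae_iff]
    refine measure_mono_null (fun t ht => ?_) hs0
    by_contra h
    exact ht (hu1 t h).symm

/-! ### The commutator estimate. -/

/-- The commutator of the transport operator with mollification. -/
def comm (u : Plane → Plane) (f : Plane → ℝ) (s : ℝ) (x : Plane) : ℝ :=
  ∑ j, (cv (fun y => u y j * f y) (pd j (mols s)) x - u x j * pd j (cv f (mols s)) x)

/-- The quadratic oscillation at scale `s`. -/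
def osc (f : Plane → ℝ) (s : ℝ) (x : Plane) : ℝ≥0∞ :=
  ENNReal.ofReal ((s ^ 2)⁻¹) * ∫⁻ h in closedBall (0 : Plane) s, ENNReal.ofReal ((f (x - h) - f x) ^ 2)

theorem aemeasurable_diff_sq {f : Plane → ℝ} (hf : AEStronglyMeasurable f volume) :
    AEMeasurable (fun p : Plane × Plane => ENNReal.ofReal ((f (p.1 - p.2) - f p.1) ^ 2))
      (volume.prod volume) := by
  have h1 : AEMeasurable (fun p : Plane × Plane => f (p.1 - p.2)) (volume.prod volume) :=
    hf.aemeasurable.comp_quasiMeasurePreserving (quasiMeasurePreserving_sub volume volume)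
  have h2 : AEMeasurable (fun p : Plane × Plane => f p.1) (volume.prod volume) :=
    hf.aemeasurable.comp_fst
  exact ((h1.sub h2).pow_const 2).ennreal_ofReal

theorem aemeasurable_diff_sq_restrict {f : Plane → ℝ} (hf : AEStronglyMeasurable f volume)
    (R s : ℝ) :
    AEMeasurable (fun p : Plane × Plane => ENNReal.ofReal ((f (p.1 - p.2) - f p.1) ^ 2))
      ((volume.restrict (ball 0 R)).prod (volume.restrict (closedBall 0 s))) := by
  rw [Measure.prod_restrict]
  exact (aemeasurable_diff_sq hf).restrict

theorem lintegral_osc_eq {f : Plane → ℝ} (hf : AEStronglyMeasurable f volume) (R s : ℝ) :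
    ∫⁻ x in ball (0 : Plane) R, ∫⁻ h in closedBall (0 : Plane) s,
      ENNReal.ofReal ((f (x - h) - f x) ^ 2) =
    ENNReal.ofReal (s ^ 2) * ∫⁻ x in ball (0 : Plane) R, osc f s x := by
  rcases eq_or_ne s 0 with rfl | hs
  · simp only [osc, closedBall_zero, Measure.restrict_singleton]
    simp
  · unfold osc
    have hm := (aemeasurable_diff_sq_restrict hf R s).lintegral_prod_right'
    rw [lintegral_const_mul'' _ hm, ← mul_assoc, ← ENNReal.ofReal_mul (by positivity),
      mul_inv_cancel₀ (by positivity), ENNReal.ofReal_one, one_mul]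

/-- Functions with at most linear growth. -/
def LinGrowth (f : Plane → ℝ) (B : ℝ) : Prop :=
  AEStronglyMeasurable f volume ∧ ∀ᵐ x, |f x| ≤ B * (1 + ‖x‖)

section Osc

variable {f : Plane → ℝ} {B : ℝ}

theorem LinGrowth.nonneg (hf : LinGrowth f B) : 0 ≤ B := by
  obtain ⟨x, hx⟩ := hf.2.exists
  by_contra h
  nlinarith [abs_nonneg (f x), norm_nonneg x]

theorem LinGrowth.locallyIntegrable (hf : LinGrowth f B) : LocallyIntegrable f volume :=
  locallyIntegrable_of_growth hf.1 (by fun_prop : Continuous fun x : Plane => B * (1 + ‖x‖)) hf.2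

theorem LinGrowth.diff_sq_le (hf : LinGrowth f B) {R : ℝ} : ∀ᵐ x, ‖x‖ ≤ R → ∀ᵐ h, ‖h‖ ≤ 1 →
    |f (x - h) - f x| ≤ 2 * B * (2 + R) := by
  have hB := hf.nonneg
  filter_upwards [hf.2] with x hx hxR
  have h2 := (quasiMeasurePreserving_sub_left_of_right_invariant (volume : Measure Plane) x).ae hf.2
  filter_upwards [h2] with h hh h1
  refine (abs_sub _ _).trans ?_
  have h3 : ‖x - h‖ ≤ R + 1 := (norm_sub_le _ _).trans (by linarith)
  have h4 : B * (1 + ‖x - h‖) ≤ B * (2 + R) := mul_le_mul_of_nonneg_left (by linarith) hB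
  have h5 : B * (1 + ‖x‖) ≤ B * (2 + R) := mul_le_mul_of_nonneg_left (by linarith) hB
  linarith

theorem LinGrowth.osc_le (hf : LinGrowth f B) {R : ℝ} : ∀ᵐ x, ‖x‖ ≤ R → ∀ s, 0 < s → s ≤ 1 →
    osc f s x ≤ ENNReal.ofReal (Real.pi * (2 * B * (2 + R)) ^ 2) := by
  filter_upwards [hf.diff_sq_le (R := R)] with x hx hxR s hs hs1
  unfold osc
  have h1 : ∫⁻ h in closedBall (0 : Plane) s, ENNReal.ofReal ((f (x - h) - f x) ^ 2) ≤
      ∫⁻ h in closedBall (0 : Plane) s, ENNReal.ofReal ((2 * B * (2 + R)) ^ 2) := by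
    refine lintegral_mono_ae ((ae_restrict_iff' measurableSet_closedBall).2 ?_)
    filter_upwards [hx hxR] with h hh hm
    rw [mem_closedBall_zero_iff] at hm
    rw [← sq_abs (f (x - h) - f x)]
    exact ENNReal.ofReal_le_ofReal (pow_le_pow_left₀ (abs_nonneg _) (hh (hm.trans hs1)) 2)
  refine (mul_le_mul_right h1 _).trans ?_
  have hv : volume (closedBall (0 : Plane) s) = ENNReal.ofReal (s ^ 2 * Real.pi) := by
    rw [← volume_closedBall_plane 0 hs.le, Measure.real, ENNReal.ofReal_toReal]
    exact measure_closedBall_lt_top.ne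
  rw [setLIntegral_const, hv, ← ENNReal.ofReal_mul (by positivity),
    ← ENNReal.ofReal_mul (by positivity)]
  refine ENNReal.ofReal_le_ofReal (le_of_eq ?_)
  field_simp

/-- Increments are bounded on bounded sets, so the quadratic oscillation is at most a constant times
the linear one, which vanishes at Lebesgue points. -/
theorem LinGrowth.tendsto_osc (hf : LinGrowth f B) : ∀ᵐ x, Tendsto (fun n => osc f (eps n) x) atTop (𝓝 0) := by
  have hbd := fun N : ℕ => hf.diff_sq_le (R := N)
  filter_upwards [ae_tendsto_lebesgue hf.locallyIntegrable, ae_all_iff.2 hbd] with x hx hb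
  obtain ⟨N, hN⟩ := exists_nat_ge ‖x‖
  have hb' := hb N hN
  have hB := hf.nonneg
  have h1 : Tendsto (fun n => ENNReal.ofReal (2 * B * (2 + N) *
      (((eps n) ^ 2)⁻¹ * ∫ y in closedBall x (eps n), |f y - f x|))) atTop (𝓝 0) := by
    have := ENNReal.tendsto_ofReal ((hx.comp tendsto_eps_within).const_mul (2 * B * (2 + N)))
    simpa using this
  refine tendsto_of_tendsto_of_tendsto_of_le_of_le tendsto_const_nhds h1 (fun _ => zero_le) fun n => ?_
  have hs := eps_pos n
  have hi : Integrable (fun h => f (x - h) - f x) (volume.restrict (closedBall 0 (eps n))) := by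
    have h2 : LocallyIntegrable (fun y => f y - f x) volume :=
      hf.locallyIntegrable.sub (locallyIntegrable_const _)
    have h3 : IntegrableOn (fun y => f y - f x) (closedBall x (eps n)) volume :=
      h2.integrableOn_isCompact (isCompact_closedBall _ _)
    rw [← integrable_indicator_iff measurableSet_closedBall] at h3
    have h4 := h3.comp_sub_left x
    rw [← IntegrableOn, ← integrable_indicator_iff measurableSet_closedBall]
    refine h4.congr (Eventually.of_forall fun h => ?_)
    dsimp only
    by_cases hh : ‖h‖ ≤ eps n
    · rw [indicator_of_mem (by simpa using hh), indicator_of_mem (by simpa using hh)]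
    · rw [indicator_of_notMem (by simpa using hh), indicator_of_notMem (by simpa using hh)]
  have e : ∫ y in closedBall x (eps n), |f y - f x| =
      ∫ h in closedBall (0 : Plane) (eps n), |f (x - h) - f x| := by
    rw [← integral_indicator measurableSet_closedBall, ← integral_indicator measurableSet_closedBall,
      ← integral_sub_left_eq_self _ volume x]
    refine integral_congr_ae (Eventually.of_forall fun h => ?_)
    dsimp only
    by_cases hh : ‖h‖ ≤ eps n
    · rw [indicator_of_mem (by simpa using hh), indicator_of_mem (by simpa using hh)]
    · rw [indicator_of_notMem (by simpa using hh), indicator_of_notMem (by simpa using hh)]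
  unfold osc
  rw [e, mul_left_comm, ENNReal.ofReal_mul (by positivity), ← integral_const_mul]
  refine mul_le_mul_right ?_ _
  rw [ofReal_integral_eq_lintegral_ofReal (hi.abs.const_mul _) (Eventually.of_forall fun h => by positivity)]
  refine lintegral_mono_ae ((ae_restrict_iff' measurableSet_closedBall).2 ?_)
  filter_upwards [hb'] with h hh hm
  rw [mem_closedBall_zero_iff] at hm
  refine ENNReal.ofReal_le_ofReal ?_
  rw [← sq_abs, sq]
  exact mul_le_mul_of_nonneg_right (hh (hm.trans (eps_le_one n))) (abs_nonneg _)

theorem LinGrowth.aemeasurable_osc (hf : LinGrowth f B) (R s : ℝ) :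
    AEMeasurable (osc f s) (volume.restrict (ball 0 R)) :=
  (aemeasurable_diff_sq_restrict hf.1 R s).lintegral_prod_right'.const_mul _

theorem LinGrowth.lintegral_osc_le (hf : LinGrowth f B) (R : ℝ) {s : ℝ} (hs : 0 < s) (hs1 : s ≤ 1) :
    ∫⁻ x in ball (0 : Plane) R, osc f s x ≤
      ENNReal.ofReal (Real.pi * (2 * B * (2 + R)) ^ 2) * volume (ball (0 : Plane) R) := by
  rw [← setLIntegral_const]
  refine lintegral_mono_ae ((ae_restrict_iff' measurableSet_ball).2 ?_)
  filter_upwards [hf.osc_le (R := R)] with x hx hm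
  rw [mem_ball_zero_iff] at hm
  exact hx hm.le s hs hs1

theorem LinGrowth.tendsto_lintegral_osc (hf : LinGrowth f B) (R : ℝ) :
    Tendsto (fun n => ∫⁻ x in ball (0 : Plane) R, osc f (eps n) x) atTop (𝓝 0) := by
  have h := tendsto_lintegral_of_dominated_convergence' (μ := volume.restrict (ball (0 : Plane) R))
    (F := fun n => osc f (eps n)) (f := fun _ => 0)
    (fun _ => ENNReal.ofReal (Real.pi * (2 * B * (2 + R)) ^ 2))
    (fun n => hf.aemeasurable_osc R _) (fun n => ?_) ?_ (ae_restrict_of_ae hf.tendsto_osc)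
  · simpa using h
  · refine (ae_restrict_iff' measurableSet_ball).2 ?_
    filter_upwards [hf.osc_le (R := R)] with x hx hm
    rw [mem_ball_zero_iff] at hm
    exact hx hm.le _ (eps_pos n) (eps_le_one n)
  · rw [setLIntegral_const]
    exact ENNReal.mul_ne_top ENNReal.ofReal_ne_top measure_ball_lt_top.ne

end Osc

namespace Flow

variable {u : Plane → Plane} {ω f : Plane → ℝ} {W A B s : ℝ}

theorem linGrowth (hu : Flow u ω W A) (i : Fin 2) : LinGrowth (fun y => u y i) A :=
  ⟨hu.coord_meas i, hu.coord_growth i⟩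

theorem linGrowth_vort (hu : Flow u ω W A) : LinGrowth ω W :=
  ⟨hu.vort.1.aestronglyMeasurable, by
    filter_upwards [hu.bound] with x hx
    nlinarith [hu.W_nonneg, norm_nonneg x]⟩

theorem locallyIntegrable_mul (hu : Flow u ω W A) (hf : LinGrowth f B) (j : Fin 2) :
    LocallyIntegrable (fun y => u y j * f y) volume := by
  refine locallyIntegrable_of_growth ((hu.coord_meas j).mul hf.1)
    (by fun_prop : Continuous fun x : Plane => (A * (1 + ‖x‖)) * (B * (1 + ‖x‖))) ?_
  filter_upwards [hu.coord_growth j, hf.2] with x h1 h2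
  rw [abs_mul]
  exact mul_le_mul h1 h2 (abs_nonneg _) ((abs_nonneg _).trans h1)

/-- Subtracting values at `x` is free, since the derivatives of the mollifier have mean zero and `u`
is divergence-free. The commutator becomes bilinear in the increments. -/
theorem comm_eq (hu : Flow u ω W A) (hf : LinGrowth f B) (hs : 0 < s) (x : Plane) :
    comm u f s x = ∫ y, ∑ j, (f y - f x) * (u y j - u x j) * pd j (mols s) (x - y) := by
  have hη (j) := (isTest_mols hs).pd j
  have i1 (j) : Integrable (fun y => (u y j * f y) * pd j (mols s) (x - y)) volume :=
    integrable_cv_integrand (hu.locallyIntegrable_mul hf j) (hη j).continuous (hη j).2 x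
  have i2 (j) : Integrable (fun y => u y j * pd j (mols s) (x - y)) volume :=
    integrable_cv_integrand (hu.loc j) (hη j).continuous (hη j).2 x
  have i3 (j) : Integrable (fun y => f y * pd j (mols s) (x - y)) volume :=
    integrable_cv_integrand hf.locallyIntegrable (hη j).continuous (hη j).2 x
  have i4 (j) : Integrable (fun y => pd j (mols s) (x - y)) volume :=
    ((hη j).comp_sub_left x).integrable
  have e4 (j) : ∫ y, pd j (mols s) (x - y) = 0 := by
    rw [integral_sub_left_eq_self (fun y => pd j (mols s) y)]
    exact integral_pd_eq_zero (isTest_mols hs) j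
  have e2 : (∫ y, u y 0 * pd 0 (mols s) (x - y)) + ∫ y, u y 1 * pd 1 (mols s) (x - y) = 0 := by
    have := hu.div_cv (isTest_mols hs) x
    rwa [pd_cv (hu.loc 0) (isTest_mols hs), pd_cv (hu.loc 1) (isTest_mols hs)] at this
  have key (j) : Integrable (fun y => (f y - f x) * (u y j - u x j) * pd j (mols s) (x - y)) volume ∧
      ∫ y, (f y - f x) * (u y j - u x j) * pd j (mols s) (x - y) =
        (∫ y, (u y j * f y) * pd j (mols s) (x - y)) - f x * (∫ y, u y j * pd j (mols s) (x - y)) -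
          u x j * ∫ y, f y * pd j (mols s) (x - y) := by
    have a1 : Integrable (fun y => (u y j * f y) * pd j (mols s) (x - y) -
        f x * (u y j * pd j (mols s) (x - y))) volume := (i1 j).sub ((i2 j).const_mul _)
    have a2 : Integrable (fun y => (u y j * f y) * pd j (mols s) (x - y) -
        f x * (u y j * pd j (mols s) (x - y)) - u x j * (f y * pd j (mols s) (x - y))) volume :=
      a1.sub ((i3 j).const_mul _)
    have a3 : Integrable (fun y => (u y j * f y) * pd j (mols s) (x - y) -
        f x * (u y j * pd j (mols s) (x - y)) - u x j * (f y * pd j (mols s) (x - y)) +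
        (f x * u x j) * pd j (mols s) (x - y)) volume := a2.add ((i4 j).const_mul _)
    have e : (fun y => (f y - f x) * (u y j - u x j) * pd j (mols s) (x - y)) =
        fun y => (u y j * f y) * pd j (mols s) (x - y) -
        f x * (u y j * pd j (mols s) (x - y)) - u x j * (f y * pd j (mols s) (x - y)) +
        (f x * u x j) * pd j (mols s) (x - y) := by ext y; ring
    rw [e]
    refine ⟨a3, ?_⟩
    rw [integral_add a2 ((i4 j).const_mul _), integral_sub a1 ((i3 j).const_mul _),
      integral_sub (i1 j) ((i2 j).const_mul _), integral_const_mul, integral_const_mul,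
      integral_const_mul, e4, mul_zero, add_zero]
  rw [integral_finsetSum _ fun j _ => (key j).1, comm]
  simp only [(key _).2, Fin.sum_univ_two, pd_cv hf.locallyIntegrable (isTest_mols hs), cv_apply]
  linear_combination (f x) * e2

/-- Increments of `u` at scale `s` are `O(s)` in `L²`, while those of `f` merely tend to zero. The
inequality `|a| |b| ≤ (l/s) b² + (s/l) a²` separates the two, with `l` left free to balance them. -/
theorem enorm_comm_le (hu : Flow u ω W A) (hf : LinGrowth f B) (hs : 0 < s) {l : ℝ} (hl : 0 < l)
    (x : Plane) : ‖comm u f s x‖ₑ ≤ ∫⁻ h in closedBall (0 : Plane) s,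
      (ENNReal.ofReal (molBd * (s ^ 4)⁻¹ * l) * (ENNReal.ofReal ((u (x - h) 0 - u x 0) ^ 2) +
        ENNReal.ofReal ((u (x - h) 1 - u x 1) ^ 2)) +
      ENNReal.ofReal (2 * molBd * (s ^ 2)⁻¹ * l⁻¹) * ENNReal.ofReal ((f (x - h) - f x) ^ 2)) := by
  have hB := molBd_pos
  rw [hu.comm_eq hf hs]
  refine (enorm_integral_le_lintegral_enorm _).trans ?_
  rw [← lintegral_sub_left_eq_self _ x, ← lintegral_indicator measurableSet_closedBall]
  refine lintegral_mono fun h => ?_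
  simp only [sub_sub_cancel]
  by_cases hh : ‖h‖ ≤ s
  · rw [indicator_of_mem (by simpa using hh), ← ENNReal.ofReal_add (sq_nonneg _) (sq_nonneg _),
      ← ENNReal.ofReal_mul (by positivity), ← ENNReal.ofReal_mul (by positivity),
      ← ENNReal.ofReal_add (by positivity) (by positivity), ← ofReal_norm]
    refine ENNReal.ofReal_le_ofReal ?_
    rw [Fin.sum_univ_two, Real.norm_eq_abs]
    set a := f (x - h) - f x
    set b₀ := u (x - h) 0 - u x 0
    set b₁ := u (x - h) 1 - u x 1
    have k0 := abs_pd_mols_le hs 0 h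
    have k1 := abs_pd_mols_le hs 1 h
    have hab (b : ℝ) : |a| * |b| ≤ (l / s) * b ^ 2 + (s / l) * a ^ 2 := by
      have h1 : 0 ≤ (l / s) * (|b| - (s / l) * |a|) ^ 2 := by positivity
      have h2 : (l / s) * (|b| - (s / l) * |a|) ^ 2 =
          (l / s) * |b| ^ 2 - 2 * (|a| * |b|) + (s / l) * |a| ^ 2 := by
        field_simp
        ring
      rw [sq_abs, sq_abs] at h2
      have h3 : 0 ≤ |a| * |b| := by positivity
      linarith
    calc |a * b₀ * pd 0 (mols s) h + a * b₁ * pd 1 (mols s) h|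
        ≤ (|a| * |b₀|) * |pd 0 (mols s) h| + (|a| * |b₁|) * |pd 1 (mols s) h| := by
          refine (abs_add_le _ _).trans ?_
          simp only [abs_mul]; rfl
      _ ≤ ((l / s) * b₀ ^ 2 + (s / l) * a ^ 2) * (molBd * (s ^ 3)⁻¹) +
          ((l / s) * b₁ ^ 2 + (s / l) * a ^ 2) * (molBd * (s ^ 3)⁻¹) :=
          add_le_add (mul_le_mul (hab _) k0 (abs_nonneg _) (by positivity))
            (mul_le_mul (hab _) k1 (abs_nonneg _) (by positivity))
      _ = _ := by field_simp; ring
  · rw [indicator_of_notMem (by simpa using hh)]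
    have h0 := fun j => pd_mols_eq_zero hs j (not_le.1 hh).le
    simp [h0]

theorem lintegral_lintegral_diff_sq_le (hu : Flow u ω W A) (hs : 0 < s) (hs1 : s ≤ 1)
    {R : ℝ} (hR : 1 ≤ R) (j : Fin 2) :
    ∫⁻ x in ball (0 : Plane) R, ∫⁻ h in closedBall (0 : Plane) s,
      ENNReal.ofReal ((u (x - h) j - u x j) ^ 2) ≤
      ENNReal.ofReal (s ^ 4 * Real.pi * (2 * gradBd W A (R + 1))) := by
  have hG : 0 ≤ gradBd W A (R + 1) := gradBd_nonneg
  rw [lintegral_lintegral_swap (aemeasurable_diff_sq_restrict (hu.coord_meas j) R s)]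
  calc _ ≤ ∫⁻ h in closedBall (0 : Plane) s, ENNReal.ofReal (s ^ 2 * (2 * gradBd W A (R + 1))) := by
        refine setLIntegral_mono' measurableSet_closedBall fun h hh => ?_
        rw [mem_closedBall_zero_iff] at hh
        refine (hu.lintegral_diff_sq_le hR (hh.trans hs1) j).trans (ENNReal.ofReal_le_ofReal ?_)
        gcongr
    _ = _ := by
        have hv : volume (closedBall (0 : Plane) s) = ENNReal.ofReal (s ^ 2 * Real.pi) := by
          rw [← volume_closedBall_plane 0 hs.le, Measure.real, ENNReal.ofReal_toReal]
          exact measure_closedBall_lt_top.ne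
        rw [setLIntegral_const, hv, ← ENNReal.ofReal_mul (by positivity)]
        congr 1; ring

theorem lintegral_quadratic_split {X Y : Type*} [MeasurableSpace X]
    [MeasurableSpace Y] {μ : Measure X} {ν : Measure Y} [SFinite μ] [SFinite ν]
    {a b c : X × Y → ℝ≥0∞} (ha : AEMeasurable a (μ.prod ν)) (hb : AEMeasurable b (μ.prod ν))
    (hc : AEMeasurable c (μ.prod ν)) (p q : ℝ≥0∞) :
    ∫⁻ x, ∫⁻ y, (p * (a (x, y) + b (x, y)) + q * c (x, y)) ∂ν ∂μ =
      p * ((∫⁻ x, ∫⁻ y, a (x, y) ∂ν ∂μ) + ∫⁻ x, ∫⁻ y, b (x, y) ∂ν ∂μ) +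
        q * ∫⁻ x, ∫⁻ y, c (x, y) ∂ν ∂μ := by
  have hab : AEMeasurable (fun z => a z + b z) (μ.prod ν) := ha.add hb
  have hpab : AEMeasurable (fun z => p * (a z + b z)) (μ.prod ν) := hab.const_mul p
  have hall : AEMeasurable (fun z => p * (a z + b z) + q * c z) (μ.prod ν) :=
    hpab.add (hc.const_mul q)
  rw [← lintegral_prod _ hall, ← lintegral_prod _ ha, ← lintegral_prod _ hb, ← lintegral_prod _ hc,
    lintegral_add_left' hpab, lintegral_const_mul'' _ hab, lintegral_const_mul'' _ hc,
    lintegral_add_left' ha]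

/-- The contribution of `u` is proportional to `l` uniformly in the scale; that of `f` is `l⁻¹`
times an oscillation that vanishes with the scale. -/
theorem lintegral_comm_le_aux (hu : Flow u ω W A) (hf : LinGrowth f B) (hs : 0 < s) (hs1 : s ≤ 1)
    {l R : ℝ} (hl : 0 < l) (hR : 1 ≤ R) : ∫⁻ x in ball (0 : Plane) R, ‖comm u f s x‖ₑ ≤
      ENNReal.ofReal (l * (4 * molBd * Real.pi * gradBd W A (R + 1))) +
        ENNReal.ofReal (2 * molBd * l⁻¹) * ∫⁻ x in ball (0 : Plane) R, osc f s x := by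
  have hB := molBd_pos
  have hG : 0 ≤ gradBd W A (R + 1) := gradBd_nonneg
  refine (lintegral_mono fun x => hu.enorm_comm_le hf hs hl x).trans ?_
  have h := lintegral_quadratic_split (aemeasurable_diff_sq_restrict (hu.coord_meas 0) R s)
    (aemeasurable_diff_sq_restrict (hu.coord_meas 1) R s) (aemeasurable_diff_sq_restrict hf.1 R s)
    (ENNReal.ofReal (molBd * (s ^ 4)⁻¹ * l)) (ENNReal.ofReal (2 * molBd * (s ^ 2)⁻¹ * l⁻¹))
  refine h.le.trans ?_
  dsimp only
  rw [lintegral_osc_eq hf.1, ← mul_assoc (ENNReal.ofReal (2 * molBd * (s ^ 2)⁻¹ * l⁻¹)),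
    ← ENNReal.ofReal_mul (by positivity)]
  have e2 : 2 * molBd * (s ^ 2)⁻¹ * l⁻¹ * s ^ 2 = 2 * molBd * l⁻¹ := by field_simp
  rw [e2]
  refine add_le_add_left ?_ _
  refine (mul_le_mul_right (add_le_add (hu.lintegral_lintegral_diff_sq_le hs hs1 hR 0)
    (hu.lintegral_lintegral_diff_sq_le hs hs1 hR 1)) _).trans ?_
  rw [← ENNReal.ofReal_add (by positivity) (by positivity), ← ENNReal.ofReal_mul (by positivity)]
  refine ENNReal.ofReal_le_ofReal (le_of_eq ?_)
  field_simp
  ring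

/-- A uniform bound for the mean of the commutator on a ball. -/
def commBd (W A B R : ℝ) : ℝ :=
  4 * molBd * Real.pi * gradBd W A (R + 1) +
    2 * molBd * (Real.pi * (2 * B * (2 + R)) ^ 2 * (R ^ 2 * Real.pi))

theorem lintegral_comm_le (hu : Flow u ω W A) (hf : LinGrowth f B) (hs : 0 < s) (hs1 : s ≤ 1)
    {R : ℝ} (hR : 1 ≤ R) : ∫⁻ x in ball (0 : Plane) R, ‖comm u f s x‖ₑ ≤
      ENNReal.ofReal (commBd W A B R) := by
  have hB := molBd_pos
  have hG : 0 ≤ gradBd W A (R + 1) := gradBd_nonneg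
  have hpi := Real.pi_pos
  refine (hu.lintegral_comm_le_aux hf hs hs1 one_pos hR).trans ?_
  rw [commBd, ENNReal.ofReal_add (by positivity) (by positivity), one_mul,
    inv_one, mul_one, ENNReal.ofReal_mul (p := 2 * molBd) (by positivity)]
  have hv : volume (ball (0 : Plane) R) ≤ ENNReal.ofReal (R ^ 2 * Real.pi) := by
    refine (measure_mono ball_subset_closedBall).trans_eq ?_
    rw [← volume_closedBall_plane (0 : Plane) (by linarith), Measure.real, ENNReal.ofReal_toReal]
    exact measure_closedBall_lt_top.ne
  refine add_le_add_right (mul_le_mul_right ((hf.lintegral_osc_le R hs hs1).trans ?_) _) _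
  refine (mul_le_mul_right hv _).trans_eq ?_
  rw [← ENNReal.ofReal_mul (by positivity)]

/-- First `l` is fixed small, then the scale tends to zero. This is the DiPerna–Lions lemma, in a
form that needs only an `L²` bound on the increments of `u`. -/
theorem tendsto_lintegral_comm (hu : Flow u ω W A) (hf : LinGrowth f B) {R : ℝ} (hR : 1 ≤ R) :
    Tendsto (fun n => ∫⁻ x in ball (0 : Plane) R, ‖comm u f (eps n) x‖ₑ) atTop (𝓝 0) := by
  have hB := molBd_pos
  have hG : 0 ≤ gradBd W A (R + 1) := gradBd_nonneg
  have hpi := Real.pi_pos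
  rw [ENNReal.tendsto_nhds_zero]
  intro ε hε
  set D := 4 * molBd * Real.pi * gradBd W A (R + 1) with hD
  have hD0 : 0 ≤ D := by positivity
  obtain ⟨δ, hδ0, hδ⟩ : ∃ δ : ℝ, 0 < δ ∧ ENNReal.ofReal δ ≤ ε := by
    rcases eq_or_ne ε ∞ with h | h
    · exact ⟨1, one_pos, h ▸ le_top⟩
    · exact ⟨ε.toReal, ENNReal.toReal_pos hε.ne' h, (ENNReal.ofReal_toReal h).le⟩
  set l := δ / (2 * (D + 1)) with hl
  have hl0 : 0 < l := by positivity
  have ho : Tendsto (fun n => ENNReal.ofReal (2 * molBd * l⁻¹) *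
      ∫⁻ x in ball (0 : Plane) R, osc f (eps n) x) atTop (𝓝 0) := by
    have := ENNReal.Tendsto.const_mul (a := ENNReal.ofReal (2 * molBd * l⁻¹))
      (hf.tendsto_lintegral_osc R) (Or.inr ENNReal.ofReal_ne_top)
    simpa using this
  have hδ2 : (0 : ℝ≥0∞) < ENNReal.ofReal (δ / 2) := by simpa using hδ0
  filter_upwards [ENNReal.tendsto_nhds_zero.1 ho _ hδ2] with n hn
  refine (hu.lintegral_comm_le_aux hf (eps_pos n) (eps_le_one n) hl0 hR).trans
    (le_trans ?_ hδ)
  refine (add_le_add (ENNReal.ofReal_le_ofReal (q := δ / 2) ?_) hn).trans_eq ?_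
  · rw [hl, div_mul_eq_mul_div, div_le_iff₀ (by positivity)]
    nlinarith
  · rw [← ENNReal.ofReal_add (by positivity) (by positivity)]
    congr 1; ring

end Flow

/-! ### Renormalization -/

/-- The chain rule in time at fixed `x`, integrated against `χ` by Fubini. -/
theorem renormalized {v F : ℝ → Plane → ℝ} {v₀ χ : Plane → ℝ} {β : ℝ → ℝ} {C T t : ℝ}
    (hF : StronglyMeasurable (Function.uncurry F)) (hC : ∀ t x, |F t x| ≤ C * (1 + ‖x‖) ^ 3)
    (hv₀ : Continuous v₀) (hβ : ContDiff ℝ (⊤ : ℕ∞) β) (hχ : IsTest χ)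
    (hev : ∀ᵐ s, s ∈ Ioo 0 T → ∀ x, v s x = v₀ x + ∫ r in (0 : ℝ)..s, F r x) (ht : t ∈ Ioo 0 T)
    (hvt : ∀ x, v t x = v₀ x + ∫ r in (0 : ℝ)..t, F r x) :
    IntegrableOn (fun s => ∫ x, χ x * (deriv β (v s x) * F s x)) (Ioc 0 t) volume ∧
    (∫ x, χ x * β (v t x)) - ∫ x, χ x * β (v₀ x) =
      ∫ s in (0 : ℝ)..t, ∫ x, χ x * (deriv β (v s x) * F s x) := by
  -- The primitive is defined at every time and jointly measurable, whereas `v` agrees with it only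
  -- at almost every time.
  set q : ℝ → Plane → ℝ := fun s x => v₀ x + ∫ r in (0 : ℝ)..s, F r x with hq
  have hFx (x : Plane) : StronglyMeasurable fun s => F s x := stronglyMeasurable_slice hF x
  have hqL (x : Plane) : LipschitzWith (C * (1 + ‖x‖) ^ 3).toNNReal fun s => q s x :=
    lipschitzWith_primitive (hFx x) (fun s => hC s x) (v₀ x)
  have hqm : StronglyMeasurable (Function.uncurry q) := by
    refine stronglyMeasurable_uncurry_of_continuous_of_stronglyMeasurable
      (fun x => (hqL x).continuous) fun s => ?_
    refine hv₀.stronglyMeasurable.add ?_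
    have hsw : StronglyMeasurable (Function.uncurry fun x r => F r x) :=
      hF.comp_measurable measurable_swap
    simp only [intervalIntegral]
    exact hsw.integral_prod_right.sub hsw.integral_prod_right
  have hdβ : Continuous (deriv β) := hβ.continuous_deriv (by simp)
  obtain ⟨R, hR1, hR⟩ := hχ.exists_radius
  obtain ⟨V, hV⟩ := (isCompact_closedBall (0 : Plane) R).exists_bound_of_continuousOn hv₀.continuousOn
  have hC0 : 0 ≤ C := by
    have := (abs_nonneg _).trans (hC 0 0)
    simpa using this
  have hqb : ∀ s ∈ Ioc 0 t, ∀ x, ‖x‖ ≤ R → q s x ∈ Icc (-(V + C * (1 + R) ^ 3 * t)) (V + C * (1 + R) ^ 3 * t) := by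
    intro s hs x hx
    rw [mem_Icc, ← abs_le]
    refine (abs_add_le _ _).trans (add_le_add (hV x (by simpa using hx)) ?_)
    have h1 := intervalIntegral.norm_integral_le_of_norm_le_const (f := fun r => F r x) (a := 0) (b := s)
      (C := C * (1 + ‖x‖) ^ 3) fun r _ => hC r x
    refine h1.trans ?_
    rw [sub_zero, abs_of_pos hs.1]
    have hs2 := hs.2
    have hs0 := hs.1.le
    gcongr
  obtain ⟨D, hD⟩ := (isCompact_Icc (a := -(V + C * (1 + R) ^ 3 * t))
    (b := V + C * (1 + R) ^ 3 * t)).exists_bound_of_continuousOn hdβ.continuousOn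
  have hch (x : Plane) : β (q t x) - β (v₀ x) = ∫ s in Ioc 0 t, deriv β (q s x) * F s x := by
    rw [← intervalIntegral.integral_of_le ht.1.le]
    exact comp_primitive_sub (hFx x) (fun s => hC s x) (hβ.of_le (by exact_mod_cast le_top)) (v₀ x) t
  have hint : Integrable (fun p : Plane × ℝ => χ p.1 * (deriv β (q p.2 p.1) * F p.2 p.1))
      (volume.prod (volume.restrict (Ioc 0 t))) := by
    have hfin : IsFiniteMeasure (volume.restrict (Ioc 0 t)) := inferInstance
    have hb : Integrable (fun p : Plane × ℝ => D * (C * (1 + R) ^ 3) * |χ p.1|)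
        (volume.prod (volume.restrict (Ioc 0 t))) :=
      ((hχ.integrable.abs).const_mul _).comp_fst _
    refine hb.mono' ?_ ?_
    · have m1 : StronglyMeasurable fun p : Plane × ℝ => q p.2 p.1 := hqm.comp_measurable measurable_swap
      have m2 : StronglyMeasurable fun p : Plane × ℝ => F p.2 p.1 := hF.comp_measurable measurable_swap
      have m3 : Continuous fun p : Plane × ℝ => χ p.1 := hχ.continuous.comp continuous_fst
      exact (m3.stronglyMeasurable.mul ((hdβ.comp_stronglyMeasurable m1).mul m2)).aestronglyMeasurable
    · have hae : ∀ᵐ p : Plane × ℝ ∂(volume.prod (volume.restrict (Ioc 0 t))), p.2 ∈ Ioc 0 t :=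
        Measure.quasiMeasurePreserving_snd.ae (ae_restrict_mem measurableSet_Ioc)
      filter_upwards [hae] with p hp
      rcases le_or_gt R ‖p.1‖ with h | h
      · rw [hR _ h]; simp
      · rw [norm_mul, norm_mul, mul_comm, Real.norm_eq_abs (χ p.1)]
        have h1 := hD _ (hqb p.2 hp p.1 h.le)
        have h2 : ‖F p.2 p.1‖ ≤ C * (1 + R) ^ 3 := (hC p.2 p.1).trans (by gcongr)
        have hD0 : 0 ≤ D := (norm_nonneg _).trans h1
        gcongr
  have hswap := integral_integral_swap (f := fun x s => χ x * (deriv β (q s x) * F s x)) hint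
  have hvq : ∀ x, v t x = q t x := hvt
  have i0 : Integrable (fun x => χ x * β (v₀ x)) volume := by
    have hc : Continuous fun x => χ x * β (v₀ x) := hχ.continuous.mul (hβ.continuous.comp hv₀)
    exact hc.integrable_of_hasCompactSupport hχ.2.mul_right
  have e1 (x : Plane) : χ x * β (v t x) = χ x * β (v₀ x) +
      ∫ s in Ioc 0 t, χ x * (deriv β (q s x) * F s x) := by
    rw [integral_const_mul, ← hch, hvq]; ring
  have hae : (fun s => ∫ x, χ x * (deriv β (q s x) * F s x)) =ᵐ[volume.restrict (Ioc 0 t)]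
      fun s => ∫ x, χ x * (deriv β (v s x) * F s x) := by
    refine (ae_restrict_iff' measurableSet_Ioc).2 ?_
    filter_upwards [hev] with s hs hst
    refine integral_congr_ae (Eventually.of_forall fun x => ?_)
    simp only
    rw [hs ⟨hst.1, hst.2.trans_lt ht.2⟩ x]
  refine ⟨hint.integral_prod_right.congr hae, ?_⟩
  simp only [e1]
  rw [integral_add i0 hint.integral_prod_left, add_sub_cancel_left, hswap,
    intervalIntegral.integral_of_le ht.1.le]
  exact integral_congr_ae hae

/-! ### The vorticity flux -/

theorem integral_transport_smooth {v : Fin 2 → Plane → ℝ} (hv : ∀ k, ContDiff ℝ (⊤ : ℕ∞) (v k))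
    (hd : ∀ x, pd 0 (v 0) x + pd 1 (v 1) x = 0) {f Ψ : Plane → ℝ} (hf : ContDiff ℝ (⊤ : ℕ∞) f)
    (hΨ : IsTest Ψ) : (∫ x, v 0 x * f x * pd 0 Ψ x) + ∫ x, v 1 x * f x * pd 1 Ψ x =
      - ∫ x, (v 0 x * pd 0 f x + v 1 x * pd 1 f x) * Ψ x := by
  have e (j : Fin 2) := integral_mul_pd (f := fun x => v j x * f x) ((hv j).mul hf)
    hΨ.1 (Or.inr hΨ.2) j
  have i (j : Fin 2) : Integrable (fun x => pd j (fun x => v j x * f x) x * Ψ x) volume :=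
    (hΨ.mul_left (contDiff_pd ((hv j).mul hf) j)).integrable
  rw [e 0, e 1, ← neg_add, ← integral_add (i 0) (i 1), neg_inj]
  refine integral_congr_ae (Eventually.of_forall fun x => ?_)
  have hdv (k : Fin 2) : DifferentiableAt ℝ (v k) x := (hv k).differentiable (by simp) x
  have hdf : DifferentiableAt ℝ f x := hf.differentiable (by simp) x
  simp only
  rw [pd_mul 0 (hdv 0) hdf, pd_mul 1 (hdv 1) hdf]
  linear_combination (f x * Ψ x) * hd x

/-- In the plane the curl of `div (v ⊗ v)` is `div (v ζ)` with `ζ` the curl of `v`: the remaining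
term is `ζ div v = 0`. -/
theorem integral_curl_flux_smooth {v : Fin 2 → Plane → ℝ} (hv : ∀ k, ContDiff ℝ (⊤ : ℕ∞) (v k))
    (hd : ∀ x, pd 0 (v 0) x + pd 1 (v 1) x = 0) {g : Plane → ℝ} (hg : IsTest g) :
    ((∫ x, v 0 x * v 1 x * pd 0 (pd 0 g) x) + ∫ x, v 1 x * v 1 x * pd 1 (pd 0 g) x) -
      ((∫ x, v 0 x * v 0 x * pd 0 (pd 1 g) x) + ∫ x, v 1 x * v 0 x * pd 1 (pd 1 g) x) =
    -((∫ x, v 0 x * (pd 0 (v 1) x - pd 1 (v 0) x) * pd 0 g x) +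
      ∫ x, v 1 x * (pd 0 (v 1) x - pd 1 (v 0) x) * pd 1 g x) := by
  set ζ : Plane → ℝ := fun x => pd 0 (v 1) x - pd 1 (v 0) x with hζ
  have hζs : ContDiff ℝ (⊤ : ℕ∞) ζ := (contDiff_pd (hv 1) 0).sub (contDiff_pd (hv 0) 1)
  set D : Fin 2 → Plane → ℝ := fun k x => v 0 x * pd 0 (v k) x + v 1 x * pd 1 (v k) x with hD
  have hDs (k) : ContDiff ℝ (⊤ : ℕ∞) (D k) :=
    ((hv 0).mul (contDiff_pd (hv k) 0)).add ((hv 1).mul (contDiff_pd (hv k) 1))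
  rw [integral_transport_smooth hv hd (hv 1) (hg.pd 0), integral_transport_smooth hv hd (hv 0) (hg.pd 1),
    integral_transport_smooth hv hd hζs hg]
  have e1 := integral_mul_pd (hDs 1) hg.1 (Or.inr hg.2) 0
  have e0 := integral_mul_pd (hDs 0) hg.1 (Or.inr hg.2) 1
  have i1 : Integrable (fun x => pd 0 (D 1) x * g x) volume :=
    (hg.mul_left (contDiff_pd (hDs 1) 0)).integrable
  have i0 : Integrable (fun x => pd 1 (D 0) x * g x) volume :=
    (hg.mul_left (contDiff_pd (hDs 0) 1)).integrable
  simp only [hD] at e0 e1 i0 i1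
  rw [e0, e1, neg_neg, neg_neg, neg_neg, ← integral_sub i1 i0]
  refine integral_congr_ae (Eventually.of_forall fun x => ?_)
  have hdv (k : Fin 2) : DifferentiableAt ℝ (v k) x := (hv k).differentiable (by simp) x
  have hdp (j k : Fin 2) : DifferentiableAt ℝ (pd j (v k)) x :=
    (contDiff_pd (hv k) j).differentiable (by simp) x
  have t (j k : Fin 2) : DifferentiableAt ℝ (fun x => v j x * pd j (v k) x) x := (hdv j).mul (hdp j k)
  simp only [hζ]
  rw [pd_add 0 (t 0 1) (t 1 1), pd_add 1 (t 0 0) (t 1 0), pd_mul 0 (hdv 0) (hdp 0 1),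
    pd_mul 0 (hdv 1) (hdp 1 1), pd_mul 1 (hdv 0) (hdp 0 0), pd_mul 1 (hdv 1) (hdp 1 0),
    pd_sub 0 (hdp 0 1) (hdp 1 0), pd_sub 1 (hdp 0 1) (hdp 1 0), pd_comm (hv 1) 1 0, pd_comm (hv 0) 1 0]
  linear_combination (g x * (pd 0 (v 1) x - pd 1 (v 0) x)) * hd x

namespace Flow

variable {u : Plane → Plane} {ω : Plane → ℝ} {W A s : ℝ}

theorem tendsto_integral_smo_vort_mul (hu : Flow u ω W A) (j : Fin 2) {φ : Plane → ℝ}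
    (hφ : IsTest φ) : Tendsto (fun n => ∫ x, smo u (eps n) j x * (pd 0 (smo u (eps n) 1) x -
      pd 1 (smo u (eps n) 0) x) * φ x) atTop (𝓝 (∫ x, u x j * ω x * φ x)) := by
  have hW := hu.W_nonneg
  refine tendsto_integral_of_dominated_convergence (fun x => (A * (2 + ‖x‖)) * W * |φ x|)
    (fun n => ?_) ?_ (fun n => Eventually.of_forall fun x => ?_) ?_
  · exact (((hu.contDiff_smo (eps_pos n) j).continuous.mul
      ((contDiff_pd (hu.contDiff_smo (eps_pos n) 1) 0).continuous.sub
        (contDiff_pd (hu.contDiff_smo (eps_pos n) 0) 1).continuous)).mul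
          hφ.continuous).aestronglyMeasurable
  · have hc : Continuous fun x => (A * (2 + ‖x‖)) * W * |φ x| := by
      have := hφ.continuous
      fun_prop
    exact hc.integrable_of_hasCompactSupport (hφ.2.abs.mul_left)
  · have h : |smo u (eps n) j x| ≤ A * (2 + ‖x‖) :=
      (hu.abs_smo_le (eps_pos n) j x).trans
        (mul_le_mul_of_nonneg_left (by linarith [eps_le_one n]) hu.A_nonneg)
    rw [norm_mul, norm_mul, hu.curl_smo (eps_pos n)]
    exact mul_le_mul_of_nonneg_right (mul_le_mul h (hu.abs_cv_vort_le (eps_pos n) x) (abs_nonneg _)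
      ((abs_nonneg _).trans h)) (abs_nonneg _)
  · filter_upwards [hu.ae_tendsto_smo j, ae_tendsto_cv_mols hu.vort.1] with x h1 h2
    simp only [hu.curl_smo (eps_pos _)]
    exact (h1.mul (h2.comp tendsto_eps_within)).mul_const _

theorem integral_curl_flux (hu : Flow u ω W A) {g : Plane → ℝ} (hg : IsTest g) :
    ((∫ x, u x 0 * u x 1 * pd 0 (pd 0 g) x) + ∫ x, u x 1 * u x 1 * pd 1 (pd 0 g) x) -
      ((∫ x, u x 0 * u x 0 * pd 0 (pd 1 g) x) + ∫ x, u x 1 * u x 0 * pd 1 (pd 1 g) x) =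
    -((∫ x, u x 0 * ω x * pd 0 g x) + ∫ x, u x 1 * ω x * pd 1 g x) := by
  have l1 := (((hu.tendsto_integral_smo_smo_mul 0 1 ((hg.pd 0).pd 0)).add
    (hu.tendsto_integral_smo_smo_mul 1 1 ((hg.pd 0).pd 1))).sub
    ((hu.tendsto_integral_smo_smo_mul 0 0 ((hg.pd 1).pd 0)).add
    (hu.tendsto_integral_smo_smo_mul 1 0 ((hg.pd 1).pd 1))))
  have l2 := ((hu.tendsto_integral_smo_vort_mul 0 (hg.pd 0)).add
    (hu.tendsto_integral_smo_vort_mul 1 (hg.pd 1))).neg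
  refine tendsto_nhds_unique l1 (l2.congr fun n => ?_)
  exact (integral_curl_flux_smooth (fun k => hu.contDiff_smo (eps_pos n) k)
    (hu.div_smo (eps_pos n)) hg).symm

theorem cv_curl_flux (hu : Flow u ω W A) {η : Plane → ℝ} (hη : IsTest η) (x : Plane) :
    (∑ j, cv (fun y => u y j * u y 1) (pd j (pd 0 η)) x) -
      ∑ j, cv (fun y => u y j * u y 0) (pd j (pd 1 η)) x =
      ∑ j, cv (fun y => u y j * ω y) (pd j η) x := by
  have h := hu.integral_curl_flux (hη.comp_sub_left x)
  have h1 (k : Fin 2) : (pd k fun y => η (x - y)) = fun y => - pd k η (x - y) :=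
    funext fun y => pd_comp_sub_left k x
  have h2 (j k : Fin 2) (y : Plane) : pd j (pd k fun y => η (x - y)) y = pd j (pd k η) (x - y) := by
    rw [h1, pd_neg, pd_comp_sub_left, neg_neg]
  simp only [h2] at h
  simp only [h1, mul_neg, integral_neg] at h
  simp only [Fin.sum_univ_two, cv_apply]
  linarith

/-- The pressure cancels in the vorticity equation. -/
theorem force_curl (hu : Flow u ω W A) {θ : Plane → ℝ} (hθ : IsCutoff θ) (hs : 0 < s) (x : Plane) :
    force θ (pd 0 (mols s)) 1 u x - force θ (pd 1 (mols s)) 0 u x =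
      -(u x 0 * pd 0 (cv ω (mols s)) x + u x 1 * pd 1 (cv ω (mols s)) x) - comm u ω s x := by
  have h := hu.cv_curl_flux (isTest_mols hs) x
  simp only [force, hθ.presKer_curl (isTest_mols hs), comm, Fin.sum_univ_two] at h ⊢
  linarith

theorem force_component {θ : Plane → ℝ} (i : Fin 2) (s : ℝ) (x : Plane) :
    force θ (mols s) i u x =
      -(u x 0 * pd 0 (smo u s i) x + u x 1 * pd 1 (smo u s i) x) - comm u (fun y => u y i) s x -
        ∑ j, ∑ k, cv (fun y => u y j * u y k) (presKer θ 1 (mols s) i j k) x := by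
  simp only [force, comm, Fin.sum_univ_two, smo]
  ring

end Flow

/-! ### The vorticity is transported -/

namespace Flow

variable {u : Plane → Plane} {ω f : Plane → ℝ} {W A B s : ℝ}

theorem integrable_mul_test (hu : Flow u ω W A) (j : Fin 2) {φ : Plane → ℝ} (hφ : IsTest φ) :
    Integrable (fun x => u x j * φ x) volume :=
  Yudovich.integrable_mul_test (hu.loc j) hφ

/-- No derivative falls on `u`: its weak divergence condition is tested with `χ β(v)`. -/
theorem integral_transport (hu : Flow u ω W A) {v χ : Plane → ℝ} (hv : ContDiff ℝ (⊤ : ℕ∞) v)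
    (hχ : IsTest χ) {β : ℝ → ℝ} (hβ : ContDiff ℝ (⊤ : ℕ∞) β) :
    Integrable (fun x => χ x * (deriv β (v x) * (u x 0 * pd 0 v x + u x 1 * pd 1 v x))) volume ∧
    ∫ x, χ x * (deriv β (v x) * (u x 0 * pd 0 v x + u x 1 * pd 1 v x)) =
      -∫ x, (u x 0 * pd 0 χ x + u x 1 * pd 1 χ x) * β (v x) := by
  have hβv : ContDiff ℝ (⊤ : ℕ∞) fun x => β (v x) := hβ.comp hv
  have hφ : IsTest fun x => χ x * β (v x) := hχ.mul_right hβv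
  have h := hu.divFree.integral_eq hu.loc hφ
  have hdv (x : Plane) : DifferentiableAt ℝ v x := hv.differentiable (by simp) x
  have hdβ (y : ℝ) : DifferentiableAt ℝ β y := hβ.differentiable (by simp) y
  have e (j : Fin 2) (x : Plane) : pd j (fun x => χ x * β (v x)) x =
      pd j χ x * β (v x) + χ x * (deriv β (v x) * pd j v x) := by
    rw [pd_mul j (hχ.differentiable x) (hβv.differentiable (by simp) x), pd_scomp j (hdβ _) (hdv x)]
    ring
  have hb (j : Fin 2) : Integrable (fun x => u x j * (pd j χ x * β (v x))) volume :=
    hu.integrable_mul_test j ((hχ.pd j).mul_right hβv)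
  have hdβ' : ContDiff ℝ (⊤ : ℕ∞) (deriv β) := by
    exact contDiff_infty_iff_deriv.1 hβ |>.2
  have hc (j : Fin 2) : Integrable (fun x => u x j * (χ x * (deriv β (v x) * pd j v x))) volume :=
    hu.integrable_mul_test j (hχ.mul_right ((hdβ'.comp hv).mul (contDiff_pd hv j)))
  simp only [e, mul_add] at h
  rw [integral_add (hb 0) (hc 0), integral_add (hb 1) (hc 1)] at h
  have e1 : (fun x => χ x * (deriv β (v x) * (u x 0 * pd 0 v x + u x 1 * pd 1 v x))) =
      fun x => u x 0 * (χ x * (deriv β (v x) * pd 0 v x)) +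
        u x 1 * (χ x * (deriv β (v x) * pd 1 v x)) := funext fun x => by ring
  have e2 : (fun x => (u x 0 * pd 0 χ x + u x 1 * pd 1 χ x) * β (v x)) =
      fun x => u x 0 * (pd 0 χ x * β (v x)) + u x 1 * (pd 1 χ x * β (v x)) :=
    funext fun x => by ring
  rw [e1, e2, integral_add (hb 0) (hb 1)]
  refine ⟨(hc 0).add (hc 1), ?_⟩
  rw [integral_add (hc 0) (hc 1)]
  linarith

theorem enorm_integral_mul_comm_le {g : Plane → ℝ} {D R : ℝ} (hg : ∀ x, |g x| ≤ D)
    (hgR : ∀ x, R ≤ ‖x‖ → g x = 0) :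
    ‖∫ x, g x * comm u f s x‖ₑ ≤
      ENNReal.ofReal D * ∫⁻ x in ball (0 : Plane) R, ‖comm u f s x‖ₑ := by
  refine (enorm_integral_le_lintegral_enorm _).trans ?_
  rw [← lintegral_const_mul' _ _ ENNReal.ofReal_ne_top, ← lintegral_indicator measurableSet_ball]
  refine lintegral_mono fun x => ?_
  by_cases hx : x ∈ ball (0 : Plane) R
  · rw [indicator_of_mem hx, enorm_mul]
    refine mul_le_mul' ?_ le_rfl
    rw [Real.enorm_eq_ofReal_abs]
    exact ENNReal.ofReal_le_ofReal (hg x)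
  · rw [hgR x (by simpa using hx)]
    simp

end Flow

theorem tendsto_integral_mul_comp {v : ℕ → Plane → ℝ} {w φ : Plane → ℝ} {β : ℝ → ℝ} {a R : ℝ}
    (hβ : Continuous β) (hφ : Integrable φ volume) (hφR : ∀ x, R ≤ ‖x‖ → φ x = 0)
    (hv : ∀ n, Continuous (v n)) (ha : ∀ n x, ‖x‖ ≤ R → |v n x| ≤ a)
    (hvw : ∀ᵐ x, Tendsto (fun n => v n x) atTop (𝓝 (w x))) :
    Tendsto (fun n => ∫ x, φ x * β (v n x)) atTop (𝓝 (∫ x, φ x * β (w x))) := by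
  obtain ⟨D, hD⟩ := (isCompact_Icc (a := -a) (b := a)).exists_bound_of_continuousOn hβ.continuousOn
  refine tendsto_integral_of_dominated_convergence (fun x => |φ x| * D)
    (fun n => hφ.1.mul (hβ.comp (hv n)).aestronglyMeasurable) (hφ.abs.mul_const _)
    (fun n => Eventually.of_forall fun x => ?_) ?_
  · rw [norm_mul]
    rcases le_or_gt R ‖x‖ with h | h
    · simp [hφR x h]
    · exact mul_le_mul_of_nonneg_left (hD _ (abs_le.1 (ha n x h.le))) (abs_nonneg _)
  · filter_upwards [hvw] with x hx
    exact ((hβ.tendsto _).comp hx).const_mul _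

theorem abs_integral_mul_le {φ g : Plane → ℝ} {D R : ℝ} (hφ : Integrable φ volume)
    (hφR : ∀ x, R ≤ ‖x‖ → φ x = 0) (hg : ∀ x, ‖x‖ ≤ R → |g x| ≤ D) :
    |∫ x, φ x * g x| ≤ (∫ x, |φ x|) * D := by
  rw [← integral_mul_const]
  refine norm_integral_le_of_norm_le (f := fun x => φ x * g x) (hφ.abs.mul_const _)
    (Eventually.of_forall fun x => ?_)
  rw [norm_mul]
  rcases le_or_gt R ‖x‖ with h | h
  · simp [hφR x h]
  · exact mul_le_mul_of_nonneg_left (hg x h.le) (abs_nonneg _)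

theorem Evolves.curl {α W m T : ℝ} {u : ℝ → Plane → Plane} {ω : ℝ → Plane → ℝ}
    {θ : Plane → ℝ} {u₀ : Plane → Plane} {ω₀ : Plane → ℝ} {W₀ A₀ s : ℝ}
    (hev : Evolves θ u₀ T u) (hu : FlowFamily α W m u ω) (hθ : IsCutoff θ)
    (h₀ : Flow u₀ ω₀ W₀ A₀) (hs : 0 < s) : ∀ᵐ t, t ∈ Ioo 0 T → ∀ x,
      cv (ω t) (mols s) x = cv ω₀ (mols s) x + ∫ r in (0 : ℝ)..t,
        (force θ (pd 0 (mols s)) 1 (u r) x - force θ (pd 1 (mols s)) 0 (u r) x) := by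
  have hm := isTest_mols hs
  filter_upwards [hev _ (hm.pd 0) 1, hev _ (hm.pd 1) 0] with t h1 h2 ht x
  have c {v : Plane → Plane} {ζ : Plane → ℝ} {V B : ℝ} (hv : Flow v ζ V B) :
      cv ζ (mols s) x = cv (fun y => v y 1) (pd 0 (mols s)) x -
        cv (fun y => v y 0) (pd 1 (mols s)) x := by
    rw [← hv.curl_cv hm x, pd_cv (hv.loc 1) hm, pd_cv (hv.loc 0) hm]
  have ii (ρ : Plane → ℝ) (hρ : IsTest ρ) (i : Fin 2) :
      IntervalIntegrable (fun r => force θ ρ i (u r) x) volume 0 t := by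
    obtain ⟨C, -, hC⟩ := hu.exists_force_bound hθ hρ i
    exact intervalIntegrable_of_bounded (stronglyMeasurable_slice (hu.meas_force hθ hρ i) x)
      (fun r => hC r x) 0 t
  rw [c (hu.flow t), c h₀, h1 ht x, h2 ht x,
    intervalIntegral.integral_sub (ii _ (hm.pd 0) 1) (ii _ (hm.pd 1) 0)]
  ring

/-- For the mollified vorticity the only error is the commutator against the bounded factor `χ β'`.
At each time it tends to zero, and it is bounded uniformly in time, so dominated convergence gives
the limit equation. -/
theorem renormalized_vorticity {α W m T : ℝ} {u : ℝ → Plane → Plane} {ω : ℝ → Plane → ℝ}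
    {θ : Plane → ℝ} {u₀ : Plane → Plane} {ω₀ : Plane → ℝ} {W₀ A₀ : ℝ}
    (hev : Evolves θ u₀ T u) (hu : FlowFamily α W m u ω) (hθ : IsCutoff θ)
    (h₀ : Flow u₀ ω₀ W₀ A₀) {β : ℝ → ℝ} (hβ : ContDiff ℝ (⊤ : ℕ∞) β) {χ : Plane → ℝ}
    (hχ : IsTest χ) : ∀ᵐ t, t ∈ Ioo 0 T →
      IntegrableOn (fun s => ∫ x, (u s x 0 * pd 0 χ x + u s x 1 * pd 1 χ x) * β (ω s x))
        (Ioc 0 t) volume ∧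
      (∫ x, χ x * β (ω t x)) - ∫ x, χ x * β (ω₀ x) = ∫ s in (0 : ℝ)..t,
        ∫ x, (u s x 0 * pd 0 χ x + u s x 1 * pd 1 χ x) * β (ω s x) := by
  have hmol (n : ℕ) := isTest_mols (eps_pos n)
  obtain ⟨R, hR1, hR⟩ := hχ.exists_radius
  obtain ⟨X, hX0, hX⟩ := hχ.exists_bound
  have hβ' : Continuous (deriv β) := hβ.continuous_deriv (by simp)
  obtain ⟨D, hD⟩ := (isCompact_Icc (a := -W) (b := W)).exists_bound_of_continuousOn
    hβ.continuous.continuousOn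
  obtain ⟨D', hD'⟩ := (isCompact_Icc (a := -W) (b := W)).exists_bound_of_continuousOn hβ'.continuousOn
  have hWm (s : ℝ) (n : ℕ) (x : Plane) : cv (ω s) (mols (eps n)) x ∈ Icc (-W) W :=
    abs_le.1 ((hu.flow s).abs_cv_vort_le (eps_pos n) x)
  have hD0 : 0 ≤ D := (norm_nonneg _).trans (hD _ (hWm 0 0 0))
  have hD'0 : 0 ≤ D' := (norm_nonneg _).trans (hD' _ (hWm 0 0 0))
  set G : ℝ := growthBd W m with hG
  set g : ℝ → Plane → ℝ := fun s x => u s x 0 * pd 0 χ x + u s x 1 * pd 1 χ x with hg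
  have hpR (j : Fin 2) (x : Plane) (hx : R ≤ ‖x‖) : pd j χ x = 0 :=
    pd_eq_zero_of_forall hR hχ.1 j (by linarith) hx
  have hgi (s : ℝ) : Integrable (g s) volume :=
    ((hu.flow s).integrable_mul_test 0 (hχ.pd 0)).add ((hu.flow s).integrable_mul_test 1 (hχ.pd 1))
  have hgR (s : ℝ) (x : Plane) (hx : R ≤ ‖x‖) : g s x = 0 := by simp [hg, hpR _ x hx]
  have hgb (s : ℝ) : ∫ x, |g s x| ≤ ∫ x, G * (1 + R) * (|pd 0 χ x| + |pd 1 χ x|) := by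
    refine integral_mono_ae (hgi s).abs
      (((hχ.pd 0).integrable.abs.add (hχ.pd 1).integrable.abs).const_mul _) ?_
    filter_upwards [(hu.flow s).coord_growth 0, (hu.flow s).coord_growth 1] with x h0 h1
    rcases le_or_gt R ‖x‖ with h | h
    · simp [hgR s x h, hpR _ x h]
    · have hG0 := (hu.flow s).A_nonneg
      have hl : G * (1 + ‖x‖) ≤ G * (1 + R) := mul_le_mul_of_nonneg_left (by linarith) hG0
      refine (abs_add_le _ _).trans ?_
      rw [abs_mul, abs_mul, mul_add]
      exact add_le_add (mul_le_mul_of_nonneg_right (h0.trans hl) (abs_nonneg _))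
        (mul_le_mul_of_nonneg_right (h1.trans hl) (abs_nonneg _))
  filter_upwards [ae_all_iff.2 fun n => hev.curl hu hθ h₀ (eps_pos n)] with t ht htT
  set F : ℕ → ℝ → Plane → ℝ := fun n r x =>
    force θ (pd 0 (mols (eps n))) 1 (u r) x - force θ (pd 1 (mols (eps n))) 0 (u r) x with hF
  set H : ℕ → ℝ → ℝ := fun n s =>
    ∫ x, χ x * (deriv β (cv (ω s) (mols (eps n)) x) * F n s x) with hH
  have hren (n : ℕ) : IntegrableOn (H n) (Ioc 0 t) volume ∧
      (∫ x, χ x * β (cv (ω t) (mols (eps n)) x)) - ∫ x, χ x * β (cv ω₀ (mols (eps n)) x) =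
        ∫ s in (0 : ℝ)..t, H n s := by
    obtain ⟨C1, -, h1⟩ := hu.exists_force_bound hθ ((hmol n).pd 0) 1
    obtain ⟨C2, -, h2⟩ := hu.exists_force_bound hθ ((hmol n).pd 1) 0
    refine renormalized (v := fun s x => cv (ω s) (mols (eps n)) x) (F := F n) (C := C1 + C2)
      (T := T) ?_ (fun s x => ?_)
      (contDiff_cv h₀.vort.1 (hmol n)).continuous hβ hχ (hev.curl hu hθ h₀ (eps_pos n)) htT
      (ht n htT)
    · exact (hu.meas_force hθ ((hmol n).pd 0) 1).sub (hu.meas_force hθ ((hmol n).pd 1) 0)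
    · refine (abs_sub _ _).trans ?_
      rw [add_mul]
      exact add_le_add (h1 s x) (h2 s x)
  have hHeq (n : ℕ) (s : ℝ) : H n s = (∫ x, g s x * β (cv (ω s) (mols (eps n)) x)) -
      ∫ x, χ x * deriv β (cv (ω s) (mols (eps n)) x) * comm (u s) (ω s) (eps n) x := by
    have hv := contDiff_cv (hu.flow s).vort.1 (hmol n)
    obtain ⟨i2, e2⟩ := (hu.flow s).integral_transport hv hχ hβ
    have i1 : Integrable (fun x => χ x * (deriv β (cv (ω s) (mols (eps n)) x) * F n s x)) volume := by
      have hFc : Continuous (F n s) :=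
        (hu.continuous_force hθ ((hmol n).pd 0) 1 s).sub (hu.continuous_force hθ ((hmol n).pd 1) 0 s)
      exact (hχ.continuous.mul ((hβ'.comp hv.continuous).mul hFc)).integrable_of_hasCompactSupport
        hχ.2.mul_right
    have e3 : ∫ x, χ x * deriv β (cv (ω s) (mols (eps n)) x) * comm (u s) (ω s) (eps n) x =
        -(∫ x, χ x * (deriv β (cv (ω s) (mols (eps n)) x) * (u s x 0 * pd 0 (cv (ω s)
          (mols (eps n))) x + u s x 1 * pd 1 (cv (ω s) (mols (eps n))) x))) - H n s := by
      have e4 := integral_sub i2.neg i1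
      simp only [Pi.neg_apply, integral_neg] at e4
      simp only [hH]
      rw [← e4]
      refine integral_congr_ae (Eventually.of_forall fun x => ?_)
      simp only [hF]
      rw [(hu.flow s).force_curl hθ (eps_pos n) x]
      ring
    rw [e3, e2]
    ring
  have hcb (n : ℕ) (s : ℝ) : ‖∫ x, χ x * deriv β (cv (ω s) (mols (eps n)) x) *
      comm (u s) (ω s) (eps n) x‖ₑ ≤ ENNReal.ofReal (X * D') *
        ∫⁻ x in ball (0 : Plane) R, ‖comm (u s) (ω s) (eps n) x‖ₑ := by
    refine Flow.enorm_integral_mul_comm_le (fun x => ?_) fun x hx => by rw [hR x hx, zero_mul]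
    rw [abs_mul]
    exact mul_le_mul (hX x) (hD' _ (hWm s n x)) (abs_nonneg _) hX0
  have hlim (s : ℝ) : Tendsto (fun n => H n s) atTop (𝓝 (∫ x, g s x * β (ω s x))) := by
    simp only [hHeq]
    have l1 : Tendsto (fun n => ∫ x, g s x * β (cv (ω s) (mols (eps n)) x)) atTop
        (𝓝 (∫ x, g s x * β (ω s x))) := by
      refine tendsto_integral_mul_comp (a := W) (R := R) hβ.continuous (hgi s) (hgR s)
        (fun n => (contDiff_cv (hu.flow s).vort.1 (hmol n)).continuous)
        (fun n x _ => abs_le.2 (hWm s n x)) ?_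
      filter_upwards [ae_tendsto_cv_mols (hu.flow s).vort.1] with x hx
      exact hx.comp tendsto_eps_within
    have l2 : Tendsto (fun n => ∫ x, χ x * deriv β (cv (ω s) (mols (eps n)) x) *
        comm (u s) (ω s) (eps n) x) atTop (𝓝 0) := by
      rw [tendsto_zero_iff_enorm_tendsto_zero]
      have l3 := ENNReal.Tendsto.const_mul (a := ENNReal.ofReal (X * D'))
        ((hu.flow s).tendsto_lintegral_comm (hu.flow s).linGrowth_vort hR1)
        (Or.inr ENNReal.ofReal_ne_top)
      rw [mul_zero] at l3
      exact tendsto_of_tendsto_of_tendsto_of_le_of_le tendsto_const_nhds l3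
        (fun n => zero_le) fun n => hcb n s
    simpa using l1.sub l2
  set Q : ℝ := (∫ x, G * (1 + R) * (|pd 0 χ x| + |pd 1 χ x|)) * D +
    (ENNReal.ofReal (X * D') * ENNReal.ofReal (Flow.commBd W G W R)).toReal with hQ
  have hHb (n : ℕ) (s : ℝ) : ‖H n s‖ ≤ Q := by
    rw [hHeq]
    refine (abs_sub _ _).trans (add_le_add ?_ ?_)
    · exact (abs_integral_mul_le (R := R) (hgi s) (hgR s) (fun x _ => hD _ (hWm s n x))).trans
        (mul_le_mul_of_nonneg_right (hgb s) hD0)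
    · rw [← Real.norm_eq_abs, ← toReal_enorm]
      refine ENNReal.toReal_mono (by finiteness) ((hcb n s).trans (mul_le_mul' le_rfl ?_))
      exact (hu.flow s).lintegral_comm_le (hu.flow s).linGrowth_vort (eps_pos n) (eps_le_one n) hR1
  have hzm : AEStronglyMeasurable (fun s => ∫ x, g s x * β (ω s x)) (volume.restrict (Ioc 0 t)) :=
    aestronglyMeasurable_of_tendsto_ae atTop (fun n => (hren n).1.1) (Eventually.of_forall hlim)
  have hzb (s : ℝ) : ‖∫ x, g s x * β (ω s x)‖ ≤ Q :=
    le_of_tendsto (hlim s).norm (Eventually.of_forall fun n => hHb n s)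
  refine ⟨(integrable_const Q).mono' hzm (Eventually.of_forall hzb), ?_⟩
  have hl1 : Tendsto (fun n => ∫ s in (0 : ℝ)..t, H n s) atTop
      (𝓝 (∫ s in (0 : ℝ)..t, ∫ x, g s x * β (ω s x))) := by
    simp only [intervalIntegral.integral_of_le htT.1.le]
    exact tendsto_integral_of_dominated_convergence (fun _ => Q) (fun n => (hren n).1.1)
      (integrable_const Q) (fun n => Eventually.of_forall fun s => hHb n s)
      (Eventually.of_forall hlim)
  have hl (ζ : Plane → ℝ) {v : Plane → Plane} {V B : ℝ} (hv : Flow v ζ V B) :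
      Tendsto (fun n => ∫ x, χ x * β (cv ζ (mols (eps n)) x)) atTop (𝓝 (∫ x, χ x * β (ζ x))) := by
    refine tendsto_integral_mul_comp (a := V) (R := R) hβ.continuous hχ.integrable hR
      (fun n => (contDiff_cv hv.vort.1 (hmol n)).continuous)
      (fun n x _ => hv.abs_cv_vort_le (eps_pos n) x) ?_
    filter_upwards [ae_tendsto_cv_mols hv.vort.1] with x hx
    exact hx.comp tendsto_eps_within
  refine tendsto_nhds_unique ((hl _ (hu.flow t)).sub (hl _ h₀)) (hl1.congr fun n => ?_)
  exact (hren n).2.symm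

/-! ### The maximum principle -/

/-- As `z` is merely integrable, Gronwall's inequality is applied to `Φ`, a continuously
differentiable majorant of the primitive `Y`. -/
theorem integral_le_of_gronwall {z : ℝ → ℝ} {C τ t : ℝ} (hC : 0 < C) (ht : 0 ≤ t)
    (hz : IntegrableOn z (Ioc 0 t) volume)
    (h : ∀ᵐ s, s ∈ Ioc 0 t → z s ≤ C * (∫ r in (0 : ℝ)..s, z r) + C * τ) :
    ∫ s in (0 : ℝ)..t, z s ≤ τ * (Real.exp (C * t) - 1) := by
  set z' : ℝ → ℝ := (Ioc 0 t).indicator z with hz'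
  have hz'i : Integrable z' volume := (integrable_indicator_iff measurableSet_Ioc).2 hz
  set Y : ℝ → ℝ := fun s => ∫ r in (0 : ℝ)..s, z' r with hY
  have hYc : Continuous Y := intervalIntegral.continuous_primitive
    (fun a b => hz'i.intervalIntegrable) 0
  have hYe {s : ℝ} (hs : s ∈ Icc 0 t) : ∫ r in (0 : ℝ)..s, z r = Y s := by
    rw [hY]
    simp only [intervalIntegral.integral_of_le hs.1]
    refine setIntegral_congr_fun measurableSet_Ioc fun r hr => ?_
    have hr' : r ∈ Ioc 0 t := ⟨hr.1, hr.2.trans hs.2⟩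
    rw [hz', indicator_of_mem hr']
  set Φ : ℝ → ℝ := fun s => ∫ r in (0 : ℝ)..s, (C * Y r + C * τ) with hΦ
  have hc : Continuous fun r => C * Y r + C * τ := by fun_prop
  have hd (s : ℝ) : HasDerivAt Φ (C * Y s + C * τ) s := (hc.integral_hasStrictDerivAt 0 s).hasDerivAt
  have hYΦ {s : ℝ} (hs : s ∈ Icc 0 t) : Y s ≤ Φ s := by
    refine intervalIntegral.integral_mono_ae_restrict hs.1 hz'i.intervalIntegrable
      (hc.intervalIntegrable _ _) ?_
    refine (ae_restrict_iff' measurableSet_Icc).2 ?_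
    have h0 : ∀ᵐ r : ℝ, r ≠ 0 := by simp [ae_iff, measure_singleton]
    filter_upwards [h, h0] with r hr h0 hrs
    have hrt : r ∈ Ioc 0 t := ⟨lt_of_le_of_ne hrs.1 (Ne.symm h0), hrs.2.trans hs.2⟩
    have := hr hrt
    rwa [hYe ⟨hrs.1, hrt.2⟩, ← indicator_of_mem hrt z] at this
  have hΦb := le_gronwallBound_of_liminf_deriv_right_le (f := Φ) (f' := fun s => C * Y s + C * τ)
    (δ := 0) (K := C) (ε := C * τ) (a := 0) (b := t) (fun s _ => (hd s).continuousAt.continuousWithinAt)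
    (fun s _ r hr => ((hd s).hasDerivWithinAt.liminf_right_slope_le hr))
    (by simp [hΦ]) (fun s hs => by
      have := mul_le_mul_of_nonneg_left (hYΦ ⟨hs.1, hs.2.le⟩) hC.le
      linarith) t ⟨ht, le_rfl⟩
  rw [gronwallBound_of_K_ne_0 hC.ne'] at hΦb
  rw [hYe ⟨ht, le_rfl⟩]
  refine (hYΦ ⟨ht, le_rfl⟩).trans (hΦb.trans_eq ?_)
  field_simp
  simp

/-- The weight `(1 + |x|²)⁻²`. -/
def wt (x : Plane) : ℝ := ((1 + ‖x‖ ^ 2) ^ 2)⁻¹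

theorem wt_pos (x : Plane) : 0 < wt x := by unfold wt; positivity

theorem integrable_wt : Integrable wt volume := integrable_bracket

theorem contDiff_wt : ContDiff ℝ (⊤ : ℕ∞) wt := by
  have h : ContDiff ℝ (⊤ : ℕ∞) fun x : Plane => (1 + ‖x‖ ^ 2) ^ 2 :=
    (contDiff_const.add (contDiff_norm_sq ℝ)).pow 2
  exact h.inv fun x => by positivity

/-- The gain of one power of `1 + ‖x‖` compensates for the linear growth of the velocity. -/
theorem abs_pd_wt_le (j : Fin 2) (x : Plane) : (1 + ‖x‖) * |pd j wt x| ≤ 8 * wt x := by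
  have ha : DifferentiableAt ℝ (fun x : Plane => ‖x‖ ^ 2) x :=
    (contDiff_norm_sq ℝ (n := (⊤ : ℕ∞))).differentiable (by simp) x
  have hw : DifferentiableAt ℝ wt x := contDiff_wt.differentiable (by simp) x
  have h1 : (fun x => wt x * ((1 + ‖x‖ ^ 2) * (1 + ‖x‖ ^ 2))) = fun _ : Plane => (1 : ℝ) := by
    funext y
    have : (0 : ℝ) < 1 + ‖y‖ ^ 2 := by positivity
    unfold wt
    field_simp
  have ha1 : DifferentiableAt ℝ (fun x : Plane => 1 + ‖x‖ ^ 2) x := ha.const_add 1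
  have hp : pd j (fun x : Plane => 1 + ‖x‖ ^ 2) x = 2 * x j := by
    rw [pd_add j (differentiableAt_const _) ha, pd_const, pd_normSq, zero_add]
  have h2 := congrArg (fun f => pd j f x) h1
  simp only [pd_const] at h2
  have ha2 : DifferentiableAt ℝ (fun x : Plane => (1 + ‖x‖ ^ 2) * (1 + ‖x‖ ^ 2)) x := ha1.mul ha1
  rw [pd_mul j hw ha2, pd_mul j ha1 ha1, hp] at h2
  set N := 1 + ‖x‖ ^ 2 with hN
  have hN0 : 0 < N := by positivity
  have h3 : pd j wt x * N = -(4 * x j * wt x) := by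
    have : N * (pd j wt x * N + 4 * x j * wt x) = 0 := by linarith
    rcases mul_eq_zero.1 this with h | h
    · exact absurd h hN0.ne'
    · linarith
  have h4 : |pd j wt x| * N = 4 * |x j| * wt x := by
    rw [← abs_of_pos hN0, ← abs_mul, h3, abs_neg, abs_mul, abs_mul, abs_of_pos (wt_pos x)]
    norm_num
  have h5 : (1 + ‖x‖) * |x j| ≤ 2 * N := by
    have := abs_coord_le x j
    have h0 := norm_nonneg x
    nlinarith [abs_nonneg (x j), sq_nonneg (‖x‖ - 1)]
  refine le_of_mul_le_mul_right ?_ hN0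
  calc (1 + ‖x‖) * |pd j wt x| * N = 4 * ((1 + ‖x‖) * |x j|) * wt x := by
        rw [mul_assoc, h4]; ring
    _ ≤ 4 * (2 * N) * wt x := by
        have := (wt_pos x).le
        gcongr
    _ = 8 * wt x * N := by ring

/-- The weight `(1 + |x|²)⁻²` cut off at radius `r`. -/
def wtCut (r : ℝ) (x : Plane) : ℝ := cutoff r x * wt x

/-- It absorbs the terms in which the cut-off is differentiated, and its integral is the error in
the Gronwall inequality. -/
def wtTail (r : ℝ) : Plane → ℝ := {x | r ≤ ‖x‖}.indicator wt

theorem isTest_wtCut {r : ℝ} (hr : 0 < r) : IsTest (wtCut r) :=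
  (isTest_cutoff hr).mul_right contDiff_wt

theorem wtCut_nonneg (r : ℝ) (x : Plane) : 0 ≤ wtCut r x :=
  mul_nonneg (cutoff_nonneg x) (wt_pos x).le

theorem measurableSet_norm_ge (r : ℝ) : MeasurableSet {x : Plane | r ≤ ‖x‖} :=
  (isClosed_le continuous_const continuous_norm).measurableSet

theorem integrable_wtTail (r : ℝ) : Integrable (wtTail r) volume :=
  integrable_wt.indicator (measurableSet_norm_ge r)

theorem wtTail_nonneg (r : ℝ) (x : Plane) : 0 ≤ wtTail r x :=
  indicator_nonneg (fun x _ => (wt_pos x).le) x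

theorem tendsto_integral_wtTail :
    Tendsto (fun k : ℕ => ∫ x, wtTail (k + 1) x) atTop (𝓝 0) := by
  rw [← integral_zero Plane ℝ (μ := volume)]
  refine tendsto_integral_of_dominated_convergence wt (fun k => (integrable_wtTail _).1)
    integrable_wt (fun k => Eventually.of_forall fun x => ?_) (Eventually.of_forall fun x => ?_)
  · rw [Real.norm_eq_abs, abs_of_nonneg (wtTail_nonneg _ x)]
    exact indicator_le_self' (fun _ _ => (wt_pos x).le) x
  · refine tendsto_const_nhds.congr' ?_
    obtain ⟨n, hn⟩ := exists_nat_gt ‖x‖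
    filter_upwards [eventually_ge_atTop n] with k hk
    have : (n : ℝ) ≤ k := by exact_mod_cast hk
    have hx : x ∉ {x : Plane | (k : ℝ) + 1 ≤ ‖x‖} := fun h => by
      have h' : (k : ℝ) + 1 ≤ ‖x‖ := h
      linarith
    rw [wtTail, indicator_of_notMem hx]

theorem abs_transport_wtCut_le {v : Plane} {x : Plane} {G r : ℝ} (hG : 0 ≤ G)
    (hv : ∀ j, |v j| ≤ G * (1 + ‖x‖)) (hr : 1 ≤ r) :
    |v 0 * pd 0 (wtCut r) x + v 1 * pd 1 (wtCut r) x| ≤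
      (16 + 6 * cutBd) * G * (wtCut r x + wtTail r x) := by
  have hr0 : 0 < r := by linarith
  have hB := one_le_cutBd
  have hw := (wt_pos x).le
  have hcut (j : Fin 2) : (1 + ‖x‖) * |pd j (cutoff r) x| * wt x ≤ 3 * cutBd * wtTail r x := by
    rcases lt_or_ge ‖x‖ r with h | h
    · rw [pd_cutoff_eq_zero_of_lt hr0 j h]
      have := wtTail_nonneg r x
      simp only [abs_zero, mul_zero, zero_mul]
      positivity
    · rw [wtTail, indicator_of_mem (by exact h)]
      refine mul_le_mul_of_nonneg_right ?_ hw
      rcases le_or_gt (9 / 8 * r) ‖x‖ with h' | h'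
      · rw [pd_cutoff_eq_zero hr0 j h', abs_zero, mul_zero]
        positivity
      · calc (1 + ‖x‖) * |pd j (cutoff r) x| ≤ (3 * r) * (cutBd / r) :=
              mul_le_mul (by linarith) (abs_pd_cutoff_le hr0 j x) (abs_nonneg _) (by positivity)
          _ = 3 * cutBd := by field_simp
  have hj (j : Fin 2) : |v j * pd j (wtCut r) x| ≤
      G * (8 * wtCut r x + 3 * cutBd * wtTail r x) := by
    have e : pd j (wtCut r) x = cutoff r x * pd j wt x + wt x * pd j (cutoff r) x :=
      pd_mul j ((isTest_cutoff hr0).differentiable x) (contDiff_wt.differentiable (by simp) x)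
    rw [abs_mul]
    refine (mul_le_mul_of_nonneg_right (hv j) (abs_nonneg _)).trans ?_
    rw [mul_assoc]
    refine mul_le_mul_of_nonneg_left ?_ hG
    have h1 : |pd j (wtCut r) x| ≤ |pd j (cutoff r) x| * wt x + cutoff r x * |pd j wt x| := by
      rw [e]
      refine (abs_add_le _ _).trans_eq ?_
      rw [abs_mul, abs_mul, abs_of_pos (wt_pos x), abs_of_nonneg (cutoff_nonneg x)]
      ring
    calc (1 + ‖x‖) * |pd j (wtCut r) x|
        ≤ (1 + ‖x‖) * (|pd j (cutoff r) x| * wt x + cutoff r x * |pd j wt x|) := by gcongr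
      _ = cutoff r x * ((1 + ‖x‖) * |pd j wt x|) + (1 + ‖x‖) * |pd j (cutoff r) x| * wt x := by ring
      _ ≤ cutoff r x * (8 * wt x) + 3 * cutBd * wtTail r x :=
          add_le_add (mul_le_mul_of_nonneg_left (abs_pd_wt_le j x) (cutoff_nonneg x)) (hcut j)
      _ = _ := by rw [wtCut]; ring
  have h0 := wtCut_nonneg r x
  have h1 := wtTail_nonneg r x
  calc _ ≤ G * (8 * wtCut r x + 3 * cutBd * wtTail r x) + G * (8 * wtCut r x + 3 * cutBd * wtTail r x) :=
        (abs_add_le _ _).trans (add_le_add (hj 0) (hj 1))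
    _ ≤ _ := by
        have : 0 ≤ G * (6 * cutBd * wtCut r x + 16 * wtTail r x) := by positivity
        linarith

/-- A smooth function with values in `[0, 1]` that vanishes exactly on `[-W, W]`. -/
def excess (W s : ℝ) : ℝ := expNegInvGlue (s ^ 2 - W ^ 2)

theorem contDiff_excess (W : ℝ) : ContDiff ℝ (⊤ : ℕ∞) (excess W) :=
  expNegInvGlue.contDiff.comp ((contDiff_id.pow 2).sub contDiff_const)

theorem excess_nonneg (W s : ℝ) : 0 ≤ excess W s := expNegInvGlue.nonneg _

theorem excess_le_one (W s : ℝ) : excess W s ≤ 1 := by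
  unfold excess expNegInvGlue
  split_ifs with h
  · exact zero_le_one
  · exact Real.exp_le_one_iff.2 (by simp only [Left.neg_nonpos_iff, inv_nonneg]; linarith)

theorem excess_eq_zero {W s : ℝ} (h : |s| ≤ W) : excess W s = 0 :=
  expNegInvGlue.zero_of_nonpos (by
    have := sq_le_sq' (abs_le.1 h).1 (abs_le.1 h).2
    linarith)

theorem abs_le_of_excess_eq_zero {W s : ℝ} (hW : 0 ≤ W) (h : excess W s = 0) : |s| ≤ W := by
  by_contra! hlt
  have : 0 < s ^ 2 - W ^ 2 := by
    rw [← sq_abs s]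
    nlinarith [abs_nonneg s]
  exact (expNegInvGlue.pos_of_pos this).ne' h

theorem integrable_mul_excess {χ f : Plane → ℝ} (hχ : Integrable χ volume)
    (hf : AEStronglyMeasurable f volume) (W : ℝ) : Integrable (fun x => χ x * excess W (f x)) volume :=
  hχ.mono (hχ.1.mul ((contDiff_excess W).continuous.comp_aestronglyMeasurable hf))
    (Eventually.of_forall fun x => by
      rw [norm_mul, Real.norm_eq_abs (excess W (f x)), abs_of_nonneg (excess_nonneg _ _)]
      exact mul_le_of_le_one_right (norm_nonneg _) (excess_le_one _ _))

/-- Renormalize with `excess W₀`, which vanishes on the initial vorticity. Its integral against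
`wtCut` satisfies a Gronwall inequality whose source is the tail of the weight; removing the cut-off
leaves a nonnegative quantity of integral zero. -/
theorem Evolves.abs_vort_le {α W m T : ℝ} {u : ℝ → Plane → Plane} {ω : ℝ → Plane → ℝ}
    {θ : Plane → ℝ} {u₀ : Plane → Plane} {ω₀ : Plane → ℝ} {W₀ A₀ : ℝ}
    (hev : Evolves θ u₀ T u) (hu : FlowFamily α W m u ω) (hθ : IsCutoff θ)
    (h₀ : Flow u₀ ω₀ W₀ A₀) : ∀ᵐ t, t ∈ Ioo 0 T → ∀ᵐ x, |ω t x| ≤ W₀ := by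
  have hW₀ := h₀.W_nonneg
  set G := growthBd W m with hG
  have hG0 : 0 ≤ G := (hu.flow 0).A_nonneg
  -- The `+ 1` keeps the rate positive when `G = 0`.
  set C := (16 + 6 * cutBd) * G + 1 with hC
  have hB := one_le_cutBd
  have hC0 : 0 < C := by positivity
  have hωm (s : ℝ) : AEStronglyMeasurable (ω s) volume := (hu.vort s).1.aestronglyMeasurable
  have hr (k : ℕ) : (1 : ℝ) ≤ k + 1 := by
    have := k.cast_nonneg (α := ℝ)
    linarith
  have key (k : ℕ) : ∀ᵐ t, t ∈ Ioo 0 T → ∫ x, wtCut (k + 1) x * excess W₀ (ω t x) ≤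
      (∫ x, wtTail (k + 1) x) * (Real.exp (C * t) - 1) := by
    set r : ℝ := k + 1 with hrk
    have hr0 : 0 < r := by linarith [hr k]
    have hren := renormalized_vorticity hev hu hθ h₀ (contDiff_excess W₀) (isTest_wtCut hr0)
    set z : ℝ → ℝ := fun s => ∫ x, (u s x 0 * pd 0 (wtCut r) x + u s x 1 * pd 1 (wtCut r) x) *
      excess W₀ (ω s x) with hz
    have h0 : ∫ x, wtCut r x * excess W₀ (ω₀ x) = 0 := by
      refine integral_eq_zero_of_ae ?_
      filter_upwards [h₀.bound] with x hx
      simp [excess_eq_zero hx]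
    have hi (s : ℝ) : Integrable (fun x => wtCut r x * excess W₀ (ω s x)) volume :=
      integrable_mul_excess (isTest_wtCut hr0).integrable (hωm s) W₀
    have hzle (s : ℝ) : z s ≤ C * (∫ x, wtCut r x * excess W₀ (ω s x)) + C * ∫ x, wtTail r x := by
      rw [← mul_add, ← integral_add (hi s) (integrable_wtTail r), ← integral_const_mul]
      have i1 := ((hu.flow s).integrable_mul_test 0 ((isTest_wtCut hr0).pd 0)).add
        ((hu.flow s).integrable_mul_test 1 ((isTest_wtCut hr0).pd 1))
      refine integral_mono_ae (integrable_mul_excess i1 (hωm s) W₀)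
        (((hi s).add (integrable_wtTail r)).const_mul C) ?_
      filter_upwards [(hu.flow s).coord_growth 0, (hu.flow s).coord_growth 1] with x h0 h1
      have hj : ∀ j, |u s x j| ≤ G * (1 + ‖x‖) := fun j => by fin_cases j <;> assumption
      have h2 := abs_transport_wtCut_le hG0 hj (hr k)
      have e0 := excess_nonneg W₀ (ω s x)
      have e1 := excess_le_one W₀ (ω s x)
      have w0 := wtCut_nonneg r x
      have w1 := wtTail_nonneg r x
      have h3 : (wtCut r x + wtTail r x) * excess W₀ (ω s x) ≤
          wtCut r x * excess W₀ (ω s x) + wtTail r x := by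
        rw [add_mul]
        exact add_le_add le_rfl (mul_le_of_le_one_right w1 e1)
      calc _ ≤ ((16 + 6 * cutBd) * G * (wtCut r x + wtTail r x)) * excess W₀ (ω s x) :=
            mul_le_mul_of_nonneg_right ((le_abs_self _).trans h2) e0
        _ ≤ (C * (wtCut r x + wtTail r x)) * excess W₀ (ω s x) := by
            refine mul_le_mul_of_nonneg_right (mul_le_mul_of_nonneg_right ?_ (by positivity)) e0
            linarith
        _ ≤ C * (wtCut r x * excess W₀ (ω s x) + wtTail r x) := by
            rw [mul_assoc]
            exact mul_le_mul_of_nonneg_left h3 hC0.le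
    filter_upwards [hren] with t ht htT
    obtain ⟨hint, heq⟩ := ht htT
    rw [h0, sub_zero] at heq
    rw [heq]
    refine integral_le_of_gronwall hC0 htT.1.le hint ?_
    filter_upwards [hren] with s hs hst
    have h2 := (hs ⟨hst.1, hst.2.trans_lt htT.2⟩).2
    rw [h0, sub_zero] at h2
    rw [← h2]
    exact hzle s
  filter_upwards [ae_all_iff.2 key] with t ht htT
  have hi : Integrable (fun x => wt x * excess W₀ (ω t x)) volume :=
    integrable_mul_excess integrable_wt (hωm t) W₀
  have l1 : Tendsto (fun k : ℕ => ∫ x, wtCut (k + 1) x * excess W₀ (ω t x)) atTop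
      (𝓝 (∫ x, wt x * excess W₀ (ω t x))) := by
    refine tendsto_integral_of_dominated_convergence (fun x => wt x * excess W₀ (ω t x))
      (fun k => ?_) hi (fun k => Eventually.of_forall fun x => ?_) (Eventually.of_forall fun x => ?_)
    · exact (integrable_mul_excess (isTest_wtCut (by linarith [hr k])).integrable (hωm t) W₀).1
    · have e0 := excess_nonneg W₀ (ω t x)
      rw [Real.norm_eq_abs, abs_of_nonneg (mul_nonneg (wtCut_nonneg _ x) e0)]
      exact mul_le_mul_of_nonneg_right (mul_le_of_le_one_left (wt_pos x).le (cutoff_le_one x)) e0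
    · refine tendsto_const_nhds.congr' ?_
      obtain ⟨n, hn⟩ := exists_nat_gt ‖x‖
      filter_upwards [eventually_ge_atTop n] with k hk
      have : (n : ℝ) ≤ k := by exact_mod_cast hk
      rw [wtCut, cutoff_eq_one (by linarith [hr k]) (by linarith), one_mul]
  have l2 := tendsto_integral_wtTail.mul_const (Real.exp (C * t) - 1)
  rw [zero_mul] at l2
  have h1 : ∫ x, wt x * excess W₀ (ω t x) ≤ 0 := le_of_tendsto_of_tendsto' l1 l2 fun k => ht k htT
  have hnn : ∀ x, 0 ≤ wt x * excess W₀ (ω t x) :=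
    fun x => mul_nonneg (wt_pos x).le (excess_nonneg _ _)
  have h2 := (integral_eq_zero_iff_of_nonneg hnn hi).1 (le_antisymm h1 (integral_nonneg hnn))
  filter_upwards [h2] with x hx
  refine abs_le_of_excess_eq_zero hW₀ ?_
  simpa [(wt_pos x).ne'] using hx

/-! ### The energy flux -/

theorem cv_eq_cv_indicator {f k : Plane → ℝ} {a b : ℝ} (hk : ∀ z, b ≤ ‖z‖ → k z = 0) {x : Plane}
    (hx : ‖x‖ + b ≤ a) : cv f k x = cv ((ball 0 a).indicator f) k x := by
  rw [cv_apply, cv_apply]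
  refine integral_congr_ae (Eventually.of_forall fun y => ?_)
  simp only
  by_cases hy : y ∈ ball (0 : Plane) a
  · rw [indicator_of_mem hy]
  · have h1 : a ≤ ‖y‖ := by simpa using hy
    have h2 : ‖y‖ ≤ ‖x‖ + ‖x - y‖ := by
      have := norm_sub_le x (x - y)
      rwa [sub_sub_cancel] at this
    rw [hk _ (by linarith), mul_zero, mul_zero]

theorem cv_eq_zero_of_norm {K ρ : Plane → ℝ} {a b : ℝ} (hK : ∀ z, a < ‖z‖ → K z = 0)
    (hρ : ∀ z, b ≤ ‖z‖ → ρ z = 0) {z : Plane} (hz : a + b ≤ ‖z‖) : cv K ρ z = 0 := by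
  rw [cv_apply]
  refine integral_eq_zero_of_ae (Eventually.of_forall fun t => ?_)
  rcases lt_or_ge a ‖t‖ with h | h
  · simp [hK t h]
  · have : ‖z‖ ≤ ‖t‖ + ‖z - t‖ := by simpa using norm_add_le t (z - t)
    simp [hρ (z - t) (by linarith)]

theorem rpow_scale_le {c r α : ℝ} (hc : 1 ≤ c) (hr : 0 ≤ r) (hα : α ≤ 1 / 2) :
    (c * r) ^ (2 + 2 * α) ≤ c ^ 3 * r ^ (2 + 2 * α) := by
  rw [Real.mul_rpow (by linarith) hr, ← Real.rpow_natCast c 3]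
  exact mul_le_mul_of_nonneg_right (Real.rpow_le_rpow_of_exponent_le hc (by push_cast; linarith))
    (Real.rpow_nonneg hr _)

theorem integral_sq_le_of_lintegral {X : Type*} [MeasurableSpace X] {μ : Measure X} {f : X → ℝ}
    {B : ℝ} (hf : AEStronglyMeasurable f μ) (hB : 0 ≤ B)
    (h : ∫⁻ x, ‖f x‖ₑ ^ 2 ∂μ ≤ ENNReal.ofReal B) : ∫ x, f x ^ 2 ∂μ ≤ B := by
  rw [integral_eq_lintegral_of_nonneg_ae (Eventually.of_forall fun x => sq_nonneg _) (hf.pow 2)]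
  refine ENNReal.toReal_le_of_le_ofReal hB (le_trans (le_of_eq ?_) h)
  refine lintegral_congr fun x => ?_
  rw [Real.enorm_eq_ofReal_abs, ← ENNReal.ofReal_pow (abs_nonneg _), sq_abs]

section Local

variable {u : Plane → Plane} {α r m U s : ℝ}

theorem MorreyBd.lintegral_scale_le (h : MorreyBd α r m u) (hr : 0 ≤ r) (hα : α ≤ 1 / 2) {c : ℝ}
    (hc : 1 ≤ c) : ∫⁻ x in ball (0 : Plane) (c * r), ‖u x‖ₑ ^ 2 ≤
      ENNReal.ofReal (m ^ 2 * (c ^ 3 * r ^ (2 + 2 * α))) :=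
  (h (c * r) (le_mul_of_one_le_left hr hc)).trans
    (ENNReal.ofReal_le_ofReal (mul_le_mul_of_nonneg_left (rpow_scale_le hc hr hα) (sq_nonneg m)))

/-- The mollification on the ball of radius `9/8 * r` sees only the ball of radius `2 * r`, whose
energy costs the factor `8 = 2 ^ 3`. -/
theorem MorreyBd.integral_smo_sq_le (h : MorreyBd α r m u) (hr : 0 < r) (hα : α ≤ 1 / 2)
    (hu : AEStronglyMeasurable u volume) (hs : 0 < s) (hsr : s ≤ r / 8) (i : Fin 2) :
    ∫ x in ball (0 : Plane) (9 / 8 * r), smo u s i x ^ 2 ≤ 8 * (m ^ 2 * r ^ (2 + 2 * α)) := by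
  set f : Plane → ℝ := (ball (0 : Plane) (2 * r)).indicator fun y => u y i with hf
  have hui := aestronglyMeasurable_coord hu i
  have hfm : AEStronglyMeasurable f volume := hui.indicator measurableSet_ball
  have hc := (isTest_mols hs).continuous
  have hfb : ∫⁻ x, ‖f x‖ₑ ^ 2 ≤ ENNReal.ofReal (8 * (m ^ 2 * r ^ (2 + 2 * α))) := by
    have e : (fun x => ‖f x‖ₑ ^ 2) =
        (ball (0 : Plane) (2 * r)).indicator fun y => ‖u y i‖ₑ ^ 2 := by
      funext x
      by_cases hx : x ∈ ball (0 : Plane) (2 * r)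
      · rw [hf, indicator_of_mem hx, indicator_of_mem hx]
      · rw [hf, indicator_of_notMem hx, indicator_of_notMem hx]; simp
    rw [e, lintegral_indicator measurableSet_ball]
    calc ∫⁻ x in ball (0 : Plane) (2 * r), ‖u x i‖ₑ ^ 2
        ≤ ∫⁻ x in ball (0 : Plane) (2 * r), ‖u x‖ₑ ^ 2 :=
          lintegral_mono fun x => pow_le_pow_left' (enorm_coord_le _ _) 2
      _ ≤ ENNReal.ofReal (m ^ 2 * (2 ^ 3 * r ^ (2 + 2 * α))) :=
          h.lintegral_scale_le hr.le hα (by norm_num)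
      _ = _ := by congr 1; ring
  have e : ∫ x in ball (0 : Plane) (9 / 8 * r), smo u s i x ^ 2 =
      ∫ x in ball (0 : Plane) (9 / 8 * r), cv f (mols s) x ^ 2 := by
    refine setIntegral_congr_fun measurableSet_ball fun x hx => ?_
    have hx' : ‖x‖ < 9 / 8 * r := by simpa using hx
    rw [smo, cv_eq_cv_indicator (a := 2 * r) (fun z hz => mols_eq_zero hs hz) (by linarith)]
  rw [e]
  have hloc : LocallyIntegrable f volume := by
    have hL : MemLp f 2 volume := ⟨hfm, by
      rw [eLpNorm_lt_top_iff_lintegral_rpow_enorm_lt_top (by norm_num) (by norm_num)]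
      refine lt_of_le_of_lt ?_ (hfb.trans_lt ENNReal.ofReal_lt_top)
      refine lintegral_mono fun x => ?_
      simp⟩
    exact hL.locallyIntegrable (by norm_num)
  refine integral_sq_le_of_lintegral
    (contDiff_cv hloc (isTest_mols hs)).continuous.aestronglyMeasurable (by positivity) ?_
  calc ∫⁻ x in ball (0 : Plane) (9 / 8 * r), ‖cv f (mols s) x‖ₑ ^ 2
      ≤ ∫⁻ x, ‖cv f (mols s) x‖ₑ ^ 2 := setLIntegral_le_lintegral _ _
    _ ≤ (∫⁻ t, ‖mols s t‖ₑ) ^ 2 * ∫⁻ t, ‖f t‖ₑ ^ 2 := lintegral_cv_sq_le hfm.aemeasurable hc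
    _ ≤ _ := by rw [lintegral_mols hs, one_pow, one_mul]; exact hfb

theorem setIntegral_ball_eq {f : Plane → ℝ} {a : ℝ} (h : ∀ x, a ≤ ‖x‖ → f x = 0) :
    ∫ x in ball (0 : Plane) a, f x = ∫ x, f x :=
  setIntegral_eq_integral_of_forall_compl_eq_zero fun x hx => h x (by simpa using hx)

theorem integrableOn_ball_of_continuous {f : Plane → ℝ} (hf : Continuous f) (a : ℝ) :
    IntegrableOn f (ball (0 : Plane) a) volume :=
  (hf.continuousOn.integrableOn_compact (isCompact_closedBall (0 : Plane) a)).mono_set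
    ball_subset_closedBall

end Local

namespace Flow

variable {u : Plane → Plane} {ω : Plane → ℝ} {W A α r m U s : ℝ}

theorem abs_smo_le_of_local (hU : ∀ᵐ x, ‖x‖ < 4 * r → ∀ j, |u x j| ≤ U)
    (hs : 0 < s) (hsr : s ≤ r / 8) (i : Fin 2) {x : Plane} (hx : ‖x‖ ≤ 9 / 8 * r) :
    |smo u s i x| ≤ U := by
  refine cv_mols_abs_le hs ?_
  filter_upwards [hU] with y hy hyx
  refine hy ?_ i
  have : ‖y‖ ≤ ‖y - x‖ + ‖x‖ := by simpa using norm_add_le (y - x) x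
  linarith

theorem abs_transport_energy_le (hu : Flow u ω W A) (hm : MorreyBd α r m u) (hr : 0 < r)
    (hα : α ≤ 1 / 2) (hU0 : 0 ≤ U) (hU : ∀ᵐ x, ‖x‖ < 4 * r → ∀ j, |u x j| ≤ U) (hs : 0 < s)
    (hsr : s ≤ r / 8) (i : Fin 2) :
    |∫ x, (u x 0 * pd 0 (cutoff r) x + u x 1 * pd 1 (cutoff r) x) * smo u s i x ^ 2| ≤
      16 * cutBd * (U * (m ^ 2 * (r ^ (2 + 2 * α) / r))) := by
  have hB := one_le_cutBd
  have hc := (hu.contDiff_smo hs i).continuous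
  have hz : ∀ x, 9 / 8 * r ≤ ‖x‖ →
      (u x 0 * pd 0 (cutoff r) x + u x 1 * pd 1 (cutoff r) x) * smo u s i x ^ 2 = 0 := fun x hx => by
    rw [pd_cutoff_eq_zero hr 0 hx, pd_cutoff_eq_zero hr 1 hx]
    ring
  rw [← setIntegral_ball_eq hz]
  have h1 := norm_integral_le_of_norm_le (μ := volume.restrict (ball (0 : Plane) (9 / 8 * r)))
    (f := fun x => (u x 0 * pd 0 (cutoff r) x + u x 1 * pd 1 (cutoff r) x) * smo u s i x ^ 2)
    (g := fun x => 2 * (U * (cutBd / r)) * smo u s i x ^ 2)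
    ((integrableOn_ball_of_continuous (hc.pow 2) _).const_mul _) (by
      refine (ae_restrict_iff' measurableSet_ball).2 ?_
      filter_upwards [hU] with x hx hxb
      have hxn : ‖x‖ < 9 / 8 * r := by simpa using hxb
      have hxU := hx (by linarith)
      rw [norm_mul, Real.norm_eq_abs (_ ^ 2), abs_of_nonneg (sq_nonneg (smo u s i x))]
      refine mul_le_mul_of_nonneg_right ?_ (sq_nonneg _)
      have hj (j : Fin 2) : |u x j * pd j (cutoff r) x| ≤ U * (cutBd / r) := by
        rw [abs_mul]
        exact mul_le_mul (hxU j) (abs_pd_cutoff_le hr j x) (abs_nonneg _) hU0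
      refine (abs_add_le _ _).trans ((add_le_add (hj 0) (hj 1)).trans_eq (by ring)))
  refine h1.trans ?_
  rw [integral_const_mul]
  calc 2 * (U * (cutBd / r)) * ∫ x in ball (0 : Plane) (9 / 8 * r), smo u s i x ^ 2
      ≤ 2 * (U * (cutBd / r)) * (8 * (m ^ 2 * r ^ (2 + 2 * α))) :=
        mul_le_mul_of_nonneg_left (hm.integral_smo_sq_le hr hα hu.meas hs hsr i) (by positivity)
    _ = _ := by ring

theorem integral_div_cutoff_sq_le (hu : Flow u ω W A) (hm : MorreyBd α r m u) (hr : 0 < r)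
    (hα : α ≤ 1 / 2) (hs : 0 < s) (hsr : s ≤ r / 8) :
    ∫ x, (smo u s 0 x * pd 0 (cutoff r) x + smo u s 1 x * pd 1 (cutoff r) x) ^ 2 ≤
      32 * (cutBd / r) ^ 2 * (m ^ 2 * r ^ (2 + 2 * α)) := by
  have hB := one_le_cutBd
  have hc (i) := (hu.contDiff_smo hs i).continuous
  have hp (i) := ((isTest_cutoff hr).pd i).continuous
  have hz : ∀ x, 9 / 8 * r ≤ ‖x‖ →
      (smo u s 0 x * pd 0 (cutoff r) x + smo u s 1 x * pd 1 (cutoff r) x) ^ 2 = 0 := fun x hx => by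
    rw [pd_cutoff_eq_zero hr 0 hx, pd_cutoff_eq_zero hr 1 hx]
    ring
  rw [← setIntegral_ball_eq hz]
  have i0 (i : Fin 2) : IntegrableOn (fun x => smo u s i x ^ 2) (ball 0 (9 / 8 * r)) volume :=
    integrableOn_ball_of_continuous ((hc i).pow 2) (9 / 8 * r)
  calc ∫ x in ball (0 : Plane) (9 / 8 * r),
        (smo u s 0 x * pd 0 (cutoff r) x + smo u s 1 x * pd 1 (cutoff r) x) ^ 2
      ≤ ∫ x in ball (0 : Plane) (9 / 8 * r),
        2 * (cutBd / r) ^ 2 * (smo u s 0 x ^ 2 + smo u s 1 x ^ 2) := by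
        refine integral_mono (integrableOn_ball_of_continuous
          ((((hc 0).mul (hp 0)).add ((hc 1).mul (hp 1))).pow 2) _)
          (((i0 0).add (i0 1)).const_mul _) fun x => ?_
        have hq (j : Fin 2) : pd j (cutoff r) x ^ 2 ≤ (cutBd / r) ^ 2 :=
          sq_le_sq' (abs_le.1 (abs_pd_cutoff_le hr j x)).1 (abs_le.1 (abs_pd_cutoff_le hr j x)).2
        have h0 := mul_le_mul_of_nonneg_left (hq 0) (sq_nonneg (smo u s 0 x))
        have h1 := mul_le_mul_of_nonneg_left (hq 1) (sq_nonneg (smo u s 1 x))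
        simp only
        nlinarith [sq_nonneg (smo u s 0 x * pd 0 (cutoff r) x - smo u s 1 x * pd 1 (cutoff r) x)]
    _ = 2 * (cutBd / r) ^ 2 * ((∫ x in ball (0 : Plane) (9 / 8 * r), smo u s 0 x ^ 2) +
        ∫ x in ball (0 : Plane) (9 / 8 * r), smo u s 1 x ^ 2) := by
        rw [integral_const_mul, integral_add (i0 0) (i0 1)]
    _ ≤ 2 * (cutBd / r) ^ 2 * (8 * (m ^ 2 * r ^ (2 + 2 * α)) + 8 * (m ^ 2 * r ^ (2 + 2 * α))) :=
        mul_le_mul_of_nonneg_left (add_le_add (hm.integral_smo_sq_le hr hα hu.meas hs hsr 0)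
          (hm.integral_smo_sq_le hr hα hu.meas hs hsr 1)) (by positivity)
    _ = _ := by ring

end Flow

theorem IsCutoff.near_pressure {θ : Plane → ℝ} (hθ : IsCutoff θ) {r s : ℝ} (hr : 0 < r) (hs : 0 < s)
    {h : Plane → ℝ} (hh : Integrable h volume) (hhc : HasCompactSupport h) (j k : Fin 2) :
    cv h (cv (nearKer θ r) (pd j (pd k (mols s)))) =
      cv (nearKer θ r) (pd j (pd k (cv h (mols s)))) := by
  have hm := isTest_mols hs
  have hK := hθ.integrable_nearKer hr
  funext x
  rw [← cv_assoc_of_compact hh hK (hθ.hasCompactSupport_nearKer hr) ((hm.pd k).pd j), cv_comm h,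
    cv_assoc_of_compact hK hh hhc ((hm.pd k).pd j), pd_cv hh.locallyIntegrable hm,
    pd_cv hh.locallyIntegrable (hm.pd k)]

namespace Flow

variable {u : Plane → Plane} {ω : Plane → ℝ} {W A α r m U s : ℝ} {θ : Plane → ℝ}

/-- As the mollified field is divergence-free, the work of `∇P` is `-∫ P v · ∇χ`. Cauchy–Schwarz
pairs the `L²` bound of `P`, of order `U m r^(1+α)`, with that of `v · ∇χ`, of order `m r^α`. -/
theorem exists_abs_near_flux_le (hθ : IsCutoff θ) : ∃ E, 0 < E ∧
    ∀ {u : Plane → Plane} {ω : Plane → ℝ} {W A α r m U s : ℝ}, Flow u ω W A → MorreyBd α r m u →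
      0 < r → α ≤ 1 / 2 → 0 ≤ U → (∀ᵐ x, ‖x‖ < 4 * r → ∀ j, |u x j| ≤ U) → 0 < s → s ≤ r / 8 →
      ∀ j k : Fin 2, LocallyIntegrable (fun y => u y j * u y k) volume →
      |∑ i, ∫ x, cutoff r x * smo u s i x * cv (fun y => u y j * u y k)
        (cv (nearKer θ r) (pd i (pd j (pd k (mols s))))) x| ≤
      E * (U * (m ^ 2 * (r ^ (2 + 2 * α) / r))) := by
  obtain ⟨C, hC0, hC⟩ := hθ.exists_lintegral_cv_nearKer_le
  have hB := one_le_cutBd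
  refine ⟨46 * (C * cutBd), by positivity, ?_⟩
  intro u ω W A α r m U s hu hm hr hα hU0 hU hs hsr j k hloc
  have hη := isTest_mols hs
  have hχ := isTest_cutoff hr
  have hK := hθ.integrable_nearKer hr
  set κ := cv (nearKer θ r) (pd j (pd k (mols s))) with hκ
  have hκt : IsTest κ := hθ.isTest_cv_nearKer hr ((hη.pd k).pd j)
  set P := cv (fun y => u y j * u y k) κ with hP
  have hPs : ContDiff ℝ (⊤ : ℕ∞) P := contDiff_cv hloc hκt
  have hPd (i : Fin 2) : cv (fun y => u y j * u y k)
      (cv (nearKer θ r) (pd i (pd j (pd k (mols s))))) = pd i P := by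
    rw [hP, pd_cv hloc hκt, hκ, pd_cv hK.locallyIntegrable ((hη.pd k).pd j)]
  simp only [hPd]
  set g : Plane → ℝ := fun x => smo u s 0 x * pd 0 (cutoff r) x + smo u s 1 x * pd 1 (cutoff r) x
    with hg
  have hv (i) := hu.contDiff_smo hs i
  have hgt : IsTest g := ((hχ.pd 0).mul_left (hv 0)).add ((hχ.pd 1).mul_left (hv 1))
  have hgz : ∀ x, 9 / 8 * r ≤ ‖x‖ → g x = 0 := fun x hx => by
    simp [hg, pd_cutoff_eq_zero hr _ hx]
  -- Truncation at `4 * r` changes nothing where `∇χ` lives: the reach is `9/8 * r + 2 * r + s`.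
  set h : Plane → ℝ := (ball (0 : Plane) (4 * r)).indicator fun y => u y j * u y k with hh
  have hhi : Integrable h volume := (integrable_indicator_iff measurableSet_ball).2
    ((hloc.integrableOn_isCompact (isCompact_closedBall (0 : Plane) (4 * r))).mono_set
      ball_subset_closedBall)
  have hhc : HasCompactSupport h := HasCompactSupport.intro (isCompact_closedBall (0 : Plane) (4 * r))
    fun x hx => indicator_of_notMem (fun hb => hx (ball_subset_closedBall hb)) _
  have hsum : ∑ i, ∫ x, cutoff r x * smo u s i x * pd i P x = -∫ x, cv h κ x * g x := by
    have e := integral_transport_smooth hv (hu.div_smo hs) hPs hχ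
    have i1 (i : Fin 2) : Integrable (fun x => cutoff r x * smo u s i x * pd i P x) volume :=
      ((hχ.mul_right (hv i)).mul_right (contDiff_pd hPs i)).integrable
    have i2 (i : Fin 2) : Integrable (fun x => smo u s i x * P x * pd i (cutoff r) x) volume :=
      ((hχ.pd i).mul_left ((hv i).mul hPs)).integrable
    rw [← integral_add (i2 0) (i2 1)] at e
    rw [Fin.sum_univ_two, ← integral_add (i1 0) (i1 1)]
    have e1 : ∫ x, cv h κ x * g x = ∫ x, (smo u s 0 x * P x * pd 0 (cutoff r) x +
        smo u s 1 x * P x * pd 1 (cutoff r) x) := by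
      refine integral_congr_ae (Eventually.of_forall fun x => ?_)
      simp only
      rcases le_or_gt (9 / 8 * r) ‖x‖ with hx | hx
      · rw [hgz x hx, pd_cutoff_eq_zero hr 0 hx, pd_cutoff_eq_zero hr 1 hx]
        ring
      · have hz : ∀ z, 2 * r + s ≤ ‖z‖ → κ z = 0 := fun z hz =>
          cv_eq_zero_of_norm (fun z hz => hθ.nearKer_eq_zero hr hz)
            (fun z hz => pd_eq_zero_of_forall (fun y hy => pd_mols_eq_zero hs k hy)
              (hη.pd k).1 j hs hz) hz
        have e2 : cv h κ x = P x := (cv_eq_cv_indicator hz (by linarith)).symm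
        rw [e2, hg]
        ring
    rw [e1, e, neg_neg]
    refine integral_congr_ae (Eventually.of_forall fun x => ?_)
    simp only
    ring
  rw [hsum, abs_neg]
  have hnp := hθ.near_pressure hr hs hhi hhc j k
  have hgh : IsTest (cv h (mols s)) := isTest_cv hhi.locallyIntegrable hhc hη
  have hQt : IsTest (cv h κ) := by
    rw [hκ, hnp]
    exact hθ.isTest_cv_nearKer hr ((hgh.pd k).pd j)
  have hh2 : ∫⁻ x, ‖h x‖ₑ ^ 2 ≤ ENNReal.ofReal (U ^ 2 * (m ^ 2 * (4 ^ 3 * r ^ (2 + 2 * α)))) := by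
    have e : (fun x => ‖h x‖ₑ ^ 2) =
        (ball (0 : Plane) (4 * r)).indicator fun y => ‖u y j * u y k‖ₑ ^ 2 := by
      funext x
      by_cases hx : x ∈ ball (0 : Plane) (4 * r)
      · rw [hh, indicator_of_mem hx, indicator_of_mem hx]
      · rw [hh, indicator_of_notMem hx, indicator_of_notMem hx]; simp
    rw [e, lintegral_indicator measurableSet_ball, ENNReal.ofReal_mul (sq_nonneg U)]
    calc ∫⁻ x in ball (0 : Plane) (4 * r), ‖u x j * u x k‖ₑ ^ 2
        ≤ ∫⁻ x in ball (0 : Plane) (4 * r), ENNReal.ofReal (U ^ 2) * ‖u x‖ₑ ^ 2 := by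
          refine lintegral_mono_ae ((ae_restrict_iff' measurableSet_ball).2 ?_)
          filter_upwards [hU] with x hx hxb
          rw [enorm_mul, mul_pow, ENNReal.ofReal_pow hU0]
          refine mul_le_mul' (pow_le_pow_left' ?_ 2) (pow_le_pow_left' (enorm_coord_le _ _) 2)
          rw [Real.enorm_eq_ofReal_abs]
          exact ENNReal.ofReal_le_ofReal (hx (by simpa using hxb) j)
      _ = ENNReal.ofReal (U ^ 2) * ∫⁻ x in ball (0 : Plane) (4 * r), ‖u x‖ₑ ^ 2 :=
          lintegral_const_mul' _ _ ENNReal.ofReal_ne_top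
      _ ≤ _ := mul_le_mul' le_rfl (hm.lintegral_scale_le hr.le hα (by norm_num))
  have hQ2 : ∫ x, cv h κ x ^ 2 ≤ C ^ 2 * (U ^ 2 * (m ^ 2 * (4 ^ 3 * r ^ (2 + 2 * α)))) := by
    refine integral_sq_le_of_lintegral hQt.continuous.aestronglyMeasurable (by positivity) ?_
    rw [hκ, hnp, ENNReal.ofReal_mul (sq_nonneg C)]
    refine (hC r hr _ hgh j k).trans (mul_le_mul' le_rfl (le_trans ?_ hh2))
    refine (lintegral_cv_sq_le hhi.1.aemeasurable hη.continuous).trans_eq ?_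
    rw [lintegral_mols hs, one_pow, one_mul]
  have hcs := sq_integral_mul_le (hQt.memLp 2) (hgt.memLp 2)
  have hg2 := hu.integral_div_cutoff_sq_le hm hr hα hs hsr
  refine abs_le_of_sq_le_sq ?_ (by positivity)
  calc (∫ x, cv h κ x * g x) ^ 2 ≤ (∫ x, cv h κ x ^ 2) * ∫ x, g x ^ 2 := hcs
    _ ≤ (C ^ 2 * (U ^ 2 * (m ^ 2 * (4 ^ 3 * r ^ (2 + 2 * α))))) *
        (32 * (cutBd / r) ^ 2 * (m ^ 2 * r ^ (2 + 2 * α))) :=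
        mul_le_mul hQ2 hg2 (integral_nonneg fun x => sq_nonneg _) (by positivity)
    -- `2048 = 4 ^ 3 * 32` is not a square; it is rounded up to `2116 = 46 ^ 2`.
    _ = 2048 * (C * cutBd * (U * (m ^ 2 * (r ^ (2 + 2 * α) / r)))) ^ 2 := by ring
    _ ≤ 2116 * (C * cutBd * (U * (m ^ 2 * (r ^ (2 + 2 * α) / r)))) ^ 2 :=
        mul_le_mul_of_nonneg_right (by norm_num) (sq_nonneg _)
    _ = _ := by ring

/-- On the support of the cut-off the far force is bounded pointwise, through the cubic decay of its
kernel and `MorreyBd.lintegral_weight_le`. It remains to multiply by `U` and by the area of the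
ball. -/
theorem exists_abs_far_flux_le (hθ : IsCutoff θ) : ∃ E, 0 < E ∧
    ∀ {u : Plane → Plane} {ω : Plane → ℝ} {W A α r m U s : ℝ}, Flow u ω W A → MorreyBd α r m u →
      0 < r → α < 1 / 2 → 0 ≤ U → (∀ᵐ x, ‖x‖ < 4 * r → ∀ j, |u x j| ≤ U) → 0 < s → s ≤ r / 8 →
      ∀ i j k : Fin 2,
      |∫ x, cutoff r x * smo u s i x * cv (fun y => u y j * u y k) (cv (farD θ r i j k) (mols s)) x| ≤
      E * dyadBd α * (U * (m ^ 2 * (r ^ (2 + 2 * α) / r))) := by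
  obtain ⟨C, hC0, hC⟩ := exists_farD_bound hθ
  refine ⟨27 * (8 * C) * 4, by positivity, ?_⟩
  intro u ω W A α r m U s hu hm hr hα hU0 hU hs hsr i j k
  have hη := isTest_mols hs
  have hd := (dyadBd_pos hα).le
  have hker (z : Plane) : |cv (farD θ r i j k) (mols s) z| ≤ 8 * C / (r + ‖z‖) ^ 3 := by
    have h := abs_cv_le_of_decay (a := s) hr hC0.le (by linarith) (hC r hr i j k) hη.integrable
      (fun x hx => mols_eq_zero hs hx) z
    have e : ∫ t, |mols s t| = 1 := by
      rw [← integral_mols hs]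
      exact integral_congr_ae (Eventually.of_forall fun t => abs_of_nonneg (mols_nonneg t))
    rwa [e, mul_one] at h
  have hrp : r ^ (2 * α - 1) = r ^ (2 + 2 * α) / r ^ 3 := by
    rw [← Real.rpow_natCast r 3, ← Real.rpow_sub hr]
    congr 1
    push_cast
    ring
  set D := 27 * (8 * C) * (dyadBd α * (m ^ 2 * r ^ (2 * α - 1))) with hD
  have hrp0 : 0 ≤ r ^ (2 * α - 1) := Real.rpow_nonneg hr.le _
  have hD0 : 0 ≤ D := by positivity
  have hf (x : Plane) (hx : ‖x‖ ≤ 9 / 8 * r) :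
      |cv (fun y => u y j * u y k) (cv (farD θ r i j k) (mols s)) x| ≤ D := by
    rw [← Real.norm_eq_abs, ← toReal_enorm, cv_apply]
    refine ENNReal.toReal_le_of_le_ofReal hD0 ((enorm_integral_le_lintegral_enorm _).trans ?_)
    calc ∫⁻ y, ‖u y j * u y k * cv (farD θ r i j k) (mols s) (x - y)‖ₑ
        ≤ ∫⁻ y, ENNReal.ofReal (27 * (8 * C)) * (‖u y‖ₑ ^ 2 * ENNReal.ofReal (1 / (r + ‖y‖) ^ 3)) := by
          refine lintegral_mono fun y => ?_
          rw [enorm_mul, enorm_mul, mul_left_comm, sq]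
          refine mul_le_mul' (mul_le_mul' (enorm_coord_le _ _) (enorm_coord_le _ _)) ?_
          rw [← ENNReal.ofReal_mul (by positivity), Real.enorm_eq_ofReal_abs]
          refine ENNReal.ofReal_le_ofReal ((hker _).trans ?_)
          have h1 : ‖y‖ ≤ ‖x‖ + ‖x - y‖ := by
            have := norm_sub_le x (x - y)
            rwa [sub_sub_cancel] at this
          -- From `‖x‖ ≤ 9/8 * r`; the cube of `3` is the constant `27`.
          have h2 : r + ‖y‖ ≤ 3 * (r + ‖x - y‖) := by linarith [norm_nonneg (x - y)]
          have h3 : (r + ‖y‖) ^ 3 ≤ (3 * (r + ‖x - y‖)) ^ 3 := by gcongr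
          rw [mul_one_div, div_le_div_iff₀ (by positivity) (by positivity)]
          calc 8 * C * (r + ‖y‖) ^ 3 ≤ 8 * C * (3 * (r + ‖x - y‖)) ^ 3 := by gcongr
            _ = _ := by ring
      _ = ENNReal.ofReal (27 * (8 * C)) *
          ∫⁻ y, ‖u y‖ₑ ^ 2 * ENNReal.ofReal (1 / (r + ‖y‖) ^ 3) :=
          lintegral_const_mul' _ _ ENNReal.ofReal_ne_top
      _ ≤ ENNReal.ofReal (27 * (8 * C)) * ENNReal.ofReal (dyadBd α * (m ^ 2 * r ^ (2 * α - 1))) :=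
          mul_le_mul' le_rfl (hm.lintegral_weight_le hr hα hu.meas)
      _ = ENNReal.ofReal D := by rw [← ENNReal.ofReal_mul (by positivity)]
  have hz : ∀ x, 9 / 8 * r ≤ ‖x‖ → cutoff r x * smo u s i x *
      cv (fun y => u y j * u y k) (cv (farD θ r i j k) (mols s)) x = 0 := fun x hx => by
    rw [cutoff_eq_zero hr hx]
    ring
  rw [← setIntegral_ball_eq hz]
  have hb := norm_setIntegral_le_of_norm_le_const (μ := volume) (s := ball (0 : Plane) (9 / 8 * r))
    (f := fun x => cutoff r x * smo u s i x *
      cv (fun y => u y j * u y k) (cv (farD θ r i j k) (mols s)) x) (C := U * D)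
    measure_ball_lt_top (fun x hx => by
      have hx' : ‖x‖ ≤ 9 / 8 * r := (by simpa using hx : ‖x‖ < 9 / 8 * r).le
      rw [norm_mul, norm_mul, Real.norm_eq_abs, abs_of_nonneg (cutoff_nonneg x)]
      refine mul_le_mul ?_ (hf x hx') (abs_nonneg _) hU0
      exact (mul_le_of_le_one_left (norm_nonneg _) (cutoff_le_one x)).trans
        (abs_smo_le_of_local hU hs hsr i hx'))
  have hvol : volume.real (ball (0 : Plane) (9 / 8 * r)) ≤ 4 * r ^ 2 := by
    have h1 : volume.real (ball (0 : Plane) (9 / 8 * r)) ≤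
        volume.real (closedBall (0 : Plane) (9 / 8 * r)) :=
      measureReal_mono ball_subset_closedBall measure_closedBall_lt_top.ne
    have h2 := volume_closedBall_plane (0 : Plane) (show 0 ≤ 9 / 8 * r by positivity)
    rw [h2] at h1
    -- The bound `π < 3.15` suffices for `(9/8)² π ≤ 4`.
    have h3 := Real.pi_lt_d2
    nlinarith [sq_nonneg r]
  refine hb.trans ((mul_le_mul_of_nonneg_left hvol (by positivity)).trans_eq ?_)
  rw [hD, hrp]
  field_simp

end Flow

/-! ### The local energy inequality -/

theorem integrable_cutoff_mul {f : Plane → ℝ} {r : ℝ} (hr : 0 < r) (hf : Continuous f) :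
    Integrable (fun x => cutoff r x * f x) volume :=
  ((isTest_cutoff hr).continuous.mul hf).integrable_of_hasCompactSupport
    (isTest_cutoff hr).2.mul_right

theorem isDecaying_farD_of_one_le {θ : Plane → ℝ} (hθ : IsCutoff θ) {r : ℝ} (hr : 1 ≤ r)
    (i j k : Fin 2) : IsDecaying (farD θ r i j k) := by
  obtain ⟨C, hC0, hC⟩ := exists_farD_bound hθ
  refine ⟨(contDiff_farD hθ i j k).continuous, C, hC0.le, fun z => ?_⟩
  refine (hC r (by linarith) i j k z).trans ?_
  gcongr

theorem deriv_sq : deriv (fun s : ℝ => s ^ 2) = fun s => 2 * s := by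
  funext s
  simp

/-- The force splits into transport, commutator and pressure, and `integral_transport` with `β(s) =
s²` moves the transport term onto the cut-off. -/
theorem Flow.energy_split {u : Plane → Plane} {ω : Plane → ℝ} {W A r s : ℝ} {θ : Plane → ℝ}
    (hu : Flow u ω W A) (hθ : IsCutoff θ) (hr : 1 ≤ r) (hs : 0 < s)
    (hcub : ∀ j k, CubicIntegrable fun y => u y j * u y k)
    (hF : ∀ i, Continuous (force θ (mols s) i u)) (i : Fin 2) :
    ∫ x, cutoff r x * (2 * smo u s i x * force θ (mols s) i u x) =
      (∫ x, (u x 0 * pd 0 (cutoff r) x + u x 1 * pd 1 (cutoff r) x) * smo u s i x ^ 2) -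
      (∫ x, cutoff r x * (2 * smo u s i x) * comm u (fun y => u y i) s x) -
      2 * ∑ j, ∑ k, ((∫ x, cutoff r x * smo u s i x * cv (fun y => u y j * u y k)
        (cv (nearKer radialCut r) (pd i (pd j (pd k (mols s))))) x) +
        ∫ x, cutoff r x * smo u s i x * cv (fun y => u y j * u y k)
          (cv (farD radialCut r i j k) (mols s)) x) := by
  have hr0 : 0 < r := by linarith
  have hη := isTest_mols hs
  have hχ := isTest_cutoff hr0
  have hθ' := isCutoff_radialCut
  have hv := hu.contDiff_smo hs i
  set near : Fin 2 → Fin 2 → Plane → ℝ := fun j k => cv (fun y => u y j * u y k)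
    (cv (nearKer radialCut r) (pd i (pd j (pd k (mols s))))) with hnear
  set far : Fin 2 → Fin 2 → Plane → ℝ := fun j k => cv (fun y => u y j * u y k)
    (cv (farD radialCut r i j k) (mols s)) with hfar
  have dn (j k) : IsDecaying (cv (nearKer radialCut r) (pd i (pd j (pd k (mols s))))) :=
    (hθ'.isTest_cv_nearKer hr0 (((hη.pd k).pd j).pd i)).isDecaying
  have df (j k) : IsDecaying (cv (farD radialCut r i j k) (mols s)) :=
    (isDecaying_farD_of_one_le hθ' hr i j k).cv hη.continuous hη.2
  have hp (j k : Fin 2) (x : Plane) : cv (fun y => u y j * u y k) (presKer θ 1 (mols s) i j k) x =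
      near j k x + far j k x := by
    -- Scale one and the cut-off `θ` are exchanged for scale `r` and `radialCut`.
    rw [hθ.presKer_eq hθ' one_pos hr0 hη, cv_apply]
    simp only [presKer, mul_add]
    exact integral_add ((dn j k).integrable_mul (hcub j k) x) ((df j k).integrable_mul (hcub j k) x)
  have cn (j k) : Continuous (near j k) := (dn j k).continuous_cv (hcub j k)
  have cf (j k) : Continuous (far j k) := (df j k).continuous_cv (hcub j k)
  have inn (j k) : Integrable (fun x => cutoff r x * smo u s i x * near j k x) volume := by
    have h : Continuous fun x => smo u s i x * near j k x := hv.continuous.mul (cn j k)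
    simpa only [mul_assoc] using integrable_cutoff_mul hr0 h
  have inf (j k) : Integrable (fun x => cutoff r x * smo u s i x * far j k x) volume := by
    have h : Continuous fun x => smo u s i x * far j k x := hv.continuous.mul (cf j k)
    simpa only [mul_assoc] using integrable_cutoff_mul hr0 h
  obtain ⟨i2, e2⟩ := hu.integral_transport hv hχ (β := fun s => s ^ 2) (contDiff_id.pow 2)
  simp only [deriv_sq] at i2 e2
  have i1 : Integrable (fun x => cutoff r x * (2 * smo u s i x * force θ (mols s) i u x)) volume :=
    integrable_cutoff_mul hr0 ((continuous_const.mul hv.continuous).mul (hF i))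
  have is (j k) : Integrable (fun x => cutoff r x * smo u s i x * near j k x +
      cutoff r x * smo u s i x * far j k x) volume := (inn j k).add (inf j k)
  have i3 : Integrable (fun x => ∑ j, ∑ k, (cutoff r x * smo u s i x * near j k x +
      cutoff r x * smo u s i x * far j k x)) volume :=
    integrable_finsetSum _ fun j _ => integrable_finsetSum _ fun k _ => is j k
  have e3 : ∫ x, ∑ j, ∑ k, (cutoff r x * smo u s i x * near j k x +
      cutoff r x * smo u s i x * far j k x) = ∑ j, ∑ k, ((∫ x, cutoff r x * smo u s i x * near j k x)
        + ∫ x, cutoff r x * smo u s i x * far j k x) := by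
    rw [integral_finsetSum _ fun j _ => integrable_finsetSum _ fun k _ => is j k]
    refine Finset.sum_congr rfl fun j _ => ?_
    rw [integral_finsetSum _ fun k _ => is j k]
    exact Finset.sum_congr rfl fun k _ => integral_add (inn j k) (inf j k)
  have e4 : ∫ x, cutoff r x * (2 * smo u s i x) * comm u (fun y => u y i) s x =
      -(∫ x, cutoff r x * (2 * smo u s i x * (u x 0 * pd 0 (smo u s i) x +
        u x 1 * pd 1 (smo u s i) x))) -
      (∫ x, cutoff r x * (2 * smo u s i x * force θ (mols s) i u x)) -
      2 * ∫ x, ∑ j, ∑ k, (cutoff r x * smo u s i x * near j k x +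
        cutoff r x * smo u s i x * far j k x) := by
    have e5 := integral_sub (i2.neg.sub i1) (i3.const_mul 2)
    have e6 := integral_sub i2.neg i1
    simp only [Pi.sub_apply, Pi.neg_apply, integral_neg, integral_const_mul] at e5 e6
    rw [← e6, ← e5]
    refine integral_congr_ae (Eventually.of_forall fun x => ?_)
    simp only
    rw [Flow.force_component i s x]
    simp only [hp, Fin.sum_univ_two]
    ring
  rw [e4, e2, ← e3]
  ring

theorem exists_energy_flux_le : ∃ E, 0 < E ∧
    ∀ {u : Plane → Plane} {ω : Plane → ℝ} {W A α r m U s : ℝ} {θ : Plane → ℝ}, Flow u ω W A →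
      MorreyBd α r m u → IsCutoff θ → 1 ≤ r → α < 1 / 2 → 0 ≤ U →
      (∀ᵐ x, ‖x‖ < 4 * r → ∀ j, |u x j| ≤ U) → 0 < s → s ≤ r / 8 →
      (∀ j k, CubicIntegrable fun y => u y j * u y k) →
      (∀ i, Continuous (force θ (mols s) i u)) →
      ∑ i, ∫ x, cutoff r x * (2 * smo u s i x * force θ (mols s) i u x) ≤
        E * (1 + dyadBd α) * (U * (m ^ 2 * (r ^ (2 + 2 * α) / r))) +
        ∑ i, |∫ x, cutoff r x * (2 * smo u s i x) * comm u (fun y => u y i) s x| := by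
  obtain ⟨E1, hE1, h1⟩ := Flow.exists_abs_near_flux_le isCutoff_radialCut
  obtain ⟨E2, hE2, h2⟩ := Flow.exists_abs_far_flux_le isCutoff_radialCut
  have hB := one_le_cutBd
  refine ⟨32 * cutBd + 8 * E1 + 16 * E2, by positivity, ?_⟩
  intro u ω W A α r m U s θ hu hm hθ hr hα hU0 hU hs hsr hcub hF
  have hr0 : 0 < r := by linarith
  set Q := U * (m ^ 2 * (r ^ (2 + 2 * α) / r)) with hQ
  have hQ0 : 0 ≤ Q := by positivity
  have hd := dyadBd_pos hα
  have t (i) := abs_le.1 (hu.abs_transport_energy_le hm hr0 hα.le hU0 hU hs hsr i)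
  have n (j k) := abs_le.1 (h1 hu hm hr0 hα.le hU0 hU hs hsr j k (hcub j k).locallyIntegrable)
  have f (i j k) := abs_le.1 (h2 hu hm hr0 hα hU0 hU hs hsr i j k)
  rw [← hQ] at t n f
  simp only [hu.energy_split hθ hr hs hcub hF, Fin.sum_univ_two] at n ⊢
  set c : Fin 2 → ℝ := fun i => ∫ x, cutoff r x * (2 * smo u s i x) * comm u (fun y => u y i) s x
  have c0 : -c 0 ≤ |c 0| := neg_le_abs _
  have c1 : -c 1 ≤ |c 1| := neg_le_abs _
  have hex : (32 * cutBd + 8 * E1 + 16 * E2) * (1 + dyadBd α) * Q =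
      32 * cutBd * Q + 8 * (E1 * Q) + 16 * (E2 * dyadBd α * Q) +
        ((32 * cutBd + 8 * E1) * dyadBd α * Q + 16 * E2 * Q) := by ring
  have hpos : 0 ≤ (32 * cutBd + 8 * E1) * dyadBd α * Q + 16 * E2 * Q := by positivity
  have t0 := t 0
  have t1 := t 1
  have n00 := n 0 0
  have n01 := n 0 1
  have n10 := n 1 0
  have n11 := n 1 1
  have f000 := f 0 0 0
  have f001 := f 0 0 1
  have f010 := f 0 1 0
  have f011 := f 0 1 1
  have f100 := f 1 0 0
  have f101 := f 1 0 1
  have f110 := f 1 1 0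
  have f111 := f 1 1 1
  linarith

/-- The functions `H n` are controlled uniformly only from above, so dominated convergence is
applied to the positive part of `H n - g`. -/
theorem le_integral_of_tendsto {H e : ℕ → ℝ → ℝ} {g : ℝ → ℝ} {Y : ℕ → ℝ} {t Q L : ℝ} (ht : 0 ≤ t)
    (hH : ∀ n, IntegrableOn (H n) (Ioc 0 t) volume) (hg : IntegrableOn g (Ioc 0 t) volume)
    (hle : ∀ᶠ n in atTop, ∀ᵐ s, s ∈ Ioc 0 t → H n s ≤ g s + e n s)
    (he0 : ∀ n s, 0 ≤ e n s) (heQ : ∀ n s, e n s ≤ Q)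
    (hlim : ∀ s, Tendsto (fun n => e n s) atTop (𝓝 0)) (hY : ∀ n, Y n = ∫ s in (0 : ℝ)..t, H n s)
    (hL : Tendsto Y atTop (𝓝 L)) : L ≤ ∫ s in (0 : ℝ)..t, g s := by
  set P : ℕ → ℝ → ℝ := fun n s => max (H n s - g s) 0 with hP
  have hPi (n) : IntegrableOn (P n) (Ioc 0 t) volume := ((hH n).sub hg).pos_part
  have hPle : ∀ᶠ n in atTop, ∀ᵐ s ∂(volume.restrict (Ioc 0 t)), ‖P n s‖ ≤ e n s := by
    filter_upwards [hle] with n hn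
    refine (ae_restrict_iff' measurableSet_Ioc).2 ?_
    filter_upwards [hn] with s hs hst
    rw [Real.norm_eq_abs, abs_of_nonneg (le_max_right _ _)]
    exact max_le (by linarith [hs hst]) (he0 n s)
  have hP0 : Tendsto (fun n => ∫ s in Ioc 0 t, P n s) atTop (𝓝 0) := by
    suffices h : Tendsto (fun n => ∫ s in Ioc 0 t, P n s) atTop (𝓝 (∫ s in Ioc 0 t, (0 : ℝ))) by
      simpa using h
    refine tendsto_integral_filter_of_dominated_convergence (fun _ => Q)
      (Eventually.of_forall fun n => (hPi n).1) ?_ (integrable_const Q) ?_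
    · filter_upwards [hPle] with n hn
      filter_upwards [hn] with s hs using hs.trans (heQ n s)
    · obtain ⟨N, hN⟩ := eventually_atTop.1 hPle
      have hall : ∀ᵐ s ∂(volume.restrict (Ioc 0 t)), ∀ k, ‖P (N + k) s‖ ≤ e (N + k) s :=
        ae_all_iff.2 fun k => hN _ (Nat.le_add_right _ _)
      filter_upwards [hall] with s hs
      refine squeeze_zero_norm' ?_ (hlim s)
      filter_upwards [eventually_ge_atTop N] with n hn
      obtain ⟨k, rfl⟩ := Nat.exists_eq_add_of_le hn
      exact hs k
  have hle2 (n) : Y n ≤ (∫ s in Ioc 0 t, g s) + ∫ s in Ioc 0 t, P n s := by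
    rw [hY, intervalIntegral.integral_of_le ht, ← integral_add hg (hPi n)]
    refine integral_mono (hH n) (hg.add (hPi n)) fun s => ?_
    have := le_max_left (H n s - g s) 0
    simp only [hP]
    linarith
  rw [intervalIntegral.integral_of_le ht]
  refine le_of_tendsto_of_tendsto' hL ?_ hle2
  simpa using hP0.const_add (∫ s in Ioc 0 t, g s)

theorem Flow.cutoff_energy {u : Plane → Plane} {ω : Plane → ℝ} {W A r : ℝ} (hu : Flow u ω W A)
    (hr : 0 < r) :
    ∫⁻ x in ball (0 : Plane) r, ‖u x‖ₑ ^ 2 ≤ ENNReal.ofReal (∑ i, ∫ x, cutoff r x * u x i ^ 2) ∧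
    ENNReal.ofReal (∑ i, ∫ x, cutoff r x * u x i ^ 2) ≤
      ∫⁻ x in ball (0 : Plane) (9 / 8 * r), ‖u x‖ₑ ^ 2 := by
  have hi (i : Fin 2) : Integrable (fun x => cutoff r x * u x i ^ 2) volume := by
    have h := hu.locallyIntegrable_mul (hu.linGrowth i) i
    refine (Yudovich.integrable_mul_test h (isTest_cutoff hr)).congr
      (Eventually.of_forall fun x => ?_)
    simp only
    ring
  have his : Integrable (fun x => cutoff r x * u x 0 ^ 2 + cutoff r x * u x 1 ^ 2) volume :=
    (hi 0).add (hi 1)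
  have e : ENNReal.ofReal (∑ i, ∫ x, cutoff r x * u x i ^ 2) =
      ∫⁻ x, ENNReal.ofReal (cutoff r x) * ‖u x‖ₑ ^ 2 := by
    rw [Fin.sum_univ_two, ← integral_add (hi 0) (hi 1), ofReal_integral_eq_lintegral_ofReal
      his (Eventually.of_forall fun x => by
        have := cutoff_nonneg (r := r) x
        simp only [Pi.zero_apply]
        positivity)]
    refine lintegral_congr fun x => ?_
    rw [← mul_add, ← norm_sq_plane, ENNReal.ofReal_mul (cutoff_nonneg x),
      ENNReal.ofReal_pow (norm_nonneg _), ofReal_norm]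
  rw [e]
  constructor
  · rw [← lintegral_indicator measurableSet_ball]
    refine lintegral_mono fun x => ?_
    by_cases hx : x ∈ ball (0 : Plane) r
    · rw [indicator_of_mem hx, cutoff_eq_one hr (by simpa using (mem_ball_zero_iff.1 hx).le)]
      simp
    · rw [indicator_of_notMem hx]
      exact zero_le
  · rw [← lintegral_indicator measurableSet_ball]
    refine lintegral_mono fun x => ?_
    by_cases hx : x ∈ ball (0 : Plane) (9 / 8 * r)
    · rw [indicator_of_mem hx]
      refine mul_le_of_le_one_left' ?_
      rw [ENNReal.ofReal_le_one]
      exact cutoff_le_one x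
    · rw [indicator_of_notMem hx, cutoff_eq_zero hr (by simpa using hx)]
      simp

/-! ### The velocity on a ball, and the time-integrated local energy estimate. -/

/-- The local bound on the velocity, per unit length, in terms of the vorticity and of the
scale-invariant size of the velocity. -/
def supBd (W X : ℝ) : ℝ := (12 * molBd + 1) * (√(W * X) + X)

theorem supBd_nonneg {W X : ℝ} (hX : 0 ≤ X) : 0 ≤ supBd W X := by
  have := molBd_pos
  unfold supBd
  positivity

/-- Minimize the left side under `s ≤ r`, up to constants: take `√(a / W)` when it is admissible and
the endpoint `r` otherwise. -/
theorem exists_scale {W B a r : ℝ} (hW : 0 ≤ W) (hB : 0 ≤ B) (ha : 0 < a) (hr : 0 < r) :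
    ∃ s, 0 < s ∧ s ≤ r ∧ W * s + B * (s⁻¹ * a) ≤ (B + 1) * (√(W * a) + a / r) := by
  rcases le_or_gt (W * r ^ 2) a with h | h
  · refine ⟨r, hr, le_rfl, ?_⟩
    have h1 : W * r ≤ a / r := by rw [le_div_iff₀ hr]; linarith
    have h2 : r⁻¹ * a = a / r := by ring
    have h3 := Real.sqrt_nonneg (W * a)
    rw [h2]
    nlinarith
  · have hW0 : 0 < W := by
      rcases hW.eq_or_lt with h0 | h0
      · rw [← h0, zero_mul] at h; linarith
      · exact h0
    have hq : 0 < √(W * a) := Real.sqrt_pos.2 (by positivity)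
    have hqq : √(W * a) * √(W * a) = W * a := Real.mul_self_sqrt (by positivity)
    refine ⟨√(W * a) / W, by positivity, ?_, ?_⟩
    · rw [div_le_iff₀ hW0]
      refine Real.sqrt_le_iff.2 ⟨by positivity, ?_⟩
      nlinarith
    · have h1 : W * (√(W * a) / W) = √(W * a) := by field_simp
      have h2 : (√(W * a) / W)⁻¹ * a = √(W * a) := by
        rw [inv_div, div_mul_eq_mul_div, div_eq_iff hq.ne', hqq]
      rw [h1, h2]
      have : 0 ≤ a / r := by positivity
      nlinarith

/-- The `L²` size of `u` at radius `r` is of order `a = m r^(1+α)`. Inserting it into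
`ae_abs_coord_le` at the scale given by `exists_scale` yields `√(W a) + a / r`, which is `r` times a
function of `W` and `m r^(α-1)`. -/
theorem MorreyBd.ae_abs_le_supBd {u : Plane → Plane} {ω : Plane → ℝ} {α r m m' W : ℝ}
    (h : MorreyBd α r m u) (h' : MorreyBd α 1 m' u) (hu : AEStronglyMeasurable u volume)
    (hd : IsDivFree u) (hω : IsVorticity u ω) (hW : ∀ᵐ x, |ω x| ≤ W) (hW0 : 0 ≤ W) (hr : 0 < r)
    (hα : α ≤ 1 / 2) (hm : 0 < m) :
    ∀ᵐ x, ‖x‖ < 4 * r → ∀ j, |u x j| ≤ r * supBd W (m * r ^ (α - 1)) := by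
  have hB := molBd_pos
  set a := m * r ^ (1 + α) with ha
  have hra : r ^ (1 + α) = r ^ (α - 1) * r ^ 2 := by
    rw [← Real.rpow_natCast r 2, ← Real.rpow_add hr]
    congr 1
    push_cast
    ring
  have hr2 : r ^ (2 + 2 * α) = (r ^ (1 + α)) ^ 2 := by
    rw [← Real.rpow_natCast (r ^ (1 + α)) 2, ← Real.rpow_mul hr.le]
    congr 1
    push_cast
    ring
  obtain ⟨s, hs, hsr, hsb⟩ := exists_scale hW0 (by positivity : 0 ≤ 12 * molBd)
    (by positivity : 0 < a) hr
  have h0 := ae_abs_coord_le h' hu hd hω hW 0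
  have h1 := ae_abs_coord_le h' hu hd hω hW 1
  filter_upwards [h0, h1] with x h0 h1 hx j
  -- As `‖x‖ + s ≤ 5 * r`, the energy costs `5 ^ 3 = 125 ≤ 12 ^ 2`.
  have hE : ∫⁻ y in ball (0 : Plane) (‖x‖ + s), ‖u y‖ₑ ^ 2 ≤ ENNReal.ofReal ((12 * a) ^ 2) := by
    calc ∫⁻ y in ball (0 : Plane) (‖x‖ + s), ‖u y‖ₑ ^ 2
        ≤ ∫⁻ y in ball (0 : Plane) (5 * r), ‖u y‖ₑ ^ 2 :=
          lintegral_mono_set (ball_subset_ball (by linarith))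
      _ ≤ ENNReal.ofReal (m ^ 2 * (5 ^ 3 * r ^ (2 + 2 * α))) :=
          h.lintegral_scale_le hr.le hα (by norm_num)
      _ ≤ _ := by
          refine ENNReal.ofReal_le_ofReal ?_
          rw [hr2, ha]
          nlinarith [sq_nonneg (m * r ^ (1 + α))]
  have hj : |u x j| ≤ W * s + molBd * s⁻¹ * (12 * a) := by
    fin_cases j
    · exact h0 s hs _ (by positivity) hE
    · exact h1 s hs _ (by positivity) hE
  calc |u x j| ≤ W * s + 12 * molBd * (s⁻¹ * a) := hj.trans_eq (by ring)
    _ ≤ (12 * molBd + 1) * (√(W * a) + a / r) := hsb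
    _ = r * supBd W (m * r ^ (α - 1)) := by
        have e1 : a / r = r * (m * r ^ (α - 1)) := by rw [ha, hra]; field_simp
        have e2 : √(W * a) = r * √(W * (m * r ^ (α - 1))) := by
          rw [ha, hra, show W * (m * (r ^ (α - 1) * r ^ 2)) = r ^ 2 * (W * (m * r ^ (α - 1))) by ring,
            Real.sqrt_mul (sq_nonneg r), Real.sqrt_sq hr.le]
        rw [e1, e2, supBd]
        ring

/-- Two Morrey bounds are admitted: `m₁` up to time `t₀`, and a possibly much worse `m₂`, charged
only for the remaining duration `h`. This asymmetry is what the step-by-step bootstrap needs. -/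
theorem exists_local_energy_le : ∃ E, 0 < E ∧
    ∀ {α W m T : ℝ} {u : ℝ → Plane → Plane} {ω : ℝ → Plane → ℝ} {θ : Plane → ℝ}
      {u₀ : Plane → Plane} {ω₀ : Plane → ℝ} {W₀ A₀ N r t₀ h m₁ m₂ : ℝ}, Evolves θ u₀ T u →
      FlowFamily α W m u ω → IsCutoff θ → Flow u₀ ω₀ W₀ A₀ → MorreyBd α 1 N u₀ → 1 ≤ r →
      T ≤ t₀ + h → 0 ≤ h → (∀ᵐ s, s ∈ Ioo 0 T → ∀ᵐ x, |ω s x| ≤ W₀) → 0 < m₁ → 0 < m₂ →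
      (∀ᵐ s, s ∈ Ioo 0 T → s ≤ t₀ → MorreyBd α r m₁ (u s)) →
      (∀ᵐ s, s ∈ Ioo 0 T → MorreyBd α r m₂ (u s)) →
      ∀ᵐ t, t ∈ Ioo 0 T → ∫⁻ x in ball (0 : Plane) r, ‖u t x‖ₑ ^ 2 ≤
        ENNReal.ofReal (r ^ (2 + 2 * α) * (2 * N ^ 2 + E * (1 + dyadBd α) *
          (t * (m₁ ^ 2 * supBd W₀ (m₁ * r ^ (α - 1))) +
            h * (m₂ ^ 2 * supBd W₀ (m₂ * r ^ (α - 1)))))) := by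
  obtain ⟨E, hE, hflux⟩ := exists_energy_flux_le
  refine ⟨E, hE, ?_⟩
  intro α W m T u ω θ u₀ ω₀ W₀ A₀ N r t₀ h m₁ m₂ hev hu hθ h₀ hN hr hT hh hW hm₁ hm₂ hM₁ hM₂
  have hr0 : 0 < r := by linarith
  have hα := hu.lt_half
  have hd := dyadBd_pos hα
  have hW₀ := h₀.W_nonneg
  have hχ := isTest_cutoff hr0
  have hmol (n : ℕ) := isTest_mols (eps_pos n)
  set G := growthBd W m with hG
  have hG0 : 0 ≤ G := (hu.flow 0).A_nonneg
  set ρ := r ^ (2 + 2 * α) with hρ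
  have hρ0 : 0 ≤ ρ := Real.rpow_nonneg hr0.le _
  set c : ℝ → ℝ := fun k => E * (1 + dyadBd α) * (k ^ 2 * supBd W₀ (k * r ^ (α - 1)) * ρ) with hc
  have hX (k : ℝ) (hk : 0 < k) : 0 ≤ k * r ^ (α - 1) := by positivity
  have hc0 (k : ℝ) (hk : 0 < k) : 0 ≤ c k := by
    have := supBd_nonneg (W := W₀) (hX k hk)
    positivity
  -- After `t₀` the term `c m₁` is superfluous but nonnegative.
  set g : ℝ → ℝ := fun s => c m₁ + (Ioi t₀).indicator (fun _ => c m₂) s with hg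
  set R := 9 / 8 * r with hR
  have hR1 : 1 ≤ R := by linarith
  set D := 2 * (G * (2 + R)) with hD
  have hvb (n : ℕ) (s : ℝ) (i : Fin 2) (x : Plane) (hx : ‖x‖ ≤ R) :
      |smo (u s) (eps n) i x| ≤ G * (2 + R) :=
    ((hu.flow s).abs_smo_le (eps_pos n) i x).trans
      (mul_le_mul_of_nonneg_left (by linarith [eps_le_one n]) hG0)
  set H : ℕ → ℝ → ℝ := fun n s => ∑ i, ∫ x, cutoff r x * (2 * smo (u s) (eps n) i x *
    force θ (mols (eps n)) i (u s) x) with hH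
  set cm : Fin 2 → ℕ → ℝ → ℝ := fun i n s => ∫ x, cutoff r x * (2 * smo (u s) (eps n) i x) *
    comm (u s) (fun y => u s y i) (eps n) x with hcm
  have hcb (i : Fin 2) (n : ℕ) (s : ℝ) : ‖cm i n s‖ₑ ≤ ENNReal.ofReal D *
      ∫⁻ x in ball (0 : Plane) R, ‖comm (u s) (fun y => u s y i) (eps n) x‖ₑ := by
    refine Flow.enorm_integral_mul_comm_le (fun x => ?_) fun x hx => by
      rw [cutoff_eq_zero hr0 hx, zero_mul]
    rcases le_or_gt R ‖x‖ with hx | hx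
    · rw [cutoff_eq_zero hr0 hx, zero_mul, abs_zero]
      positivity
    · rw [abs_mul, abs_mul, abs_of_nonneg (cutoff_nonneg x), abs_two]
      exact (mul_le_of_le_one_left (by positivity) (cutoff_le_one x)).trans
        (mul_le_mul_of_nonneg_left (hvb n s i x hx.le) zero_le_two)
  have hlin (s : ℝ) (i : Fin 2) : LinGrowth (fun y => u s y i) G := (hu.flow s).linGrowth i
  set Q := (ENNReal.ofReal D * ENNReal.ofReal (Flow.commBd W G G R)).toReal with hQ
  have hcQ (i : Fin 2) (n : ℕ) (s : ℝ) : |cm i n s| ≤ Q := by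
    rw [← Real.norm_eq_abs, ← toReal_enorm]
    refine ENNReal.toReal_mono (by finiteness) ((hcb i n s).trans (mul_le_mul' le_rfl ?_))
    exact (hu.flow s).lintegral_comm_le (hlin s i) (eps_pos n) (eps_le_one n) hR1
  have hclim (i : Fin 2) (s : ℝ) : Tendsto (fun n => |cm i n s|) atTop (𝓝 0) := by
    have l : Tendsto (fun n => cm i n s) atTop (𝓝 0) := by
      rw [tendsto_zero_iff_enorm_tendsto_zero]
      have l3 := ENNReal.Tendsto.const_mul (a := ENNReal.ofReal D)
        ((hu.flow s).tendsto_lintegral_comm (hlin s i) hR1) (Or.inr ENNReal.ofReal_ne_top)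
      rw [mul_zero] at l3
      exact tendsto_of_tendsto_of_tendsto_of_le_of_le tendsto_const_nhds l3
        (fun n => zero_le) fun n => hcb i n s
    simpa using l.abs
  have hsq : ContDiff ℝ (⊤ : ℕ∞) fun s : ℝ => s ^ 2 := contDiff_id.pow 2
  have hflow (k : ℝ) (hk : 0 < k) (s : ℝ) (hs : MorreyBd α r k (u s)) (hWs : ∀ᵐ x, |ω s x| ≤ W₀)
      (n : ℕ) (hn : eps n ≤ r / 8) : H n s ≤ c k + ∑ i, |cm i n s| := by
    have hU := hs.ae_abs_le_supBd (hu.morrey s) (hu.slice_meas s) (hu.divFree s) (hu.vort s) hWs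
      hW₀ hr0 hα.le hk
    refine (hflux (hu.flow s) hs hθ hr hα
      (mul_nonneg hr0.le (supBd_nonneg (hX k hk))) hU (eps_pos n) hn (fun j k => hu.cubicIntegrable s j k)
      (fun i => hu.continuous_force hθ (hmol n) i s)).trans_eq ?_
    congr 1
    rw [hc, ← hρ]
    field_simp
  have hlim (v : Plane → Plane) {ζ : Plane → ℝ} {V B : ℝ} (hv : Flow v ζ V B) :
      Tendsto (fun n => ∑ i, ∫ x, cutoff r x * smo v (eps n) i x ^ 2) atTop
        (𝓝 (∑ i, ∫ x, cutoff r x * v x i ^ 2)) := by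
    refine tendsto_finsetSum _ fun i _ => ?_
    refine tendsto_integral_mul_comp (β := fun s => s ^ 2) (a := B * (2 + R)) (R := R) hsq.continuous
      hχ.integrable (fun x hx => cutoff_eq_zero hr0 hx)
      (fun n => (hv.contDiff_smo (eps_pos n) i).continuous)
      (fun n x hx => (hv.abs_smo_le (eps_pos n) i x).trans
        (mul_le_mul_of_nonneg_left (by linarith [eps_le_one n]) hv.A_nonneg)) (hv.ae_tendsto_smo i)
  filter_upwards [ae_all_iff.2 fun n => ae_all_iff.2 fun i => hev _ (hmol n) i] with t ht htT
  have hren (n : ℕ) (i : Fin 2) :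
      IntegrableOn (fun s => ∫ x, cutoff r x * (deriv (fun s => s ^ 2) (smo (u s) (eps n) i x) *
        force θ (mols (eps n)) i (u s) x)) (Ioc 0 t) volume ∧
      (∫ x, cutoff r x * smo (u t) (eps n) i x ^ 2) - ∫ x, cutoff r x * smo u₀ (eps n) i x ^ 2 =
        ∫ s in (0 : ℝ)..t, ∫ x, cutoff r x * (deriv (fun s => s ^ 2) (smo (u s) (eps n) i x) *
          force θ (mols (eps n)) i (u s) x) := by
    obtain ⟨C, -, hC⟩ := hu.exists_force_bound hθ (hmol n) i
    exact renormalized (v := fun s => smo (u s) (eps n) i)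
      (F := fun s x => force θ (mols (eps n)) i (u s) x) (hu.meas_force hθ (hmol n) i) hC
      (h₀.contDiff_smo (eps_pos n) i).continuous hsq hχ (hev _ (hmol n) i) htT (ht n i htT)
  simp only [deriv_sq] at hren
  have hHi (n : ℕ) : IntegrableOn (H n) (Ioc 0 t) volume :=
    integrable_finsetSum _ fun i _ => (hren n i).1
  have hgi : IntegrableOn g (Ioc 0 t) volume :=
    (integrable_const _).add ((integrable_const _).indicator measurableSet_Ioi)
  have hmain := le_integral_of_tendsto (H := H) (e := fun n s => ∑ i, |cm i n s|) (g := g)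
    (Y := fun n => (∑ i, ∫ x, cutoff r x * smo (u t) (eps n) i x ^ 2) -
      ∑ i, ∫ x, cutoff r x * smo u₀ (eps n) i x ^ 2) (Q := Q + Q) htT.1.le hHi hgi ?_
    (fun n s => Finset.sum_nonneg fun i _ => abs_nonneg _)
    (fun n s => by rw [Fin.sum_univ_two]; exact add_le_add (hcQ 0 n s) (hcQ 1 n s))
    (fun s => by simpa using tendsto_finsetSum Finset.univ fun i _ => hclim i s) (fun n => ?_)
    ((hlim _ (hu.flow t)).sub (hlim _ h₀))
  · have hgint : ∫ s in (0 : ℝ)..t, g s ≤ t * c m₁ + h * c m₂ := by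
      have i1 : IntegrableOn (fun _ : ℝ => c m₁) (Ioc 0 t) volume := integrable_const _
      have i2 : IntegrableOn ((Ioi t₀).indicator fun _ : ℝ => c m₂) (Ioc 0 t) volume :=
        (integrable_const _).indicator measurableSet_Ioi
      rw [intervalIntegral.integral_of_le htT.1.le, hg, integral_add i1 i2,
        integral_indicator measurableSet_Ioi, Measure.restrict_restrict measurableSet_Ioi]
      simp only [integral_const, smul_eq_mul]
      refine add_le_add (le_of_eq ?_) ?_
      · simp [htT.1.le]
      · refine mul_le_mul_of_nonneg_right ?_ (hc0 _ hm₂)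
        rw [measureReal_restrict_apply_univ]
        calc volume.real (Ioi t₀ ∩ Ioc 0 t) ≤ volume.real (Icc t₀ (t₀ + h)) :=
              measureReal_mono (fun s hs => ⟨le_of_lt hs.1, hs.2.2.trans (htT.2.le.trans hT)⟩)
                measure_Icc_lt_top.ne
          _ = h := by simp [hh]
    have h1 := ((hu.flow t).cutoff_energy hr0).1
    have h2 := (h₀.cutoff_energy hr0).2.trans (hN R hR1)
    have h3 := (ENNReal.ofReal_le_ofReal_iff (by positivity)).1 h2
    -- `(9/8) ^ 3 ≤ 2`: the enlarged ball at most doubles the bound on the initial energy, whence `2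
    -- * N ^ 2`.
    have h4 : R ^ (2 + 2 * α) ≤ 2 * ρ := by
      refine (rpow_scale_le (by norm_num) hr0.le hα.le).trans ?_
      exact mul_le_mul_of_nonneg_right (by norm_num) hρ0
    have h5 : N ^ 2 * R ^ (2 + 2 * α) ≤ N ^ 2 * (2 * ρ) :=
      mul_le_mul_of_nonneg_left h4 (sq_nonneg N)
    refine h1.trans (ENNReal.ofReal_le_ofReal ?_)
    have h6 : t * c m₁ + h * c m₂ = ρ * (E * (1 + dyadBd α) *
          (t * (m₁ ^ 2 * supBd W₀ (m₁ * r ^ (α - 1))) +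
            h * (m₂ ^ 2 * supBd W₀ (m₂ * r ^ (α - 1))))) := by rw [hc]; ring
    rw [mul_add, ← h6]
    linarith
  · have hn : ∀ᶠ n in atTop, eps n ≤ r / 8 :=
      tendsto_eps.eventually_le_const (by positivity)
    filter_upwards [hn] with n hn
    filter_upwards [hM₁, hM₂, hW] with s h1 h2 hWs hst
    have hsT : s ∈ Ioo 0 T := ⟨hst.1, hst.2.trans_lt htT.2⟩
    rcases le_or_gt s t₀ with hs | hs
    · refine (hflow _ hm₁ s (h1 hsT hs) (hWs hsT) n hn).trans ?_
      simp [hg, hs]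
    · refine (hflow _ hm₂ s (h2 hsT) (hWs hsT) n hn).trans ?_
      rw [hg]
      simp only
      rw [indicator_of_mem (by exact hs)]
      linarith [hc0 _ hm₁]
  · rw [hH, intervalIntegral.integral_finsetSum fun i _ =>
      (intervalIntegrable_iff_integrableOn_Ioc_of_le htT.1.le).2 (hren n i).1,
      ← Finset.sum_sub_distrib]
    exact Finset.sum_congr rfl fun i _ => (hren n i).2

/-! ### Propagation of the Morrey bound -/

theorem supBd_mono {W X Y : ℝ} (hW : 0 ≤ W) (h : X ≤ Y) : supBd W X ≤ supBd W Y := by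
  have := molBd_pos
  unfold supBd
  gcongr

theorem supBd_two_mul_le {W X : ℝ} :
    supBd W (2 * X) ≤ 2 * (12 * molBd + 1) * (√(W * X) + X) := by
  have hB := molBd_pos
  have h1 : √(W * (2 * X)) ≤ 2 * √(W * X) := by
    rw [show W * (2 * X) = 2 * (W * X) by ring, Real.sqrt_mul zero_le_two]
    refine mul_le_mul_of_nonneg_right ?_ (Real.sqrt_nonneg _)
    rw [Real.sqrt_le_left zero_le_two]
    norm_num
  unfold supBd
  nlinarith

theorem le_of_eventually_rat_gt {b : ℝ → ℝ≥0∞} {r : ℝ} {L : ℝ≥0∞} (hb : ContinuousAt b r)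
    (h : ∀ᶠ x in 𝓝 r, r < x → (∃ q : ℚ, (q : ℝ) = x) → L ≤ b x) : L ≤ b r := by
  by_contra! hlt
  obtain ⟨l, v, hr, hs⟩ := mem_nhds_iff_exists_Ioo_subset.1 (h.and (hb.eventually_lt_const hlt))
  obtain ⟨q, hq1, hq2⟩ := exists_rat_btwn hr.2
  have := hs ⟨hr.1.trans hq1, hq2⟩
  exact (this.1 hq1 ⟨q, rfl⟩).not_gt this.2

theorem continuousAt_morrey_bound (m : ℝ) {α r : ℝ} (hr : 0 < r) :
    ContinuousAt (fun q : ℝ => ENNReal.ofReal (m ^ 2 * q ^ (2 + 2 * α))) r :=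
  ENNReal.continuous_ofReal.continuousAt.comp
    (continuousAt_const.mul (Real.continuousAt_rpow_const _ _ (Or.inl hr.ne')))

/-- Rational radii decrease to a given one. Countably many radii suffice, so their exceptional sets
of times can be united. -/
theorem MorreyBd.of_rat {α R m : ℝ} (hR : 0 < R) {f : Plane → Plane}
    (h : ∀ q : ℚ, R < q → ∫⁻ x in ball (0 : Plane) q, ‖f x‖ₑ ^ 2 ≤
      ENNReal.ofReal (m ^ 2 * (q : ℝ) ^ (2 + 2 * α))) : MorreyBd α R m f := by
  intro r hr
  refine le_of_eventually_rat_gt (r := r) (continuousAt_morrey_bound m (α := α) (hR.trans_le hr))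
    (Eventually.of_forall ?_)
  rintro x hx ⟨q, rfl⟩
  exact (lintegral_mono_set (ball_subset_ball hx.le)).trans (h q (hr.trans_lt hx))

theorem Evolves.mono {θ : Plane → ℝ} {u₀ : Plane → Plane} {T T' : ℝ} {u : ℝ → Plane → Plane}
    (h : Evolves θ u₀ T u) (hT : T' ≤ T) : Evolves θ u₀ T' u := fun ρ hρ i => by
  filter_upwards [h ρ hρ i] with t ht htT using ht ⟨htT.1, htT.2.trans_le hT⟩

/-- Induction over time steps of fixed length `h`. The budget `(2N)² = 2N² + N² + N²` is shared by
the initial energy, the flux under the bound `2N` already known, and the flux under the crude bound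
`M` on the newest step. -/
theorem exists_morrey_propagation {α : ℝ} (hα : α < 1 / 2) : ∃ c, 0 < c ∧
    ∀ {W m T : ℝ} {u : ℝ → Plane → Plane} {ω : ℝ → Plane → ℝ} {θ : Plane → ℝ}
      {u₀ : Plane → Plane} {ω₀ : Plane → ℝ} {W₀ A₀ N R : ℝ}, Evolves θ u₀ T u →
      FlowFamily α W m u ω → IsCutoff θ → Flow u₀ ω₀ W₀ A₀ → 0 < N → MorreyBd α 1 N u₀ → 1 ≤ R →
      T * (√(W₀ * (N * R ^ (α - 1))) + N * R ^ (α - 1)) ≤ c →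
      ∀ᵐ t, t ∈ Ioo 0 T → MorreyBd α R (2 * N) (u t) := by
  obtain ⟨E, hE, hen⟩ := exists_local_energy_le
  have hd := dyadBd_pos hα
  have hB := molBd_pos
  set C := E * (1 + dyadBd α) with hC
  have hC0 : 0 < C := by positivity
  -- The factor `8` is `4 * 2`, from `(2 * N) ^ 2` and from `supBd_two_mul_le`; the flux under the
  -- bound `2 * N` then uses at most `N ^ 2`.
  refine ⟨1 / (8 * (12 * molBd + 1) * C), by positivity, ?_⟩
  intro W m T u ω θ u₀ ω₀ W₀ A₀ N R hev hu hθ h₀ hN hN₀ hR hcond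
  have hR0 : 0 < R := by linarith
  have hW₀ := h₀.W_nonneg
  have hWω := hev.abs_vort_le hu hθ h₀
  set X := N * R ^ (α - 1) with hX
  have hX0 : 0 ≤ X := by positivity
  set M := m + 2 * N with hM
  have hM0 : 0 < M := by have := hu.nonneg; positivity
  set S := supBd W₀ (M * R ^ (α - 1)) with hS
  have hS0 : 0 ≤ S := supBd_nonneg (by positivity)
  -- The crude bound costs at most `N ^ 2` on a step of this length. The length is the same for all
  -- steps, so finitely many reach `T`.
  set h := N ^ 2 / (C * (M ^ 2 * S) + 1) with hh
  have hh0 : 0 < h := by positivity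
  have hhb : C * (h * (M ^ 2 * S)) ≤ N ^ 2 := by
    rw [hh, show C * (N ^ 2 / (C * (M ^ 2 * S) + 1) * (M ^ 2 * S)) =
      N ^ 2 * ((C * (M ^ 2 * S)) / (C * (M ^ 2 * S) + 1)) by ring]
    refine mul_le_of_le_one_right (sq_nonneg N) ((div_le_one (by positivity)).2 (by linarith))
  have hpow {q : ℝ} (hq : R ≤ q) : q ^ (α - 1) ≤ R ^ (α - 1) :=
    Real.rpow_le_rpow_of_nonpos hR0 hq (by linarith)
  have step (k : ℕ) : ∀ᵐ s, s ∈ Ioo 0 T → s ≤ k * h → MorreyBd α R (2 * N) (u s) := by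
    induction k with
    | zero =>
      refine Eventually.of_forall fun s hs hs0 => ?_
      rw [Nat.cast_zero, zero_mul] at hs0
      exact absurd hs.1 hs0.not_gt
    | succ k ih =>
      set T' := min T (((k + 1 : ℕ) : ℝ) * h) with hT'
      have hT'T : T' ≤ T := min_le_left _ _
      have hq (q : ℚ) : ∀ᵐ t, t ∈ Ioo 0 T' → R < q → ∫⁻ x in ball (0 : Plane) q, ‖u t x‖ₑ ^ 2 ≤
          ENNReal.ofReal ((2 * N) ^ 2 * (q : ℝ) ^ (2 + 2 * α)) := by
        rcases le_or_gt (q : ℝ) R with hqR | hqR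
        · exact Eventually.of_forall fun t _ h => absurd h hqR.not_gt
        have hq1 : 1 ≤ (q : ℝ) := by linarith
        have hres := hen (t₀ := k * h) (h := h) (m₁ := 2 * N) (m₂ := M) (hev.mono hT'T) hu hθ h₀ hN₀
          hq1 ((min_le_right _ _).trans_eq (by push_cast; ring)) hh0.le
          (hWω.mono fun s hs hsT => hs ⟨hsT.1, hsT.2.trans_le hT'T⟩) (by positivity) hM0
          (ih.mono fun s hs hsT hsk => (hs ⟨hsT.1, hsT.2.trans_le hT'T⟩ hsk).mono hR0.le hqR.le
            (by positivity) le_rfl)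
          (Eventually.of_forall fun s _ => (hu.morrey s).mono zero_le_one hq1 hu.nonneg (by linarith))
        filter_upwards [hres] with t ht htT _
        refine (ht htT).trans (ENNReal.ofReal_le_ofReal ?_)
        rw [mul_comm ((2 * N) ^ 2) ((q : ℝ) ^ (2 + 2 * α))]
        refine mul_le_mul_of_nonneg_left ?_ (Real.rpow_nonneg (by linarith) _)
        have h1 : supBd W₀ (2 * N * (q : ℝ) ^ (α - 1)) ≤ 2 * (12 * molBd + 1) * (√(W₀ * X) + X) := by
          refine (supBd_mono hW₀ ?_).trans (supBd_two_mul_le)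
          rw [mul_assoc]
          exact mul_le_mul_of_nonneg_left (mul_le_mul_of_nonneg_left (hpow hqR.le) hN.le) zero_le_two
        have h2 : supBd W₀ (M * (q : ℝ) ^ (α - 1)) ≤ S :=
          supBd_mono hW₀ (mul_le_mul_of_nonneg_left (hpow hqR.le) hM0.le)
        have h3 : t * (√(W₀ * X) + X) ≤ 1 / (8 * (12 * molBd + 1) * C) :=
          (mul_le_mul_of_nonneg_right (htT.2.le.trans hT'T) (by positivity)).trans hcond
        have h4 : C * (t * ((2 * N) ^ 2 * supBd W₀ (2 * N * (q : ℝ) ^ (α - 1)))) ≤ N ^ 2 := by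
          calc C * (t * ((2 * N) ^ 2 * supBd W₀ (2 * N * (q : ℝ) ^ (α - 1))))
              ≤ C * (t * ((2 * N) ^ 2 * (2 * (12 * molBd + 1) * (√(W₀ * X) + X)))) := by
                have := htT.1.le
                gcongr
            _ = N ^ 2 * (8 * (12 * molBd + 1) * C) * (t * (√(W₀ * X) + X)) := by ring
            _ ≤ N ^ 2 * (8 * (12 * molBd + 1) * C) * (1 / (8 * (12 * molBd + 1) * C)) :=
                mul_le_mul_of_nonneg_left h3 (by positivity)
            _ = N ^ 2 := by field_simp
        have h5 : C * (h * (M ^ 2 * supBd W₀ (M * (q : ℝ) ^ (α - 1)))) ≤ N ^ 2 := by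
          refine le_trans ?_ hhb
          gcongr
        nlinarith
      -- The energy estimate lives on an open interval, so the endpoint of the step is discarded as
      -- a null set.
      have hne : ∀ᵐ s : ℝ, s ≠ ((k + 1 : ℕ) : ℝ) * h := by simp [ae_iff, measure_singleton]
      filter_upwards [ae_all_iff.2 hq, hne] with t ht hne htT htk
      exact MorreyBd.of_rat hR0 fun q hqR =>
        ht q ⟨htT.1, lt_min htT.2 (lt_of_le_of_ne htk hne)⟩ hqR
  obtain ⟨k, hk⟩ := exists_nat_ge (T / h)
  filter_upwards [step k] with t ht htT
  exact ht htT (htT.2.le.trans ((div_le_iff₀ hh0).1 hk))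

/-- Raised to the power `1 - α`, the condition says `(Kt + (Kt)² W) X ≤ 1`. Each summand is at most
one, and so is the root `Kt √(WX)` of the second, which gives the `2`. -/
theorem rate_le_of_radius_le {α K t W N R : ℝ} (hα : α < 1) (hK : 0 < K) (ht : 0 ≤ t) (hW : 0 ≤ W)
    (hN : 0 ≤ N) (hR : 1 ≤ R)
    (h : (K * t + (K * t) ^ 2 * W) ^ (1 / (1 - α)) * N ^ (1 / (1 - α)) ≤ R) :
    t * (√(W * (N * R ^ (α - 1))) + N * R ^ (α - 1)) ≤ 2 / K := by
  have hR0 : 0 < R := by linarith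
  have ha : 0 ≤ K * t + (K * t) ^ 2 * W := by positivity
  rw [← Real.mul_rpow ha hN] at h
  have h1 : (K * t + (K * t) ^ 2 * W) * N ≤ R ^ (1 - α) := by
    have h2 := Real.rpow_le_rpow (by positivity) h (by linarith : 0 ≤ 1 - α)
    rwa [← Real.rpow_mul (by positivity), one_div_mul_cancel (by linarith), Real.rpow_one] at h2
  set X := N * R ^ (α - 1) with hX
  have hX0 : 0 ≤ X := by positivity
  have h3 : (K * t + (K * t) ^ 2 * W) * X ≤ 1 := by
    have h4 := mul_le_mul_of_nonneg_right h1 (Real.rpow_nonneg hR0.le (α - 1))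
    rw [← Real.rpow_add hR0, show 1 - α + (α - 1) = 0 by ring, Real.rpow_zero] at h4
    rwa [hX, ← mul_assoc]
  have h5 : 0 ≤ (K * t) ^ 2 * W * X := by positivity
  have h6 : 0 ≤ K * t * X := by positivity
  have h7 : K * t * √(W * X) ≤ 1 := by
    refine le_of_sq_le_sq (b := 1) ?_ zero_le_one
    rw [mul_pow, Real.sq_sqrt (by positivity)]
    linarith
  rw [le_div_iff₀ hK]
  linarith

/-! ### Weakly continuous representatives -/

theorem enorm_sq_plane (x : Plane) : ‖x‖ₑ ^ 2 = ‖x 0‖ₑ ^ 2 + ‖x 1‖ₑ ^ 2 := by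
  have e (a : ℝ) : ‖a‖ₑ ^ 2 = ENNReal.ofReal (a ^ 2) := by
    rw [Real.enorm_eq_ofReal_abs, ← ENNReal.ofReal_pow (abs_nonneg _), sq_abs]
  rw [e, e, ← ENNReal.ofReal_add (sq_nonneg _) (sq_nonneg _), ← norm_sq_plane,
    ENNReal.ofReal_pow (norm_nonneg _), ofReal_norm]

theorem lintegral_ball_cv_mols_sq_le {f : Plane → ℝ} (hf : AEStronglyMeasurable f volume) {s : ℝ}
    (hs : 0 < s) (r : ℝ) : ∫⁻ x in ball (0 : Plane) r, ‖cv f (mols s) x‖ₑ ^ 2 ≤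
      ∫⁻ x in ball (0 : Plane) (r + s), ‖f x‖ₑ ^ 2 := by
  set g := (ball (0 : Plane) (r + s)).indicator f with hg
  have hgm : AEStronglyMeasurable g volume := hf.indicator measurableSet_ball
  calc ∫⁻ x in ball (0 : Plane) r, ‖cv f (mols s) x‖ₑ ^ 2
      = ∫⁻ x in ball (0 : Plane) r, ‖cv g (mols s) x‖ₑ ^ 2 := by
        refine setLIntegral_congr_fun measurableSet_ball fun x hx => ?_
        have hx' : ‖x‖ < r := by simpa using hx
        rw [cv_eq_cv_indicator (a := r + s) (fun z hz => mols_eq_zero hs hz) (by linarith)]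
    _ ≤ ∫⁻ x, ‖cv g (mols s) x‖ₑ ^ 2 := setLIntegral_le_lintegral _ _
    _ ≤ (∫⁻ t, ‖mols s t‖ₑ) ^ 2 * ∫⁻ t, ‖g t‖ₑ ^ 2 :=
        lintegral_cv_sq_le hgm.aemeasurable (isTest_mols hs).continuous
    _ = ∫⁻ x in ball (0 : Plane) (r + s), ‖f x‖ₑ ^ 2 := by
        rw [lintegral_mols hs, one_pow, one_mul, ← lintegral_indicator measurableSet_ball]
        refine lintegral_congr fun x => ?_
        by_cases hx : x ∈ ball (0 : Plane) (r + s)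
        · rw [hg, indicator_of_mem hx, indicator_of_mem hx]
        · rw [hg, indicator_of_notMem hx, indicator_of_notMem hx]; simp

theorem lintegral_le_of_tendsto_of_le {X : Type*} [MeasurableSpace X] {μ : Measure X}
    {f : ℕ → X → ℝ≥0∞} {g : X → ℝ≥0∞} {b : ℕ → ℝ≥0∞} {B : ℝ≥0∞} (hf : ∀ n, Measurable (f n))
    (hlim : ∀ᵐ x ∂μ, Tendsto (fun n => f n x) atTop (𝓝 (g x))) (hb : ∀ n, ∫⁻ x, f n x ∂μ ≤ b n)
    (hB : Tendsto b atTop (𝓝 B)) : ∫⁻ x, g x ∂μ ≤ B := by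
  calc ∫⁻ x, g x ∂μ = ∫⁻ x, liminf (fun n => f n x) atTop ∂μ :=
        lintegral_congr_ae (hlim.mono fun x hx => hx.liminf_eq.symm)
    _ ≤ liminf (fun n => ∫⁻ x, f n x ∂μ) atTop := lintegral_liminf_le hf
    _ ≤ liminf b atTop := liminf_le_liminf (Eventually.of_forall hb)
    _ = B := hB.liminf_eq

theorem locallyIntegrable_coord {u : Plane → Plane} (hu : LocallyIntegrable u volume) (i : Fin 2) :
    LocallyIntegrable (fun x => u x i) volume :=
  hu.mono (aestronglyMeasurable_coord hu.aestronglyMeasurable i)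
    (Eventually.of_forall fun x => abs_coord_le (u x) i)

namespace IsWeaklyContinuous

variable {v : ℝ → Plane → Plane}

theorem tendsto_cv (hv : IsWeaklyContinuous v) {t : ℝ} (ht : 0 ≤ t) {s : ℕ → ℝ} (hs0 : ∀ n, 0 ≤ s n)
    (hs : Tendsto s atTop (𝓝 t)) {ρ : Plane → ℝ} (hρ : IsTest ρ) (i : Fin 2) (x : Plane) :
    Tendsto (fun n => cv (fun y => v (s n) y i) ρ x) atTop (𝓝 (cv (fun y => v t y i) ρ x)) := by
  have hη := hρ.comp_sub_left x
  set φ : Plane → Plane := fun y => ρ (x - y) • EuclideanSpace.single i (1 : ℝ) with hφ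
  have hφs : ContDiff ℝ (⊤ : ℕ∞) φ := hη.1.smul contDiff_const
  have hφc : HasCompactSupport φ := hη.2.smul_right
  have e (r : ℝ) : ∫ y, inner ℝ (v r y) (φ y) = cv (fun y => v r y i) ρ x := by
    rw [cv_apply]
    refine integral_congr_ae (Eventually.of_forall fun y => ?_)
    simp [hφ, inner_smul_right, EuclideanSpace.inner_single_right, mul_comm]
  have h := (hv.continuousOn φ hφs hφc t ht).tendsto
  simp only [e] at h
  exact h.comp (tendsto_nhdsWithin_iff.2 ⟨hs, Eventually.of_forall hs0⟩)

/-- Weak lower semicontinuity of local energies. At a fixed mollification scale weak continuity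
gives pointwise convergence along times tending to `t`, and Fatou applies; a second use of Fatou
removes the mollification. -/
theorem morreyBd_of_frequently (hv : IsWeaklyContinuous v) {α R M t : ℝ} (hR : 0 < R) (ht : 0 ≤ t)
    (h : ∀ ε, 0 < ε → ∃ s, 0 ≤ s ∧ |s - t| < ε ∧ MorreyBd α R M (v s)) : MorreyBd α R M (v t) := by
  choose s hs0 hst hsM using fun n => h (eps n) (eps_pos n)
  have hs : Tendsto s atTop (𝓝 t) := by
    rw [tendsto_iff_norm_sub_tendsto_zero]
    exact squeeze_zero (fun n => norm_nonneg _) (fun n => (hst n).le) tendsto_eps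
  have hloc {r : ℝ} (hr : 0 ≤ r) (i : Fin 2) := locallyIntegrable_coord (hv.locallyIntegrable r hr) i
  have hm {r δ : ℝ} (hr : 0 ≤ r) (hδ : 0 < δ) (i : Fin 2) :
      Measurable fun x => ‖cv (fun y => v r y i) (mols δ) x‖ₑ ^ 2 :=
    ((contDiff_cv (hloc hr i) (isTest_mols hδ)).continuous.measurable.enorm).pow_const 2
  have hbd {r δ : ℝ} (hr : R ≤ r) (hδ : 0 < δ) : ∫⁻ x in ball (0 : Plane) r,
      (‖cv (fun y => v t y 0) (mols δ) x‖ₑ ^ 2 + ‖cv (fun y => v t y 1) (mols δ) x‖ₑ ^ 2) ≤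
      ENNReal.ofReal (M ^ 2 * (r + δ) ^ (2 + 2 * α)) := by
    refine lintegral_le_of_tendsto_of_le
      (f := fun n x => ‖cv (fun y => v (s n) y 0) (mols δ) x‖ₑ ^ 2 +
        ‖cv (fun y => v (s n) y 1) (mols δ) x‖ₑ ^ 2)
      (fun n => (hm (hs0 n) hδ 0).add (hm (hs0 n) hδ 1)) (Eventually.of_forall fun x => ?_)
      (fun n => ?_) tendsto_const_nhds
    · have l (i : Fin 2) := ENNReal.Tendsto.pow (n := 2)
        (hv.tendsto_cv ht hs0 hs (isTest_mols hδ) i x).enorm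
      exact (l 0).add (l 1)
    · rw [lintegral_add_left (hm (hs0 n) hδ 0)]
      refine (add_le_add (lintegral_ball_cv_mols_sq_le (hloc (hs0 n) 0).aestronglyMeasurable hδ r)
        (lintegral_ball_cv_mols_sq_le (hloc (hs0 n) 1).aestronglyMeasurable hδ r)).trans ?_
      rw [← lintegral_add_left' (((hloc (hs0 n) 0).aestronglyMeasurable.enorm).pow_const 2).restrict]
      simp only [← enorm_sq_plane]
      exact hsM n _ (by linarith)
  intro r hr
  refine lintegral_le_of_tendsto_of_le
    (f := fun n x => ‖cv (fun y => v t y 0) (mols (eps n)) x‖ₑ ^ 2 +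
      ‖cv (fun y => v t y 1) (mols (eps n)) x‖ₑ ^ 2)
    (b := fun n => ENNReal.ofReal (M ^ 2 * (r + eps n) ^ (2 + 2 * α)))
    (fun n => (hm ht (eps_pos n) 0).add (hm ht (eps_pos n) 1)) (ae_restrict_of_ae ?_)
    (fun n => hbd hr (eps_pos n)) ?_
  · filter_upwards [ae_tendsto_cv_mols (hloc ht 0), ae_tendsto_cv_mols (hloc ht 1)] with x h0 h1
    rw [enorm_sq_plane]
    exact (ENNReal.Tendsto.pow (h0.comp tendsto_eps_within).enorm).add
      (ENNReal.Tendsto.pow (h1.comp tendsto_eps_within).enorm)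
  · have l : Tendsto (fun n => r + eps n) atTop (𝓝 r) := by
      simpa using tendsto_eps.const_add r
    exact (continuousAt_morrey_bound M (α := α) (hR.trans_le hr)).tendsto.comp l

end IsWeaklyContinuous

/-! ### Yudovich solutions -/

/-- Taking `N` strictly above the Morrey norm keeps it positive even when the datum vanishes. -/
theorem exists_ae_morreyBd {α : ℝ} (hα : α < 1 / 2) : ∃ c, 0 < c ∧
    ∀ {θ : Plane → ℝ} {u₀ : Plane → Plane} {ω₀ : Plane → ℝ} {v : ℝ → Plane → Plane} {T R N : ℝ},
      IsCutoff θ → MemY α u₀ → IsVorticity u₀ ω₀ → IsYudovichSolution θ α u₀ v → 0 < T → 1 ≤ R →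
      (morreyNorm α u₀).toReal < N →
      T * (√((eLpNorm ω₀ ∞ volume).toReal * (N * R ^ (α - 1))) + N * R ^ (α - 1)) ≤ c →
      ∀ᵐ t, t ∈ Ioo 0 T → MorreyBd α R (2 * N) (v t) := by
  obtain ⟨c, hc, h⟩ := exists_morrey_propagation hα
  refine ⟨c, hc, ?_⟩
  intro θ u₀ ω₀ v T R N hθ hu₀ hω₀ hv hT hR hN hcond
  have hN0 : 0 < N := ENNReal.toReal_nonneg.trans_lt hN
  have hM₀ : MorreyBd α 1 N u₀ := by
    rw [← morreyNormFrom_le_iff one_pos hN0.le]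
    exact (ENNReal.le_ofReal_iff_toReal_le hu₀.morreyNorm_lt_top.ne hN0.le).2 hN.le
  obtain ⟨ω', hω', hLp⟩ := hu₀.exists_vorticity
  have hfin : eLpNorm ω₀ ∞ volume ≠ ∞ := by
    rw [eLpNorm_congr_ae (isVorticity_unique hω₀ hω')]
    exact hLp.2.ne
  have hWb : ∀ᵐ x, |ω₀ x| ≤ (eLpNorm ω₀ ∞ volume).toReal := by
    rw [eLpNorm_exponent_top] at hfin ⊢
    filter_upwards [ae_le_eLpNormEssSup (f := ω₀) (μ := volume)] with x hx
    rw [← Real.norm_eq_abs, ← toReal_enorm]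
    exact ENNReal.toReal_mono hfin hx
  have h₀ := flow_of_morrey hM₀ hN0.le (by linarith) hu₀.aestronglyMeasurable hu₀.isDivFree hω₀ hWb
  obtain ⟨W, m, u, ω, hu, huv⟩ := hv.memLinftyLocY.exists_flowFamily hα T
  have hev := hv.evolves hu hθ hT huv fun i => h₀.loc i
  have hres := h hev hu hθ h₀ hN0 hM₀ hR hcond
  filter_upwards [hres, (ae_restrict_iff' measurableSet_Icc).1 huv] with t ht htv htT
  exact (ht htT).congr (htv (Ioo_subset_Icc_self htT))

/-- The null set must serve all radii at once, so `exists_ae_morreyBd` is used for rational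
horizons, radii and norms only, from above. The choice `K = 3 / c` gives the rate `2 / K < c`, and
this strict gap leaves room for the rational approximations. -/
theorem exists_rate_constant {α : ℝ} (hα : α < 1 / 2) : ∃ K, 0 < K ∧
    ∀ {θ : Plane → ℝ} {u₀ : Plane → Plane} {ω₀ : Plane → ℝ} {v : ℝ → Plane → Plane},
      IsCutoff θ → MemY α u₀ → IsVorticity u₀ ω₀ → IsYudovichSolution θ α u₀ v →
      ∀ᵐ t ∂(volume.restrict (Ici (0 : ℝ))), ∀ R : ℝ, 1 ≤ R →
        (K * t + (K * t) ^ 2 * (eLpNorm ω₀ ∞ volume).toReal) ^ (1 / (1 - α)) *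
          (morreyNorm α u₀).toReal ^ (1 / (1 - α)) ≤ R →
        MorreyBd α R (2 * (morreyNorm α u₀).toReal) (v t) := by
  obtain ⟨c, hc, h⟩ := exists_ae_morreyBd hα
  refine ⟨3 / c, by positivity, ?_⟩
  intro θ u₀ ω₀ v hθ hu₀ hω₀ hv
  set N := (morreyNorm α u₀).toReal with hN
  set W := (eLpNorm ω₀ ∞ volume).toReal with hW
  have hN0 : 0 ≤ N := ENNReal.toReal_nonneg
  have hW0 : 0 ≤ W := ENNReal.toReal_nonneg
  have hall : ∀ᵐ t : ℝ, ∀ T R N' : ℚ, 1 ≤ (R : ℝ) → N < N' →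
      (T : ℝ) * (√(W * (N' * (R : ℝ) ^ (α - 1))) + N' * (R : ℝ) ^ (α - 1)) ≤ c →
      t ∈ Ioo 0 (T : ℝ) → MorreyBd α R (2 * N') (v t) := by
    refine ae_all_iff.2 fun T => ae_all_iff.2 fun R => ae_all_iff.2 fun N' => ?_
    by_cases hcond : 1 ≤ (R : ℝ) ∧ N < N' ∧
      (T : ℝ) * (√(W * (N' * (R : ℝ) ^ (α - 1))) + N' * (R : ℝ) ^ (α - 1)) ≤ c ∧ 0 < (T : ℝ)
    · filter_upwards [h hθ hu₀ hω₀ hv hcond.2.2.2 hcond.1 hcond.2.1 hcond.2.2.1] with t ht _ _ _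
      exact ht
    · exact Eventually.of_forall fun t h1 h2 h3 h4 =>
        absurd ⟨h1, h2, h3, h4.1.trans h4.2⟩ hcond
  have hne : ∀ᵐ t : ℝ, t ≠ 0 := by simp [ae_iff, measure_singleton]
  refine (ae_restrict_iff' measurableSet_Ici).2 ?_
  filter_upwards [hall, hne] with t ht ht0 htI R hR hthr
  have htp : 0 < t := lt_of_le_of_ne htI (Ne.symm ht0)
  have hR0 : 0 < R := by linarith
  have hrate := rate_le_of_radius_le (by linarith) (by positivity) htp.le hW0 hN0 hR hthr
  set S : ℝ → ℝ := fun n => √(W * (n * R ^ (α - 1))) + n * R ^ (α - 1) with hS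
  have hSc : Continuous S := by fun_prop
  have hlt : t * S N < c := by
    refine lt_of_le_of_lt hrate ?_
    rw [div_div_eq_mul_div, div_lt_iff₀ (by norm_num)]
    linarith
  refine MorreyBd.of_rat hR0 fun q hq => ?_
  refine le_of_eventually_rat_gt (r := N)
    (b := fun n => ENNReal.ofReal ((2 * n) ^ 2 * (q : ℝ) ^ (2 + 2 * α)))
    (ENNReal.continuous_ofReal.comp (by fun_prop)).continuousAt ?_
  have hev : ∀ᶠ n in 𝓝 N, t * S n < c :=
    ((continuous_const.mul hSc).tendsto N).eventually_lt_const hlt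
  filter_upwards [hev] with n hn hNn hrat
  obtain ⟨n, rfl⟩ := hrat
  have hT : ∀ᶠ T in 𝓝 t, T * S n < c :=
    ((continuous_id.mul continuous_const).tendsto t).eventually_lt_const hn
  obtain ⟨l, b, htb, hlb⟩ := mem_nhds_iff_exists_Ioo_subset.1 hT
  obtain ⟨T, hT1, hT2⟩ := exists_rat_btwn htb.2
  have hTS : (T : ℝ) * S n < c := hlb ⟨htb.1.trans hT1, hT2⟩
  have hn0 : 0 ≤ (n : ℝ) := hN0.trans hNn.le
  have hpow : (n : ℝ) * (q : ℝ) ^ (α - 1) ≤ n * R ^ (α - 1) :=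
    mul_le_mul_of_nonneg_left (Real.rpow_le_rpow_of_nonpos hR0 hq.le (by linarith)) hn0
  refine ht T q n (hR.trans hq.le) hNn (le_trans ?_ hTS.le) ⟨htp, hT1⟩ q le_rfl
  refine mul_le_mul_of_nonneg_left ?_ (htp.trans hT1).le
  exact add_le_add (Real.sqrt_le_sqrt (mul_le_mul_of_nonneg_left hpow hW0)) hpow

theorem exists_mem_Ioo_of_ae_restrict_Ici {P : ℝ → Prop}
    (h : ∀ᵐ t ∂(volume.restrict (Ici (0 : ℝ))), P t) {a b : ℝ} (ha : 0 ≤ a) (hab : a < b) :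
    ∃ s ∈ Ioo a b, P s := by
  by_contra! hno
  have h1 := (ae_restrict_iff' measurableSet_Ici).1 h
  have h2 : volume (Ioo a b) ≤ 0 := by
    rw [← ae_iff.1 h1]
    exact measure_mono fun s hs hP => hno s hs (hP (ha.trans hs.1.le))
  rw [Real.volume_Ioo, nonpos_iff_eq_zero, ENNReal.ofReal_eq_zero] at h2
  linarith

/-- The threshold increases with time, so earlier times close to `t > 0` inherit the condition. At
`t = 0` the threshold is `0 < R`, and slightly later times serve by continuity. -/
theorem exists_time_near {α K W N R t : ℝ} {P : ℝ → Prop} (hα : α < 1) (hK : 0 < K) (hW : 0 ≤ W)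
    (hN : 0 ≤ N) (hR : 1 ≤ R) (ht : 0 ≤ t)
    (hthr : (K * t + (K * t) ^ 2 * W) ^ (1 / (1 - α)) * N ^ (1 / (1 - α)) ≤ R)
    (h : ∀ᵐ s ∂(volume.restrict (Ici (0 : ℝ))),
      (K * s + (K * s) ^ 2 * W) ^ (1 / (1 - α)) * N ^ (1 / (1 - α)) ≤ R → P s) {ε : ℝ}
    (hε : 0 < ε) : ∃ s, 0 ≤ s ∧ |s - t| < ε ∧ P s := by
  have hp : 0 < 1 / (1 - α) := by
    have : 0 < 1 - α := by linarith
    positivity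
  rcases ht.eq_or_lt with rfl | ht0
  · have hc : Continuous fun s : ℝ =>
        (K * s + (K * s) ^ 2 * W) ^ (1 / (1 - α)) * N ^ (1 / (1 - α)) := by
      refine Continuous.mul ?_ continuous_const
      exact Continuous.rpow_const (by fun_prop) fun _ => Or.inr hp.le
    have h0 : (K * 0 + (K * 0) ^ 2 * W) ^ (1 / (1 - α)) * N ^ (1 / (1 - α)) < R := by
      simp only [mul_zero, ne_eq, OfNat.ofNat_ne_zero, not_false_eq_true, zero_pow, zero_mul,
        add_zero, Real.zero_rpow hp.ne']
      linarith
    obtain ⟨l, b, hb, hlb⟩ :=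
      mem_nhds_iff_exists_Ioo_subset.1 ((hc.tendsto 0).eventually_lt_const h0)
    obtain ⟨s, hs, hPs⟩ := exists_mem_Ioo_of_ae_restrict_Ici h le_rfl (lt_min hε hb.2)
    refine ⟨s, hs.1.le, ?_, hPs ?_⟩
    · rw [sub_zero, abs_of_pos hs.1]
      exact hs.2.trans_le (min_le_left _ _)
    · exact (hlb ⟨hb.1.trans hs.1, hs.2.trans_le (min_le_right _ _)⟩ : _ < _).le
  · obtain ⟨s, hs, hPs⟩ := exists_mem_Ioo_of_ae_restrict_Ici h (le_max_left 0 (t - ε))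
      (max_lt ht0 (by linarith : t - ε < t))
    have hs0 : 0 ≤ s := (le_max_left _ _).trans hs.1.le
    refine ⟨s, hs0, ?_, hPs (le_trans ?_ hthr)⟩
    · have := (le_max_right 0 (t - ε)).trans_lt hs.1
      rw [abs_sub_lt_iff]
      constructor <;> linarith [hs.2]
    · have := hs.2.le
      gcongr

theorem MorreyBd.morreyNormFrom_le {α R : ℝ} {u₀ f : Plane → Plane} (hR : 0 < R)
    (h₀ : morreyNorm α u₀ < ∞) (h : MorreyBd α R (2 * (morreyNorm α u₀).toReal) f) :
    morreyNormFrom α R f ≤ 2 * morreyNorm α u₀ := by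
  refine ((morreyNormFrom_le_iff hR (by positivity)).2 h).trans_eq ?_
  rw [ENNReal.ofReal_mul zero_le_two, ENNReal.ofReal_toReal h₀.ne]
  simp

end Yudovich
end

theorem theorem4p1 :
    ∃ K : ℝ → ℝ, (∀ s, 0 < K s) ∧
      ∀ (α : ℝ), 0 ≤ α → α < 1 / 2 →
      ∀ (θ : Yudovich.Plane → ℝ), Yudovich.IsCutoff θ →
      ∀ (u₀ : Yudovich.Plane → Yudovich.Plane) (ω₀ : Yudovich.Plane → ℝ),
        Yudovich.MemY α u₀ → Yudovich.IsVorticity u₀ ω₀ →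
      ∀ (u : ℝ → Yudovich.Plane → Yudovich.Plane), Yudovich.IsYudovichSolution θ α u₀ u →
        (∀ᵐ t ∂(volume.restrict (Ici (0 : ℝ))), ∀ R : ℝ, 1 ≤ R →
          (K (1 / (1 - 2 * α)) * t +
              (K (1 / (1 - 2 * α)) * t) ^ 2 * (eLpNorm ω₀ ∞ volume).toReal) ^ (1 / (1 - α)) *
            (Yudovich.morreyNorm α u₀).toReal ^ (1 / (1 - α)) ≤ R →
          Yudovich.morreyNormFrom α R (u t) ≤ 2 * Yudovich.morreyNorm α u₀) ∧
        (Yudovich.IsWeaklyContinuous u → ∀ t : ℝ, 0 ≤ t → ∀ R : ℝ, 1 ≤ R →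
          (K (1 / (1 - 2 * α)) * t +
              (K (1 / (1 - 2 * α)) * t) ^ 2 * (eLpNorm ω₀ ∞ volume).toReal) ^ (1 / (1 - α)) *
            (Yudovich.morreyNorm α u₀).toReal ^ (1 / (1 - α)) ≤ R →
          Yudovich.morreyNormFrom α R (u t) ≤ 2 * Yudovich.morreyNorm α u₀) := by
  have hex : ∀ α : ℝ, ∃ K : ℝ, 0 < K ∧ (α < 1 / 2 → ∀ {θ : Yudovich.Plane → ℝ}
      {u₀ : Yudovich.Plane → Yudovich.Plane} {ω₀ : Yudovich.Plane → ℝ}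
      {v : ℝ → Yudovich.Plane → Yudovich.Plane}, Yudovich.IsCutoff θ → Yudovich.MemY α u₀ →
      Yudovich.IsVorticity u₀ ω₀ → Yudovich.IsYudovichSolution θ α u₀ v →
      ∀ᵐ t ∂(volume.restrict (Ici (0 : ℝ))), ∀ R : ℝ, 1 ≤ R →
        (K * t + (K * t) ^ 2 * (eLpNorm ω₀ ∞ volume).toReal) ^ (1 / (1 - α)) *
          (Yudovich.morreyNorm α u₀).toReal ^ (1 / (1 - α)) ≤ R →
        Yudovich.MorreyBd α R (2 * (Yudovich.morreyNorm α u₀).toReal) (v t)) := by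
    intro α
    by_cases hα : α < 1 / 2
    · obtain ⟨K, hK, h⟩ := Yudovich.exists_rate_constant hα
      exact ⟨K, hK, fun _ => h⟩
    -- An arbitrary value outside the range of `α` in question.
    · exact ⟨1, one_pos, fun h => absurd h hα⟩
  choose K hK0 hK using hex
  -- The relation `s = 1 / (1 - 2 * α)` is inverted by `α = (1 - 1 / s) / 2`, so a constant
  -- depending on `α` is one depending on `s`.
  refine ⟨fun s => K ((1 - 1 / s) / 2), fun s => hK0 _, ?_⟩
  intro α _ hα θ hθ u₀ ω₀ hu₀ hω₀ u hu
  have hs : (1 - 1 / (1 / (1 - 2 * α))) / 2 = α := by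
    rw [one_div_one_div]
    ring
  simp only [hs]
  have hae := hK α hα hθ hu₀ hω₀ hu
  refine ⟨?_, fun hw t ht R hR hthr => ?_⟩
  · filter_upwards [hae] with t ht R hR hthr
    exact (ht R hR hthr).morreyNormFrom_le (by linarith) hu₀.morreyNorm_lt_top
  · refine Yudovich.MorreyBd.morreyNormFrom_le (by linarith) hu₀.morreyNorm_lt_top ?_
    refine hw.morreyBd_of_frequently (by linarith) ht fun ε hε => ?_
    exact Yudovich.exists_time_near (by linarith) (hK0 α) ENNReal.toReal_nonneg
      ENNReal.toReal_nonneg hR ht hthr (hae.mono fun s hs' => hs' R hR) hε
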